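/- **Setting.** For $S\in\{\mathbb P^2,\ \mathbb P^1\times\mathbb P^1,\ W\mathbb P[1,1,2],\ \mathbb F_1\}$ the affine mirror curve $C_q^\circ\subset(\mathbb C^*)^2$ of $K_S$ is $H(x,y,q)=0$, where $H$ is respectively $$x+y+1+q_1\tfrac{x^3}{y},\qquad x+y+1+q_1x^2+q_2\tfrac{x^2}{y},\qquad x+y+1+q_1x^2+q_2\tfrac{x^4}{y},\qquad x+y+1+q_1\tfrac xy+q_2x^2 .$$ Let $\mathcal U_S$ be the set of $q$ with all $q_i\neq0$ and $C_q^\circ$ smooth; then $C^\circ_q$ is a genus one curve $C_q$ minus finitely many points. A rational one-parameter subfamily is given by rational functions $s\mapsto q(s)$, $q_i\in\mathbb C(s)$. A *uniformization* of it consists of meromorphic functions $x(u,\tau),y(u,\tau)$ on $\mathbb C\times\mathcal H$ and $s(\tau)$ on $\mathcal H$ such that, for all $\tau$ outside a closed discrete subset of $\mathcal H$, one has $q(s(\tau))\in\mathcal U_S$, the map $u\mapsto(x(u,\tau),y(u,\tau))$ induces a biholomorphism $\mathbb C/(\mathbb Z\oplus\mathbb Z\tau)\cong C_{q(s(\tau))}$,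 and $u=0$ is a ramification point of $x$. For a subgroup $\Gamma<SL_2(\mathbb Z)$ of finite index, a *weak Jacobi form* of weight $k\in\mathbb Z$ and index $\ell\in\mathbb Z$ for $\Gamma$ is a holomorphic $\Phi$ on $\mathbb C\times\mathcal H$ with $\Phi|_{k,\ell}\gamma=\Phi$ for $\gamma=\begin{pmatrix}a&b\\c&d\end{pmatrix}\in\Gamma$, where $$(\Phi|_{k,\ell}\gamma)(z,\tau)=(c\tau+d)^{-k}e^{-2\pi i\ell cz^2/(c\tau+d)}\,\Phi\Big(\tfrac z{c\tau+d},\tfrac{a\tau+b}{c\tau+d}\Big),$$ with $\Phi(z+m\tau+n,\tau)=e^{-2\pi i\ell(m^2\tau+2mz)}\Phi(z,\tau)$ for $m,n\in\mathbb Z$, and such that for every $\gamma\in SL_2(\mathbb Z)$ the Fourier expansion of $\Phi|_{k,\ell}\gamma$ contains only terms $e^{2\pi i(n\tau+rz)}$ with $n\ge0$. A *meromorphic Jacobi form* of weight $k$ and index $\ell$ for $\Gamma$ is a quotient $N/D$, $D\not\equiv 0$, of weak Jacobi forms for $\Gamma$ whose weights and indices differ by $k$ and $\ell$. The disk potential is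 $\partial_xW=\partial_uW/\partial_ux$, where $W$ is, locally on $\mathbb C\times\mathcal H$ away from zeros and poles of $x,y$, a fibrewise primitive of $\log y\,\frac{dx}{x}$ for some branch of $\log y$; that is, $\partial_xW=\frac{\log y}{x}$. **Proposition.** (1) For each $S$ and each rational one-parameter subfamily $q(s)$ there is a finite-index subgroup $\Gamma<SL_2(\mathbb Z)$, depending only on the subfamily, such that for every uniformization $(x,y,s)$ of it the functions $x(u,\tau)$ and $y(u,\tau)$ are meromorphic Jacobi forms of weight $0$ and index $0$ for $\Gamma$, and $x\,\partial_xW$ is a logarithm of the meromorphic Jacobi form $y$: $\exp(x\,\partial_xW)=y$ wherever $\partial_u x\ne0$. (2) Such uniformizations exist for the following subfamilies: $S=\mathbb P^2$ with $q_1=s$; $S=\mathbb P^1\times\mathbb P^1$ with $q_1=q_2=s$; $S=W\mathbb P[1,1,2]$ with $q_1=s$, $q_2=c$ for any constant $c\neq0$; $S=\mathbb F_1$ with $q_1=1$, $q_2=s$. -/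

import Mathlib

open UpperHalfPlane
open scoped MatrixGroups

noncomputable section

namespace DiskPotential

/-! ### Meromorphic functions on `ℂ × ℍ` -/

/-- Holomorphy on an open set `V` of the two-dimensional complex manifold `ℂ × ℍ`. -/
def IsHolomorphicOn (Φ : ℂ × ℍ → ℂ) (V : Set (ℂ × ℍ)) : Prop :=
  DifferentiableOn ℂ (fun p : ℂ × ℂ => Φ (p.1, ofComplex p.2))
    {p : ℂ × ℂ | 0 < p.2.im ∧ (p.1, ofComplex p.2) ∈ V}

/-- `Φ` is (a representative of) a meromorphic function on `ℂ × ℍ`: locally it is a quotient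
`f / g` of holomorphic functions, where `g` vanishes on no nonempty open subset; the values of `Φ`
on the thin set `g = 0` are irrelevant. -/
def IsMeromorphic (Φ : ℂ × ℍ → ℂ) : Prop :=
  ∀ p : ℂ × ℍ, ∃ (V : Set (ℂ × ℍ)) (f g : ℂ × ℍ → ℂ), IsOpen V ∧ p ∈ V ∧
    IsHolomorphicOn f V ∧ IsHolomorphicOn g V ∧ V ⊆ closure {w ∈ V | g w ≠ 0} ∧
    ∀ w ∈ V, g w ≠ 0 → Φ w = f w / g w

/-! ### Jacobi forms -/

/-- `c τ + d` for `γ = (a, b; c, d)`. -/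
def autFactor (γ : SL(2, ℤ)) (τ : ℍ) : ℂ := ((γ 1 0 : ℤ) : ℂ) * (τ : ℂ) + ((γ 1 1 : ℤ) : ℂ)

/-- The slash action of weight `k` and index `l`:
`(Φ | γ)(z, τ) = (cτ+d)^(-k) exp(-2πi l c z² / (cτ+d)) Φ(z / (cτ+d), (aτ+b) / (cτ+d))`. -/
def jacobiSlash (k l : ℤ) (Φ : ℂ × ℍ → ℂ) (γ : SL(2, ℤ)) (p : ℂ × ℍ) : ℂ :=
  autFactor γ p.2 ^ (-k) *
    Complex.exp (-(2 * Real.pi * Complex.I * l * ((γ 1 0 : ℤ) : ℂ) * p.1 ^ 2 / autFactor γ p.2)) *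
    Φ (p.1 / autFactor γ p.2, γ • p.2)

/-- Translation `(z, τ) ↦ (z + mτ + n, τ)`. -/
def latticeShift (m n : ℤ) (p : ℂ × ℍ) : ℂ × ℍ := (p.1 + m * (p.2 : ℂ) + n, p.2)

/-- Weak Jacobi forms of weight `k` and index `l` for a subgroup `Γ` of `SL₂(ℤ)`.
The last condition is the one at the cusps: in the Fourier expansion `∑ c(n,r) e^{2πi(nτ + rz)}`
of every `Φ | γ`, `γ ∈ SL₂(ℤ)`, one has `c(n,r) = 0` unless `n ≥ 0`. -/
structure IsWeakJacobiForm (Γ : Subgroup SL(2, ℤ)) (k l : ℤ) (Φ : ℂ × ℍ → ℂ) : Prop where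
  holo : IsHolomorphicOn Φ Set.univ
  modular : ∀ γ ∈ Γ, ∀ p, jacobiSlash k l Φ γ p = Φ p
  elliptic : ∀ (m n : ℤ) (p : ℂ × ℍ), Φ (latticeShift m n p) =
    Complex.exp (-(2 * Real.pi * Complex.I * l * (m ^ 2 * (p.2 : ℂ) + 2 * m * p.1))) * Φ p
  cusps : ∀ (γ : SL(2, ℤ)) (z : ℂ), IsBoundedAtImInfty fun τ => jacobiSlash k l Φ γ (z, τ)

/-- Meromorphic Jacobi forms of weight `k` and index `l` for `Γ`: the elements of bidegree `(k, l)`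
of the bigraded fraction field of the ring of weak Jacobi forms for `Γ`. The equality
`Φ = N / D` is one of meromorphic functions, i.e. it holds on a dense open set. -/
def IsMeromorphicJacobiForm (Γ : Subgroup SL(2, ℤ)) (k l : ℤ) (Φ : ℂ × ℍ → ℂ) : Prop :=
  ∃ (k' l' : ℤ) (N D : ℂ × ℍ → ℂ),
    IsWeakJacobiForm Γ (k + k') (l + l') N ∧ IsWeakJacobiForm Γ k' l' D ∧
    ∃ W : Set (ℂ × ℍ), IsOpen W ∧ Dense W ∧ ∀ p ∈ W, D p ≠ 0 ∧ Φ p = N p / D p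

/-! ### Mirror curves -/

/-- The toric surfaces `S` for which `K_S` is considered. -/
inductive Surface
  | P2
  | P1xP1
  | WP112
  | F1

/-- The number of parameters `q` of the mirror family of `K_S`. -/
def Surface.numParams : Surface → ℕ
  | .P2 => 1
  | .P1xP1 => 2
  | .WP112 => 2
  | .F1 => 2

/-- The exponents `(m, n)` of the monomials `q_i x^m y^n` of the mirror curve. -/
def Surface.exponents : (S : Surface) → Fin S.numParams → ℤ × ℤ
  | .P2 => ![(3, -1)]
  | .P1xP1 => ![(2, 0), (2, -1)]
  | .WP112 => ![(2, 0), (4, -1)]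
  | .F1 => ![(1, -1), (2, 0)]

/-- The Laurent polynomial `H(x, y, q) = x + y + 1 + ∑ q_i x^{m_i} y^{n_i}`. -/
def mirrorH (S : Surface) (q : Fin S.numParams → ℂ) (x y : ℂ) : ℂ :=
  x + y + 1 + ∑ i, q i * x ^ (S.exponents i).1 * y ^ (S.exponents i).2

/-- The affine mirror curve `H = 0` in `(ℂ*)²`. -/
def affineCurve (S : Surface) (q : Fin S.numParams → ℂ) : Set (ℂ × ℂ) :=
  {p | p.1 ≠ 0 ∧ p.2 ≠ 0 ∧ mirrorH S q p.1 p.2 = 0}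

/-- The base of the family: all `q` in the torus with smooth mirror curve. (For these four
families the compactified curve is smooth as soon as the affine one is.) -/
def mirrorBase (S : Surface) : Set (Fin S.numParams → ℂ) :=
  {q | (∀ i, q i ≠ 0) ∧ ∀ p ∈ affineCurve S q,
    deriv (fun x => mirrorH S q x p.2) p.1 ≠ 0 ∨ deriv (fun y => mirrorH S q p.1 y) p.2 ≠ 0}

/-- A rational one-parameter subfamily `s ↦ q(s)` of the mirror family, with `q_i ∈ ℂ(s)`.
(At a pole of `q_i` the value is `0`, which is outside `mirrorBase S`.) -/
def subfamilyAt {S : Surface} (r : Fin S.numParams → RatFunc ℂ) (s : ℂ) : Fin S.numParams → ℂ :=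
  fun i => (r i).eval (RingHom.id ℂ) s

/-! ### Uniformization -/

/-- The functions `x, y` on `ℂ` uniformize the mirror curve `C_q` by `ℂ / (ℤ ⊕ ℤτ)`: they are
meromorphic and doubly periodic, and, off the finitely many classes of zeros and poles of `x`
and `y`, the map `u ↦ (x u, y u)` induces a bijection onto the affine mirror curve. Moreover
`u = 0` is a ramification point of `x : C_q → ℙ¹`. -/
structure UniformizesCurve (S : Surface) (q : Fin S.numParams → ℂ) (τ : ℍ) (x y : ℂ → ℂ) :
    Prop where
  mero_x : MeromorphicOn x Set.univ
  mero_y : MeromorphicOn y Set.univ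
  periodic_x : ∀ (m n : ℤ) (u : ℂ), x (u + m * (τ : ℂ) + n) = x u
  periodic_y : ∀ (m n : ℤ) (u : ℂ), y (u + m * (τ : ℂ) + n) = y u
  mapsTo : ∀ u, AnalyticAt ℂ x u → AnalyticAt ℂ y u → x u ≠ 0 → y u ≠ 0 →
    (x u, y u) ∈ affineCurve S q
  surj : ∀ p ∈ affineCurve S q, ∃ u, AnalyticAt ℂ x u ∧ AnalyticAt ℂ y u ∧ (x u, y u) = p
  inj : ∀ u v, AnalyticAt ℂ x u → AnalyticAt ℂ y u → AnalyticAt ℂ x v → AnalyticAt ℂ y v →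
    (x u, y u) ∈ affineCurve S q → (x v, y v) = (x u, y u) →
    ∃ m n : ℤ, v = u + m * (τ : ℂ) + n
  ramified : (AnalyticAt ℂ x 0 ∧ deriv x 0 = 0) ∨ meromorphicOrderAt x 0 ≤ ((-2 : ℤ) : WithTop ℤ)

/-- A uniformization `(u, τ) ↦ (x(u, τ), y(u, τ), s(τ))` of the one-parameter subfamily `r`:
the functions are meromorphic, and for all `τ` off a closed discrete subset of `ℍ` the curve with
parameter `q(s(τ))` is a smooth mirror curve, uniformized by `x(·, τ), y(·, τ)`. -/
structure IsUniformization (S : Surface) (r : Fin S.numParams → RatFunc ℂ)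
    (x y : ℂ × ℍ → ℂ) (s : ℍ → ℂ) : Prop where
  mero_x : IsMeromorphic x
  mero_y : IsMeromorphic y
  mero_s : MeromorphicOn (fun w : ℂ => s (ofComplex w)) {w : ℂ | 0 < w.im}
  fiber : ∀ᶠ τ in Filter.codiscrete ℍ, subfamilyAt r (s τ) ∈ mirrorBase S ∧
    UniformizesCurve S (subfamilyAt r (s τ)) τ (fun u => x (u, τ)) (fun u => y (u, τ))

/-! ### The disk potential -/

/-- The derivative of `Φ` in the elliptic variable. -/
def derivU (Φ : ℂ × ℍ → ℂ) (p : ℂ × ℍ) : ℂ := deriv (fun u => Φ (u, p.2)) p.1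

/-- On the open set `V`, where `x` and `y` are holomorphic without zeros, `W` is a fibrewise
primitive of the differential `log y · dx / x` for some continuous branch of `log y` on `V`. -/
def IsSuperpotential (x y : ℂ × ℍ → ℂ) (V : Set (ℂ × ℍ)) (W : ℂ × ℍ → ℂ) : Prop :=
  IsOpen V ∧ IsHolomorphicOn x V ∧ IsHolomorphicOn y V ∧ (∀ p ∈ V, x p ≠ 0 ∧ y p ≠ 0) ∧
  ∃ logy : ℂ × ℍ → ℂ, ContinuousOn logy V ∧ (∀ p ∈ V, Complex.exp (logy p) = y p) ∧
    ∀ p ∈ V, HasDerivAt (fun u => W (u, p.2)) (logy p * derivU x p / x p) p.1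

/-- The disk potential `∂W/∂x = (∂W/∂u) / (∂x/∂u)`. -/
def diskPotential (x W : ℂ × ℍ → ℂ) (p : ℂ × ℍ) : ℂ := derivU W p / derivU x p

end DiskPotential

end

noncomputable section

namespace DiskPotential

open Filter Topology

/-! ### Codiscrete sets -/

/-! After multiplication of H by y, all four mirror curves have the form y² + (1 + x + b x²) y + c
x^m = 0. So x is a function of degree two on the curve, and V = 2y + 1 + x + b x² is a square root
of a discriminant of degree at most four in x. On ℂ/(ℤ + ℤτ), with u = 0 a ramification point of x,
it follows that x is a Möbius transform W/N of ℘(u), and that V N² is a constant multiple of ℘'(u)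
(`exists_moebius`, `exists_normalForm`). Equivalently, a Möbius substitution carries the
discriminant to the Weierstrass cubic of the lattice.

Assertion (1). Put G = g₂³/g₃² and P = ℘ g₂/g₃; rescaling turns the cubic into 4X³ - GX - G. The
branch point, the Möbius coefficients and G are algebraic over ℂ(s). Exchanging the roles of s and G
makes s algebraic over ℂ(G), hence x and y algebraic over ℂ(G, P). A prime ideal argument in the
ring of all functions on the set of possible fibre data produces a single equation for the whole
subfamily (`exists_eval₂_eq_zero`, `FiberPoint.exists_polynomial_x`). Homogenized with powers of g₃
and of the theta form ϑ⁸, it reads Σ H_i x^i = 0 with weak Jacobi forms H_i of level one and of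
common weight and index (`exists_weakJacobiForm_equation`). Now M = H_{n+1} x is a root of a monic
equation with holomorphic coefficients. It is locally bounded, so Riemann's theorem extends it
holomorphically to ℂ × ℍ. The slash action of SL₂(ℤ) permutes the finitely many holomorphic roots.
The subgroup fixing all of them has finite index and depends on the equation only, and M is a weak
Jacobi form for it; the condition at the cusps comes from the bound for roots of monic polynomials
(`isMeromorphicJacobiForm_of_algebraic`). The formula for the disk potential is immediate from x
∂_xW = log y.

Assertion (2). Conversely, a family of normal forms whose coefficients are holomorphic in τ yields a
uniformization (`exists_isUniformization`); smoothness of the curves is automatic, because the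
Weierstrass cubic has distinct roots. For ℙ¹ × ℙ¹, WP[1,1,2] and 𝔽₁ the coefficients are written
with fourth roots of differences of the values of ℘ at half periods (`exists_halfPeriodData`). For
ℙ² they come from a point of order three, whose tangent is inflectional
(`sq_eq_three_mul_of_third`).

The value of a meromorphic function at a pole carries no information, so identities are stated on
codiscrete sets and transferred to individual points by continuity. -/

theorem eventually_codiscrete_iff {X : Type*} [TopologicalSpace X] {P : X → Prop} :
    (∀ᶠ x in codiscrete X, P x) ↔ ∀ x, ∀ᶠ y in 𝓝[≠] x, P y := by
  simp only [Filter.Eventually, mem_codiscrete, disjoint_principal_right, compl_compl]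

theorem eventually_codiscrete_comp_equiv {X : Type*} [TopologicalSpace X] {P : X → Prop}
    (e : X ≃ₜ X) (h : ∀ᶠ x in codiscrete X, P x) : ∀ᶠ x in codiscrete X, P (e x) := by
  rw [eventually_codiscrete_iff] at h ⊢
  intro x
  have ht : Tendsto e (𝓝[≠] x) (𝓝[≠] (e x)) := by
    refine tendsto_nhdsWithin_of_tendsto_nhds_of_eventually_within _
      (e.continuous.continuousAt.mono_left nhdsWithin_le_nhds) ?_
    filter_upwards [self_mem_nhdsWithin] with y hy
    exact fun h => hy (e.injective h)
  exact ht.eventually (h (e x))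

theorem eventually_codiscrete_add {P : ℂ → Prop} (c : ℂ)
    (h : ∀ᶠ x in codiscrete ℂ, P x) : ∀ᶠ x in codiscrete ℂ, P (x + c) :=
  eventually_codiscrete_comp_equiv (Homeomorph.addRight c) h

theorem eventually_codiscrete_neg {P : ℂ → Prop}
    (h : ∀ᶠ x in codiscrete ℂ, P x) : ∀ᶠ x in codiscrete ℂ, P (-x) :=
  eventually_codiscrete_comp_equiv (Homeomorph.neg ℂ) h

theorem countable_compl_of_eventually_codiscrete {P : ℂ → Prop}
    (h : ∀ᶠ x in codiscrete ℂ, P x) : {x | ¬ P x}.Countable := by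
  have h' : {x | P x} ∈ codiscrete ℂ := h
  rw [mem_codiscrete'] at h'
  have h2 : DiscreteTopology ({x | P x}ᶜ : Set ℂ) := h'.2.to_subtype
  have : Countable ({x | P x}ᶜ : Set ℂ) := countable_of_Lindelof_of_discrete
  exact Set.countable_coe_iff.mp this

theorem frequently_codiscrete_of_mem_nhds {P : ℂ → Prop} (h : ∀ᶠ x in codiscrete ℂ, P x)
    (z : ℂ) {U : Set ℂ} (hU : U ∈ 𝓝 z) : ∃ u ∈ U, P u := by
  have h1 := eventually_codiscrete_iff.mp h z
  have h2 : ∀ᶠ y in 𝓝[≠] z, y ∈ U := nhdsWithin_le_nhds hU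
  obtain ⟨u, hu⟩ := (h1.and h2).exists
  exact ⟨u, hu.2, hu.1⟩

instance : (codiscrete ℂ).NeBot := by
  refine neBot_iff.mpr fun h => ?_
  have : ∀ᶠ x in codiscrete ℂ, False := by rw [h]; trivial
  obtain ⟨u, -, hu⟩ := frequently_codiscrete_of_mem_nhds this 0 univ_mem
  exact hu

theorem eventually_codiscrete_analyticAt {f : ℂ → ℂ} (hf : Meromorphic f) :
    ∀ᶠ z in codiscrete ℂ, AnalyticAt ℂ f z := by
  have := MeromorphicOn.analyticAt_mem_codiscreteWithin (meromorphicOn_univ.mpr hf)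
  exact this

theorem eventually_codiscrete_ne_zero {f : ℂ → ℂ} (hf : Meromorphic f)
    (z0 : ℂ) (h0 : meromorphicOrderAt f z0 ≠ ⊤) : ∀ᶠ z in codiscrete ℂ, f z ≠ 0 := by
  have hf' : MeromorphicOn f Set.univ := meromorphicOn_univ.mpr hf
  refine MeromorphicOn.eventually_codiscreteWithin_apply_ne_zero hf' fun x hx => ?_
  exact hf'.meromorphicOrderAt_ne_top_of_isPreconnected isPreconnected_univ
    (Set.mem_univ z0) hx h0

theorem eventually_codiscrete_ne_const {f : ℂ → ℂ} (hf : Meromorphic f)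
    (hc : ∀ c, ¬ (f =ᶠ[codiscrete ℂ] fun _ => c)) (c : ℂ) : ∀ᶠ z in codiscrete ℂ, f z ≠ c := by
  by_cases h : ∃ z0, meromorphicOrderAt (fun z => f z - c) z0 ≠ ⊤
  · obtain ⟨z0, h0⟩ := h
    have := eventually_codiscrete_ne_zero (f := fun z => f z - c) (by fun_prop) z0 h0
    filter_upwards [this] with z hz h
    exact hz (by rw [h, sub_self])
  · push Not at h
    refine absurd ?_ (hc c)
    refine eventually_codiscrete_iff.mpr fun z => ?_
    have := meromorphicOrderAt_eq_top_iff.mp (h z)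
    filter_upwards [this] with y hy
    exact sub_eq_zero.mp hy

/-- Two meromorphic functions which agree on a codiscrete set agree where both are continuous. -/
theorem eq_of_eventuallyEq_codiscrete {f g : ℂ → ℂ} (h : f =ᶠ[codiscrete ℂ] g) {z : ℂ}
    (hf : ContinuousAt f z) (hg : ContinuousAt g z) : f z = g z := by
  have h1 : f =ᶠ[𝓝[≠] z] g := eventually_codiscrete_iff.mp h z
  have h2 : Tendsto f (𝓝[≠] z) (𝓝 (f z)) := hf.mono_left nhdsWithin_le_nhds
  have h3 : Tendsto g (𝓝[≠] z) (𝓝 (g z)) := hg.mono_left nhdsWithin_le_nhds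
  exact tendsto_nhds_unique (h2.congr' h1) h3

/-! ### Local multiplicity -/

/-- Near a pole of order `k`, a meromorphic function takes every value close to infinity at
`k` distinct points. -/
theorem exists_finset_preimages {Y : ℂ → ℂ} {u0 : ℂ} {k : ℕ} (hk : k ≠ 0)
    (ho : meromorphicOrderAt Y u0 = ((-(k : ℤ) : ℤ) : WithTop ℤ)) {U : Set ℂ}
    (hU : U ∈ 𝓝[≠] u0) :
    ∃ R : ℝ, ∀ X : ℂ, R < ‖X‖ → ∃ S : Finset ℂ, S.card = k ∧ ∀ u ∈ S, u ∈ U ∧ Y u = X := by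
  have hm : MeromorphicAt Y u0 := meromorphicAt_of_meromorphicOrderAt_ne_zero (by
    rw [ho]; simpa using hk)
  obtain ⟨g, hg, hg0, hYg⟩ := (meromorphicOrderAt_eq_int_iff hm).mp ho
  obtain ⟨c, hc⟩ := IsAlgClosed.exists_pow_nat_eq (1 / g u0) (Nat.pos_of_ne_zero hk)
  have hk' : (k : ℂ) ≠ 0 := Nat.cast_ne_zero.mpr hk
  have hc0 : c ≠ 0 := by
    rintro rfl
    rw [zero_pow hk] at hc
    exact one_div_ne_zero hg0 hc.symm
  -- Near u₀ the function E is the branch of the k-th root of g(u₀)/g(z) with value 1 at u₀. Since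
  -- c^k = 1/g(u₀), the local coordinate ψ = (z - u₀) c E satisfies ψ^k = 1/Y.
  set E : ℂ → ℂ := fun z => Complex.exp (-(Complex.log (g z / g u0)) / k) with hE
  have hq : g u0 / g u0 = 1 := div_self hg0
  have hEa : AnalyticAt ℂ E u0 := by
    have h1 : AnalyticAt ℂ (fun z => g z / g u0) u0 := by fun_prop (disch := assumption)
    have h2 : AnalyticAt ℂ (fun z => Complex.log (g z / g u0)) u0 :=
      h1.clog (by rw [hq]; exact Complex.one_mem_slitPlane)
    fun_prop
  have hE0 : E u0 = 1 := by simp [hE, hq]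
  set ψ : ℂ → ℂ := fun z => (z - u0) * c * E z with hψ
  have hψd : HasStrictDerivAt ψ c u0 := by
    have h0 : HasStrictDerivAt (fun z : ℂ => z - u0) 1 u0 := (hasStrictDerivAt_id u0).sub_const u0
    have h1 : HasStrictDerivAt (fun z : ℂ => (z - u0) * c) (1 * c) u0 :=
      HasStrictDerivAt.mul_const h0 c
    have h2 : HasStrictDerivAt ψ (1 * c * E u0 + (u0 - u0) * c * deriv E u0) u0 :=
      HasStrictDerivAt.mul h1 hEa.hasStrictDerivAt
    have h3 : 1 * c * E u0 + (u0 - u0) * c * deriv E u0 = c := by rw [hE0]; ring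
    rwa [h3] at h2
  have hψ0 : ψ u0 = 0 := by simp [hψ]
  have hmap : map ψ (𝓝 u0) = 𝓝 0 := by
    rw [← hψ0]; exact hψd.map_nhds_eq hc0
  have hgne : ∀ᶠ z in 𝓝 u0, g z ≠ 0 := hg.continuousAt.eventually_ne hg0
  have hrel : ∀ᶠ z in 𝓝 u0, z ≠ u0 → (z ∈ U ∧ Y z = (z - u0) ^ (-(k : ℤ)) * g z ∧ g z ≠ 0) := by
    have h1 := eventually_nhdsWithin_iff.mp (hU : ∀ᶠ z in 𝓝[≠] u0, z ∈ U)
    have h2 := eventually_nhdsWithin_iff.mp hYg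
    filter_upwards [h1, h2, hgne] with z a b d hz
    exact ⟨a hz, by simpa using b hz, d⟩
  have him : ψ '' {z | z ≠ u0 → (z ∈ U ∧ Y z = (z - u0) ^ (-(k : ℤ)) * g z ∧ g z ≠ 0)} ∈
      𝓝 (0 : ℂ) := by
    rw [← hmap]; exact image_mem_map hrel
  obtain ⟨ε, hε, hball⟩ := Metric.mem_nhds_iff.mp him
  -- For ‖X‖ > ε^(-k) all k-th roots of 1/X lie in the ε-disc covered by ψ; their preimages under ψ
  -- are the k solutions.
  refine ⟨1 / ε ^ k, fun X hX => ?_⟩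
  have hX0 : X ≠ 0 := by
    rintro rfl
    rw [norm_zero] at hX
    exact absurd hX (not_lt.mpr (by positivity))
  obtain ⟨ζ, hζ⟩ := IsAlgClosed.exists_pow_nat_eq (1 / X) (Nat.pos_of_ne_zero hk)
  have hζn : ‖ζ‖ < ε := by
    by_contra hcon
    push Not at hcon
    have h1 : ε ^ k ≤ ‖ζ‖ ^ k := pow_le_pow_left₀ hε.le hcon k
    rw [← norm_pow, hζ, norm_div, norm_one] at h1
    have hXp : 0 < ‖X‖ := norm_pos_iff.mpr hX0
    have : ‖X‖ ≤ 1 / ε ^ k := by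
      rw [le_div_iff₀ (by positivity)]
      rw [le_div_iff₀ hXp] at h1
      linarith
    linarith
  have hζ0 : ζ ≠ 0 := by
    rintro rfl
    rw [zero_pow hk] at hζ
    exact one_div_ne_zero hX0 hζ.symm
  set ω := Complex.exp (2 * Real.pi * Complex.I / k) with hω
  have hωp : IsPrimitiveRoot ω k := Complex.isPrimitiveRoot_exp k hk
  have hωn : ‖ω‖ = 1 := hωp.norm'_eq_one hk
  have hpre : ∀ j : ℕ, ∃ z, z ≠ u0 ∧ z ∈ U ∧ Y z = X ∧ ψ z = ζ * ω ^ j := by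
    intro j
    have hin : ζ * ω ^ j ∈ Metric.ball (0 : ℂ) ε := by
      simpa [hωn] using hζn
    obtain ⟨z, hz, hzψ⟩ := hball hin
    have hzne : z ≠ u0 := by
      rintro rfl
      rw [hψ0] at hzψ
      exact mul_ne_zero hζ0 (pow_ne_zero _ (hωp.ne_zero hk)) hzψ.symm
    obtain ⟨h1, h2, h3⟩ := hz hzne
    refine ⟨z, hzne, h1, ?_, hzψ⟩
    have h4 : ψ z ^ k = (z - u0) ^ k / g z := by
      have : E z ^ k = g u0 / g z := by
        rw [hE, ← Complex.exp_nat_mul, mul_div_cancel₀ _ hk', Complex.exp_neg,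
          Complex.exp_log (div_ne_zero h3 hg0), inv_div]
      simp only [hψ, mul_pow, this, hc]
      field_simp
    have h5 : ψ z ^ k = 1 / X := by
      rw [hzψ, mul_pow, hζ, ← pow_mul, mul_comm j k, pow_mul, hωp.pow_eq_one, one_pow, mul_one]
    have h6 : (z - u0) ^ k ≠ 0 := pow_ne_zero _ (sub_ne_zero.mpr hzne)
    rw [h2, zpow_neg, zpow_natCast]
    rw [h4] at h5
    field_simp at h5 ⊢
    exact h5.symm
  choose z hz1 hz2 hz3 hz4 using hpre
  refine ⟨(Finset.range k).image z, ?_, ?_⟩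
  · rw [Finset.card_image_of_injOn, Finset.card_range]
    intro i hi j hj hij
    have : ζ * ω ^ i = ζ * ω ^ j := by rw [← hz4, ← hz4]; exact congrArg ψ hij
    exact hωp.pow_inj (by simpa using hi) (by simpa using hj) (mul_left_cancel₀ hζ0 this)
  · intro u hu
    obtain ⟨j, -, rfl⟩ := Finset.mem_image.mp hu
    exact ⟨hz2 j, hz3 j⟩

end DiskPotential

end

/-! ### Elliptic functions for a fixed lattice -/

noncomputable section

namespace DiskPotential

open Filter Topology PeriodPair

/-! ### Elliptic functions -/

/-- Meromorphic functions on `ℂ` with period lattice `L`, up to discrete sets. -/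
structure IsElliptic (L : PeriodPair) (f : ℂ → ℂ) : Prop where
  mero : Meromorphic f
  periodic : ∀ l ∈ L.lattice, (fun z => f (z + l)) =ᶠ[codiscrete ℂ] f

namespace IsElliptic

variable {L : PeriodPair} {f g : ℂ → ℂ}

theorem add (hf : IsElliptic L f) (hg : IsElliptic L g) : IsElliptic L (fun z => f z + g z) :=
  ⟨by have := hf.mero; have := hg.mero; fun_prop, fun l hl => by
    filter_upwards [hf.periodic l hl, hg.periodic l hl] with z h1 h2
    rw [h1, h2]⟩

theorem mul (hf : IsElliptic L f) (hg : IsElliptic L g) : IsElliptic L (fun z => f z * g z) :=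
  ⟨by have := hf.mero; have := hg.mero; fun_prop, fun l hl => by
    filter_upwards [hf.periodic l hl, hg.periodic l hl] with z h1 h2
    rw [h1, h2]⟩

theorem sub (hf : IsElliptic L f) (hg : IsElliptic L g) : IsElliptic L (fun z => f z - g z) :=
  ⟨by have := hf.mero; have := hg.mero; fun_prop, fun l hl => by
    filter_upwards [hf.periodic l hl, hg.periodic l hl] with z h1 h2
    rw [h1, h2]⟩

theorem const (c : ℂ) : IsElliptic L (fun _ => c) := ⟨by fun_prop, fun l hl => .rfl⟩

theorem inv (hf : IsElliptic L f) : IsElliptic L (fun z => (f z)⁻¹) :=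
  ⟨by have := hf.mero; fun_prop, fun l hl => by
    filter_upwards [hf.periodic l hl] with z h1
    rw [h1]⟩

theorem pow (hf : IsElliptic L f) (n : ℕ) : IsElliptic L (fun z => f z ^ n) :=
  ⟨by have := hf.mero; fun_prop, fun l hl => by
    filter_upwards [hf.periodic l hl] with z h1
    rw [h1]⟩

theorem comp_add (hf : IsElliptic L f) (c : ℂ) : IsElliptic L (fun z => f (z + c)) := by
  refine ⟨fun z => ?_, fun l hl => ?_⟩
  · exact (hf.mero (z + c)).comp_analyticAt (g := fun z => z + c) (by fun_prop)
  · filter_upwards [eventually_codiscrete_add c (hf.periodic l hl)] with z h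
    rw [← h, add_right_comm]

theorem comp_neg (hf : IsElliptic L f) : IsElliptic L (fun z => f (-z)) := by
  refine ⟨fun z => ?_, fun l hl => ?_⟩
  · exact (hf.mero (-z)).comp_analyticAt (g := fun z => -z) (by fun_prop)
  · have := eventually_codiscrete_neg (hf.periodic (-l) (neg_mem hl))
    filter_upwards [this] with z h
    rw [← h, neg_add]

theorem order_add (hf : IsElliptic L f) {l : ℂ} (hl : l ∈ L.lattice) (z : ℂ) :
    meromorphicOrderAt f (z + l) = meromorphicOrderAt f z := by
  rw [← meromorphicOrderAt_comp_add_const_eq_meromorphicOrderAt]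
  exact meromorphicOrderAt_congr (eventually_codiscrete_iff.mp (hf.periodic l hl) z)

theorem order_lattice (hf : IsElliptic L f) {l : ℂ} (hl : l ∈ L.lattice) :
    meromorphicOrderAt f l = meromorphicOrderAt f 0 := by
  have := hf.order_add hl 0
  rwa [zero_add] at this

/-- Liouville: the normal form of f has no poles, hence is entire. By continuity its periodicity
holds everywhere, so its range is compact and it is constant. -/
theorem exists_eq_const (hf : IsElliptic L f) (h0 : ∀ z, 0 ≤ meromorphicOrderAt f z) :
    ∃ c, f =ᶠ[codiscrete ℂ] fun _ => c := by
  have hon : MeromorphicOn f Set.univ := meromorphicOn_univ.mpr hf.mero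
  set g := toMeromorphicNFOn f Set.univ with hg
  have hfg : f =ᶠ[codiscrete ℂ] g := toMeromorphicNFOn_eqOn_codiscrete hon
  have hga : ∀ z, AnalyticAt ℂ g z := fun z => by
    have h1 : MeromorphicNFAt g z := meromorphicNFOn_toMeromorphicNFOn f Set.univ (Set.mem_univ z)
    rw [← h1.meromorphicOrderAt_nonneg_iff_analyticAt, hg,
      meromorphicOrderAt_toMeromorphicNFOn hon (Set.mem_univ z)]
    exact h0 z
  have hgd : Differentiable ℂ g := fun z => (hga z).differentiableAt
  have hgp : ∀ z w, w ∈ L.lattice → g (z + w) = g z := fun z w hw => by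
    refine eq_of_eventuallyEq_codiscrete (f := fun z => g (z + w)) ?_
      (hgd.continuous.comp (continuous_add_const w)).continuousAt hgd.continuous.continuousAt
    filter_upwards [hfg, eventually_codiscrete_add w hfg, hf.periodic w hw] with z h1 h2 h3
    rw [← h1, ← h2, h3]
  have hb := (IsZLattice.isCompact_range_of_periodic L.lattice g hgd.continuous hgp).isBounded
  refine ⟨g 0, hfg.trans (Eventually.of_forall fun z => ?_)⟩
  exact hgd.apply_eq_apply_of_bounded hb z 0

end IsElliptic

section

variable (L : PeriodPair)

theorem isElliptic_weierstrassP : IsElliptic L ℘[L] :=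
  ⟨by fun_prop, fun l hl => Eventually.of_forall fun z => L.weierstrassP_add_coe z ⟨l, hl⟩⟩

theorem isElliptic_derivWeierstrassP : IsElliptic L ℘'[L] :=
  ⟨by fun_prop, fun l hl => Eventually.of_forall fun z => L.derivWeierstrassP_add_coe z ⟨l, hl⟩⟩

theorem order_weierstrassP_zero : meromorphicOrderAt ℘[L] 0 = -2 :=
  L.order_weierstrassP 0 (zero_mem _)

theorem order_derivWeierstrassP_zero : meromorphicOrderAt ℘'[L] 0 = -3 := by
  rw [← L.deriv_weierstrassP, meromorphicOrderAt_deriv_eq_sub_one (n := -2) (by norm_num)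
    (order_weierstrassP_zero L)]
  norm_num

theorem order_weierstrassP_nonneg {z : ℂ} (hz : z ∉ L.lattice) : 0 ≤ meromorphicOrderAt ℘[L] z :=
  (L.analyticOnNhd_weierstrassP z hz).meromorphicOrderAt_nonneg

theorem order_derivWeierstrassP_nonneg {z : ℂ} (hz : z ∉ L.lattice) :
    0 ≤ meromorphicOrderAt ℘'[L] z :=
  (L.analyticOnNhd_derivWeierstrassP z hz).meromorphicOrderAt_nonneg

theorem half_sum_notMem_lattice : L.ω₁ / 2 + L.ω₂ / 2 ∉ L.lattice := by
  have := L.mul_ω₁_add_mul_ω₂_mem_lattice (α := 1 / 2) (β := 1 / 2)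
  intro h
  rw [show L.ω₁ / 2 + L.ω₂ / 2 = ((1 / 2 : ℚ) : ℂ) * L.ω₁ + ((1 / 2 : ℚ) : ℂ) * L.ω₂ by
    push_cast; ring] at h
  rw [this] at h
  norm_num at h

end

/-- Cancellation of a leading term: f/φ has nonnegative order at z, and A is its limit there. -/
theorem exists_sub_mul_order {f φ : ℂ → ℂ} {z : ℂ} {n : ℤ} (hf : MeromorphicAt f z)
    (hφ : MeromorphicAt φ z) (hn : meromorphicOrderAt φ z = n)
    (hfn : (n : WithTop ℤ) ≤ meromorphicOrderAt f z) :
    ∃ A : ℂ, ((n + 1 : ℤ) : WithTop ℤ) ≤ meromorphicOrderAt (fun w => f w - A * φ w) z := by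
  have hq : 0 ≤ meromorphicOrderAt (f / φ) z := by
    rw [meromorphicOrderAt_div hf hφ, hn]
    cases h : meromorphicOrderAt f z with
    | top => simp
    | coe a =>
      rw [h] at hfn
      have : n ≤ a := by exact_mod_cast hfn
      norm_cast
      omega
  obtain ⟨A, hA⟩ := tendsto_nhds_of_meromorphicOrderAt_nonneg (hf.div hφ) hq
  have hq' : MeromorphicAt (fun w => f w / φ w - A) z := by fun_prop
  have hpos : 0 < meromorphicOrderAt (fun w => f w / φ w - A) z := by
    rw [← tendsto_zero_iff_meromorphicOrderAt_pos hq']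
    have := hA.sub_const A
    rwa [sub_self] at this
  refine ⟨A, ?_⟩
  have hne : ∀ᶠ w in 𝓝[≠] z, φ w ≠ 0 :=
    (meromorphicOrderAt_ne_top_iff_eventually_ne_zero hφ).mp (by rw [hn]; simp)
  have hcongr : (fun w => f w - A * φ w) =ᶠ[𝓝[≠] z] φ * fun w => f w / φ w - A := by
    filter_upwards [hne] with w hw
    simp only [Pi.mul_apply]
    field_simp
  rw [meromorphicOrderAt_congr hcongr, meromorphicOrderAt_mul hφ hq', hn]
  cases h : meromorphicOrderAt (fun w => f w / φ w - A) z with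
  | top => simp
  | coe a =>
    rw [h] at hpos
    have : 0 < a := by exact_mod_cast hpos
    norm_cast
    omega

theorem order_sub_mul_nonneg {f φ : ℂ → ℂ} {z : ℂ} (A : ℂ) (hf : MeromorphicAt f z)
    (hφ : MeromorphicAt φ z) (hfn : 0 ≤ meromorphicOrderAt f z)
    (hφn : 0 ≤ meromorphicOrderAt φ z) :
    0 ≤ meromorphicOrderAt (fun w => f w - A * φ w) z := by
  obtain ⟨g, hg, hfg⟩ := hf.meromorphicOrderAt_nonneg_iff.mp hfn
  obtain ⟨ψ, hψ, hφψ⟩ := hφ.meromorphicOrderAt_nonneg_iff.mp hφn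
  refine (MeromorphicAt.meromorphicOrderAt_nonneg_iff (by fun_prop)).mpr
    ⟨fun w => g w - A * ψ w, by fun_prop, ?_⟩
  filter_upwards [hfg, hφψ] with w h1 h2
  rw [h1, h2]

namespace IsElliptic

variable {L : PeriodPair} {f g : ℂ → ℂ}

theorem sub_const_mul (hf : IsElliptic L f) (hg : IsElliptic L g) (A : ℂ) :
    IsElliptic L (fun z => f z - A * g z) := hf.sub ((IsElliptic.const A).mul hg)

/-- An odd elliptic function which is holomorphic at a half-period vanishes there. -/
theorem order_half_period_pos (hf : IsElliptic L f)
    (hodd : (fun z => f (-z)) =ᶠ[codiscrete ℂ] fun z => -f z) {h : ℂ} (hh : h + h ∈ L.lattice)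
    (ho : 0 ≤ meromorphicOrderAt f h) : 0 < meromorphicOrderAt f h := by
  obtain ⟨a, ha⟩ := tendsto_nhds_of_meromorphicOrderAt_nonneg (hf.mero h) ho
  have hrefl : Tendsto (fun z : ℂ => h + h - z) (𝓝[≠] h) (𝓝[≠] h) := by
    refine tendsto_nhdsWithin_of_tendsto_nhds_of_eventually_within _ ?_ ?_
    · have : ContinuousAt (fun z : ℂ => h + h - z) h := by fun_prop
      have h2 := this.tendsto
      rw [add_sub_cancel_right] at h2
      exact h2.mono_left nhdsWithin_le_nhds
    · filter_upwards [self_mem_nhdsWithin] with z hz hz'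
      exact hz (by have : h + h - z = h := hz'; show z = h; linear_combination -this)
  have h1 := ha.comp hrefl
  have hper := eventually_codiscrete_iff.mp (eventually_codiscrete_neg (hf.periodic _ hh)) h
  have hodd' := eventually_codiscrete_iff.mp hodd h
  have h2 : (f ∘ fun z : ℂ => h + h - z) =ᶠ[𝓝[≠] h] fun z => -f z := by
    filter_upwards [hper, hodd'] with z h3 h4
    rw [Function.comp_apply, ← h4, ← h3, sub_eq_neg_add]
  have h3 : a = -a := tendsto_nhds_unique (h1.congr' h2) ha.neg
  have h4 : a = 0 := by linear_combination h3 / 2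
  rw [h4] at ha
  exact (tendsto_zero_iff_meromorphicOrderAt_pos (hf.mero h)).mp ha

/-- There is no elliptic function with a single simple pole. -/
theorem exists_eq_const_of_neg_one_le (hf : IsElliptic L f)
    (h0 : ∀ z ∉ L.lattice, 0 ≤ meromorphicOrderAt f z)
    (h1 : ((-1 : ℤ) : WithTop ℤ) ≤ meromorphicOrderAt f 0) :
    ∃ c, f =ᶠ[codiscrete ℂ] fun _ => c := by
  rcases h1.lt_or_eq with hlt | heq
  · refine hf.exists_eq_const fun z => ?_
    by_cases hz : z ∈ L.lattice
    · rw [hf.order_lattice hz]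
      cases h : meromorphicOrderAt f 0 with
      | top => simp
      | coe a =>
        rw [h] at hlt
        have : -1 < a := by exact_mod_cast hlt
        norm_cast
    · exact h0 z hz
  exfalso
  -- Antisymmetrization keeps the simple pole at the origin, and oddness forces zeros at ω₁/2 and
  -- ω₂/2.
  set R : ℂ → ℂ := fun z => f z - f (-z) with hR
  have hRe : IsElliptic L R := hf.sub hf.comp_neg
  have hodd : (fun z => R (-z)) =ᶠ[codiscrete ℂ] fun z => -R z :=
    Eventually.of_forall fun z => by simp [hR]
  have hneg : ∀ z, meromorphicOrderAt (fun z => f (-z)) z = meromorphicOrderAt f (-z) := fun z =>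
    meromorphicOrderAt_comp_of_deriv_ne_zero (f := f) (g := fun z => -z) (x := z) (by fun_prop)
      (by simp)
  have hR0 : ∀ z ∉ L.lattice, 0 ≤ meromorphicOrderAt R z := fun z hz => by
    have := order_sub_mul_nonneg (f := f) (φ := fun z => f (-z)) (z := z) 1 (hf.mero z)
      (hf.comp_neg.mero z) (h0 z hz) (by
        rw [hneg]; exact h0 _ fun h => hz (by simpa using neg_mem h))
    simpa [hR] using this
  have hRp : meromorphicOrderAt R 0 = ((-1 : ℤ) : WithTop ℤ) := by
    obtain ⟨g, hg, hg0, hfg⟩ := (meromorphicOrderAt_eq_int_iff (hf.mero 0)).mp heq.symm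
    rw [meromorphicOrderAt_eq_int_iff (hRe.mero 0)]
    refine ⟨fun z => g z + g (-z), ?_, ?_, ?_⟩
    · have : AnalyticAt ℂ (fun z => g (-z)) 0 := by
        have h' : AnalyticAt ℂ g (-0) := by simpa using hg
        exact h'.comp (f := fun z : ℂ => -z) (by fun_prop)
      exact hg.fun_add this
    · simpa [← two_mul] using hg0
    · have ht : Tendsto (fun z : ℂ => -z) (𝓝[≠] 0) (𝓝[≠] 0) := by
        refine tendsto_nhdsWithin_of_tendsto_nhds_of_eventually_within _ ?_ ?_
        · have : ContinuousAt (fun z : ℂ => -z) 0 := by fun_prop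
          have h2 := this.tendsto
          rw [neg_zero] at h2
          exact h2.mono_left nhdsWithin_le_nhds
        · filter_upwards [self_mem_nhdsWithin] with z hz hz'
          exact hz (by simpa using hz')
      filter_upwards [hfg, ht.eventually hfg] with z h2 h3
      simp only [hR, h2, h3, smul_eq_mul, zpow_neg_one, sub_zero]
      rw [inv_neg]
      ring
  have hRtop : ∀ z, meromorphicOrderAt R z ≠ ⊤ := fun z =>
    (meromorphicOn_univ.mpr hRe.mero).meromorphicOrderAt_ne_top_of_isPreconnected
      isPreconnected_univ (Set.mem_univ 0) (Set.mem_univ z) (by rw [hRp]; simp)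
  have hw1 : L.ω₁ / 2 + L.ω₁ / 2 ∈ L.lattice := by rw [add_halves]; exact L.ω₁_mem_lattice
  have hw2 : L.ω₂ / 2 + L.ω₂ / 2 ∈ L.lattice := by rw [add_halves]; exact L.ω₂_mem_lattice
  have hone : ∀ {a : WithTop ℤ}, 0 < a → ((1 : ℤ) : WithTop ℤ) ≤ a := by
    intro a ha
    cases a with
    | top => simp
    | coe a =>
      have : 0 < a := by exact_mod_cast ha
      exact_mod_cast this
  have hp1 := hone (hRe.order_half_period_pos hodd hw1 (hR0 _ L.ω₁_div_two_notMem_lattice))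
  have hp2 := hone (hRe.order_half_period_pos hodd hw2 (hR0 _ L.ω₂_div_two_notMem_lattice))
  -- The pole of each factor meets a zero of the other, so Q is constant. It vanishes at ω₂/2, hence
  -- identically, although neither factor does.
  set Q : ℂ → ℂ := fun z => R z * R (z + L.ω₁ / 2) with hQ
  have hQe : IsElliptic L Q := hRe.mul (hRe.comp_add _)
  have hQo : ∀ z, meromorphicOrderAt Q z =
      meromorphicOrderAt R z + meromorphicOrderAt R (z + L.ω₁ / 2) := fun z => by
    rw [← meromorphicOrderAt_comp_add_const_eq_meromorphicOrderAt]
    exact meromorphicOrderAt_mul (hRe.mero z) ((hRe.comp_add _).mero z)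
  have hz11 : (0 : WithTop ℤ) = ((-1 : ℤ) : WithTop ℤ) + ((1 : ℤ) : WithTop ℤ) := by norm_cast
  have hQ0 : ∀ z, 0 ≤ meromorphicOrderAt Q z := fun z => by
    rw [hQo]
    by_cases hz : z ∈ L.lattice
    · rw [hRe.order_lattice hz, hRp, add_comm z, hRe.order_add hz, hz11]
      exact add_le_add le_rfl hp1
    · by_cases hz' : z + L.ω₁ / 2 ∈ L.lattice
      · rw [hRe.order_lattice hz', hRp]
        have h3 : z = L.ω₁ / 2 + (z + L.ω₁ / 2 - (L.ω₁ / 2 + L.ω₁ / 2)) := by ring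
        rw [h3, hRe.order_add (sub_mem hz' hw1), hz11, add_comm]
        exact add_le_add hp1 le_rfl
      · exact add_nonneg (hR0 _ hz) (hR0 _ hz')
  obtain ⟨c, hc⟩ := hQe.exists_eq_const hQ0
  have hpos : 0 < meromorphicOrderAt Q (L.ω₂ / 2) := by
    rw [hQo]
    have h3 : 0 ≤ meromorphicOrderAt R (L.ω₂ / 2 + L.ω₁ / 2) :=
      hR0 _ (by rw [add_comm]; exact half_sum_notMem_lattice L)
    refine lt_of_lt_of_le ?_ (add_le_add hp2 h3)
    rw [add_zero]
    norm_cast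
  have hlim := (tendsto_zero_iff_meromorphicOrderAt_pos (hQe.mero _)).mpr hpos
  have hc0 : c = 0 := by
    have h4 := hlim.congr' (eventually_codiscrete_iff.mp hc (L.ω₂ / 2))
    exact tendsto_nhds_unique tendsto_const_nhds h4
  have htop : meromorphicOrderAt Q 0 = ⊤ := by
    rw [meromorphicOrderAt_eq_top_iff]
    filter_upwards [eventually_codiscrete_iff.mp hc 0] with z hz
    rw [hz, hc0]
  rw [hQo] at htop
  rcases WithTop.add_eq_top.mp htop with h | h
  · exact hRtop _ h
  · exact hRtop _ h

theorem exists_eq_of_neg_two_le (hf : IsElliptic L f)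
    (h0 : ∀ z ∉ L.lattice, 0 ≤ meromorphicOrderAt f z)
    (h2 : ((-2 : ℤ) : WithTop ℤ) ≤ meromorphicOrderAt f 0) :
    ∃ C D : ℂ, f =ᶠ[codiscrete ℂ] fun z => C * ℘[L] z + D := by
  obtain ⟨C, hC⟩ := exists_sub_mul_order (hf.mero 0) ((isElliptic_weierstrassP L).mero 0)
    (order_weierstrassP_zero L) h2
  obtain ⟨D, hD⟩ := (hf.sub_const_mul (isElliptic_weierstrassP L) C).exists_eq_const_of_neg_one_le
    (fun z hz => order_sub_mul_nonneg C (hf.mero z) ((isElliptic_weierstrassP L).mero z) (h0 z hz)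
      (order_weierstrassP_nonneg L hz)) hC
  refine ⟨C, D, ?_⟩
  filter_upwards [hD] with z hz
  linear_combination hz

/-- ℘², ℘' and ℘ have poles of orders 4, 3 and 2 at the origin and no others modulo L. Removing
leading terms one by one leaves at most a simple pole, hence a constant. -/
theorem exists_eq_of_neg_four_le (hf : IsElliptic L f)
    (h0 : ∀ z ∉ L.lattice, 0 ≤ meromorphicOrderAt f z)
    (h4 : ((-4 : ℤ) : WithTop ℤ) ≤ meromorphicOrderAt f 0) :
    ∃ A B C D : ℂ, f =ᶠ[codiscrete ℂ] fun z => A * ℘[L] z ^ 2 + B * ℘'[L] z + C * ℘[L] z + D := by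
  have hP := isElliptic_weierstrassP L
  have hP' := isElliptic_derivWeierstrassP L
  have ho : meromorphicOrderAt (fun z => ℘[L] z ^ 2) 0 = ((-4 : ℤ) : WithTop ℤ) := by
    have := meromorphicOrderAt_pow (hP.mero 0) (n := 2)
    rw [order_weierstrassP_zero] at this
    exact this
  have hz2 : ∀ z ∉ L.lattice, 0 ≤ meromorphicOrderAt (fun z => ℘[L] z ^ 2) z := fun z hz =>
    ((L.analyticOnNhd_weierstrassP z hz).fun_pow 2).meromorphicOrderAt_nonneg
  obtain ⟨A, hA⟩ := exists_sub_mul_order (hf.mero 0) ((hP.pow 2).mero 0) ho h4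
  have hf1 := hf.sub_const_mul (hP.pow 2) A
  have h01 : ∀ z ∉ L.lattice, 0 ≤ meromorphicOrderAt (fun w => f w - A * ℘[L] w ^ 2) z :=
    fun z hz => order_sub_mul_nonneg A (hf.mero z) ((hP.pow 2).mero z) (h0 z hz) (hz2 z hz)
  obtain ⟨B, hB⟩ := exists_sub_mul_order (hf1.mero 0) (hP'.mero 0)
    (order_derivWeierstrassP_zero L) hA
  obtain ⟨C, D, hCD⟩ := (hf1.sub_const_mul hP' B).exists_eq_of_neg_two_le
    (fun z hz => order_sub_mul_nonneg B (hf1.mero z) (hP'.mero z) (h01 z hz)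
      (order_derivWeierstrassP_nonneg L hz)) hB
  refine ⟨A, B, C, D, ?_⟩
  filter_upwards [hCD] with z hz
  linear_combination hz

theorem exists_eq_mul_derivWeierstrassP (hf : IsElliptic L f)
    (h0 : ∀ z ∉ L.lattice, 0 ≤ meromorphicOrderAt f z)
    (h4 : ((-4 : ℤ) : WithTop ℤ) ≤ meromorphicOrderAt f 0)
    (hodd : (fun z => f (-z)) =ᶠ[codiscrete ℂ] fun z => -f z) :
    ∃ B : ℂ, f =ᶠ[codiscrete ℂ] fun z => B * ℘'[L] z := by
  obtain ⟨A, B, C, D, h⟩ := hf.exists_eq_of_neg_four_le h0 h4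
  refine ⟨B, ?_⟩
  filter_upwards [h, eventually_codiscrete_neg h, hodd] with z h1 h2 h3
  rw [L.weierstrassP_neg, L.derivWeierstrassP_neg] at h2
  linear_combination h1 / 2 - h2 / 2 + h3 / 2

end IsElliptic

end DiskPotential

end

noncomputable section

namespace DiskPotential

open Filter Topology PeriodPair

/-! ### Values of the Weierstrass function -/

theorem two_le_order {f : ℂ → ℂ} {v : ℂ} (hf : AnalyticAt ℂ f v) (h0 : f v = 0)
    (h1 : deriv f v = 0) : ((2 : ℤ) : WithTop ℤ) ≤ meromorphicOrderAt f v := by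
  have hpos : 0 < meromorphicOrderAt f v := by
    rw [← tendsto_zero_iff_meromorphicOrderAt_pos hf.meromorphicAt, ← h0]
    exact hf.continuousAt.tendsto.mono_left nhdsWithin_le_nhds
  cases h : meromorphicOrderAt f v with
  | top => simp
  | coe a =>
    rw [h] at hpos
    have ha : 0 < a := by exact_mod_cast hpos
    by_contra hcon
    have ha2 : ¬ (2 ≤ a) := fun h => hcon (by exact_mod_cast h)
    obtain rfl : a = 1 := by omega
    have hd := meromorphicOrderAt_deriv_eq_sub_one (𝕜 := ℂ) (n := 1) (by norm_num) h
    have hd' : 0 < meromorphicOrderAt (deriv f) v := by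
      rw [← tendsto_zero_iff_meromorphicOrderAt_pos hf.deriv.meromorphicAt, ← h1]
      exact hf.deriv.continuousAt.tendsto.mono_left nhdsWithin_le_nhds
    rw [hd] at hd'
    simp at hd'

theorem order_eq_one {f : ℂ → ℂ} {v : ℂ} (hf : AnalyticAt ℂ f v) (h0 : f v = 0)
    (h1 : deriv f v ≠ 0) : meromorphicOrderAt f v = 1 := by
  have h := hf.analyticOrderAt_sub_eq_one_of_deriv_ne_zero h1
  simp only [h0, sub_zero] at h
  rw [hf.meromorphicOrderAt_eq, h]
  rfl

theorem order_pos_of_eq_zero {f : ℂ → ℂ} {v : ℂ} (hf : AnalyticAt ℂ f v) (h0 : f v = 0) :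
    0 < meromorphicOrderAt f v := by
  rw [← tendsto_zero_iff_meromorphicOrderAt_pos hf.meromorphicAt, ← h0]
  exact hf.continuousAt.tendsto.mono_left nhdsWithin_le_nhds

theorem order_eq_zero {f : ℂ → ℂ} {v : ℂ} (hf : AnalyticAt ℂ f v) (h0 : f v ≠ 0) :
    meromorphicOrderAt f v = 0 := by
  rw [← tendsto_ne_zero_iff_meromorphicOrderAt_eq_zero hf.meromorphicAt]
  exact ⟨f v, h0, hf.continuousAt.tendsto.mono_left nhdsWithin_le_nhds⟩

section

variable (L : PeriodPair)

theorem not_weierstrassP_eventuallyEq_const (c : ℂ) : ¬ (℘[L] =ᶠ[codiscrete ℂ] fun _ => c) := by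
  intro h
  have h1 := meromorphicOrderAt_congr (eventually_codiscrete_iff.mp h 0)
  have h2 : 0 ≤ meromorphicOrderAt (fun _ : ℂ => c) 0 := analyticAt_const.meromorphicOrderAt_nonneg
  rw [← h1, order_weierstrassP_zero] at h2
  exact absurd h2 (by decide)

theorem eventually_weierstrassP_ne (c : ℂ) : ∀ᶠ z in codiscrete ℂ, ℘[L] z ≠ c :=
  eventually_codiscrete_ne_const (by fun_prop) (not_weierstrassP_eventuallyEq_const L) c

theorem eventually_notMem_lattice : ∀ᶠ z in codiscrete ℂ, z ∉ L.lattice := by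
  refine eventually_codiscrete_iff.mpr fun z => ?_
  have h := L.compl_lattice_sdiff_singleton_mem_nhds z
  filter_upwards [self_mem_nhdsWithin, nhdsWithin_le_nhds h] with w hw hw' hwl
  exact hw' ⟨hwl, hw⟩

theorem eventually_derivWeierstrassP_ne_zero : ∀ᶠ z in codiscrete ℂ, ℘'[L] z ≠ 0 :=
  eventually_codiscrete_ne_zero (by fun_prop) 0 (by rw [order_derivWeierstrassP_zero]; decide)

/-- If c were omitted, 1/(℘ - c) would be elliptic without poles and zero at the origin, hence
identically zero. -/
theorem weierstrassP_surjective (c : ℂ) : ∃ z ∉ L.lattice, ℘[L] z = c := by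
  by_contra! hcon
  have hP := isElliptic_weierstrassP L
  have hf : IsElliptic L (fun z => (℘[L] z - c)⁻¹) := (hP.sub (IsElliptic.const c)).inv
  have ho0 : meromorphicOrderAt (fun z => ℘[L] z - c) 0 = -2 := by
    have h1 := meromorphicOrderAt_add_eq_left_of_lt (f₁ := ℘[L]) (f₂ := fun _ => -c) (x := 0)
      (by fun_prop) (by
        rw [order_weierstrassP_zero]
        exact lt_of_lt_of_le (by decide) analyticAt_const.meromorphicOrderAt_nonneg)
    rw [order_weierstrassP_zero] at h1
    rw [← h1]
    congr 1
  have hinv : ∀ z, meromorphicOrderAt (fun z => (℘[L] z - c)⁻¹) z =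
      -meromorphicOrderAt (fun z => ℘[L] z - c) z := fun z => meromorphicOrderAt_inv
  have ho2 : meromorphicOrderAt (fun z => (℘[L] z - c)⁻¹) 0 = 2 := by
    rw [hinv, ho0]; rfl
  obtain ⟨d, hd⟩ := hf.exists_eq_const fun z => by
    by_cases hz : z ∈ L.lattice
    · rw [hf.order_lattice hz, ho2]; decide
    · have ha := L.analyticOnNhd_weierstrassP z hz
      have h2 : AnalyticAt ℂ (fun z => ℘[L] z - c) z := by fun_prop
      rw [hinv, order_eq_zero h2 (sub_ne_zero.mpr (hcon z hz))]
      simp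
  have hlim := (tendsto_zero_iff_meromorphicOrderAt_pos (hf.mero 0)).mpr (by rw [ho2]; decide)
  have hd0 : d = 0 :=
    tendsto_nhds_unique tendsto_const_nhds (hlim.congr' (eventually_codiscrete_iff.mp hd 0))
  have htop : meromorphicOrderAt (fun z => (℘[L] z - c)⁻¹) 0 = ⊤ := by
    rw [meromorphicOrderAt_eq_top_iff]
    filter_upwards [eventually_codiscrete_iff.mp hd 0] with z hz
    rw [hz, hd0]
  rw [ho2] at htop
  exact absurd htop (by decide)

/-- Differentiate ℘'² = 4℘³ - g₂℘ - g₃ and divide by 2℘' where it does not vanish; continuity covers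
the remaining points. -/
theorem deriv_derivWeierstrassP {z : ℂ} (hz : z ∉ L.lattice) :
    deriv ℘'[L] z = 6 * ℘[L] z ^ 2 - L.g₂ / 2 := by
  have hopen : IsOpen (L.lattice : Set ℂ)ᶜ := L.isClosed_lattice.isOpen_compl
  have hae : deriv ℘'[L] =ᶠ[codiscrete ℂ] fun z => 6 * ℘[L] z ^ 2 - L.g₂ / 2 := by
    filter_upwards [eventually_notMem_lattice L, eventually_derivWeierstrassP_ne_zero L]
      with w hw hw0
    have h1 := (L.analyticOnNhd_weierstrassP w hw).differentiableAt.hasDerivAt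
    rw [L.deriv_weierstrassP] at h1
    have h2 := (L.analyticOnNhd_derivWeierstrassP w hw).differentiableAt.hasDerivAt
    have h3 := h2.fun_pow 2
    have h4 := (((h1.fun_pow 3).const_mul 4).fun_sub (h1.const_mul L.g₂)).sub_const L.g₃
    have h5 : (fun z => ℘'[L] z ^ 2) =ᶠ[𝓝 w]
        fun z => 4 * ℘[L] z ^ 3 - L.g₂ * ℘[L] z - L.g₃ := by
      filter_upwards [hopen.mem_nhds hw] with y hy
      exact L.derivWeierstrassP_sq y hy
    have h6 := (h3.congr_of_eventuallyEq h5.symm).unique h4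
    norm_num at h6
    have h7 : 2 * ℘'[L] w * (deriv ℘'[L] w - (6 * ℘[L] w ^ 2 - L.g₂ / 2)) = 0 := by
      linear_combination h6
    rcases mul_eq_zero.mp h7 with h | h
    · exact absurd h (mul_ne_zero two_ne_zero hw0)
    · exact sub_eq_zero.mp h
  have ha := L.analyticOnNhd_weierstrassP z hz
  exact eq_of_eventuallyEq_codiscrete hae (L.analyticOnNhd_derivWeierstrassP z hz).deriv.continuousAt
    (AnalyticAt.continuousAt (𝕜 := ℂ) (by fun_prop))

theorem analyticAt_weierstrassP_add {z v : ℂ} (h : z + v ∉ L.lattice) :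
    AnalyticAt ℂ (fun z => ℘[L] (z + v)) z :=
  (L.analyticOnNhd_weierstrassP (z + v) h).comp (f := fun z : ℂ => z + v) (by fun_prop)

theorem order_weierstrassP_add (z v : ℂ) :
    meromorphicOrderAt (fun z => ℘[L] (z + v)) z = meromorphicOrderAt ℘[L] (z + v) :=
  meromorphicOrderAt_comp_add_const_eq_meromorphicOrderAt (f := ℘[L]) (c := v)

theorem order_weierstrassP_ge (z : ℂ) : ((-2 : ℤ) : WithTop ℤ) ≤ meromorphicOrderAt ℘[L] z := by
  by_cases hz : z ∈ L.lattice
  · rw [L.order_weierstrassP z hz]; exact le_rfl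
  · exact le_trans (by decide) (order_weierstrassP_nonneg L hz)

theorem order_weierstrassP_sub_const_ge (c z : ℂ) :
    ((-2 : ℤ) : WithTop ℤ) ≤ meromorphicOrderAt (fun w => ℘[L] w - c) z := by
  have h := meromorphicOrderAt_add (f₁ := ℘[L]) (f₂ := fun _ => -c) (x := z) (by fun_prop)
    (by fun_prop)
  have h2 : (℘[L] + fun _ => -c) = fun w => ℘[L] w - c := rfl
  rw [h2] at h
  exact le_trans (le_min (order_weierstrassP_ge L z)
    (le_trans (by decide) analyticAt_const.meromorphicOrderAt_nonneg)) h

/-- Let c = ℘(v). The double zero of ℘ - c at v absorbs the pole of ℘(z - v), so (℘(z) - c) ℘(z - v)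
has at most a double pole at the origin and equals B℘ + D. A further zero u of ℘ - c, not congruent
to v, forces D = -Bc. Then ℘(z - v) is the constant B, which is absurd. -/
theorem sub_mem_lattice_of_derivWeierstrassP_eq_zero {u v : ℂ} (hu : u ∉ L.lattice)
    (hv : v ∉ L.lattice) (h : ℘[L] u = ℘[L] v) (hd : ℘'[L] v = 0) : u - v ∈ L.lattice := by
  by_contra hcon
  set c := ℘[L] v with hc
  have hP := isElliptic_weierstrassP L
  set T : ℂ → ℂ := fun z => (℘[L] z - c) * ℘[L] (z + -v) with hT
  have hTe : IsElliptic L T := (hP.sub (IsElliptic.const c)).mul (hP.comp_add (-v))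
  have hord : ∀ z, meromorphicOrderAt T z =
      meromorphicOrderAt (fun z => ℘[L] z - c) z + meromorphicOrderAt ℘[L] (z + -v) := fun z => by
    rw [← order_weierstrassP_add]
    exact meromorphicOrderAt_mul ((hP.sub (IsElliptic.const c)).mero z) ((hP.comp_add (-v)).mero z)
  have han : AnalyticAt ℂ (fun z => ℘[L] z - c) v := by
    have := L.analyticOnNhd_weierstrassP v hv
    fun_prop
  have h2v : ((2 : ℤ) : WithTop ℤ) ≤ meromorphicOrderAt (fun z => ℘[L] z - c) v :=
    two_le_order han (by simp [hc]) (by rw [deriv_sub_const, L.deriv_weierstrassP, hd])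
  obtain ⟨B, D, hBD⟩ := hTe.exists_eq_of_neg_two_le (fun z hz => by
    rw [hord]
    by_cases hz' : z + -v ∈ L.lattice
    · rw [L.order_weierstrassP _ hz', show z = v + (z + -v) by ring,
        (hP.sub (IsElliptic.const c)).order_add hz']
      exact le_trans (by decide) (add_le_add h2v (le_refl (-2 : WithTop ℤ)))
    · have ha := L.analyticOnNhd_weierstrassP z hz
      exact add_nonneg (AnalyticAt.meromorphicOrderAt_nonneg (by fun_prop))
        (order_weierstrassP_nonneg L hz')) (by
    rw [hord]
    have h1 : (0 : ℂ) + -v ∉ L.lattice := by simpa using hv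
    have h2 := add_le_add (order_weierstrassP_sub_const_ge L c 0) (order_weierstrassP_nonneg L h1)
    rwa [add_zero] at h2)
  have hu' : u + -v ∉ L.lattice := by rwa [← sub_eq_add_neg]
  have hTu : T u = B * ℘[L] u + D := by
    have ha := L.analyticOnNhd_weierstrassP u hu
    have hb := analyticAt_weierstrassP_add L hu'
    refine eq_of_eventuallyEq_codiscrete hBD ?_ ?_
    · exact AnalyticAt.continuousAt (𝕜 := ℂ) (by fun_prop)
    · exact AnalyticAt.continuousAt (𝕜 := ℂ) (by fun_prop)
  have hD : D = -B * c := by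
    have : T u = 0 := by simp [hT, h]
    rw [this, h] at hTu
    linear_combination -hTu
  have hfin : ∀ᶠ z in codiscrete ℂ, ℘[L] (z + -v) = B := by
    filter_upwards [hBD, eventually_weierstrassP_ne L c] with z h1 h2
    have h3 : (℘[L] z - c) * (℘[L] (z + -v) - B) = 0 := by
      rw [hD] at h1
      simp only [hT] at h1
      linear_combination h1
    rcases mul_eq_zero.mp h3 with h | h
    · exact absurd (sub_eq_zero.mp h) h2
    · exact sub_eq_zero.mp h
  obtain ⟨z, hz⟩ := (hfin.and (eventually_codiscrete_add (-v)
    (eventually_weierstrassP_ne L B))).exists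
  exact hz.2 hz.1

theorem two_mul_mem_lattice_of_derivWeierstrassP_eq_zero {v : ℂ} (hv : v ∉ L.lattice)
    (hd : ℘'[L] v = 0) : v + v ∈ L.lattice := by
  have := sub_mem_lattice_of_derivWeierstrassP_eq_zero L (u := -v) (fun h => hv (by
    simpa using neg_mem h)) hv (L.weierstrassP_neg v) hd
  have h2 := neg_mem this
  rwa [show -(-v - v) = v + v by ring] at h2

theorem derivWeierstrassP_eq_zero_of_two_mul_mem {v : ℂ} (h : v + v ∈ L.lattice) :
    ℘'[L] v = 0 := by
  have h1 := L.derivWeierstrassP_sub_coe v ⟨v + v, h⟩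
  have h2 : v - (v + v) = -v := by ring
  simp only [h2, L.derivWeierstrassP_neg] at h1
  linear_combination -h1 / 2

/-- Let c = ℘(v) with ℘'(v) ≠ 0. In T(z) = (℘(z) - c)² (℘(z + v) + ℘(z - v)) the double zeros at ±v
cancel the double poles, and T is even, so T is a quadratic polynomial in ℘. A point u with ℘(u) = c
that is congruent to neither v nor -v would give T(u) = 0, so the polynomial would vanish at c. But
T has order zero at v. -/
theorem weierstrassP_eq_imp {u v : ℂ} (hu : u ∉ L.lattice) (hv : v ∉ L.lattice)
    (h : ℘[L] u = ℘[L] v) : u - v ∈ L.lattice ∨ u + v ∈ L.lattice := by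
  by_cases hd : ℘'[L] v = 0
  · exact Or.inl (sub_mem_lattice_of_derivWeierstrassP_eq_zero L hu hv h hd)
  by_contra! hcon
  obtain ⟨huv, huv'⟩ := hcon
  have h2v : v + v ∉ L.lattice := fun h => hd (derivWeierstrassP_eq_zero_of_two_mul_mem L h)
  have h2v' : -v + -v ∉ L.lattice := fun h => h2v (by simpa using neg_mem h)
  set c := ℘[L] v with hc
  have hP := isElliptic_weierstrassP L
  set S : ℂ → ℂ := fun z => ℘[L] (z + v) + ℘[L] (z + -v) with hS
  set F : ℂ → ℂ := fun z => (℘[L] z - c) ^ 2 with hF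
  set T : ℂ → ℂ := fun z => F z * S z with hT
  have hSe : IsElliptic L S := (hP.comp_add v).add (hP.comp_add (-v))
  have hFe : IsElliptic L F := (hP.sub (IsElliptic.const c)).pow 2
  have hTe : IsElliptic L T := hFe.mul hSe
  have hord : ∀ z, meromorphicOrderAt T z =
      meromorphicOrderAt F z + meromorphicOrderAt S z := fun z =>
    meromorphicOrderAt_mul (hFe.mero z) (hSe.mero z)
  have hFord : ∀ z, meromorphicOrderAt F z =
      (2 : ℕ) * meromorphicOrderAt (fun z => ℘[L] z - c) z := fun z =>
    meromorphicOrderAt_pow ((hP.sub (IsElliptic.const c)).mero z)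
  have hF1 : ∀ w, w ∉ L.lattice → ℘[L] w = c → ℘'[L] w ≠ 0 →
      meromorphicOrderAt F w = ((2 : ℤ) : WithTop ℤ) := fun w hw hwc hwd => by
    have ha := L.analyticOnNhd_weierstrassP w hw
    rw [hFord, order_eq_one (f := fun z => ℘[L] z - c) (by fun_prop) (by simp [hwc])
      (by rwa [deriv_sub_const, L.deriv_weierstrassP])]
    rfl
  have hFv := hF1 v hv rfl hd
  have hvn : -v ∉ L.lattice := fun h => hv (by simpa using neg_mem h)
  have hFv' := hF1 (-v) hvn (L.weierstrassP_neg v) (by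
    rw [L.derivWeierstrassP_neg]; exact neg_ne_zero.mpr hd)
  have hSv : meromorphicOrderAt S v = ((-2 : ℤ) : WithTop ℤ) := by
    have h1 : meromorphicOrderAt (fun z => ℘[L] (z + -v)) v = ((-2 : ℤ) : WithTop ℤ) := by
      rw [order_weierstrassP_add, add_neg_cancel, order_weierstrassP_zero]; rfl
    have h2 := (analyticAt_weierstrassP_add L h2v).meromorphicOrderAt_nonneg
    have h3 := meromorphicOrderAt_add_eq_right_of_lt (f₁ := fun z => ℘[L] (z + v))
      (f₂ := fun z => ℘[L] (z + -v)) (x := v) ((hP.comp_add v).mero v)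
      (by rw [h1]; exact lt_of_lt_of_le (by decide) h2)
    rw [h1] at h3
    exact h3
  have hSv' : meromorphicOrderAt S (-v) = ((-2 : ℤ) : WithTop ℤ) := by
    have h1 : meromorphicOrderAt (fun z => ℘[L] (z + v)) (-v) = ((-2 : ℤ) : WithTop ℤ) := by
      rw [order_weierstrassP_add, neg_add_cancel, order_weierstrassP_zero]; rfl
    have h2 := (analyticAt_weierstrassP_add L h2v').meromorphicOrderAt_nonneg
    have h3 := meromorphicOrderAt_add_eq_left_of_lt (f₁ := fun z => ℘[L] (z + v))
      (f₂ := fun z => ℘[L] (z + -v)) (x := -v) ((hP.comp_add (-v)).mero (-v))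
      (by rw [h1]; exact lt_of_lt_of_le (by decide) h2)
    rw [h1] at h3
    exact h3
  have hSan : ∀ z, z + v ∉ L.lattice → z + -v ∉ L.lattice → AnalyticAt ℂ S z := fun z h1 h2 =>
    (analyticAt_weierstrassP_add L h1).fun_add (analyticAt_weierstrassP_add L h2)
  have hFan : ∀ z, z ∉ L.lattice → AnalyticAt ℂ F z := fun z hz => by
    have ha := L.analyticOnNhd_weierstrassP z hz
    fun_prop
  obtain ⟨A, B, C, D, hABCD⟩ := hTe.exists_eq_of_neg_four_le (fun z hz => by
    rw [hord]
    by_cases hz' : z + -v ∈ L.lattice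
    · rw [show z = v + (z + -v) by ring, hFe.order_add hz', hSe.order_add hz', hFv, hSv]
      decide
    · by_cases hz'' : z + v ∈ L.lattice
      · rw [show z = -v + (z + v) by ring, hFe.order_add hz'', hSe.order_add hz'', hFv', hSv']
        decide
      · exact add_nonneg (hFan z hz).meromorphicOrderAt_nonneg
          (hSan z hz'' hz').meromorphicOrderAt_nonneg) (by
    have h1 : AnalyticAt ℂ S 0 := hSan 0 (by simpa using hv) (by simpa using hv)
    have h2 : ((-4 : ℤ) : WithTop ℤ) ≤ meromorphicOrderAt F 0 := by
      have h3 := order_weierstrassP_sub_const_ge L c 0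
      rw [hFord]
      cases h : meromorphicOrderAt (fun z => ℘[L] z - c) 0 with
      | top => decide
      | coe a =>
        rw [h] at h3
        have : -2 ≤ a := by exact_mod_cast h3
        exact WithTop.coe_le_coe.mpr (by norm_num; omega : (-4 : ℤ) ≤ ((2 : ℕ) : ℤ) * a)
    have h5 := add_le_add h2 h1.meromorphicOrderAt_nonneg
    rw [add_zero] at h5
    rw [hord]
    exact h5)
  have heven : T =ᶠ[codiscrete ℂ] fun z => A * ℘[L] z ^ 2 + C * ℘[L] z + D := by
    filter_upwards [hABCD, eventually_codiscrete_neg hABCD] with z h1 h2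
    have h3 : T (-z) = T z := by
      simp only [hT, hF, hS, L.weierstrassP_neg]
      rw [show -z + v = -(z + -v) by ring, show -z + -v = -(z + v) by ring, L.weierstrassP_neg,
        L.weierstrassP_neg, add_comm (℘[L] (z + -v))]
    rw [h3, L.weierstrassP_neg, L.derivWeierstrassP_neg] at h2
    linear_combination h1 / 2 + h2 / 2
  have hpoly : ∀ z ∉ L.lattice, AnalyticAt ℂ (fun z => A * ℘[L] z ^ 2 + C * ℘[L] z + D) z :=
    fun z hz => by
      have ha := L.analyticOnNhd_weierstrassP z hz
      fun_prop
  have hTu : T u = A * ℘[L] u ^ 2 + C * ℘[L] u + D :=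
    eq_of_eventuallyEq_codiscrete heven
      ((hFan u hu).mul (hSan u huv' (by rwa [← sub_eq_add_neg]))).continuousAt
      (hpoly u hu).continuousAt
  have hTu0 : T u = 0 := by simp [hT, hF, h]
  have hTv : meromorphicOrderAt T v = 0 := by
    rw [hord, hFv, hSv]; decide
  have hpos := order_pos_of_eq_zero (hpoly v hv) (by
    rw [← hc, ← h, ← hTu, hTu0])
  rw [← meromorphicOrderAt_congr (eventually_codiscrete_iff.mp heven v), hTv] at hpos
  exact absurd hpos (lt_irrefl _)

theorem weierstrassP_half_ne {h₁ h₂ : ℂ} (hn1 : h₁ ∉ L.lattice) (hn2 : h₂ ∉ L.lattice)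
    (hh : h₂ + h₂ ∈ L.lattice) (hne : h₁ - h₂ ∉ L.lattice) : ℘[L] h₁ ≠ ℘[L] h₂ := by
  intro h
  rcases weierstrassP_eq_imp L hn1 hn2 h with h3 | h3
  · exact hne h3
  · exact hne (by have := sub_mem h3 hh; rwa [show h₁ + h₂ - (h₂ + h₂) = h₁ - h₂ by ring] at this)

theorem half_period_root {h : ℂ} (hn : h ∉ L.lattice) (hh : h + h ∈ L.lattice) :
    4 * ℘[L] h ^ 3 - L.g₂ * ℘[L] h - L.g₃ = 0 := by
  rw [← L.derivWeierstrassP_sq h hn, derivWeierstrassP_eq_zero_of_two_mul_mem L hh]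
  norm_num

theorem weierstrass_half_ne :
    ℘[L] (L.ω₁ / 2) ≠ ℘[L] (L.ω₂ / 2) ∧
    ℘[L] (L.ω₁ / 2) ≠ ℘[L] (L.ω₁ / 2 + L.ω₂ / 2) ∧
    ℘[L] (L.ω₂ / 2) ≠ ℘[L] (L.ω₁ / 2 + L.ω₂ / 2) := by
  have h1 := L.ω₁_div_two_notMem_lattice
  have h2 := L.ω₂_div_two_notMem_lattice
  have h3 := half_sum_notMem_lattice L
  have k1 : L.ω₁ / 2 + L.ω₁ / 2 ∈ L.lattice := by rw [add_halves]; exact L.ω₁_mem_lattice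
  have k2 : L.ω₂ / 2 + L.ω₂ / 2 ∈ L.lattice := by rw [add_halves]; exact L.ω₂_mem_lattice
  have k3 : (L.ω₁ / 2 + L.ω₂ / 2) + (L.ω₁ / 2 + L.ω₂ / 2) ∈ L.lattice := by
    rw [add_add_add_comm]; exact add_mem k1 k2
  refine ⟨weierstrassP_half_ne L h1 h2 k2 fun h => ?_, weierstrassP_half_ne L h1 h3 k3 fun h => ?_,
    weierstrassP_half_ne L h2 h3 k3 fun h => ?_⟩
  · exact h3 (by have := add_mem h k2; rwa [show L.ω₁ / 2 - L.ω₂ / 2 + (L.ω₂ / 2 + L.ω₂ / 2) =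
      L.ω₁ / 2 + L.ω₂ / 2 by ring] at this)
  · exact h2 (by have := neg_mem h; rwa [show -(L.ω₁ / 2 - (L.ω₁ / 2 + L.ω₂ / 2)) = L.ω₂ / 2 by
      ring] at this)
  · exact h1 (by have := neg_mem h; rwa [show -(L.ω₂ / 2 - (L.ω₁ / 2 + L.ω₂ / 2)) = L.ω₁ / 2 by
      ring] at this)

theorem cubic_eq_prod_of_roots {g₂ g₃ a b c : ℂ} (hab : a ≠ b) (hac : a ≠ c) (hbc : b ≠ c)
    (ha : 4 * a ^ 3 - g₂ * a - g₃ = 0) (hb : 4 * b ^ 3 - g₂ * b - g₃ = 0)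
    (hc : 4 * c ^ 3 - g₂ * c - g₃ = 0) :
    a + b + c = 0 ∧ g₂ = -4 * (a * b + a * c + b * c) ∧ g₃ = 4 * a * b * c := by
  have h1 : 4 * (a ^ 2 + a * b + b ^ 2) = g₂ := by
    refine mul_left_cancel₀ (sub_ne_zero.mpr hab) ?_
    linear_combination ha - hb
  have h2 : 4 * (a ^ 2 + a * c + c ^ 2) = g₂ := by
    refine mul_left_cancel₀ (sub_ne_zero.mpr hac) ?_
    linear_combination ha - hc
  have h3 : a + b + c = 0 := by
    refine mul_left_cancel₀ (sub_ne_zero.mpr hbc) ?_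
    linear_combination (h1 - h2) / 4
  obtain rfl : c = -a - b := by linear_combination h3
  refine ⟨by ring, by linear_combination -h1, ?_⟩
  linear_combination -ha + a * h1

end

end DiskPotential

end

/-! ### Holomorphic functions and removable singularities in several variables -/

noncomputable section

namespace DiskPotential

open Filter Topology PeriodPair

/-! ### Holomorphic functions of several variables -/

section SeveralVariables

variable {E : Type*} [NormedAddCommGroup E] [NormedSpace ℂ E]

open Metric

/-- Cauchy's estimate on the complex line through p in each direction v. The radius r/(2‖v‖) keeps
the closed disc inside the ball, whence the factor 2. -/
theorem norm_fderiv_le_of_forall_mem_ball {f : E → ℂ} {p : E} {r C : ℝ} (hr : 0 < r)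
    (hf : DifferentiableOn ℂ f (ball p r)) (hC : ∀ q ∈ ball p r, ‖f q‖ ≤ C) :
    ‖fderiv ℂ f p‖ ≤ 2 * C / r := by
  have hC0 : 0 ≤ C := (norm_nonneg _).trans (hC p (mem_ball_self hr))
  refine ContinuousLinearMap.opNorm_le_bound _ (by positivity) fun v => ?_
  rcases eq_or_ne v 0 with rfl | hv
  · simp
  have hv' : 0 < ‖v‖ := norm_pos_iff.mpr hv
  set R := r / (2 * ‖v‖) with hR
  have hR0 : 0 < R := by positivity
  have hmem : ∀ t : ℂ, ‖t‖ ≤ R → p + t • v ∈ ball p r := fun t ht => by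
    rw [mem_ball_iff_norm, add_sub_cancel_left, norm_smul]
    calc ‖t‖ * ‖v‖ ≤ R * ‖v‖ := by gcongr
      _ = r / 2 := by rw [hR]; field_simp
      _ < r := by linarith
  have hd : ∀ t : ℂ, ‖t‖ ≤ R → DifferentiableAt ℂ (fun t : ℂ => f (p + t • v)) t := fun t ht =>
    ((hf.differentiableAt (isOpen_ball.mem_nhds (hmem t ht))).comp t
      (f := fun t : ℂ => p + t • v) (by fun_prop))
  have h1 : deriv (fun t : ℂ => f (p + t • v)) 0 = fderiv ℂ f p v := by
    have h2 : HasDerivAt (fun t : ℂ => p + t • v) v 0 := by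
      simpa using ((hasDerivAt_id (0 : ℂ)).smul_const v).const_add p
    have h3 : HasFDerivAt f (fderiv ℂ f p) (p + (0 : ℂ) • v) := by
      simpa using (hf.differentiableAt (ball_mem_nhds p hr)).hasFDerivAt
    exact (h3.comp_hasDerivAt (0 : ℂ) h2).deriv
  have h4 : ‖deriv (fun t : ℂ => f (p + t • v)) 0‖ ≤ C / R := by
    refine Complex.norm_deriv_le_of_forall_mem_sphere_norm_le hR0 ?_ fun t ht => ?_
    · refine DifferentiableOn.diffContOnCl fun t ht => ?_
      rw [closure_ball _ hR0.ne', mem_closedBall_zero_iff] at ht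
      exact (hd t ht).differentiableWithinAt
    · exact hC _ (hmem t (by rw [mem_sphere_zero_iff_norm] at ht; exact ht.le))
  rw [h1] at h4
  calc _ ≤ C / R := h4
    _ = 2 * C / r * ‖v‖ := by rw [hR]; field_simp

/-- Cauchy's estimate on balls of half the radius turns the summable bound for the terms into one
for their derivatives, so termwise differentiation applies. -/
theorem differentiableOn_tsum_of_norm_le {ι : Type*} {f : ι → E → ℂ} {U : Set E} (hU : IsOpen U)
    {u : ι → ℝ} (hu : Summable u) (hf : ∀ i, DifferentiableOn ℂ (f i) U)
    (hb : ∀ i, ∀ p ∈ U, ‖f i p‖ ≤ u i) : DifferentiableOn ℂ (fun p => ∑' i, f i p) U := by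
  intro p hp
  obtain ⟨r, hr, hball⟩ := Metric.isOpen_iff.mp hU p hp
  refine DifferentiableAt.differentiableWithinAt ?_
  have hsub : ∀ q ∈ ball p (r / 2), ball q (r / 2) ⊆ U := fun q hq =>
    (ball_subset_ball' (by rw [mem_ball] at hq; linarith)).trans hball
  refine (hasFDerivAt_tsum_of_isPreconnected (u := fun i => 2 * u i / (r / 2)) (s := ball p (r / 2))
    (x₀ := p) (f' := fun i q => fderiv ℂ (f i) q) ((hu.mul_left 2).div_const _) isOpen_ball
    (by let _ : NormedSpace ℝ E := NormedSpace.restrictScalars ℝ ℂ E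
        exact (convex_ball p (r / 2)).isPreconnected) (fun i q hq => ?_) (fun i q hq => ?_)
    (mem_ball_self (by positivity)) ?_ (mem_ball_self (by positivity))).differentiableAt
  · exact ((hf i).differentiableAt (hU.mem_nhds (hsub q hq (mem_ball_self (by positivity))))).hasFDerivAt
  · exact norm_fderiv_le_of_forall_mem_ball (by positivity) ((hf i).mono (hsub q hq))
      fun w hw => hb i w (hsub q hq hw)
  · exact Summable.of_norm_bounded hu fun i => hb i p hp

/-- The one-variable identity theorem on the complex line joining p to q. -/
theorem eqOn_zero_of_convex {f : E → ℂ} {U : Set E} (hU : IsOpen U)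
    (hconv : ∀ p ∈ U, ∀ q ∈ U, ∃ V : Set ℂ, IsOpen V ∧ IsPreconnected V ∧ 0 ∈ V ∧ 1 ∈ V ∧
      ∀ t ∈ V, p + t • (q - p) ∈ U)
    (hf : DifferentiableOn ℂ f U) {p : E} (hp : p ∈ U) (h0 : f =ᶠ[𝓝 p] 0) : ∀ q ∈ U, f q = 0 := by
  intro q hq
  obtain ⟨V, hVo, hVc, h0V, h1V, hV⟩ := hconv p hp q hq
  have hd : DifferentiableOn ℂ (fun t : ℂ => f (p + t • (q - p))) V := fun t ht =>
    ((hf.differentiableAt (hU.mem_nhds (hV t ht))).comp t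
      (f := fun t : ℂ => p + t • (q - p)) (by fun_prop)).differentiableWithinAt
  have h := (hd.analyticOnNhd hVo).eqOn_zero_of_preconnected_of_eventuallyEq_zero hVc h0V (by
    have hc : ContinuousAt (fun t : ℂ => p + t • (q - p)) 0 := by fun_prop
    exact hc.tendsto (show {w | f w = 0} ∈ 𝓝 (p + (0 : ℂ) • (q - p)) by
      rw [zero_smul, add_zero]; exact h0)) h1V
  simpa using h

end SeveralVariables

/-- The domain of `ℂ × ℍ` in `ℂ × ℂ`. -/
def halfSpace : Set (ℂ × ℂ) := {p | 0 < p.2.im}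

theorem isOpen_halfSpace : IsOpen halfSpace :=
  isOpen_lt continuous_const (Complex.continuous_im.comp continuous_snd)

theorem eq_zero_of_eventually_eq_zero {f : ℂ × ℂ → ℂ} (hf : DifferentiableOn ℂ f halfSpace)
    {p : ℂ × ℂ} (hp : p ∈ halfSpace) (h0 : f =ᶠ[𝓝 p] 0) : ∀ q ∈ halfSpace, f q = 0 := by
  refine eqOn_zero_of_convex isOpen_halfSpace (fun p hp q hq => ?_) hf hp h0
  refine ⟨(fun t : ℂ => (p + t • (q - p)).2) ⁻¹' {w : ℂ | 0 < w.im}, ?_, ?_, ?_, ?_, fun t ht => ht⟩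
  · exact (isOpen_lt continuous_const Complex.continuous_im).preimage (by fun_prop)
  · refine Convex.isPreconnected ?_
    intro s hs t ht a b ha hb hab
    simp only [Set.mem_preimage, Set.mem_ofPred_eq] at hs ht ⊢
    have : (p + (a • s + b • t) • (q - p)).2 =
        (a : ℂ) * (p + s • (q - p)).2 + (b : ℂ) * (p + t • (q - p)).2 := by
      have : (a : ℂ) + b = 1 := by exact_mod_cast hab
      simp only [Prod.snd_add, Prod.smul_snd, Prod.snd_sub, smul_eq_mul, Complex.real_smul]
      linear_combination (-p.2) * this
    rw [this, Complex.add_im, Complex.im_ofReal_mul, Complex.im_ofReal_mul]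
    rcases ha.eq_or_lt with rfl | ha'
    · have : b = 1 := by linarith
      subst this; simpa using ht
    · have := mul_pos ha' hs
      have := mul_nonneg hb ht.le
      linarith
  · simpa [halfSpace] using hp
  · simpa [halfSpace] using hq

theorem dense_ne_zero {f : ℂ × ℂ → ℂ} (hf : DifferentiableOn ℂ f halfSpace)
    {p₀ : ℂ × ℂ} (hp₀ : p₀ ∈ halfSpace) (h0 : f p₀ ≠ 0) {p : ℂ × ℂ} (hp : p ∈ halfSpace) :
    ∃ᶠ q in 𝓝 p, f q ≠ 0 := fun h =>
  h0 (eq_zero_of_eventually_eq_zero hf hp (h.mono fun q hq => by simpa using hq) p₀ hp₀)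

theorem eq_of_mul_eq_zero {f g : ℂ × ℂ → ℂ} (hf : DifferentiableOn ℂ f halfSpace)
    (hg : DifferentiableOn ℂ g halfSpace) (h : ∀ p ∈ halfSpace, f p * g p = 0) :
    (∀ p ∈ halfSpace, f p = 0) ∨ ∀ p ∈ halfSpace, g p = 0 := by
  by_contra! hcon
  obtain ⟨⟨p, hp, hfp⟩, q, hq, hgq⟩ := hcon
  refine hgq (eq_zero_of_eventually_eq_zero hg hp ?_ q hq)
  have h1 : ContinuousAt f p := (hf.differentiableAt (isOpen_halfSpace.mem_nhds hp)).continuousAt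
  filter_upwards [h1.eventually_ne hfp, isOpen_halfSpace.mem_nhds hp] with w hw hw'
  exact (mul_eq_zero.mp (h w hw')).resolve_left hw

end DiskPotential

end

noncomputable section

namespace DiskPotential

open Filter Topology PeriodPair Metric

/-! ### Removable singularities in two variables -/

/-- The zeros of h are isolated because h(0) ≠ 0, so the bounded function φ extends across them. The
mean value property holds for the extension, which agrees with φ at the centre and on the circle. -/
theorem circleAverage_eq_of_bounded {φ h : ℂ → ℂ} {r R : ℝ} (hr : 0 < r) (hrR : r < R)
    (hh : DifferentiableOn ℂ h (ball 0 R)) (h0 : h 0 ≠ 0) (hs : ∀ t ∈ sphere (0 : ℂ) r, h t ≠ 0)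
    (hφ : ∀ t ∈ ball (0 : ℂ) R, h t ≠ 0 → DifferentiableAt ℂ φ t)
    (hb : ∀ t ∈ ball (0 : ℂ) R, ∃ C, ∀ᶠ w in 𝓝 t, h w ≠ 0 → ‖φ w‖ ≤ C) :
    Real.circleAverage φ 0 r = φ 0 := by
  classical
  set ψ : ℂ → ℂ := fun t => if h t ≠ 0 then φ t else limUnder (𝓝[≠] t) φ with hψ
  have han := hh.analyticOnNhd isOpen_ball
  have hcont : ∀ t ∈ ball (0 : ℂ) R, ContinuousAt h t := fun t ht => (han t ht).continuousAt
  have hpre : IsPreconnected (ball (0 : ℂ) R) := (convex_ball _ _).isPreconnected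
  have h0R : (0 : ℂ) ∈ ball (0 : ℂ) R := mem_ball_self (hr.trans hrR)
  have hd : ∀ t ∈ ball (0 : ℂ) R, DifferentiableAt ℂ ψ t := by
    intro t ht
    by_cases hht : h t = 0
    · have hpunct : ∀ᶠ w in 𝓝[≠] t, h w ≠ 0 := by
        rcases (han t ht).eventually_eq_zero_or_eventually_ne_zero with h1 | h1
        · exact absurd (han.eqOn_zero_of_preconnected_of_eventuallyEq_zero hpre ht h1 h0R) h0
        · exact h1
      obtain ⟨C, hC⟩ := hb t ht
      obtain ⟨ε, hε, hball⟩ := Metric.eventually_nhds_iff_ball.mp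
        ((eventually_nhdsWithin_iff.mp hpunct).and (hC.and (isOpen_ball.mem_nhds ht)))
      have h1 : DifferentiableOn ℂ (Function.update φ t (limUnder (𝓝[≠] t) φ)) (ball t ε) := by
        refine Complex.differentiableOn_update_limUnder_of_bddAbove (ball_mem_nhds t hε) ?_ ?_
        · rintro w ⟨hw1, hw2⟩
          exact (hφ w (hball w hw1).2.2 ((hball w hw1).1 hw2)).differentiableWithinAt
        · refine ⟨C, ?_⟩
          rintro _ ⟨w, ⟨hw1, hw2⟩, rfl⟩
          exact (hball w hw1).2.1 ((hball w hw1).1 hw2)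
      refine (h1.differentiableAt (ball_mem_nhds t hε)).congr_of_eventuallyEq ?_
      filter_upwards [ball_mem_nhds t hε] with w hw
      rcases eq_or_ne w t with rfl | hwt
      · simp [hψ, hht]
      · simp [hψ, Function.update_of_ne hwt, (hball w hw).1 hwt]
    · refine (hφ t ht hht).congr_of_eventuallyEq ?_
      filter_upwards [(hcont t ht).eventually_ne hht] with w hw
      simp [hψ, hw]
  have h1 : Real.circleAverage ψ 0 r = ψ 0 := by
    refine DiffContOnCl.circleAverage (DifferentiableOn.diffContOnCl fun t ht => ?_)
    rw [abs_of_pos hr, closure_ball _ hr.ne'] at ht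
    exact (hd t (closedBall_subset_ball hrR ht)).differentiableWithinAt
  rw [Real.circleAverage_congr_sphere (f₂ := φ) (fun t ht => ?_)] at h1
  · simpa [hψ, h0] using h1
  · rw [abs_of_pos hr] at ht
    simp [hψ, hs t ht]

/-- Differentiation under the integral sign. The kernel k serves two purposes: k = 1 gives the mean
value in the extension theorem, k = t⁻¹ gives Cauchy's formula for a derivative. -/
theorem differentiableAt_circleAverage {f : ℂ × ℂ → ℂ} {U : Set (ℂ × ℂ)} (hU : IsOpen U)
    (hf : DifferentiableOn ℂ f U) {p v : ℂ × ℂ} {r : ℝ} (hr : 0 < r)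
    (h : ∀ t ∈ sphere (0 : ℂ) r, p + t • v ∈ U) {k : ℂ → ℂ} (hk : ContinuousOn k (sphere 0 r)) :
    DifferentiableAt ℂ (fun q => Real.circleAverage (fun t => k t * f (q + t • v)) 0 r) p := by
  obtain ⟨M, hM⟩ := (isCompact_sphere (0 : ℂ) r).exists_bound_of_continuousOn hk
  set K := (fun t : ℂ => p + t • v) '' sphere 0 r with hK
  have hKc : IsCompact K := (isCompact_sphere _ _).image (by fun_prop)
  obtain ⟨δ, hδ, hsub⟩ := hKc.exists_cthickening_subset_open hU (by rintro _ ⟨t, ht, rfl⟩; exact h t ht)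
  obtain ⟨C, hC⟩ := hKc.cthickening (r := δ) |>.exists_bound_of_continuousOn
    (hf.continuousOn.mono hsub)
  have hmem : ∀ t ∈ sphere (0 : ℂ) r, ∀ w ∈ ball (p + t • v) δ, w ∈ cthickening δ K := fun t ht w hw =>
    thickening_subset_cthickening _ _ (mem_thickening_iff.mpr ⟨_, ⟨t, ht, rfl⟩, hw⟩)
  have hcirc : ∀ θ : ℝ, circleMap 0 r θ ∈ sphere (0 : ℂ) r := fun θ => circleMap_mem_sphere _ hr.le _
  have hkc : Continuous fun θ : ℝ => k (circleMap 0 r θ) :=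
    hk.comp_continuous (continuous_circleMap 0 r) hcirc
  have hball : ∀ q ∈ ball p (δ / 2), ∀ θ : ℝ,
      ball (q + circleMap 0 r θ • v) (δ / 2) ⊆ cthickening δ K := fun q hq θ w hw => by
    refine hmem _ (hcirc θ) w ?_
    rw [mem_ball_iff_norm] at *
    calc ‖w - (p + circleMap 0 r θ • v)‖ = ‖(w - (q + circleMap 0 r θ • v)) + (q - p)‖ := by
          congr 1; abel
      _ ≤ _ := norm_add_le _ _
      _ < δ := by linarith
  have hdf : ∀ q ∈ ball p (δ / 2), ∀ θ : ℝ, DifferentiableAt ℂ f (q + circleMap 0 r θ • v) :=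
    fun q hq θ => hf.differentiableAt (hU.mem_nhds (hsub (hball q hq θ (mem_ball_self (by positivity)))))
  have hcont : ∀ q ∈ ball p (δ / 2), Continuous fun θ : ℝ => f (q + circleMap 0 r θ • v) :=
    fun q hq => continuous_iff_continuousAt.mpr fun θ => (hdf q hq θ).continuousAt.comp
      (f := fun θ : ℝ => q + circleMap 0 r θ • v)
      (((continuous_circleMap 0 r).smul continuous_const).const_add q |>.continuousAt)
  have hp : p ∈ ball p (δ / 2) := mem_ball_self (by positivity)
  have key := intervalIntegral.hasFDerivAt_integral_of_dominated_of_fderiv_le (𝕜 := ℂ)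
    (μ := MeasureTheory.volume) (a := 0) (b := 2 * Real.pi)
    (F := fun q θ => k (circleMap 0 r θ) * f (q + circleMap 0 r θ • v))
    (F' := fun q θ => k (circleMap 0 r θ) • fderiv ℂ f (q + circleMap 0 r θ • v)) (x₀ := p) (s := ball p (δ / 2))
    (bound := fun _ => M * (2 * C / (δ / 2))) (ball_mem_nhds p (by positivity))
    (by filter_upwards [ball_mem_nhds p (show 0 < δ / 2 by positivity)] with q hq
        exact (hkc.mul (hcont q hq)).aestronglyMeasurable)
    ((hkc.mul (hcont p hp)).intervalIntegrable _ _)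
    (hkc.measurable.smul ((measurable_fderiv ℂ f).comp (by fun_prop))).aestronglyMeasurable
    (Eventually.of_forall fun θ _ q hq => by
      rw [norm_smul]
      exact mul_le_mul (hM _ (hcirc θ)) (norm_fderiv_le_of_forall_mem_ball (by positivity)
        (hf.mono ((hball q hq θ).trans hsub)) fun w hw => hC w (hball q hq θ hw)) (norm_nonneg _)
        ((norm_nonneg _).trans (hM _ (hcirc θ))))
    intervalIntegrable_const
    (Eventually.of_forall fun θ _ q hq => by
      have h1 := (hdf q hq θ).hasFDerivAt
      have h2 : HasFDerivAt (fun q : ℂ × ℂ => q + circleMap 0 r θ • v)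
        (ContinuousLinearMap.id ℂ (ℂ × ℂ)) q := (hasFDerivAt_id q).add_const _
      have h3 := h1.comp q h2
      rw [ContinuousLinearMap.comp_id] at h3
      exact h3.const_mul _)
  exact key.differentiableAt.const_smul ((2 * Real.pi)⁻¹ : ℝ)

/-- On a line through p on which h is not identically zero, choose a small circle avoiding the zeros
of h. The average of N over translates of this circle is holomorphic near p, because the circle
stays off the zero set. It equals N where h ≠ 0 by the one-variable theorem. -/
theorem exists_local_extension {V : Set (ℂ × ℂ)} (hV : IsOpen V) {h N : ℂ × ℂ → ℂ}
    (hh : DifferentiableOn ℂ h V) {p : ℂ × ℂ} (hp : p ∈ V) (hfreq : ∃ᶠ q in 𝓝 p, h q ≠ 0)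
    (hN : ∀ q ∈ V, h q ≠ 0 → DifferentiableAt ℂ N q)
    (hb : ∀ q ∈ V, ∃ C, ∀ᶠ w in 𝓝 q, h w ≠ 0 → ‖N w‖ ≤ C) :
    ∃ M : ℂ × ℂ → ℂ, ∀ᶠ q in 𝓝 p, DifferentiableAt ℂ M q ∧ (h q ≠ 0 → M q = N q) := by
  obtain ⟨ρ, hρ, hball⟩ := Metric.isOpen_iff.mp hV p hp
  -- The direction is v = q₁ - p with h(q₁) ≠ 0, so h does not vanish at parameter t = 1. Discs of
  -- radius 3/2 contain this parameter and still stay in the ball of radius ρ.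
  obtain ⟨q₁, hq₁, hq₁ρ⟩ := (hfreq.and_eventually
    (ball_mem_nhds p (show 0 < ρ / 2 by positivity))).exists
  set v := q₁ - p with hv
  have hvρ : ‖v‖ < ρ / 2 := by rwa [hv, ← dist_eq_norm]
  have hline : ∀ q ∈ ball p (ρ / 4), ∀ t ∈ ball (0 : ℂ) (3 / 2), q + t • v ∈ V := by
    intro q hq t ht
    refine hball ?_
    rw [mem_ball_zero_iff] at ht
    rw [mem_ball_iff_norm] at hq ⊢
    calc ‖q + t • v - p‖ = ‖(q - p) + t • v‖ := by congr 1; abel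
      _ ≤ ‖q - p‖ + ‖t‖ * ‖v‖ := by rw [← norm_smul]; exact norm_add_le _ _
      _ ≤ ‖q - p‖ + 3 / 2 * (ρ / 2) := by gcongr
      _ < ρ := by linarith
  have hhd : ∀ q ∈ ball p (ρ / 4), DifferentiableOn ℂ (fun t : ℂ => h (q + t • v)) (ball 0 (3 / 2)) :=
    fun q hq t ht => ((hh.differentiableAt (hV.mem_nhds (hline q hq t ht))).comp t
      (f := fun t : ℂ => q + t • v) (by fun_prop)).differentiableWithinAt
  have hpρ : p ∈ ball p (ρ / 4) := mem_ball_self (by positivity)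
  obtain ⟨r, hr0, hr1, hr⟩ : ∃ r : ℝ, 0 < r ∧ r < 3 / 2 ∧ ∀ t ∈ sphere (0 : ℂ) r, h (p + t • v) ≠ 0 := by
    have han := (hhd p hpρ).analyticOnNhd isOpen_ball
    have hpunct : ∀ᶠ w in 𝓝[≠] (0 : ℂ), h (p + w • v) ≠ 0 := by
      rcases (han 0 (by simp)).eventually_eq_zero_or_eventually_ne_zero with h1 | h1
      · refine absurd (han.eqOn_zero_of_preconnected_of_eventuallyEq_zero
          (convex_ball _ _).isPreconnected (by simp) h1 (show (1 : ℂ) ∈ ball (0 : ℂ) (3 / 2) by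
            rw [mem_ball_zero_iff]; norm_num)) ?_
        simpa [hv] using hq₁
      · exact h1
    obtain ⟨ε, hε, hε'⟩ := Metric.eventually_nhds_iff_ball.mp (eventually_nhdsWithin_iff.mp hpunct)
    refine ⟨min (ε / 2) 1, by positivity, (min_le_right _ _).trans_lt (by norm_num), fun t ht => ?_⟩
    rw [mem_sphere_zero_iff_norm] at ht
    refine hε' t ?_ ?_
    · rw [mem_ball_zero_iff, ht]; exact (min_le_left _ _).trans_lt (by linarith)
    · rintro rfl
      rw [norm_zero] at ht
      have : 0 < min (ε / 2) 1 := by positivity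
      linarith
  set Ω : Set (ℂ × ℂ) := {q | q ∈ V ∧ h q ≠ 0} with hΩ
  have hΩo : IsOpen Ω := hh.continuousOn.isOpen_inter_preimage hV isOpen_ne
  have hNΩ : DifferentiableOn ℂ N Ω := fun q hq => (hN q hq.1 hq.2).differentiableWithinAt
  have hKc : IsCompact ((fun t : ℂ => p + t • v) '' sphere 0 r) :=
    (isCompact_sphere _ _).image (by fun_prop)
  obtain ⟨δ, hδ, hsub⟩ := hKc.exists_thickening_subset_open hΩo (by
    rintro _ ⟨t, ht, rfl⟩
    refine ⟨hline p hpρ t ?_, hr t ht⟩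
    rw [mem_sphere_zero_iff_norm] at ht
    rw [mem_ball_zero_iff, ht]; exact hr1)
  refine ⟨fun q => Real.circleAverage (fun t => N (q + t • v)) 0 r, ?_⟩
  filter_upwards [ball_mem_nhds p hδ, ball_mem_nhds p (show 0 < ρ / 4 by positivity)] with q hq hqρ
  have hqΩ : ∀ t ∈ sphere (0 : ℂ) r, q + t • v ∈ Ω := fun t ht => by
    refine hsub (mem_thickening_iff.mpr ⟨_, ⟨t, ht, rfl⟩, ?_⟩)
    simpa using hq
  refine ⟨by
    simpa using differentiableAt_circleAverage hΩo hNΩ hr0 hqΩ (continuousOn_const (c := (1 : ℂ))),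
    fun hqne => ?_⟩
  have := circleAverage_eq_of_bounded (φ := fun t => N (q + t • v)) hr0 hr1 (hhd q hqρ)
    (by simpa using hqne) (fun t ht => (hqΩ t ht).2)
    (fun t ht hne => (hN _ (hline q hqρ t ht) hne).comp t (f := fun t : ℂ => q + t • v) (by fun_prop))
    (fun t ht => by
      obtain ⟨C, hC⟩ := hb _ (hline q hqρ t ht)
      have hc : ContinuousAt (fun t : ℂ => q + t • v) t := by fun_prop
      exact ⟨C, hc.eventually hC⟩)
  simpa using this

theorem eq_of_frequently_eq {X : Type*} [TopologicalSpace X] {F G : X → ℂ} {p : X}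
    (hF : ContinuousAt F p) (hG : ContinuousAt G p) (h : ∃ᶠ q in 𝓝 p, F q = G q) : F p = G p := by
  by_contra hne
  obtain ⟨q, hq1, hq2⟩ := (h.and_eventually ((hF.sub hG).eventually_ne (sub_ne_zero.mpr hne))).exists
  exact hq2 (sub_eq_zero.mpr hq1)

/-- Riemann's extension theorem for locally bounded functions which are holomorphic off the zero
set of local nonzero holomorphic functions. -/
theorem exists_extension {Ω : Set (ℂ × ℂ)} {N : ℂ × ℂ → ℂ}
    (hloc : ∀ p ∈ Ω, ∃ (V : Set (ℂ × ℂ)) (h : ℂ × ℂ → ℂ), IsOpen V ∧ p ∈ V ∧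
      DifferentiableOn ℂ h V ∧ (∀ q ∈ V, ∃ᶠ w in 𝓝 q, h w ≠ 0) ∧
      (∀ q ∈ V, h q ≠ 0 → DifferentiableAt ℂ N q) ∧
      ∀ q ∈ V, ∃ C, ∀ᶠ w in 𝓝 q, h w ≠ 0 → ‖N w‖ ≤ C) (hΩ : IsOpen Ω) :
    ∃ M : ℂ × ℂ → ℂ, DifferentiableOn ℂ M Ω ∧
      ∀ p ∈ Ω, ∃ᶠ q in 𝓝 p, ∀ᶠ w in 𝓝 q, M w = N w := by
  choose! V h hVo hpV hh hfreq hN hb using hloc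
  choose! M hM using fun p hp => exists_local_extension (hVo p hp) (hh p hp) (hpV p hp)
    (hfreq p hp p (hpV p hp)) (hN p hp) (hb p hp)
  -- Two local extensions agree with N off both zero sets, which leaves points arbitrarily close to
  -- q; by continuity they agree at q. So the diagonal p ↦ M p p is holomorphic.
  have hglue : ∀ p ∈ Ω, ∀ᶠ q in 𝓝 p, M q q = M p q := by
    intro p hp
    filter_upwards [(hM p hp).eventually_nhds, hΩ.mem_nhds hp, (hVo p hp).mem_nhds (hpV p hp)]
      with q hq hqΩ hqV
    refine eq_of_frequently_eq (hM q hqΩ).self_of_nhds.1.continuousAt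
      hq.self_of_nhds.1.continuousAt ?_
    intro hcon
    have hqq : ∀ᶠ w in 𝓝 q, w ∈ V q := (hVo q hqΩ).mem_nhds (hpV q hqΩ)
    have hqp : ∀ᶠ w in 𝓝 q, w ∈ V p := (hVo p hp).mem_nhds hqV
    have hev := (hcon.and ((hM q hqΩ).and hq)).eventually_nhds
    obtain ⟨w, hw1, hw2, hw3, hw4⟩ := ((hfreq q hqΩ q (hpV q hqΩ)).and_eventually
      (hqq.and (hqp.and hev))).exists
    have hc := ((hh q hqΩ).differentiableAt ((hVo q hqΩ).mem_nhds hw2)).continuousAt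
    obtain ⟨v, hv1, hv2, hv3, hv4, hv5⟩ := ((hfreq p hp w hw3).and_eventually
      ((hc.eventually_ne hw1).and hw4)).exists
    exact hv3 ((hv4.2 hv2).trans (hv5.2 hv1).symm)
  refine ⟨fun p => M p p, fun p hp => DifferentiableAt.differentiableWithinAt
    ((hM p hp).self_of_nhds.1.congr_of_eventuallyEq (hglue p hp)), fun p hp => ?_⟩
  have hpp : ∀ᶠ w in 𝓝 p, w ∈ V p := (hVo p hp).mem_nhds (hpV p hp)
  refine ((hfreq p hp p (hpV p hp)).and_eventually
    (((hM p hp).and (hglue p hp)).eventually_nhds.and hpp)).mono fun q ⟨hq1, hq2, hq3⟩ => ?_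
  have hc := ((hh p hp).differentiableAt ((hVo p hp).mem_nhds hq3)).continuousAt
  filter_upwards [hc.eventually_ne hq1, hq2] with w hw1 hw2
  rw [hw2.2, hw2.1.2 hw1]

end DiskPotential

end

/-! ### Degree two functions on a uniformized curve -/

noncomputable section

namespace DiskPotential

open Filter Topology PeriodPair

/-! ### Elliptic uniformizations of the curves `y² + (1 + x + b x²) y + c x^m = 0` -/

/-- The content of `UniformizesCurve` for one fibre, with y H in place of H and an arbitrary period
lattice. -/
structure IsCurveUniformization (L : PeriodPair) (b c : ℂ) (m : ℕ) (x y : ℂ → ℂ) : Prop where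
  ell_x : IsElliptic L x
  ell_y : IsElliptic L y
  mapsTo : ∀ u, AnalyticAt ℂ x u → AnalyticAt ℂ y u → x u ≠ 0 → y u ≠ 0 →
    y u ^ 2 + (1 + x u + b * x u ^ 2) * y u + c * x u ^ m = 0
  surj : ∀ X Y, X ≠ 0 → Y ≠ 0 → Y ^ 2 + (1 + X + b * X ^ 2) * Y + c * X ^ m = 0 →
    ∃ u, AnalyticAt ℂ x u ∧ AnalyticAt ℂ y u ∧ x u = X ∧ y u = Y
  inj : ∀ u v, AnalyticAt ℂ x u → AnalyticAt ℂ y u → AnalyticAt ℂ x v → AnalyticAt ℂ y v →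
    x u ≠ 0 → y u ≠ 0 → x v = x u → y v = y u → v - u ∈ L.lattice
  ramified : (AnalyticAt ℂ x 0 ∧ deriv x 0 = 0) ∨ meromorphicOrderAt x 0 ≤ ((-2 : ℤ) : WithTop ℤ)

theorem exists_quadratic_root (B C : ℂ) : ∃ Y : ℂ, Y ^ 2 + B * Y + C = 0 := by
  obtain ⟨D, hD⟩ := IsAlgClosed.exists_pow_nat_eq (B ^ 2 - 4 * C) (n := 2) (by norm_num)
  exact ⟨(-B + D) / 2, by linear_combination hD / 4⟩

theorem exists_norm_gt_notMem {T : Set ℂ} (hT : T.Countable) (R : ℝ) : ∃ X ∉ T, R < ‖X‖ := by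
  have ho : IsOpen {X : ℂ | R < ‖X‖} := isOpen_lt continuous_const continuous_norm
  have hne : {X : ℂ | R < ‖X‖}.Nonempty := by
    refine ⟨((|R| + 1 : ℝ) : ℂ), ?_⟩
    have h1 := le_abs_self R
    have h2 : ‖((|R| + 1 : ℝ) : ℂ)‖ = |R| + 1 := by
      rw [Complex.norm_real, Real.norm_eq_abs, abs_of_nonneg (by positivity)]
    change R < _
    rw [h2]; linarith
  obtain ⟨X, hX, hX'⟩ := (hT.dense_compl ℂ).inter_open_nonempty _ ho hne
  exact ⟨X, hX', hX⟩

/-- Separates preimages modulo the lattice: points near 0 are congruent to no point near v ∉ L, and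
distinct points near 0 are incongruent. -/
theorem exists_ball_sub_notMem (L : PeriodPair) {v : ℂ} (hv : v ∉ L.lattice ∨ v = 0) :
    ∃ ε > 0, ∀ a ∈ Metric.ball (0 : ℂ) ε, ∀ w ∈ Metric.ball v ε, w - a ∈ L.lattice → v = 0 ∧ w = a := by
  have h1 : ((L.lattice : Set ℂ) \ {0})ᶜ ∈ 𝓝 v := by
    rcases hv with hv | rfl
    · have := L.compl_lattice_sdiff_singleton_mem_nhds v
      have h0 : (L.lattice : Set ℂ)ᶜ ∈ 𝓝 v := L.isClosed_lattice.isOpen_compl.mem_nhds hv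
      filter_upwards [h0] with w hw hw'
      exact hw hw'.1
    · exact L.compl_lattice_sdiff_singleton_mem_nhds 0
  have h2 : ∀ᶠ w in 𝓝 v, w ∈ L.lattice → w = 0 ∧ v = 0 := by
    rcases hv with hv | rfl
    · have h0 : (L.lattice : Set ℂ)ᶜ ∈ 𝓝 v := L.isClosed_lattice.isOpen_compl.mem_nhds hv
      filter_upwards [h0] with w hw hw'
      exact absurd hw' hw
    · filter_upwards [h1] with w hw hw'
      by_contra hne
      exact hw ⟨hw', fun h => hne ⟨h, rfl⟩⟩
  obtain ⟨ε, hε, hball⟩ := Metric.eventually_nhds_iff_ball.mp h2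
  refine ⟨ε / 2, by positivity, fun a ha w hw hwa => ?_⟩
  have := hball (w - a) (by
    rw [mem_ball_iff_norm] at *
    calc ‖w - a - v‖ = ‖(w - v) - (a - 0)‖ := by congr 1; ring
      _ ≤ _ := norm_sub_le _ _
      _ < ε := by linarith) hwa
  exact ⟨this.2, sub_eq_zero.mp this.1⟩

namespace IsCurveUniformization

variable {L : PeriodPair} {b c : ℂ} {m : ℕ} {x y : ℂ → ℂ}

/-- The points with image in the affine curve. -/
def Good (x y : ℂ → ℂ) (u : ℂ) : Prop := AnalyticAt ℂ x u ∧ AnalyticAt ℂ y u ∧ x u ≠ 0 ∧ y u ≠ 0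

theorem exists_good (h : IsCurveUniformization L b c m x y) (hc : c ≠ 0) {X : ℂ} (hX : X ≠ 0) :
    ∃ u, Good x y u ∧ x u = X := by
  obtain ⟨Y, hY⟩ := exists_quadratic_root (1 + X + b * X ^ 2) (c * X ^ m)
  have hY0 : Y ≠ 0 := by
    rintro rfl
    exact mul_ne_zero hc (pow_ne_zero m hX) (by linear_combination hY)
  obtain ⟨u, h1, h2, rfl, rfl⟩ := h.surj X Y hX hY0 hY
  exact ⟨u, ⟨h1, h2, hX, hY0⟩, rfl⟩

theorem not_const (h : IsCurveUniformization L b c m x y) (hc : c ≠ 0) (k : ℂ) :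
    ¬ (x =ᶠ[codiscrete ℂ] fun _ => k) := by
  intro hk
  obtain ⟨u, hu, hu1⟩ := h.exists_good hc (one_ne_zero (α := ℂ))
  obtain ⟨v, hv, hv1⟩ := h.exists_good hc (two_ne_zero (α := ℂ))
  have h1 := eq_of_eventuallyEq_codiscrete hk hu.1.continuousAt continuousAt_const
  have h2 := eq_of_eventuallyEq_codiscrete hk hv.1.continuousAt continuousAt_const
  rw [hu1] at h1
  rw [hv1, ← h1] at h2
  norm_num at h2

theorem eventually_good (h : IsCurveUniformization L b c m x y) (hc : c ≠ 0) :
    ∀ᶠ u in codiscrete ℂ, Good x y u := by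
  have hy0 : ∃ z, meromorphicOrderAt y z ≠ ⊤ := by
    obtain ⟨u, hu, -⟩ := h.exists_good hc (one_ne_zero (α := ℂ))
    refine ⟨u, ?_⟩
    rw [order_eq_zero hu.2.1 hu.2.2.2]; decide
  obtain ⟨z, hz⟩ := hy0
  filter_upwards [eventually_codiscrete_analyticAt h.ell_x.mero,
    eventually_codiscrete_analyticAt h.ell_y.mero,
    eventually_codiscrete_ne_const h.ell_x.mero (h.not_const hc) 0,
    eventually_codiscrete_ne_zero h.ell_y.mero z hz] with u h1 h2 h3 h4
  exact ⟨h1, h2, h3, h4⟩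

/-- The equation is quadratic in y, so over one value of x two of three points share the same y;
injectivity makes these two congruent. -/
theorem three_points (h : IsCurveUniformization L b c m x y) {u v w : ℂ} (hu : Good x y u)
    (hv : Good x y v) (hw : Good x y w) (huv : x u = x v) (huw : x u = x w) :
    v - u ∈ L.lattice ∨ w - u ∈ L.lattice ∨ w - v ∈ L.lattice := by
  have e1 := h.mapsTo u hu.1 hu.2.1 hu.2.2.1 hu.2.2.2
  have e2 := h.mapsTo v hv.1 hv.2.1 hv.2.2.1 hv.2.2.2
  have e3 := h.mapsTo w hw.1 hw.2.1 hw.2.2.1 hw.2.2.2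
  rw [← huv] at e2
  rw [← huw] at e3
  by_cases h1 : y v = y u
  · exact Or.inl (h.inj u v hu.1 hu.2.1 hv.1 hv.2.1 hu.2.2.1 hu.2.2.2 huv.symm h1)
  by_cases h2 : y w = y u
  · exact Or.inr (Or.inl (h.inj u w hu.1 hu.2.1 hw.1 hw.2.1 hu.2.2.1 hu.2.2.2 huw.symm h2))
  have h3 : y w = y v := by
    have k1 : y v + y u + (1 + x u + b * x u ^ 2) = 0 :=
      mul_left_cancel₀ (sub_ne_zero.mpr h1) (by linear_combination e2 - e1)
    have k2 : y w + y u + (1 + x u + b * x u ^ 2) = 0 :=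
      mul_left_cancel₀ (sub_ne_zero.mpr h2) (by linear_combination e3 - e1)
    linear_combination k2 - k1
  exact Or.inr (Or.inr (h.inj v w hv.1 hv.2.1 hw.1 hw.2.1 hv.2.2.1 hv.2.2.2 (huw.symm.trans huv) h3))

/-- Intended for Y = x and Y = 1/(x - x(0)). By `three_points` a generic value of Y has at most two
preimages modulo L. Near a pole of order k every large value is taken k times, so the pole at 0 is
exactly double and already accounts for both preimages. Hence there is no other pole modulo L. -/
theorem exists_eq_weierstrassP (h : IsCurveUniformization L b c m x y) (hc : c ≠ 0) {Y : ℂ → ℂ}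
    (hY : IsElliptic L Y) (hYx : ∀ u v, Y u = Y v → x u = x v)
    (ho : meromorphicOrderAt Y 0 ≤ ((-2 : ℤ) : WithTop ℤ)) :
    ∃ A C : ℂ, A ≠ 0 ∧ Y =ᶠ[codiscrete ℂ] fun z => A * ℘[L] z + C := by
  have hgood := h.eventually_good hc
  -- Large values X are chosen outside this countable set, so that all their preimages lie over the
  -- affine curve.
  have hTc : (Y '' {u | ¬ Good x y u}).Countable :=
    (countable_compl_of_eventually_codiscrete hgood).image _
  have hpole : ∀ {v : ℂ}, meromorphicOrderAt Y v < 0 → ∃ k : ℕ, k ≠ 0 ∧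
      meromorphicOrderAt Y v = ((-(k : ℤ) : ℤ) : WithTop ℤ) := by
    intro v hv
    cases hY' : meromorphicOrderAt Y v with
    | top => rw [hY'] at hv; exact absurd hv (by simp)
    | coe a =>
      rw [hY'] at hv
      have ha : a < 0 := by exact_mod_cast hv
      exact ⟨(-a).toNat, by omega, by congr 1; omega⟩
  obtain ⟨k, hk0, hk⟩ := hpole (lt_of_le_of_lt ho (by decide))
  have hk2 : 2 ≤ k := by
    rw [hk] at ho
    have : -(k : ℤ) ≤ -2 := WithTop.coe_le_coe.mp ho
    omega
  have hpairs : k ≤ 2 := by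
    obtain ⟨ε, hε, hball⟩ := exists_ball_sub_notMem L (v := 0) (Or.inr rfl)
    obtain ⟨R, hR⟩ := exists_finset_preimages hk0 hk
      (mem_nhdsWithin_of_mem_nhds (Metric.ball_mem_nhds (0 : ℂ) hε))
    obtain ⟨X, hXT, hXR⟩ := exists_norm_gt_notMem hTc R
    obtain ⟨S, hS, hSX⟩ := hR X hXR
    by_contra! hlt
    rw [← hS, Finset.two_lt_card] at hlt
    obtain ⟨u, hu, v, hv, w, hw, huv, huw, hvw⟩ := hlt
    have hg : ∀ u ∈ S, Good x y u := fun u hu => by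
      by_contra hcon; exact hXT ⟨u, hcon, (hSX u hu).2⟩
    rcases h.three_points (hg u hu) (hg v hv) (hg w hw) (hYx _ _ ((hSX u hu).2.trans (hSX v hv).2.symm))
      (hYx _ _ ((hSX u hu).2.trans (hSX w hw).2.symm)) with h1 | h1 | h1
    · exact huv (hball _ (hSX u hu).1 _ (hSX v hv).1 h1).2.symm
    · exact huw (hball _ (hSX u hu).1 _ (hSX w hw).1 h1).2.symm
    · exact hvw (hball _ (hSX v hv).1 _ (hSX w hw).1 h1).2.symm
  obtain rfl : k = 2 := le_antisymm hpairs hk2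
  have hoff : ∀ v ∉ L.lattice, 0 ≤ meromorphicOrderAt Y v := by
    intro v hv
    by_contra! hneg
    obtain ⟨j, hj0, hj⟩ := hpole hneg
    obtain ⟨ε, hε, hball⟩ := exists_ball_sub_notMem L (v := 0) (Or.inr rfl)
    obtain ⟨δ, hδ, hball'⟩ := exists_ball_sub_notMem L (v := v) (Or.inl hv)
    have hv0 : v ≠ 0 := fun h => hv (h ▸ zero_mem _)
    obtain ⟨R, hR⟩ := exists_finset_preimages hk0 hk
      (mem_nhdsWithin_of_mem_nhds (Metric.ball_mem_nhds (0 : ℂ) (lt_min hε hδ)))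
    obtain ⟨R', hR'⟩ := exists_finset_preimages hj0 hj
      (mem_nhdsWithin_of_mem_nhds (Metric.ball_mem_nhds v hδ))
    obtain ⟨X, hXT, hXR⟩ := exists_norm_gt_notMem hTc (max R R')
    obtain ⟨S, hS, hSX⟩ := hR X ((le_max_left _ _).trans_lt hXR)
    obtain ⟨S', hS', hSX'⟩ := hR' X ((le_max_right _ _).trans_lt hXR)
    obtain ⟨u, w, huw, rfl⟩ := Finset.card_eq_two.mp hS
    obtain ⟨t, ht⟩ : S'.Nonempty := Finset.card_ne_zero.mp (hS' ▸ hj0)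
    have hgg : ∀ u, Y u = X → Good x y u := fun u hu => by
      by_contra hcon; exact hXT ⟨u, hcon, hu⟩
    obtain ⟨hu1, hu2⟩ := hSX u (by simp)
    obtain ⟨hw1, hw2⟩ := hSX w (by simp)
    obtain ⟨ht1, ht2⟩ := hSX' t ht
    have hmin1 := Metric.ball_subset_ball (x := (0 : ℂ)) (min_le_left ε δ)
    have hmin2 := Metric.ball_subset_ball (x := (0 : ℂ)) (min_le_right ε δ)
    rcases h.three_points (hgg u hu2) (hgg w hw2) (hgg t ht2) (hYx _ _ (hu2.trans hw2.symm))
      (hYx _ _ (hu2.trans ht2.symm)) with h1 | h1 | h1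
    · exact huw (hball _ (hmin1 hu1) _ (hmin1 hw1) h1).2.symm
    · exact hv0 (hball' _ (hmin2 hu1) _ ht1 h1).1
    · exact hv0 (hball' _ (hmin2 hw1) _ ht1 h1).1
  obtain ⟨A, C, hAC⟩ := hY.exists_eq_of_neg_two_le hoff hk.ge
  refine ⟨A, C, ?_, hAC⟩
  rintro rfl
  have h1 := meromorphicOrderAt_congr (eventually_codiscrete_iff.mp hAC 0)
  have h2 : 0 ≤ meromorphicOrderAt (fun z => 0 * ℘[L] z + C) 0 := by
    simp only [zero_mul, zero_add]
    exact analyticAt_const.meromorphicOrderAt_nonneg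
  rw [← h1, hk] at h2
  exact absurd h2 (by decide)

end IsCurveUniformization

end DiskPotential

end

/-! ### Weierstrass normal form of a uniformized curve -/

noncomputable section

namespace DiskPotential

open Filter Topology PeriodPair

theorem eventually_eq_zero_or_ne_zero {f : ℂ → ℂ} (hf : Meromorphic f) :
    (∀ᶠ z in codiscrete ℂ, f z = 0) ∨ ∀ᶠ z in codiscrete ℂ, f z ≠ 0 := by
  by_cases h : ∃ z0, meromorphicOrderAt f z0 ≠ ⊤
  · obtain ⟨z0, h0⟩ := h
    exact Or.inr (eventually_codiscrete_ne_zero hf z0 h0)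
  · push Not at h
    exact Or.inl (eventually_codiscrete_iff.mpr fun z => meromorphicOrderAt_eq_top_iff.mp (h z))

theorem le_order_mul {f g : ℂ → ℂ} {z : ℂ} {a b : ℤ} (hf : MeromorphicAt f z)
    (hg : MeromorphicAt g z) (ha : (a : WithTop ℤ) ≤ meromorphicOrderAt f z)
    (hb : (b : WithTop ℤ) ≤ meromorphicOrderAt g z) :
    ((a + b : ℤ) : WithTop ℤ) ≤ meromorphicOrderAt (fun z => f z * g z) z := by
  have := meromorphicOrderAt_mul hf hg
  change _ ≤ meromorphicOrderAt (f * g) z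
  rw [this, WithTop.coe_add]
  exact add_le_add ha hb

theorem le_order_add {f g : ℂ → ℂ} {z : ℂ} {a : ℤ} (hf : MeromorphicAt f z)
    (hg : MeromorphicAt g z) (ha : (a : WithTop ℤ) ≤ meromorphicOrderAt f z)
    (hb : (a : WithTop ℤ) ≤ meromorphicOrderAt g z) :
    (a : WithTop ℤ) ≤ meromorphicOrderAt (fun z => f z + g z) z :=
  (le_min ha hb).trans (meromorphicOrderAt_add hf hg)

theorem le_order_pow {f : ℂ → ℂ} {z : ℂ} {a : ℤ} (hf : MeromorphicAt f z)
    (ha : (a : WithTop ℤ) ≤ meromorphicOrderAt f z) (n : ℕ) :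
    ((n * a : ℤ) : WithTop ℤ) ≤ meromorphicOrderAt (fun z => f z ^ n) z := by
  induction n with
  | zero => simpa using (analyticAt_const (𝕜 := ℂ) (v := (1 : ℂ)) (x := z)).meromorphicOrderAt_nonneg
  | succ n ih =>
    have := le_order_mul (hf.fun_pow n) hf ih ha
    simp only [pow_succ]
    convert this using 2
    push_cast; ring

theorem le_order_const {z : ℂ} {a : ℤ} (ha : a ≤ 0) (k : ℂ) :
    (a : WithTop ℤ) ≤ meromorphicOrderAt (fun _ => k) z :=
  le_trans (by exact_mod_cast ha) (analyticAt_const (𝕜 := ℂ)).meromorphicOrderAt_nonneg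

theorem le_order_of_sq {f : ℂ → ℂ} {z : ℂ} {a : ℤ} (hf : MeromorphicAt f z)
    (h : ((2 * a : ℤ) : WithTop ℤ) ≤ meromorphicOrderAt (fun z => f z ^ 2) z) :
    (a : WithTop ℤ) ≤ meromorphicOrderAt f z := by
  have h1 : meromorphicOrderAt (fun z => f z ^ 2) z =
      meromorphicOrderAt f z + meromorphicOrderAt f z := by
    simp only [pow_two]; exact meromorphicOrderAt_mul hf hf
  rw [h1] at h
  cases hk : meromorphicOrderAt f z with
  | top => exact le_top
  | coe k =>
    rw [hk, ← WithTop.coe_add] at h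
    have := WithTop.coe_le_coe.mp h
    exact WithTop.coe_le_coe.mpr (by omega)

/-- The quartic `(N² + N W + b W²)² - 4 c N^(4-m) W^m`. -/
def quarticForm (b c : ℂ) (m : ℕ) (N W : ℂ) : ℂ :=
  (N ^ 2 + N * W + b * W ^ 2) ^ 2 - 4 * c * (N ^ (4 - m) * W ^ m)

/-- The quartic is the discriminant of the equation in y, homogenized by x = W/N. -/
theorem quarticForm_eq {b c : ℂ} {m : ℕ} (hm : m ≤ 4) {N x W : ℂ} (hx : x * N = W) :
    quarticForm b c m N W = ((1 + x + b * x ^ 2) ^ 2 - 4 * (c * x ^ m)) * N ^ 4 := by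
  subst hx
  obtain ⟨k, hk⟩ := Nat.exists_eq_add_of_le hm
  have h1 : 4 - m = k := by omega
  have h2 : N ^ 4 = N ^ m * N ^ k := by rw [← pow_add, ← hk]
  rw [quarticForm, h1, mul_pow]
  linear_combination 4 * c * x ^ m * h2

/-- The quartic of a curve with coefficients `b, c` and exponent `m` is brought to Weierstrass form
with invariants `g₂, g₃` by a Möbius transformation with coefficients `ξ, α, γ, β`. -/
structure IsNormalForm (g₂ g₃ b c : ℂ) (m : ℕ) (ξ α γ β : ℂ) : Prop where
  α_ne : α ≠ 0
  β_ne : β ≠ 0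
  eq : ∀ X, quarticForm b c m (ξ * (α * X + γ) + 1) (α * X + γ) =
    β ^ 2 * (4 * X ^ 3 - g₂ * X - g₃)

theorem eventually_affine_ne_zero (L : PeriodPair) {ξ α γ : ℂ} (hα : α ≠ 0) :
    ∀ᶠ u in codiscrete ℂ, ξ * (α * ℘[L] u + γ) + 1 ≠ 0 := by
  by_cases hξ : ξ = 0
  · simp [hξ]
  · filter_upwards [eventually_weierstrassP_ne L (-(ξ * γ + 1) / (ξ * α))] with u hu h
    refine hu ?_
    field_simp
    linear_combination h

theorem eventually_two_mul_notMem (L : PeriodPair) : ∀ᶠ u in codiscrete ℂ, u + u ∉ L.lattice := by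
  filter_upwards [eventually_derivWeierstrassP_ne_zero L] with u hu h
  exact hu (derivWeierstrassP_eq_zero_of_two_mul_mem L h)

namespace IsCurveUniformization

variable {L : PeriodPair} {b c : ℂ} {m : ℕ} {x y : ℂ → ℂ}

/-- If x and y were both even, u and -u would give the same point for generic u, against
injectivity. -/
theorem not_even (h : IsCurveUniformization L b c m x y) (hc : c ≠ 0)
    (hx : (fun u => x (-u)) =ᶠ[codiscrete ℂ] x) : ¬ ((fun u => y (-u)) =ᶠ[codiscrete ℂ] y) := by
  intro hy
  obtain ⟨u, ⟨h1, h2⟩, h3, h4, h5⟩ := ((hx.and hy).and ((h.eventually_good hc).and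
    ((eventually_codiscrete_neg (h.eventually_good hc)).and (eventually_two_mul_notMem L)))).exists
  have := h.inj u (-u) h3.1 h3.2.1 h4.1 h4.2.1 h3.2.2.1 h3.2.2.2 h1 h2
  exact h5 (by have := neg_mem this; rwa [show -(-u - u) = u + u by ring] at this)

theorem isElliptic_two_mul_add (h : IsCurveUniformization L b c m x y) :
    IsElliptic L (fun u => 2 * y u + (1 + x u + b * x u ^ 2)) :=
  ((IsElliptic.const 2).mul h.ell_y).add
    (((IsElliptic.const 1).add h.ell_x).add ((IsElliptic.const b).mul (h.ell_x.pow 2)))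

theorem sq_eq (h : IsCurveUniformization L b c m x y) (hc : c ≠ 0) : ∀ᶠ u in codiscrete ℂ,
    (2 * y u + (1 + x u + b * x u ^ 2)) ^ 2 = (1 + x u + b * x u ^ 2) ^ 2 - 4 * (c * x u ^ m) := by
  filter_upwards [h.eventually_good hc] with u hu
  linear_combination 4 * h.mapsTo u hu.1 hu.2.1 hu.2.2.1 hu.2.2.2

/-- V = 2y + 1 + x + b x² has an even square, so V(-u) = ±V(u). By the dichotomy for meromorphic
functions one sign holds almost everywhere, and the plus sign would make y even. -/
theorem odd (h : IsCurveUniformization L b c m x y) (hc : c ≠ 0)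
    (hx : (fun u => x (-u)) =ᶠ[codiscrete ℂ] x) :
    (fun u => 2 * y (-u) + (1 + x (-u) + b * x (-u) ^ 2)) =ᶠ[codiscrete ℂ]
      fun u => -(2 * y u + (1 + x u + b * x u ^ 2)) := by
  have hV := h.isElliptic_two_mul_add
  rcases eventually_eq_zero_or_ne_zero (f := fun u => 2 * y (-u) + (1 + x (-u) + b * x (-u) ^ 2) +
    (2 * y u + (1 + x u + b * x u ^ 2))) (hV.comp_neg.add hV).mero with h1 | h1
  · filter_upwards [h1] with u hu
    linear_combination hu
  · refine absurd ?_ (h.not_even hc hx)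
    filter_upwards [h1, hx, h.sq_eq hc, eventually_codiscrete_neg (h.sq_eq hc)] with u h1 h2 h3 h4
    rw [h2] at h1 h4
    refine mul_left_cancel₀ h1 ?_
    linear_combination (h4 - h3) / 2

/-- Ramification at 0 means that 1/(x - x(0)), or x itself at a pole, has a pole of order at least
two at 0. By `exists_eq_weierstrassP` this function is A℘ + C. -/
theorem exists_moebius (h : IsCurveUniformization L b c m x y) (hc : c ≠ 0) (hm : m ≠ 0) :
    ∃ ξ α γ : ℂ, α ≠ 0 ∧ ∀ᶠ u in codiscrete ℂ,
      x u * (ξ * (α * ℘[L] u + γ) + 1) = α * ℘[L] u + γ := by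
  rcases h.ramified with ⟨han, hd⟩ | hpole
  · have hntop : meromorphicOrderAt (fun u => x u - x 0) 0 ≠ ⊤ := by
      intro htop
      refine h.not_const hc (x 0) ?_
      rcases eventually_eq_zero_or_ne_zero (f := fun u => x u - x 0)
        (h.ell_x.sub (IsElliptic.const (x 0))).mero with h1 | h1
      · filter_upwards [h1] with u hu using sub_eq_zero.mp hu
      · have h2 := eventually_codiscrete_iff.mp h1 0
        obtain ⟨u, hu1, hu2⟩ := (h2.and (meromorphicOrderAt_eq_top_iff.mp htop)).exists
        exact absurd hu2 hu1
    have h2 : ((2 : ℤ) : WithTop ℤ) ≤ meromorphicOrderAt (fun u => x u - x 0) 0 :=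
      two_le_order (han.sub analyticAt_const) (sub_self _) (by rw [deriv_sub_const]; exact hd)
    have hord : meromorphicOrderAt (fun u => (x u - x 0)⁻¹) 0 ≤ ((-2 : ℤ) : WithTop ℤ) := by
      have h3 := meromorphicOrderAt_inv (f := fun u => x u - x 0) (x := (0 : ℂ))
      change meromorphicOrderAt (fun u => x u - x 0)⁻¹ 0 ≤ _
      rw [h3]
      cases hk : meromorphicOrderAt (fun u => x u - x 0) 0 with
      | top => exact absurd hk hntop
      | coe k =>
        rw [hk] at h2
        have := WithTop.coe_le_coe.mp h2
        exact WithTop.coe_le_coe.mpr (by omega : -k ≤ -2)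
    obtain ⟨A, C, hA, hAC⟩ := h.exists_eq_weierstrassP hc
      (h.ell_x.sub (IsElliptic.const (x 0))).inv
      (fun u v huv => sub_left_injective (inv_injective huv)) hord
    have hxe : (fun u => x (-u)) =ᶠ[codiscrete ℂ] x := by
      filter_upwards [hAC, eventually_codiscrete_neg hAC] with u h1 h2
      rw [L.weierstrassP_neg, ← h1] at h2
      exact sub_left_injective (inv_injective h2)
    -- If x(0) = 0, the discriminant equals 1 at u = 0, since m ≠ 0, so V has order zero there. But
    -- V is odd and must vanish at 0.
    have hx0 : x 0 ≠ 0 := by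
      intro h0
      have hxm := h.ell_x.mero
      have hym := h.ell_y.mero
      have hVm := h.isElliptic_two_mul_add
      have ho : meromorphicOrderAt (fun u => (2 * y u + (1 + x u + b * x u ^ 2)) ^ 2) 0 = 0 := by
        rw [meromorphicOrderAt_congr (eventually_codiscrete_iff.mp (h.sq_eq hc) 0)]
        refine order_eq_zero (by fun_prop) ?_
        simp [h0, hm]
      have ho2 := le_order_of_sq (a := 0) (hVm.mero 0) (by rw [ho]; exact le_rfl)
      have ho3 := hVm.order_half_period_pos (h.odd hc hxe) (h := 0) (by simp) (by exact_mod_cast ho2)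
      have ho4 : meromorphicOrderAt (fun u => (2 * y u + (1 + x u + b * x u ^ 2)) ^ 2) 0 =
          meromorphicOrderAt (fun u => 2 * y u + (1 + x u + b * x u ^ 2)) 0 +
          meromorphicOrderAt (fun u => 2 * y u + (1 + x u + b * x u ^ 2)) 0 := by
        simp only [pow_two (_ + _)]; exact meromorphicOrderAt_mul (hVm.mero 0) (hVm.mero 0)
      rw [ho4] at ho
      exact (lt_of_lt_of_le ho3 (le_add_of_nonneg_right ho3.le)).ne' ho
    -- Solves 1/(x - x(0)) = A℘ + C for x, scaled so that the denominator has the form ξ W + 1.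
    refine ⟨(x 0)⁻¹, -(x 0) ^ 2 * A, -(x 0) ^ 2 * C - x 0, by simp [hx0, hA], ?_⟩
    filter_upwards [hAC, eventually_codiscrete_ne_const h.ell_x.mero (h.not_const hc) (x 0)] with u h1 h2
    have h3 : x u - x 0 ≠ 0 := sub_ne_zero.mpr h2
    have h4 : (x u - x 0) * (A * ℘[L] u + C) = 1 := by rw [← h1, mul_inv_cancel₀ h3]
    field_simp
    linear_combination (-(x 0)) * h4
  · obtain ⟨A, C, hA, hAC⟩ := h.exists_eq_weierstrassP hc h.ell_x (fun u v h => h) hpole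
    refine ⟨0, A, C, hA, ?_⟩
    filter_upwards [hAC] with u hu
    rw [hu]; ring

/-- V N² is odd, and its square is a quartic form in N and W. So it is holomorphic off L with a pole
of order at most four at 0, hence equals β℘'. Squaring gives the polynomial identity at X = ℘(z),
and ℘ takes every value. -/
theorem exists_normalForm (h : IsCurveUniformization L b c m x y) (hc : c ≠ 0) (hm : m ≠ 0)
    (hm4 : m ≤ 4) : ∃ ξ α γ β : ℂ, IsNormalForm L.g₂ L.g₃ b c m ξ α γ β ∧
      ∀ᶠ u in codiscrete ℂ, x u * (ξ * (α * ℘[L] u + γ) + 1) = α * ℘[L] u + γ ∧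
        (2 * y u + (1 + x u + b * x u ^ 2)) * (ξ * (α * ℘[L] u + γ) + 1) ^ 2 = β * ℘'[L] u := by
  obtain ⟨ξ, α, γ, hα, hx⟩ := h.exists_moebius hc hm
  have hxm := h.ell_x.mero
  have hym := h.ell_y.mero
  have hP := isElliptic_weierstrassP L
  have hNe := eventually_affine_ne_zero L (ξ := ξ) (γ := γ) hα
  have hxe : (fun u => x (-u)) =ᶠ[codiscrete ℂ] x := by
    filter_upwards [hx, eventually_codiscrete_neg hx, hNe] with u h1 h2 h3
    rw [L.weierstrassP_neg] at h2
    exact mul_right_cancel₀ h3 (h2.trans h1.symm)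
  have hW : IsElliptic L (fun u => α * ℘[L] u + γ) := ((IsElliptic.const α).mul hP).add (IsElliptic.const γ)
  have hN : IsElliptic L (fun u => ξ * (α * ℘[L] u + γ) + 1) :=
    ((IsElliptic.const ξ).mul hW).add (IsElliptic.const 1)
  set N : ℂ → ℂ := fun u => ξ * (α * ℘[L] u + γ) + 1 with hNdef
  set W : ℂ → ℂ := fun u => α * ℘[L] u + γ with hWdef
  have hV := h.isElliptic_two_mul_add
  have hF : IsElliptic L (fun u => (2 * y u + (1 + x u + b * x u ^ 2)) * N u ^ 2) := hV.mul (hN.pow 2)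
  have hsq : ∀ᶠ u in codiscrete ℂ, ((2 * y u + (1 + x u + b * x u ^ 2)) * N u ^ 2) ^ 2 =
      quarticForm b c m (N u) (W u) := by
    filter_upwards [hx, h.sq_eq hc] with u h1 h2
    rw [quarticForm_eq hm4 h1]
    linear_combination N u ^ 4 * h2
  have hWan : ∀ z ∉ L.lattice, AnalyticAt ℂ W z := fun z hz => by
    have := L.analyticOnNhd_weierstrassP z hz
    fun_prop
  have hNan : ∀ z ∉ L.lattice, AnalyticAt ℂ N z := fun z hz => by
    have := hWan z hz
    exact (analyticAt_const.mul this).add analyticAt_const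
  have hRan : ∀ z ∉ L.lattice, AnalyticAt ℂ (fun u => quarticForm b c m (N u) (W u)) z := by
    intro z hz
    have h1 := hWan z hz
    have h2 := hNan z hz
    simp only [quarticForm]
    fun_prop
  obtain ⟨β, hβ⟩ := hF.exists_eq_mul_derivWeierstrassP (fun z hz => by
    refine le_order_of_sq (a := 0) (hF.mero z) ?_
    rw [meromorphicOrderAt_congr (eventually_codiscrete_iff.mp hsq z)]
    simpa using (hRan z hz).meromorphicOrderAt_nonneg) (by
    refine le_order_of_sq (a := -4) (hF.mero 0) ?_
    rw [meromorphicOrderAt_congr (eventually_codiscrete_iff.mp hsq 0)]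
    have hw : ((-2 : ℤ) : WithTop ℤ) ≤ meromorphicOrderAt W 0 := by
      refine le_order_add (by fun_prop) (by fun_prop) ?_ (le_order_const (by norm_num) γ)
      exact le_order_mul (a := 0) (b := -2) (by fun_prop) (hP.mero 0) (le_order_const le_rfl α)
        (order_weierstrassP_ge L 0)
    have hn : ((-2 : ℤ) : WithTop ℤ) ≤ meromorphicOrderAt N 0 := by
      refine le_order_add (by fun_prop) (by fun_prop) ?_ (le_order_const (by norm_num) 1)
      exact le_order_mul (a := 0) (b := -2) (by fun_prop) (hW.mero 0) (le_order_const le_rfl ξ) hw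
    have hwm := hW.mero 0
    have hnm := hN.mero 0
    have e1 : ((-4 : ℤ) : WithTop ℤ) ≤
        meromorphicOrderAt (fun u => N u ^ 2 + N u * W u + b * W u ^ 2) 0 := by
      refine le_order_add (by fun_prop) (by fun_prop) (le_order_add (by fun_prop) (by fun_prop)
        (le_order_pow hnm hn 2) (le_order_mul hnm hwm hn hw)) ?_
      exact le_order_mul (a := 0) (b := -4) (by fun_prop) (by fun_prop) (le_order_const le_rfl b)
        (le_order_pow hwm hw 2)
    have e2 : ((-8 : ℤ) : WithTop ℤ) ≤ meromorphicOrderAt (fun u => N u ^ (4 - m) * W u ^ m) 0 := by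
      have := le_order_mul (by fun_prop) (by fun_prop) (le_order_pow hnm hn (4 - m))
        (le_order_pow hwm hw m)
      convert this using 2
      omega
    have e3 : ((-8 : ℤ) : WithTop ℤ) ≤
        meromorphicOrderAt (fun u => -(4 * c) * (N u ^ (4 - m) * W u ^ m)) 0 :=
      le_order_mul (a := 0) (b := -8) (by fun_prop) (by fun_prop) (le_order_const le_rfl _) e2
    have := le_order_add (by fun_prop) (by fun_prop) (le_order_pow (by fun_prop) e1 2) e3
    refine this.trans_eq (congrArg (fun f => meromorphicOrderAt f 0) (funext fun u => ?_))
    rw [quarticForm]; ring) (by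
    filter_upwards [h.odd hc hxe] with u hu
    have : N (-u) = N u := by simp [hNdef, L.weierstrassP_neg]
    rw [this, hu]; ring)
  refine ⟨ξ, α, γ, β, ⟨hα, ?_, fun X => ?_⟩, by filter_upwards [hx, hβ] with u h1 h2 using ⟨h1, h2⟩⟩
  · rintro rfl
    refine h.not_even hc hxe ?_
    have hz : ∀ᶠ u in codiscrete ℂ, 2 * y u + (1 + x u + b * x u ^ 2) = 0 := by
      filter_upwards [hβ, hNe] with u h1 h2
      rw [zero_mul] at h1
      exact (mul_eq_zero.mp h1).resolve_right (pow_ne_zero 2 h2)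
    filter_upwards [hz, eventually_codiscrete_neg hz, hxe] with u h1 h2 h3
    rw [h3] at h2
    linear_combination (h2 - h1) / 2
  · obtain ⟨z, hz, rfl⟩ := weierstrassP_surjective L X
    have hae : (fun u => quarticForm b c m (N u) (W u)) =ᶠ[codiscrete ℂ]
        fun u => β ^ 2 * (4 * ℘[L] u ^ 3 - L.g₂ * ℘[L] u - L.g₃) := by
      filter_upwards [hsq, hβ, eventually_notMem_lattice L] with u h1 h2 h3
      rw [← h1, h2, mul_pow, L.derivWeierstrassP_sq u h3]
    have hPa := L.analyticOnNhd_weierstrassP z hz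
    exact eq_of_eventuallyEq_codiscrete hae (hRan z hz).continuousAt
      (AnalyticAt.continuousAt (𝕜 := ℂ) (by fun_prop))

end IsCurveUniformization

end DiskPotential

end

/-! ### Jacobi forms of level one from the lattice ℤ + ℤτ -/

noncomputable section

namespace DiskPotential

open Filter Topology PeriodPair

/-! ### The lattices `ℤ + ℤτ` -/

/-- The period pair `(1, τ)`. -/
def lat (τ : ℍ) : PeriodPair where
  ω₁ := 1
  ω₂ := τ
  indep := by
    refine LinearIndependent.pair_iff.mpr fun s t h => ?_
    have h1 := congrArg Complex.im h
    have h2 := congrArg Complex.re h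
    simp only [Complex.real_smul, mul_one, Complex.add_im, Complex.ofReal_im, zero_add,
      Complex.im_ofReal_mul, coe_im, Complex.zero_im, mul_eq_zero, τ.im_ne_zero, or_false] at h1
    simp [h1] at h2
    exact ⟨h2, h1⟩

theorem mem_lat {τ : ℍ} {z : ℂ} : z ∈ (lat τ).lattice ↔ ∃ m n : ℤ, z = m * (τ : ℂ) + n := by
  rw [PeriodPair.mem_lattice]
  constructor
  · rintro ⟨m, n, h⟩
    refine ⟨n, m, ?_⟩
    rw [← h]; simp [lat]; ring
  · rintro ⟨m, n, rfl⟩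
    exact ⟨n, m, by simp [lat]; ring⟩

theorem IsElliptic.of_periodic {τ : ℍ} {f : ℂ → ℂ} (hf : MeromorphicOn f Set.univ)
    (hp : ∀ (m n : ℤ) (u : ℂ), f (u + m * (τ : ℂ) + n) = f u) : IsElliptic (lat τ) f := by
  refine ⟨meromorphicOn_univ.mp hf, fun l hl => ?_⟩
  obtain ⟨m, n, rfl⟩ := mem_lat.mp hl
  exact Eventually.of_forall fun z => by
    change f (z + (m * τ + n)) = f z
    rw [← add_assoc, hp]

/-- The lattice point with coordinates `i`. -/
def latPt (i : Fin 2 → ℤ) (τ : ℂ) : ℂ := i 0 * τ + i 1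

/-- Coordinates on the lattice. -/
def latEquiv (τ : ℍ) : (Fin 2 → ℤ) ≃ (lat τ).lattice :=
  ((finTwoArrowEquiv ℤ).trans (Equiv.prodComm ℤ ℤ)).trans (lat τ).latticeEquivProd.symm.toEquiv

theorem latEquiv_apply (τ : ℍ) (i : Fin 2 → ℤ) : (latEquiv τ i : ℂ) = latPt i τ := by
  change ((lat τ).latticeEquivProd.symm (i 1, i 0) : ℂ) = _
  rw [PeriodPair.latticeEquiv_symm_apply]
  simp [lat, latPt]; ring

theorem latPt_ne_zero {τ : ℍ} {i : Fin 2 → ℤ} (hi : i ≠ 0) : latPt i τ ≠ 0 := by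
  intro h
  have h1 : (latEquiv τ i : ℂ) = (latEquiv τ 0 : ℂ) := by
    rw [latEquiv_apply, latEquiv_apply, h]; simp [latPt]
  exact hi ((latEquiv τ).injective (Subtype.ext h1))

theorem differentiable_latPt (i : Fin 2 → ℤ) : Differentiable ℂ (latPt i) := by
  unfold latPt; fun_prop

theorem exists_norm_latPt_ge (A : ℝ) {B : ℝ} (hB : 0 < B) : ∃ ρ > 0, ∀ τ ∈ verticalStrip A B,
    ∀ i : Fin 2 → ℤ, ρ * ‖i‖ ≤ ‖latPt i τ‖ := by
  refine ⟨EisensteinSeries.r ⟨⟨A, B⟩, hB⟩, EisensteinSeries.r_pos _, fun τ hτ i => ?_⟩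
  rcases eq_or_ne i 0 with rfl | hi
  · simp
  · exact (mul_le_mul_of_nonneg_right (EisensteinSeries.r_lower_bound_on_verticalStrip τ hB hτ)
      (norm_nonneg i)).trans (EisensteinSeries.r_mul_max_le τ hi)

/-! ### Holomorphic dependence of `℘` on the lattice -/

/-- The summands of `℘` without its pole at the origin. -/
def wpTerm (i : Fin 2 → ℤ) (p : ℂ × ℂ) : ℂ :=
  if i = 0 then 0 else 1 / (p.1 - latPt i p.2) ^ 2 - 1 / latPt i p.2 ^ 2

theorem tsum_wpTerm (z : ℂ) (τ : ℍ) : ∑' i, wpTerm i (z, τ) = (lat τ).weierstrassPExcept 0 z := by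
  rw [weierstrassPExcept, ← (latEquiv τ).tsum_eq]
  refine tsum_congr fun i => ?_
  rw [latEquiv_apply, wpTerm]
  by_cases hi : i = 0
  · subst hi; simp [latPt]
  · rw [if_neg hi, if_neg (latPt_ne_zero hi)]

theorem exists_wpTerm_bound (A : ℝ) {B R : ℝ} (hB : 0 < B) (hR : 0 < R) :
    ∃ M K : ℝ, ∀ i : Fin 2 → ℤ, M ≤ ‖i‖ → ∀ τ ∈ verticalStrip A B, ∀ z : ℂ, ‖z‖ < R →
      2 * R ≤ ‖latPt i τ‖ ∧ ‖wpTerm i (z, τ)‖ ≤ K * ‖i‖ ^ (-3 : ℝ) := by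
  obtain ⟨ρ, hρ, h⟩ := exists_norm_latPt_ge A hB
  refine ⟨2 * R / ρ, 10 * R * ρ ^ (-3 : ℝ), fun i hi τ hτ z hz => ?_⟩
  have hi0 : 0 < ‖i‖ := lt_of_lt_of_le (by positivity) hi
  have h1 : 2 * R ≤ ‖latPt i τ‖ := by
    refine le_trans ?_ (h τ hτ i)
    rw [div_le_iff₀ hρ] at hi
    linarith
  refine ⟨h1, ?_⟩
  rw [wpTerm, if_neg (norm_pos_iff.mp hi0)]
  refine (weierstrassP_bound R hR z hz _ h1).trans ?_
  rw [mul_assoc _ (ρ ^ _), ← Real.mul_rpow hρ.le hi0.le]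
  refine mul_le_mul_of_nonneg_left ?_ (by positivity)
  exact Real.rpow_le_rpow_of_nonpos (by positivity) (h τ hτ i) (by norm_num)

theorem finite_norm_lt (M : ℝ) : {i : Fin 2 → ℤ | ¬ M ≤ ‖i‖}.Finite := by
  refine ((isCompact_closedBall (0 : Fin 2 → ℤ) M).finite_of_discrete).subset fun i hi => ?_
  rw [Metric.mem_closedBall, dist_zero_right]
  exact (not_le.mp hi).le

theorem summable_bound (M K : ℝ) (C : (Fin 2 → ℤ) → ℝ) :
    Summable fun i : Fin 2 → ℤ => |K| * ‖i‖ ^ (-3 : ℝ) + if M ≤ ‖i‖ then 0 else |C i| := by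
  refine ((EisensteinSeries.summable_one_div_norm_rpow (by norm_num : (2 : ℝ) < 3)).mul_left _).add
    (summable_of_hasFiniteSupport ((finite_norm_lt M).subset fun i hi => ?_))
  by_contra hcon
  exact hi (if_pos (not_not.mp hcon))

theorem le_bound_of_le {M K : ℝ} {C : (Fin 2 → ℤ) → ℝ} {i : Fin 2 → ℤ} {a : ℝ}
    (h1 : M ≤ ‖i‖ → a ≤ K * ‖i‖ ^ (-3 : ℝ)) (h2 : ¬ M ≤ ‖i‖ → a ≤ C i) :
    a ≤ |K| * ‖i‖ ^ (-3 : ℝ) + if M ≤ ‖i‖ then 0 else |C i| := by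
  have h0 : 0 ≤ ‖i‖ ^ (-3 : ℝ) := by positivity
  split_ifs with h
  · rw [add_zero]
    exact (h1 h).trans (mul_le_mul_of_nonneg_right (le_abs_self K) h0)
  · exact (h2 h).trans ((le_abs_self _).trans (le_add_of_nonneg_left (by positivity)))

theorem eventually_mem_strip {τ₀ : ℂ} (hτ : 0 < τ₀.im) : ∀ᶠ τ in 𝓝 τ₀, 0 < τ.im ∧
    ofComplex τ ∈ verticalStrip (|τ₀.re| + 1) (τ₀.im / 2) := by
  have h1 : ∀ᶠ τ : ℂ in 𝓝 τ₀, |τ.re| < |τ₀.re| + 1 :=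
    (Complex.continuous_re.abs.tendsto τ₀).eventually_lt_const (by simp)
  have h2 : ∀ᶠ τ : ℂ in 𝓝 τ₀, τ₀.im / 2 < τ.im :=
    (Complex.continuous_im.tendsto τ₀).eventually_const_lt (by linarith)
  filter_upwards [h1, h2] with τ h1 h2
  have h3 : 0 < τ.im := by linarith
  refine ⟨h3, ?_⟩
  rw [ofComplex_apply_of_im_pos h3]
  exact ⟨h1.le, h2.le⟩

theorem coe_ofComplex {τ : ℂ} (h : 0 < τ.im) : ((ofComplex τ : ℍ) : ℂ) = τ := by
  rw [ofComplex_apply_of_im_pos h]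

/-- Normal convergence: all but finitely many terms are bounded by a multiple of ‖i‖^(-3), uniformly
for τ in a vertical strip; the finitely many others are bounded individually near p. Dropping the
pole at 0 allows p.1 = 0. -/
theorem differentiableAt_weierstrassPExcept {p : ℂ × ℂ} (hp : 0 < p.2.im)
    (hne : ∀ i : Fin 2 → ℤ, i ≠ 0 → p.1 ≠ latPt i p.2) :
    DifferentiableAt ℂ (fun p : ℂ × ℂ => (lat (ofComplex p.2)).weierstrassPExcept 0 p.1) p := by
  obtain ⟨M, K, hMK⟩ := exists_wpTerm_bound (|p.2.re| + 1) (half_pos hp)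
    (show 0 < ‖p.1‖ + 1 by positivity)
  have hl : ∀ i : Fin 2 → ℤ, i ≠ 0 → latPt i p.2 ≠ 0 := fun i hi =>
    latPt_ne_zero (τ := ⟨p.2, hp⟩) hi
  have hdiff : ∀ (i : Fin 2 → ℤ) (q : ℂ × ℂ), (i ≠ 0 → q.1 ≠ latPt i q.2) →
      (i ≠ 0 → latPt i q.2 ≠ 0) → DifferentiableAt ℂ (wpTerm i) q := by
    intro i q h1 h2
    by_cases hi : i = 0
    · subst hi
      have : wpTerm 0 = fun _ => 0 := by ext; simp [wpTerm]
      rw [this]; fun_prop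
    · have : wpTerm i = fun p => 1 / (p.1 - latPt i p.2) ^ 2 - 1 / latPt i p.2 ^ 2 := by
        ext; simp [wpTerm, hi]
      rw [this]
      have h3 := h1 hi
      have h4 := h2 hi
      have h5 : DifferentiableAt ℂ (fun q : ℂ × ℂ => latPt i q.2) q :=
        (differentiable_latPt i _).comp q differentiableAt_snd
      have h6 : (q.1 - latPt i q.2) ^ 2 ≠ 0 := pow_ne_zero _ (sub_ne_zero.mpr h3)
      fun_prop (disch := first | assumption | exact pow_ne_zero _ h4)
  have hcl : ∀ i, Continuous fun q : ℂ × ℂ => latPt i q.2 := fun i =>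
    (differentiable_latPt i).continuous.comp continuous_snd
  have hexc : ∀ i, ¬ M ≤ ‖i‖ → ∀ᶠ q in 𝓝 p, DifferentiableAt ℂ (wpTerm i) q ∧
      ‖wpTerm i q‖ ≤ ‖wpTerm i p‖ + 1 := by
    intro i _
    have e1 : ∀ᶠ q in 𝓝 p, i ≠ 0 → q.1 ≠ latPt i q.2 := by
      by_cases hi : i = 0
      · simp [hi]
      · filter_upwards [((continuous_fst.sub (hcl i)).continuousAt (x := p)).eventually_ne
          (sub_ne_zero.mpr (hne i hi))] with q hq _ using sub_ne_zero.mp hq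
    have e2 : ∀ᶠ q in 𝓝 p, i ≠ 0 → latPt i q.2 ≠ 0 := by
      by_cases hi : i = 0
      · simp [hi]
      · filter_upwards [(hcl i).continuousAt.eventually_ne (hl i hi)] with q hq _ using hq
    have e3 := (hdiff i p (hne i) (hl i)).continuousAt.norm.eventually_lt_const
      (lt_add_one ‖wpTerm i p‖)
    filter_upwards [e1, e2, e3] with q h1 h2 h3
    exact ⟨hdiff i q h1 h2, h3.le⟩
  have hall := (finite_norm_lt M).eventually_all.mpr hexc
  have hz : ∀ᶠ q in 𝓝 p, ‖q.1‖ < ‖p.1‖ + 1 :=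
    (continuous_fst.norm.tendsto p).eventually_lt_const (lt_add_one _)
  have hs := (continuous_snd.tendsto p).eventually (eventually_mem_strip hp)
  obtain ⟨U, hU, hUo, hpU⟩ := eventually_nhds_iff.mp (hall.and (hz.and hs))
  have key : DifferentiableOn ℂ (fun q => ∑' i, wpTerm i q) U := by
    refine differentiableOn_tsum_of_norm_le hUo (summable_bound M K fun i => ‖wpTerm i p‖ + 1)
      (fun i q hq => DifferentiableAt.differentiableWithinAt ?_) fun i q hq =>
        le_bound_of_le (C := fun i => ‖wpTerm i p‖ + 1) ?_ ?_
    · obtain ⟨h1, h2, h3, h4⟩ := hU q hq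
      by_cases hi : M ≤ ‖i‖
      · have := (hMK i hi _ h4 q.1 h2).1
        rw [coe_ofComplex h3] at this
        refine hdiff i q (fun _ h => ?_) fun _ h => ?_
        · rw [← h] at this; linarith [norm_nonneg p.1]
        · rw [h, norm_zero] at this; linarith [norm_nonneg p.1]
      · exact (h1 i hi).1
    · intro hi
      obtain ⟨h1, h2, h3, h4⟩ := hU q hq
      have := (hMK i hi _ h4 q.1 h2).2
      rwa [coe_ofComplex h3] at this
    · intro hi
      exact ((hU q hq).1 i hi).2
  refine (key.differentiableAt (hUo.mem_nhds hpU)).congr_of_eventuallyEq ?_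
  filter_upwards [hUo.mem_nhds hpU] with q hq
  rw [← tsum_wpTerm, coe_ofComplex (hU q hq).2.2.1]

/-- The terms with i 0 = 0 do not involve τ; for integral z a zero denominator merely contributes
the value 0. In the other terms both denominators have modulus at least 1 as soon as Im τ ≥ |Im z| +
1. -/
theorem exists_bound_weierstrassPExcept (A : ℝ) (z : ℂ) : ∃ C B : ℝ, ∀ τ ∈ verticalStrip A B,
    ‖(lat τ).weierstrassPExcept 0 z‖ ≤ C := by
  obtain ⟨M, K, hMK⟩ := exists_wpTerm_bound A (show 0 < |z.im| + 1 by positivity)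
    (show 0 < ‖z‖ + 1 by positivity)
  have hexc : ∀ i : Fin 2 → ℤ, ∃ C : ℝ, ∀ τ ∈ verticalStrip A (|z.im| + 1), ‖wpTerm i (z, τ)‖ ≤ C := by
    intro i
    by_cases h0 : i 0 = 0
    · refine ⟨‖wpTerm i (z, UpperHalfPlane.I)‖, fun τ hτ => le_of_eq ?_⟩
      simp [wpTerm, latPt, h0]
    · refine ⟨2, fun τ hτ => ?_⟩
      have hi : i ≠ 0 := fun h => h0 (by rw [h]; rfl)
      have h1 : (1 : ℝ) ≤ |(i 0 : ℝ)| := by exact_mod_cast Int.one_le_abs h0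
      have him : |z.im| + 1 ≤ |(i 0 : ℝ) * τ.im| := by
        rw [abs_mul, abs_of_pos τ.im_pos]
        exact hτ.2.trans (le_mul_of_one_le_left τ.im_pos.le h1)
      have h2 : (1 : ℝ) ≤ ‖latPt i τ‖ := by
        refine le_trans ?_ (Complex.abs_im_le_norm _)
        have : (latPt i τ).im = (i 0 : ℝ) * τ.im := by simp [latPt]
        rw [this]
        linarith [abs_nonneg z.im]
      have h3 : (1 : ℝ) ≤ ‖z - latPt i τ‖ := by
        refine le_trans ?_ (Complex.abs_im_le_norm _)
        have : (z - latPt i τ).im = z.im - (i 0 : ℝ) * τ.im := by simp [latPt]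
        rw [this]
        have := abs_sub_abs_le_abs_sub ((i 0 : ℝ) * τ.im) z.im
        rw [abs_sub_comm] at this
        linarith
      rw [wpTerm, if_neg hi]
      refine (norm_sub_le _ _).trans ?_
      have e1 : ‖1 / (z - latPt i τ) ^ 2‖ ≤ 1 := by
        rw [norm_div, norm_one, norm_pow]
        exact div_le_one_of_le₀ (one_le_pow₀ h3) (by positivity)
      have e2 : ‖1 / latPt i τ ^ 2‖ ≤ 1 := by
        rw [norm_div, norm_one, norm_pow]
        exact div_le_one_of_le₀ (one_le_pow₀ h2) (by positivity)
      linarith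
  choose C hC using hexc
  refine ⟨∑' i : Fin 2 → ℤ, (|K| * ‖i‖ ^ (-3 : ℝ) + if M ≤ ‖i‖ then 0 else |C i|), |z.im| + 1,
    fun τ hτ => ?_⟩
  rw [← tsum_wpTerm]
  refine tsum_of_norm_bounded (summable_bound M K C).hasSum fun i => le_bound_of_le (fun hi => ?_)
    fun _ => hC i τ hτ
  exact (hMK i hi τ hτ z (lt_add_one _)).2

/-! ### The invariants of the lattice -/

theorem tsum_latPt (n : ℕ) (τ : ℍ) : (lat τ).G n = ∑' i, (latPt i τ ^ n)⁻¹ := by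
  rw [PeriodPair.G, ← (latEquiv τ).tsum_eq]
  simp only [latEquiv_apply]

theorem norm_latPt_pow_inv_le {ρ : ℝ} {n : ℕ} (hn : n ≠ 0) {τ : ℍ} (hρ : 0 < ρ)
    (h : ∀ i : Fin 2 → ℤ, ρ * ‖i‖ ≤ ‖latPt i τ‖) (i : Fin 2 → ℤ) :
    ‖(latPt i τ ^ n)⁻¹‖ ≤ (ρ ^ n)⁻¹ * ‖i‖ ^ (-n : ℝ) := by
  rcases eq_or_ne i 0 with rfl | hi
  · simp only [latPt, Pi.zero_apply, Int.cast_zero, zero_mul, add_zero, zero_pow hn, inv_zero,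
      norm_zero]
    positivity
  · have hi0 : 0 < ‖i‖ := norm_pos_iff.mpr hi
    rw [norm_inv, norm_pow, Real.rpow_neg hi0.le, Real.rpow_natCast, ← mul_inv, ← mul_pow]
    gcongr
    exact h i

theorem differentiableAt_G {n : ℕ} (hn : 3 ≤ n) {τ : ℂ} (hτ : 0 < τ.im) :
    DifferentiableAt ℂ (fun τ : ℂ => (lat (ofComplex τ)).G n) τ := by
  obtain ⟨ρ, hρ, h⟩ := exists_norm_latPt_ge (|τ.re| + 1) (half_pos hτ)
  obtain ⟨U, hU, hUo, hpU⟩ := eventually_nhds_iff.mp (eventually_mem_strip hτ)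
  have key : DifferentiableOn ℂ (fun τ => ∑' i, (latPt i τ ^ n)⁻¹) U := by
    refine differentiableOn_tsum_of_norm_le hUo ((EisensteinSeries.summable_one_div_norm_rpow
      (show (2 : ℝ) < n by exact_mod_cast hn)).mul_left (ρ ^ n)⁻¹) (fun i w hw => ?_) fun i w hw => ?_
    · refine DifferentiableAt.differentiableWithinAt ?_
      rcases eq_or_ne i 0 with rfl | hi
      · have : (fun τ => (latPt 0 τ ^ n)⁻¹) = fun _ => 0 := by
          ext; simp [latPt, show n ≠ 0 by omega]
        rw [this]; fun_prop
      · have := differentiable_latPt i w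
        exact (this.pow n).inv (pow_ne_zero _ (latPt_ne_zero (τ := ⟨w, (hU w hw).1⟩) hi))
    · have := norm_latPt_pow_inv_le (n := n) (by omega) hρ (h _ (hU w hw).2) i
      rwa [coe_ofComplex (hU w hw).1] at this
  refine (key.differentiableAt (hUo.mem_nhds hpU)).congr_of_eventuallyEq ?_
  filter_upwards [hUo.mem_nhds hpU] with w hw
  rw [tsum_latPt, coe_ofComplex (hU w hw).1]

theorem exists_bound_G {n : ℕ} (hn : 3 ≤ n) (A : ℝ) : ∃ C : ℝ, ∀ τ ∈ verticalStrip A 1,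
    ‖(lat τ).G n‖ ≤ C := by
  obtain ⟨ρ, hρ, h⟩ := exists_norm_latPt_ge A one_pos
  refine ⟨∑' i : Fin 2 → ℤ, (ρ ^ n)⁻¹ * ‖i‖ ^ (-n : ℝ), fun τ hτ => ?_⟩
  rw [tsum_latPt]
  exact tsum_of_norm_bounded ((EisensteinSeries.summable_one_div_norm_rpow
    (show (2 : ℝ) < n by exact_mod_cast hn)).mul_left (ρ ^ n)⁻¹).hasSum
    (norm_latPt_pow_inv_le (by omega) hρ (h τ hτ))

/-! ### Homogeneity -/

theorem weierstrassP_smul {L L' : PeriodPair} {k : ℂ} (hk : k ≠ 0)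
    (h : ∀ w, w ∈ L.lattice ↔ k * w ∈ L'.lattice) (z : ℂ) : ℘[L'] (k * z) = (k ^ 2)⁻¹ * ℘[L] z := by
  let e : L.lattice ≃ L'.lattice :=
    { toFun := fun w => ⟨k * w, (h w).mp w.2⟩
      invFun := fun w => ⟨k⁻¹ * w, (h _).mpr (by rw [mul_inv_cancel_left₀ hk]; exact w.2)⟩
      left_inv := fun w => Subtype.ext (inv_mul_cancel_left₀ hk _)
      right_inv := fun w => Subtype.ext (mul_inv_cancel_left₀ hk _) }
  rw [weierstrassP, ← e.tsum_eq, weierstrassP, ← tsum_mul_left]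
  refine tsum_congr fun w => ?_
  change 1 / (k * z - k * w) ^ 2 - 1 / (k * w) ^ 2 = _
  rw [← mul_sub, mul_pow, mul_pow, one_div, one_div, one_div, one_div, mul_inv, mul_inv]
  ring

theorem G_smul {L L' : PeriodPair} {k : ℂ} (hk : k ≠ 0)
    (h : ∀ w, w ∈ L.lattice ↔ k * w ∈ L'.lattice) (n : ℕ) : L'.G n = (k ^ n)⁻¹ * L.G n := by
  let e : L.lattice ≃ L'.lattice :=
    { toFun := fun w => ⟨k * w, (h w).mp w.2⟩
      invFun := fun w => ⟨k⁻¹ * w, (h _).mpr (by rw [mul_inv_cancel_left₀ hk]; exact w.2)⟩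
      left_inv := fun w => Subtype.ext (inv_mul_cancel_left₀ hk _)
      right_inv := fun w => Subtype.ext (mul_inv_cancel_left₀ hk _) }
  rw [PeriodPair.G, ← e.tsum_eq, PeriodPair.G, ← tsum_mul_left]
  refine tsum_congr fun w => ?_
  change ((k * w) ^ n)⁻¹ = _
  rw [mul_pow, mul_inv]

end DiskPotential

end

noncomputable section

namespace DiskPotential

open Filter Topology PeriodPair

/-! ### The slash action -/

theorem coe_smul_eq (γ : SL(2, ℤ)) (τ : ℍ) : ((γ • τ : ℍ) : ℂ) =
    (((γ 0 0 : ℤ) : ℂ) * (τ : ℂ) + ((γ 0 1 : ℤ) : ℂ)) / autFactor γ τ := by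
  rw [UpperHalfPlane.specialLinearGroup_apply]
  simp [autFactor]

theorem autFactor_ne_zero (γ : SL(2, ℤ)) (τ : ℍ) : autFactor γ τ ≠ 0 := by
  have h := UpperHalfPlane.denom_ne_zero (γ : GL (Fin 2) ℝ) τ
  simpa [autFactor, UpperHalfPlane.denom] using h

theorem autFactor_mul (γ γ' : SL(2, ℤ)) (τ : ℍ) :
    autFactor (γ * γ') τ = autFactor γ (γ' • τ) * autFactor γ' τ := by
  have h := autFactor_ne_zero γ' τ
  rw [autFactor, autFactor, coe_smul_eq]
  simp only [Matrix.SpecialLinearGroup.coe_mul, Matrix.mul_apply, Fin.sum_univ_two]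
  field_simp
  rw [autFactor]
  push_cast
  ring

/-- Besides the cocycle rule for cτ + d, the exponents must add up. This is the relation `key`, a
consequence of det γ' = 1. -/
theorem jacobiSlash_mul (k l : ℤ) (Φ : ℂ × ℍ → ℂ) (γ γ' : SL(2, ℤ)) :
    jacobiSlash k l Φ (γ * γ') = jacobiSlash k l (jacobiSlash k l Φ γ) γ' := by
  ext ⟨z, τ⟩
  have h' := autFactor_ne_zero γ' τ
  have h := autFactor_ne_zero γ (γ' • τ)
  have hdet : ((γ' 0 0 : ℤ) : ℂ) * ((γ' 1 1 : ℤ) : ℂ) - ((γ' 0 1 : ℤ) : ℂ) * ((γ' 1 0 : ℤ) : ℂ) = 1 := by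
    have := γ'.det_coe
    rw [Matrix.det_fin_two] at this
    exact_mod_cast this
  have hJ : autFactor γ (γ' • τ) * autFactor γ' τ = ((γ 1 0 : ℤ) : ℂ) *
      (((γ' 0 0 : ℤ) : ℂ) * τ + ((γ' 0 1 : ℤ) : ℂ)) + ((γ 1 1 : ℤ) : ℂ) * autFactor γ' τ := by
    rw [autFactor, coe_smul_eq]
    field_simp
  have hj : autFactor γ' τ = ((γ' 1 0 : ℤ) : ℂ) * τ + ((γ' 1 1 : ℤ) : ℂ) := rfl
  simp only [jacobiSlash]
  rw [autFactor_mul, mul_zpow, mul_smul, div_div, mul_comm (autFactor γ' τ) (autFactor γ _)]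
  have hc : (((γ * γ') 1 0 : ℤ) : ℂ) = ((γ 1 0 : ℤ) : ℂ) * ((γ' 0 0 : ℤ) : ℂ) +
      ((γ 1 1 : ℤ) : ℂ) * ((γ' 1 0 : ℤ) : ℂ) := by
    simp [Matrix.mul_apply, Fin.sum_univ_two]
  have key : (((γ * γ') 1 0 : ℤ) : ℂ) * autFactor γ' τ =
      ((γ' 1 0 : ℤ) : ℂ) * (autFactor γ (γ' • τ) * autFactor γ' τ) + ((γ 1 0 : ℤ) : ℂ) := by
    rw [hc, hJ, hj]
    linear_combination ((γ 1 0 : ℤ) : ℂ) * hdet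
  have hexp : -(2 * Real.pi * Complex.I * l * (((γ * γ') 1 0 : ℤ) : ℂ) * z ^ 2 /
      (autFactor γ (γ' • τ) * autFactor γ' τ)) =
      -(2 * Real.pi * Complex.I * l * ((γ' 1 0 : ℤ) : ℂ) * z ^ 2 / autFactor γ' τ) +
      -(2 * Real.pi * Complex.I * l * ((γ 1 0 : ℤ) : ℂ) * (z / autFactor γ' τ) ^ 2 /
        autFactor γ (γ' • τ)) := by
    field_simp
    linear_combination (-(l : ℂ) * z ^ 2) * key
  rw [hexp, Complex.exp_add]
  ring

theorem jacobiSlash_one (k l : ℤ) (Φ : ℂ × ℍ → ℂ) : jacobiSlash k l Φ 1 = Φ := by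
  ext ⟨z, τ⟩
  simp [jacobiSlash, autFactor]

theorem jacobiSlash_mul_fun (k l k' l' : ℤ) (Φ Ψ : ℂ × ℍ → ℂ) (γ : SL(2, ℤ)) (p : ℂ × ℍ) :
    jacobiSlash (k + k') (l + l') (fun p => Φ p * Ψ p) γ p =
      jacobiSlash k l Φ γ p * jacobiSlash k' l' Ψ γ p := by
  have h := autFactor_ne_zero γ p.2
  simp only [jacobiSlash]
  rw [neg_add, zpow_add₀ h]
  push_cast
  rw [show -(2 * Real.pi * Complex.I * ((l : ℂ) + l') * ((γ 1 0 : ℤ) : ℂ) * p.1 ^ 2 / autFactor γ p.2) =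
    -(2 * Real.pi * Complex.I * l * ((γ 1 0 : ℤ) : ℂ) * p.1 ^ 2 / autFactor γ p.2) +
    -(2 * Real.pi * Complex.I * l' * ((γ 1 0 : ℤ) : ℂ) * p.1 ^ 2 / autFactor γ p.2) by ring,
    Complex.exp_add]
  ring

theorem jacobiSlash_add_fun (k l : ℤ) (Φ Ψ : ℂ × ℍ → ℂ) (γ : SL(2, ℤ)) (p : ℂ × ℍ) :
    jacobiSlash k l (fun p => Φ p + Ψ p) γ p = jacobiSlash k l Φ γ p + jacobiSlash k l Ψ γ p := by
  simp only [jacobiSlash]; ring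

theorem jacobiSlash_const (c : ℂ) (γ : SL(2, ℤ)) (p : ℂ × ℍ) :
    jacobiSlash 0 0 (fun _ => c) γ p = c := by
  simp [jacobiSlash]

theorem jacobiSlash_eq_of_generators {k l : ℤ} {Φ : ℂ × ℍ → ℂ}
    (hS : jacobiSlash k l Φ ModularGroup.S = Φ) (hT : jacobiSlash k l Φ ModularGroup.T = Φ)
    (γ : SL(2, ℤ)) : jacobiSlash k l Φ γ = Φ := by
  let H : Subgroup SL(2, ℤ) :=
    { carrier := {γ | jacobiSlash k l Φ γ = Φ}
      mul_mem' := fun {a b} ha hb => by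
        rw [Set.mem_ofPred_eq] at *
        rw [jacobiSlash_mul, ha, hb]
      one_mem' := jacobiSlash_one k l Φ
      inv_mem' := fun {a} ha => by
        rw [Set.mem_ofPred_eq] at *
        conv_lhs => rw [← ha]
        rw [← jacobiSlash_mul, mul_inv_cancel, jacobiSlash_one] }
  have h : (⊤ : Subgroup SL(2, ℤ)) ≤ H := by
    rw [← SpecialLinearGroup.SL2Z_generators, Subgroup.closure_le]
    rintro x (rfl | rfl)
    · exact hS
    · exact hT
  exact h (Subgroup.mem_top γ)

theorem coe_S_smul (τ : ℍ) : ((ModularGroup.S • τ : ℍ) : ℂ) = -1 / τ := by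
  rw [coe_smul_eq]; simp [ModularGroup.S, autFactor]

theorem coe_T_smul (τ : ℍ) : ((ModularGroup.T • τ : ℍ) : ℂ) = τ + 1 := by
  rw [coe_smul_eq]; simp [ModularGroup.T, autFactor]

theorem jacobiSlash_S (k l : ℤ) (Φ : ℂ × ℍ → ℂ) (z : ℂ) (τ : ℍ) :
    jacobiSlash k l Φ ModularGroup.S (z, τ) = (τ : ℂ) ^ (-k) *
      Complex.exp (-(2 * Real.pi * Complex.I * l * z ^ 2 / τ)) * Φ (z / τ, ModularGroup.S • τ) := by
  simp [jacobiSlash, autFactor, ModularGroup.S]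

theorem jacobiSlash_T (k l : ℤ) (Φ : ℂ × ℍ → ℂ) (z : ℂ) (τ : ℍ) :
    jacobiSlash k l Φ ModularGroup.T (z, τ) = Φ (z, ModularGroup.T • τ) := by
  simp [jacobiSlash, autFactor, ModularGroup.T]

/-! ### Weak Jacobi forms -/

theorem isHolomorphicOn_univ {Φ : ℂ × ℍ → ℂ} : IsHolomorphicOn Φ Set.univ ↔
    DifferentiableOn ℂ (fun p : ℂ × ℂ => Φ (p.1, ofComplex p.2)) halfSpace := by
  simp [IsHolomorphicOn, halfSpace]

namespace IsWeakJacobiForm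

variable {Γ : Subgroup SL(2, ℤ)} {k l k' l' : ℤ} {Φ Ψ : ℂ × ℍ → ℂ}

theorem mul (h : IsWeakJacobiForm Γ k l Φ) (h' : IsWeakJacobiForm Γ k' l' Ψ) :
    IsWeakJacobiForm Γ (k + k') (l + l') fun p => Φ p * Ψ p where
  holo := DifferentiableOn.mul h.holo h'.holo
  modular γ hγ p := by rw [jacobiSlash_mul_fun, h.modular γ hγ, h'.modular γ hγ]
  elliptic m n p := by
    rw [h.elliptic, h'.elliptic]
    push_cast
    rw [show -(2 * Real.pi * Complex.I * ((l : ℂ) + l') * (m ^ 2 * (p.2 : ℂ) + 2 * m * p.1)) =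
      -(2 * Real.pi * Complex.I * l * (m ^ 2 * (p.2 : ℂ) + 2 * m * p.1)) +
      -(2 * Real.pi * Complex.I * l' * (m ^ 2 * (p.2 : ℂ) + 2 * m * p.1)) by ring, Complex.exp_add]
    ring
  cusps γ z := by
    simp only [jacobiSlash_mul_fun]
    exact (h.cusps γ z).mul (h'.cusps γ z)

theorem add (h : IsWeakJacobiForm Γ k l Φ) (h' : IsWeakJacobiForm Γ k l Ψ) :
    IsWeakJacobiForm Γ k l fun p => Φ p + Ψ p where
  holo := DifferentiableOn.add h.holo h'.holo
  modular γ hγ p := by rw [jacobiSlash_add_fun, h.modular γ hγ, h'.modular γ hγ]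
  elliptic m n p := by rw [h.elliptic, h'.elliptic]; ring
  cusps γ z := by
    simp only [jacobiSlash_add_fun]
    exact (h.cusps γ z).add (h'.cusps γ z)

theorem const (c : ℂ) : IsWeakJacobiForm Γ 0 0 fun _ => c where
  holo := differentiableOn_const c
  modular γ _ p := jacobiSlash_const c γ p
  elliptic m n p := by simp
  cusps γ z := by
    simp only [jacobiSlash_const]
    exact const_boundedAtFilter _ c

theorem const_mul (h : IsWeakJacobiForm Γ k l Φ) (c : ℂ) :
    IsWeakJacobiForm Γ k l fun p => c * Φ p := by
  simpa using (const c).mul h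

theorem pow (h : IsWeakJacobiForm Γ k l Φ) (n : ℕ) :
    IsWeakJacobiForm Γ (n * k) (n * l) fun p => Φ p ^ n := by
  induction n with
  | zero => simpa using const 1
  | succ n ih =>
    have := ih.mul h
    simp only [pow_succ]
    convert this using 1 <;> (push_cast; ring)

theorem zero : IsWeakJacobiForm Γ k l fun _ => 0 where
  holo := differentiableOn_const 0
  modular γ _ p := by simp [jacobiSlash]
  elliptic m n p := by simp
  cusps γ z := by
    simp only [jacobiSlash, mul_zero]
    exact const_boundedAtFilter _ (0 : ℂ)

theorem sum {ι : Type*} (s : Finset ι) {f : ι → ℂ × ℍ → ℂ}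
    (h : ∀ i ∈ s, IsWeakJacobiForm Γ k l (f i)) :
    IsWeakJacobiForm Γ k l fun p => ∑ i ∈ s, f i p := by
  classical
  induction s using Finset.induction_on with
  | empty => simpa using zero
  | insert a s ha ih =>
    simp only [Finset.sum_insert ha]
    exact (h a (Finset.mem_insert_self a s)).add (ih fun i hi => h i (Finset.mem_insert_of_mem hi))

theorem mono {Γ' : Subgroup SL(2, ℤ)} (h : IsWeakJacobiForm Γ k l Φ) (hΓ : Γ' ≤ Γ) :
    IsWeakJacobiForm Γ' k l Φ :=
  ⟨h.holo, fun γ hγ => h.modular γ (hΓ hγ), h.elliptic, h.cusps⟩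

end IsWeakJacobiForm

theorem isBoundedAtImInfty_of_strip {f : ℍ → ℂ} (hT : ∀ τ, f (ModularGroup.T • τ) = f τ)
    {B C : ℝ} (h : ∀ τ ∈ verticalStrip 1 B, ‖f τ‖ ≤ C) : IsBoundedAtImInfty f := by
  rw [isBoundedAtImInfty_iff]
  refine ⟨C, B, fun τ hτ => ?_⟩
  obtain ⟨n, hn⟩ := ModularGroup_T_zpow_mem_verticalStrip τ one_pos
  have hinv : ∀ (n : ℤ) (τ : ℍ), f (ModularGroup.T ^ n • τ) = f τ := by
    intro n
    induction n using Int.induction_on with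
    | zero => simp
    | succ n ih => intro τ; rw [zpow_add_one, mul_smul, ih, hT]
    | pred n ih =>
      intro τ
      rw [← hT (ModularGroup.T ^ (-(n : ℤ) - 1) • τ), ← mul_smul, ← zpow_one_add]
      simpa using ih τ
  rw [← hinv (1 * n) τ]
  refine h _ ?_
  have h2 := verticalStrip_anti_right ((1 : ℕ) : ℝ) hτ hn
  simpa using h2

/-- Invariance under S and T gives invariance under all γ, so the condition at every cusp reduces to
boundedness of Φ itself on a vertical strip. -/
theorem IsWeakJacobiForm.of_levelOne {k l : ℤ} {Φ : ℂ × ℍ → ℂ}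
    (holo : DifferentiableOn ℂ (fun p : ℂ × ℂ => Φ (p.1, ofComplex p.2)) halfSpace)
    (hS : ∀ z τ, jacobiSlash k l Φ ModularGroup.S (z, τ) = Φ (z, τ))
    (hT : ∀ z τ, Φ (z, ModularGroup.T • τ) = Φ (z, τ))
    (hell : ∀ (m n : ℤ) (p : ℂ × ℍ), Φ (latticeShift m n p) =
      Complex.exp (-(2 * Real.pi * Complex.I * l * (m ^ 2 * (p.2 : ℂ) + 2 * m * p.1))) * Φ p)
    (hb : ∀ z, ∃ C B : ℝ, ∀ τ ∈ verticalStrip 1 B, ‖Φ (z, τ)‖ ≤ C) :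
    IsWeakJacobiForm ⊤ k l Φ := by
  have hinv := jacobiSlash_eq_of_generators (k := k) (l := l) (Φ := Φ)
    (funext fun p => hS p.1 p.2) (funext fun p => by
      rw [show p = (p.1, p.2) from rfl, jacobiSlash_T, hT])
  refine ⟨isHolomorphicOn_univ.mpr holo, fun γ _ p => by rw [hinv], hell, fun γ z => ?_⟩
  rw [hinv]
  obtain ⟨C, B, h⟩ := hb z
  exact isBoundedAtImInfty_of_strip (hT z) h

end DiskPotential

end

noncomputable section

namespace DiskPotential

open Filter Topology PeriodPair

/-! ### The invariants as Jacobi forms -/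

theorem mem_lat_S (τ : ℍ) (w : ℂ) :
    w ∈ (lat τ).lattice ↔ (τ : ℂ)⁻¹ * w ∈ (lat (ModularGroup.S • τ)).lattice := by
  have hτ := τ.ne_zero
  simp only [mem_lat, coe_S_smul]
  constructor
  · rintro ⟨m, n, rfl⟩
    exact ⟨-n, m, by push_cast; field_simp; ring⟩
  · rintro ⟨m, n, h⟩
    refine ⟨n, -m, ?_⟩
    field_simp at h
    push_cast
    linear_combination h

theorem mem_lat_T (τ : ℍ) (w : ℂ) :
    w ∈ (lat τ).lattice ↔ 1 * w ∈ (lat (ModularGroup.T • τ)).lattice := by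
  simp only [mem_lat, coe_T_smul, one_mul]
  constructor
  · rintro ⟨m, n, rfl⟩
    exact ⟨m, n - m, by push_cast; ring⟩
  · rintro ⟨m, n, h⟩
    exact ⟨m, n + m, by rw [h]; push_cast; ring⟩

theorem G_S_smul (n : ℕ) (τ : ℍ) : (lat (ModularGroup.S • τ)).G n = (τ : ℂ) ^ n * (lat τ).G n := by
  rw [G_smul (inv_ne_zero τ.ne_zero) (mem_lat_S τ) n, inv_pow, inv_inv]

theorem G_T_smul (n : ℕ) (τ : ℍ) : (lat (ModularGroup.T • τ)).G n = (lat τ).G n := by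
  rw [G_smul one_ne_zero (mem_lat_T τ) n, one_pow, inv_one, one_mul]

theorem isWeakJacobiForm_G {n : ℕ} (hn : 3 ≤ n) :
    IsWeakJacobiForm ⊤ n 0 fun p => (lat p.2).G n := by
  refine IsWeakJacobiForm.of_levelOne (fun p hp => ?_) (fun z τ => ?_) (fun z τ => G_T_smul n τ)
    (fun m k p => by simp [latticeShift]) fun z => ?_
  · exact ((differentiableAt_G hn hp).comp p differentiableAt_snd).differentiableWithinAt
  · rw [jacobiSlash_S, G_S_smul]
    have := τ.ne_zero
    simp only [Int.cast_zero, mul_zero, zero_mul, zero_div, neg_zero, Complex.exp_zero, mul_one]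
    rw [← mul_assoc, zpow_neg, zpow_natCast, inv_mul_cancel₀ (pow_ne_zero _ this), one_mul]
  · obtain ⟨C, hC⟩ := exists_bound_G hn 1
    exact ⟨C, 1, hC⟩

theorem isWeakJacobiForm_g₂ : IsWeakJacobiForm ⊤ 4 0 fun p => (lat p.2).g₂ :=
  (isWeakJacobiForm_G (n := 4) (by norm_num)).const_mul 60

theorem isWeakJacobiForm_g₃ : IsWeakJacobiForm ⊤ 6 0 fun p => (lat p.2).g₃ :=
  (isWeakJacobiForm_G (n := 6) (by norm_num)).const_mul 140

/-- The discriminant is 16 times the square of the product of differences of the three distinct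
values of ℘ at half periods. -/
theorem discr_ne_zero (L : PeriodPair) : L.g₂ ^ 3 - 27 * L.g₃ ^ 2 ≠ 0 := by
  obtain ⟨h1, h2, h3⟩ := weierstrass_half_ne L
  obtain ⟨k1, k2, k3⟩ := cubic_eq_prod_of_roots h1 h2 h3
    (half_period_root L L.ω₁_div_two_notMem_lattice (by rw [add_halves]; exact L.ω₁_mem_lattice))
    (half_period_root L L.ω₂_div_two_notMem_lattice (by rw [add_halves]; exact L.ω₂_mem_lattice))
    (half_period_root L (half_sum_notMem_lattice L) (by
      rw [show L.ω₁ / 2 + L.ω₂ / 2 + (L.ω₁ / 2 + L.ω₂ / 2) = L.ω₁ + L.ω₂ by ring]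
      exact add_mem L.ω₁_mem_lattice L.ω₂_mem_lattice))
  set a := ℘[L] (L.ω₁ / 2)
  set b := ℘[L] (L.ω₂ / 2)
  set c := ℘[L] (L.ω₁ / 2 + L.ω₂ / 2)
  have : L.g₂ ^ 3 - 27 * L.g₃ ^ 2 = 16 * ((a - b) * (a - c) * (b - c)) ^ 2 := by
    rw [k2, k3, show c = -a - b by linear_combination k1]; ring
  rw [this]
  exact mul_ne_zero (by norm_num) (pow_ne_zero _ (mul_ne_zero (mul_ne_zero (sub_ne_zero.mpr h1)
    (sub_ne_zero.mpr h2)) (sub_ne_zero.mpr h3)))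

/-- S fixes i, and the weight 6 factor there is i⁶ = -1. -/
theorem g₃_I : (lat UpperHalfPlane.I).g₃ = 0 := by
  have h := G_S_smul 6 UpperHalfPlane.I
  have hfix : ModularGroup.S • UpperHalfPlane.I = UpperHalfPlane.I := by
    apply UpperHalfPlane.ext
    rw [coe_S_smul]; simp
  rw [hfix, UpperHalfPlane.coe_I, show Complex.I ^ 6 = -1 by
    rw [show 6 = 2 * 3 by norm_num, pow_mul, Complex.I_sq]; norm_num] at h
  rw [PeriodPair.g₃, show (lat UpperHalfPlane.I).G 6 = 0 by linear_combination h / 2, mul_zero]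

theorem g₂_I_ne_zero : (lat UpperHalfPlane.I).g₂ ≠ 0 := by
  intro h
  exact discr_ne_zero (lat UpperHalfPlane.I) (by rw [h, g₃_I]; ring)

/-- The fixed point `(-1 + i√3) / 2` of order three. -/
def rhoPt : ℍ := ⟨⟨-1 / 2, Real.sqrt 3 / 2⟩, by positivity⟩

theorem rhoPt_sq : (rhoPt : ℂ) ^ 2 + rhoPt + 1 = 0 := by
  have h3 : Real.sqrt 3 * Real.sqrt 3 = 3 := Real.mul_self_sqrt (by norm_num)
  apply Complex.ext
  · simp [rhoPt, pow_two]; linear_combination -h3 / 4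
  · simp [rhoPt, pow_two]; ring

/-- ST fixes ρ, and the weight 4 factor there is (ρ + 1)⁴ = ρ² ≠ 1. -/
theorem g₂_rhoPt : (lat rhoPt).g₂ = 0 := by
  have hfix : ModularGroup.S • (ModularGroup.T • rhoPt) = rhoPt := by
    apply UpperHalfPlane.ext
    rw [coe_S_smul, coe_T_smul]
    have h := rhoPt_sq
    have h0 : (rhoPt : ℂ) + 1 ≠ 0 := fun h0 => by
      have := congrArg Complex.im h0
      simp [rhoPt.im_ne_zero] at this
    field_simp
    linear_combination -h
  have h := G_S_smul 4 (ModularGroup.T • rhoPt)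
  rw [hfix, G_T_smul, coe_T_smul] at h
  have h1 : ((rhoPt : ℂ) + 1) ^ 4 = rhoPt ^ 2 := by
    linear_combination ((rhoPt : ℂ) ^ 2 + 3 * rhoPt + 1) * rhoPt_sq
  have h2 : ((rhoPt : ℂ) ^ 2 - 1) * (lat rhoPt).G 4 = 0 := by
    rw [h1] at h; linear_combination -h
  have h3 : (rhoPt : ℂ) ^ 2 - 1 ≠ 0 := by
    intro h3
    have h4 : (rhoPt : ℂ) = -2 := by linear_combination rhoPt_sq - h3
    have := congrArg Complex.im h4
    simp [rhoPt.im_ne_zero] at this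
  rw [PeriodPair.g₂, (mul_eq_zero.mp h2).resolve_left h3, mul_zero]

theorem g₃_rhoPt_ne_zero : (lat rhoPt).g₃ ≠ 0 := by
  intro h
  exact discr_ne_zero (lat rhoPt) (by rw [h, g₂_rhoPt]; ring)

/-! ### The theta function -/

/-- The odd theta function, up to an exponential factor. -/
def oddTheta (z τ : ℂ) : ℂ := jacobiTheta₂ (z + (1 + τ) / 2) τ

/-- The eighth power of the odd theta function. -/
def thetaForm (p : ℂ × ℍ) : ℂ :=
  Complex.exp (2 * Real.pi * Complex.I * p.2 + 8 * Real.pi * Complex.I * p.1) *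
    oddTheta p.1 p.2 ^ 8

/-- The half period (1 + τ)/2 is congruent to its negative. Evenness of the theta series and the
quasi-periodicity factor -1 force its value there to be zero. -/
theorem oddTheta_zero (τ : ℂ) : oddTheta 0 τ = 0 := by
  have h1 := jacobiTheta₂_add_left' ((1 - τ) / 2) τ
  have h2 := jacobiTheta₂_add_left (-((1 + τ) / 2)) τ
  rw [jacobiTheta₂_neg_left, show -((1 + τ) / 2) + 1 = (1 - τ) / 2 by ring] at h2
  rw [h2, show (1 - τ) / 2 + τ = (1 + τ) / 2 by ring,
    show -(Real.pi : ℂ) * Complex.I * (τ + 2 * ((1 - τ) / 2)) = -(Real.pi * Complex.I) by ring,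
    Complex.exp_neg, Complex.exp_pi_mul_I] at h1
  rw [oddTheta, zero_add]
  linear_combination h1 / 2

theorem exp_eq_of_sub (n : ℤ) {w w' : ℂ} (h : w = w' + n * (2 * Real.pi * Complex.I)) :
    Complex.exp w = Complex.exp w' := by
  rw [h, Complex.exp_add, Complex.exp_int_mul_two_pi_mul_I, mul_one]

theorem jacobiTheta₂_add_one_right (z τ : ℂ) :
    jacobiTheta₂ z (τ + 1) = jacobiTheta₂ (z + 1 / 2) τ := by
  refine tsum_congr fun n => ?_
  rw [jacobiTheta₂_term, jacobiTheta₂_term]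
  obtain ⟨k, hk⟩ := Int.even_mul_succ_self (n - 1)
  have hk' : ((n : ℂ) - 1) * n = 2 * k := by
    have : (((n - 1) * (n - 1 + 1) : ℤ) : ℂ) = ((k + k : ℤ) : ℂ) := by rw [hk]
    push_cast at this
    linear_combination this
  refine exp_eq_of_sub k ?_
  linear_combination Real.pi * Complex.I * hk'

theorem oddTheta_add_one_right (z τ : ℂ) : oddTheta z (τ + 1) = oddTheta z τ := by
  rw [oddTheta, jacobiTheta₂_add_one_right,
    show z + (1 + (τ + 1)) / 2 + 1 / 2 = z + (1 + τ) / 2 + 1 by ring, jacobiTheta₂_add_left, oddTheta]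

theorem oddTheta_add_one (z τ : ℂ) : oddTheta (z + 1) τ = oddTheta z τ := by
  rw [oddTheta, show z + 1 + (1 + τ) / 2 = z + (1 + τ) / 2 + 1 by ring, jacobiTheta₂_add_left, oddTheta]

theorem oddTheta_add_tau (z τ : ℂ) :
    oddTheta (z + τ) τ = Complex.exp (-Real.pi * Complex.I * (2 * τ + 2 * z + 1)) * oddTheta z τ := by
  rw [oddTheta, show z + τ + (1 + τ) / 2 = z + (1 + τ) / 2 + τ by ring, jacobiTheta₂_add_left', oddTheta]
  congr 2; ring

theorem thetaForm_add_one (z : ℂ) (τ : ℍ) : thetaForm (z + 1, τ) = thetaForm (z, τ) := by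
  simp only [thetaForm, oddTheta_add_one]
  congr 1
  exact exp_eq_of_sub 4 (by push_cast; ring)

theorem thetaForm_add_tau (z : ℂ) (τ : ℍ) : thetaForm (z + τ, τ) =
    Complex.exp (-(8 * Real.pi * Complex.I * (τ + 2 * z))) * thetaForm (z, τ) := by
  simp only [thetaForm, oddTheta_add_tau, mul_pow, ← Complex.exp_nat_mul]
  rw [← mul_assoc, ← Complex.exp_add, ← mul_assoc (Complex.exp _) (Complex.exp _), ← Complex.exp_add]
  congr 1
  exact exp_eq_of_sub (-4) (by push_cast; ring)

theorem thetaForm_elliptic (m n : ℤ) (p : ℂ × ℍ) : thetaForm (latticeShift m n p) =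
    Complex.exp (-(2 * Real.pi * Complex.I * (4 : ℤ) * (m ^ 2 * (p.2 : ℂ) + 2 * m * p.1))) *
      thetaForm p := by
  obtain ⟨z, τ⟩ := p
  have h1 : ∀ (n : ℤ) (z : ℂ), thetaForm (z + n, τ) = thetaForm (z, τ) := by
    intro n
    induction n using Int.induction_on with
    | zero => simp
    | succ n ih =>
      intro z
      rw [← ih z, ← thetaForm_add_one (z + (n : ℤ))]; push_cast; ring_nf
    | pred n ih =>
      intro z
      rw [← ih z, ← thetaForm_add_one (z + ((-(n : ℤ) - 1 : ℤ) : ℂ))]; push_cast; ring_nf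
  have h2 : ∀ (m : ℤ) (z : ℂ), thetaForm (z + m * τ, τ) =
      Complex.exp (-(8 * Real.pi * Complex.I * (m ^ 2 * (τ : ℂ) + 2 * m * z))) * thetaForm (z, τ) := by
    intro m
    induction m using Int.induction_on with
    | zero => simp
    | succ m ih =>
      intro z
      have h3 := thetaForm_add_tau (z + (m : ℤ) * τ) τ
      rw [ih z, ← mul_assoc, ← Complex.exp_add] at h3
      rw [show z + (((m : ℤ) + 1 : ℤ) : ℂ) * τ = z + (m : ℤ) * τ + τ by push_cast; ring, h3]
      congr 2; push_cast; ring
    | pred m ih =>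
      intro z
      have h3 := thetaForm_add_tau (z + ((-(m : ℤ) - 1 : ℤ) : ℂ) * τ) τ
      rw [show z + ((-(m : ℤ) - 1 : ℤ) : ℂ) * τ + τ = z + ((-(m : ℤ) : ℤ) : ℂ) * τ by
        push_cast; ring, ih z] at h3
      refine mul_left_cancel₀ (Complex.exp_ne_zero _) (h3.symm.trans ?_)
      rw [← mul_assoc, ← Complex.exp_add]
      congr 2; push_cast; ring
  simp only [latticeShift]
  rw [h1, h2]
  congr 2; push_cast; ring

theorem thetaForm_T (z : ℂ) (τ : ℍ) : thetaForm (z, ModularGroup.T • τ) = thetaForm (z, τ) := by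
  simp only [thetaForm, coe_T_smul, oddTheta_add_one_right]
  congr 1
  exact exp_eq_of_sub 1 (by push_cast; ring)

/-- The eighth power turns the square root (-iτ)^(1/2) of the functional equation into τ⁴ and
removes all roots of unity. So the product has honest weight 4 and index 4. -/
theorem thetaForm_S (z : ℂ) (τ : ℍ) :
    jacobiSlash 4 4 thetaForm ModularGroup.S (z, τ) = thetaForm (z, τ) := by
  have hτ := τ.ne_zero
  rw [jacobiSlash_S]
  simp only [thetaForm, coe_S_smul]
  have h := jacobiTheta₂_functional_equation (z + (τ - 1) / 2) τ
  have e1 : (z + (τ - 1) / 2) / (τ : ℂ) = z / τ + (1 + -1 / τ) / 2 := by field_simp; ring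
  have e2 : jacobiTheta₂ (z + (τ - 1) / 2) τ = oddTheta z τ := by
    rw [← jacobiTheta₂_add_left, oddTheta]; congr 1; ring
  rw [e1, e2] at h
  have hroot : ((-Complex.I * (τ : ℂ)) ^ (1 / 2 : ℂ)) ^ 8 = (τ : ℂ) ^ 4 := by
    rw [← Complex.cpow_nat_mul]
    norm_num
    rw [mul_pow, Complex.I_pow_four, one_mul]
  have h8 : oddTheta z τ ^ 8 = ((τ : ℂ) ^ 4)⁻¹ *
      Complex.exp ((8 : ℕ) * (-Real.pi * Complex.I * (z + (τ - 1) / 2) ^ 2 / τ)) *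
      oddTheta (z / τ) (-1 / τ) ^ 8 := by
    rw [h, mul_pow, mul_pow, div_pow, hroot, one_pow, one_div, ← Complex.exp_nat_mul, oddTheta]
  rw [h8, zpow_neg, show (τ : ℂ) ^ (4 : ℤ) = (τ : ℂ) ^ 4 from zpow_natCast _ 4]
  have hexp : Complex.exp (-(2 * Real.pi * Complex.I * (4 : ℤ) * z ^ 2 / τ)) *
      Complex.exp (2 * Real.pi * Complex.I * (-1 / τ) + 8 * Real.pi * Complex.I * (z / τ)) =
      Complex.exp (2 * Real.pi * Complex.I * τ + 8 * Real.pi * Complex.I * z) *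
      Complex.exp ((8 : ℕ) * (-Real.pi * Complex.I * (z + (τ - 1) / 2) ^ 2 / τ)) := by
    rw [← Complex.exp_add, ← Complex.exp_add]
    refine exp_eq_of_sub (-2) ?_
    push_cast
    field_simp
    ring
  linear_combination ((τ : ℂ) ^ 4)⁻¹ * oddTheta (z / τ) (-1 / τ) ^ 8 * hexp

theorem differentiableAt_oddTheta {p : ℂ × ℂ} (hp : p ∈ halfSpace) :
    DifferentiableAt ℂ (fun p : ℂ × ℂ => oddTheta p.1 p.2) p := by
  have h := (hasFDerivAt_jacobiTheta₂ (p.1 + (1 + p.2) / 2) hp).differentiableAt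
  exact h.comp p (f := fun p : ℂ × ℂ => (p.1 + (1 + p.2) / 2, p.2)) (by fun_prop)

theorem differentiableOn_thetaForm :
    DifferentiableOn ℂ (fun p : ℂ × ℂ => thetaForm (p.1, ofComplex p.2)) halfSpace := by
  have h : DifferentiableOn ℂ (fun p : ℂ × ℂ => Complex.exp (2 * Real.pi * Complex.I * p.2 +
      8 * Real.pi * Complex.I * p.1) * oddTheta p.1 p.2 ^ 8) halfSpace := fun p hp => by
    have := differentiableAt_oddTheta hp
    exact DifferentiableAt.differentiableWithinAt (by fun_prop)
  refine h.congr fun p hp => ?_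
  simp only [thetaForm, coe_ofComplex hp]

/-- The imaginary part of τ enters the n-th term through exp(-π (n² + n) Im τ). As n² + n ≥ 0, the
terms are dominated by those at τ = i. -/
theorem norm_oddTheta_le (z : ℂ) {τ : ℂ} (hτ : 1 ≤ τ.im) :
    ‖oddTheta z τ‖ ≤ ∑' n : ℤ, ‖jacobiTheta₂_term n (z + (1 + Complex.I) / 2) Complex.I‖ := by
  have hs : Summable fun n : ℤ => ‖jacobiTheta₂_term n (z + (1 + Complex.I) / 2) Complex.I‖ :=
    ((summable_jacobiTheta₂_term_iff _ _).mpr (by simp)).norm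
  refine tsum_of_norm_bounded hs.hasSum fun n => ?_
  rw [norm_jacobiTheta₂_term, norm_jacobiTheta₂_term, Real.exp_le_exp]
  have h1 : (z + (1 + τ) / 2).im = z.im + τ.im / 2 := by simp
  have h2 : (z + (1 + Complex.I) / 2).im = z.im + 1 / 2 := by simp
  rw [h1, h2, Complex.I_im]
  have h3 : (0 : ℝ) ≤ n ^ 2 + n := by
    have : 0 ≤ n ^ 2 + n := by
      rcases le_or_gt 0 n with h | h
      · positivity
      · nlinarith
    exact_mod_cast this
  nlinarith [mul_nonneg (mul_nonneg Real.pi_pos.le h3) (sub_nonneg.mpr hτ)]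

theorem exists_bound_thetaForm (z : ℂ) : ∃ C : ℝ, ∀ τ : ℍ, 1 ≤ τ.im → ‖thetaForm (z, τ)‖ ≤ C := by
  refine ⟨Real.exp (8 * Real.pi * |z.im|) *
    (∑' n : ℤ, ‖jacobiTheta₂_term n (z + (1 + Complex.I) / 2) Complex.I‖) ^ 8, fun τ hτ => ?_⟩
  rw [thetaForm, norm_mul, norm_pow]
  refine mul_le_mul ?_ (pow_le_pow_left₀ (norm_nonneg _) (norm_oddTheta_le z hτ) 8) (by positivity)
    (by positivity)
  rw [Complex.norm_exp, Real.exp_le_exp]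
  have : (2 * Real.pi * Complex.I * (τ : ℂ) + 8 * Real.pi * Complex.I * z).re =
      -(2 * Real.pi * τ.im) - 8 * Real.pi * z.im := by
    simp; ring
  rw [this]
  have h1 := Real.pi_pos
  have h2 := neg_abs_le z.im
  have h3 := τ.im_pos
  nlinarith [mul_pos h1 h3]

theorem isWeakJacobiForm_thetaForm : IsWeakJacobiForm ⊤ 4 4 thetaForm :=
  IsWeakJacobiForm.of_levelOne differentiableOn_thetaForm thetaForm_S thetaForm_T
    thetaForm_elliptic fun z => by
      obtain ⟨C, hC⟩ := exists_bound_thetaForm z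
      exact ⟨C, 1, fun τ hτ => hC τ hτ.2⟩

/-- At z = -(1 + i)/2, τ = i the shift cancels and the theta constant at i remains, whose distance
from 1 is less than 1. -/
theorem exists_thetaForm_ne_zero : ∃ p, thetaForm p ≠ 0 := by
  refine ⟨(-((1 + Complex.I) / 2), UpperHalfPlane.I), mul_ne_zero (Complex.exp_ne_zero _)
    (pow_ne_zero _ ?_)⟩
  rw [oddTheta, UpperHalfPlane.coe_I, neg_add_cancel, ← jacobiTheta_eq_jacobiTheta₂]
  intro h0
  have h := norm_jacobiTheta_sub_one_le (τ := Complex.I) (by simp)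
  rw [h0, zero_sub, norm_neg, norm_one, Complex.I_im, mul_one] at h
  have hpi := Real.pi_gt_three
  have h1 : Real.pi + 1 ≤ Real.exp Real.pi := Real.add_one_le_exp _
  have h2 : Real.exp (-Real.pi) < 1 / 3 := by
    rw [Real.exp_neg, one_div]
    exact inv_strictAnti₀ (by norm_num) (by linarith)
  have h3 : 0 < 1 - Real.exp (-Real.pi) := by linarith
  rw [div_mul_eq_mul_div, le_div_iff₀ h3] at h
  linarith

end DiskPotential

end

noncomputable section

namespace DiskPotential

open Filter Topology PeriodPair

/-! ### The Jacobi form `ϑ⁸ ℘` -/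

/-- The mean value inequality between q and (0, q.2), with the derivative bounded by Cauchy's
estimate. -/
theorem eventually_norm_le_mul_fst {f : ℂ × ℂ → ℂ} {p : ℂ × ℂ} (hp : p.1 = 0)
    (hf : ∀ᶠ q in 𝓝 p, DifferentiableAt ℂ f q) (h0 : ∀ᶠ q in 𝓝 p, f (0, q.2) = 0) :
    ∃ C : ℝ, ∀ᶠ q in 𝓝 p, ‖f q‖ ≤ C * ‖q.1‖ := by
  have hbd := hf.self_of_nhds.continuousAt.norm.eventually_lt_const (lt_add_one ‖f p‖)
  obtain ⟨r, hr, hball⟩ := Metric.eventually_nhds_iff_ball.mp (hf.and (h0.and hbd))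
  refine ⟨2 * (‖f p‖ + 1) / (r / 2), ?_⟩
  filter_upwards [Metric.ball_mem_nhds p (half_pos hr)] with q hq
  have hsub : ∀ w ∈ Metric.ball p (r / 2), Metric.ball w (r / 2) ⊆ Metric.ball p r := fun w hw =>
    Metric.ball_subset_ball' (by rw [Metric.mem_ball] at hw; linarith)
  have hfd : ∀ w ∈ Metric.ball p (r / 2), ‖fderiv ℂ f w‖ ≤ 2 * (‖f p‖ + 1) / (r / 2) := fun w hw =>
    norm_fderiv_le_of_forall_mem_ball (half_pos hr)
      (fun v hv => (hball v (hsub w hw hv)).1.differentiableWithinAt)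
      fun v hv => (hball v (hsub w hw hv)).2.2.le
  have hq0 : ((0 : ℂ), q.2) ∈ Metric.ball p (r / 2) := by
    rw [Metric.mem_ball, Prod.dist_eq] at hq ⊢
    refine lt_of_le_of_lt (max_le ?_ (le_max_right _ _)) hq
    simp [hp]
  have := Convex.norm_image_sub_le_of_norm_fderiv_le (𝕜 := ℂ) (f := f) (s := Metric.ball p (r / 2))
    (fun w hw => (hball w (Metric.ball_subset_ball (by linarith) hw)).1) hfd
    (convex_ball _ _) hq0 hq
  rw [(hball q (Metric.ball_subset_ball (by linarith) hq)).2.1, sub_zero] at this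
  refine this.trans (le_of_eq ?_)
  congr 1
  rw [Prod.norm_def]
  simp

/-- The product of the theta form and `℘`. -/
def wpForm (p : ℂ × ℍ) : ℂ := thetaForm p * ℘[lat p.2] p.1

theorem weierstrassP_latticeShift (m n : ℤ) (p : ℂ × ℍ) :
    ℘[lat p.2] (latticeShift m n p).1 = ℘[lat p.2] p.1 := by
  have h : (m : ℂ) * (p.2 : ℂ) + n ∈ (lat p.2).lattice := mem_lat.mpr ⟨m, n, rfl⟩
  have := (lat p.2).weierstrassP_add_coe p.1 ⟨_, h⟩
  rw [← this, latticeShift, add_assoc]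

theorem wpForm_elliptic (m n : ℤ) (p : ℂ × ℍ) : wpForm (latticeShift m n p) =
    Complex.exp (-(2 * Real.pi * Complex.I * (4 : ℤ) * (m ^ 2 * (p.2 : ℂ) + 2 * m * p.1))) *
      wpForm p := by
  have h := weierstrassP_latticeShift m n p
  rw [wpForm, thetaForm_elliptic, wpForm, ← h, mul_assoc]
  rfl

theorem wpForm_T (z : ℂ) (τ : ℍ) : wpForm (z, ModularGroup.T • τ) = wpForm (z, τ) := by
  have h := weierstrassP_smul one_ne_zero (mem_lat_T τ) z
  rw [one_mul, one_pow, inv_one, one_mul] at h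
  simp only [wpForm, thetaForm_T, h]

theorem wpForm_S (z : ℂ) (τ : ℍ) :
    jacobiSlash 6 4 wpForm ModularGroup.S (z, τ) = wpForm (z, τ) := by
  have hτ := τ.ne_zero
  have h := weierstrassP_smul (inv_ne_zero hτ) (mem_lat_S τ) z
  have h2 := jacobiSlash_mul_fun 4 4 2 0 thetaForm (fun p => ℘[lat p.2] p.1) ModularGroup.S (z, τ)
  rw [show (6 : ℤ) = 4 + 2 by norm_num, show (4 : ℤ) = 4 + 0 by norm_num]
  refine h2.trans ?_
  rw [thetaForm_S, jacobiSlash_S, wpForm]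
  simp only [Int.cast_zero, mul_zero, zero_mul, zero_div, neg_zero, Complex.exp_zero, mul_one]
  rw [div_eq_inv_mul, h, inv_pow, inv_inv, ← mul_assoc (_ ^ _), zpow_neg,
    show (τ : ℂ) ^ (2 : ℤ) = (τ : ℂ) ^ 2 from zpow_natCast _ 2,
    inv_mul_cancel₀ (pow_ne_zero _ hτ), one_mul]

theorem weierstrassP_eq_except (L : PeriodPair) (z : ℂ) :
    ℘[L] z = L.weierstrassPExcept 0 z + 1 / z ^ 2 := by
  have := L.weierstrassPExcept_add 0 z
  simpa using this.symm

theorem exists_bound_wpForm (z : ℂ) : ∃ C B : ℝ, ∀ τ ∈ verticalStrip 1 B, ‖wpForm (z, τ)‖ ≤ C := by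
  obtain ⟨C, hC⟩ := exists_bound_thetaForm z
  obtain ⟨C', B, hC'⟩ := exists_bound_weierstrassPExcept 1 z
  refine ⟨C * (C' + ‖1 / z ^ 2‖), max 1 B, fun τ hτ => ?_⟩
  have h1 := hC τ ((le_max_left _ _).trans hτ.2)
  rw [wpForm, norm_mul]
  refine mul_le_mul h1 ?_ (norm_nonneg _) ((norm_nonneg _).trans h1)
  rw [weierstrassP_eq_except]
  exact (norm_add_le _ _).trans (by
    gcongr; exact hC' τ ⟨hτ.1, (le_max_right _ _).trans hτ.2⟩)

theorem eventually_mem_halfSpace {p : ℂ × ℂ} (hp : p ∈ halfSpace) : ∀ᶠ q in 𝓝 p, q ∈ halfSpace :=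
  isOpen_halfSpace.mem_nhds hp

theorem differentiableAt_thetaForm {p : ℂ × ℂ} (hp : p ∈ halfSpace) :
    DifferentiableAt ℂ (fun p : ℂ × ℂ => thetaForm (p.1, ofComplex p.2)) p :=
  differentiableOn_thetaForm.differentiableAt (isOpen_halfSpace.mem_nhds hp)

/-- The theta form vanishes to order at least `8` along the origin. -/
theorem exists_norm_thetaForm_le {p : ℂ × ℂ} (hp : p ∈ halfSpace) (h0 : p.1 = 0) :
    ∃ C : ℝ, ∀ᶠ q in 𝓝 p, ‖thetaForm (q.1, ofComplex q.2)‖ ≤ C * ‖q.1‖ ^ 8 := by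
  obtain ⟨C, hC⟩ := eventually_norm_le_mul_fst (f := fun p : ℂ × ℂ => oddTheta p.1 p.2) h0
    ((eventually_mem_halfSpace hp).mono fun q hq => differentiableAt_oddTheta hq)
    (Eventually.of_forall fun q => oddTheta_zero q.2)
  have hexp : ContinuousAt (fun q : ℂ × ℂ =>
      ‖Complex.exp (2 * Real.pi * Complex.I * q.2 + 8 * Real.pi * Complex.I * q.1)‖) p := by fun_prop
  obtain ⟨D, hD⟩ : ∃ D, ∀ᶠ q : ℂ × ℂ in 𝓝 p,
      ‖Complex.exp (2 * Real.pi * Complex.I * q.2 + 8 * Real.pi * Complex.I * q.1)‖ < D :=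
    ⟨_, hexp.eventually_lt_const (lt_add_one _)⟩
  refine ⟨D * C ^ 8, ?_⟩
  filter_upwards [hC, hD, eventually_mem_halfSpace hp] with q h1 h2 h3
  simp only [thetaForm, coe_ofComplex h3]
  rw [norm_mul, norm_pow, mul_assoc D, ← mul_pow]
  exact mul_le_mul h2.le (pow_le_pow_left₀ (norm_nonneg _) h1 8) (by positivity)
    ((norm_nonneg _).trans h2.le)

theorem differentiableAt_of_norm_le_sq {f : ℂ × ℂ → ℂ} {p : ℂ × ℂ} (hp : p.1 = 0) {C : ℝ}
    (h : ∀ᶠ q in 𝓝 p, ‖f q‖ ≤ C * ‖q.1‖ ^ 2) : DifferentiableAt ℂ f p := by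
  have hO : f =O[𝓝 p] fun q => ‖q - p‖ ^ 2 := by
    refine Asymptotics.IsBigO.of_bound |C| ?_
    filter_upwards [h] with q hq
    refine hq.trans ?_
    have h1 : ‖q.1‖ ≤ ‖q - p‖ := by
      have := norm_fst_le (q - p)
      rwa [Prod.fst_sub, hp, sub_zero] at this
    rw [Real.norm_of_nonneg (by positivity)]
    exact mul_le_mul (le_abs_self C) (pow_le_pow_left₀ (norm_nonneg _) h1 2) (by positivity)
      (abs_nonneg C)
  exact (hO.hasFDerivAt (by norm_num)).differentiableAt

theorem eq_latPt_of_mem {τ : ℍ} {z : ℂ} : z ∈ (lat τ).lattice ↔ ∃ i, z = latPt i τ := by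
  rw [mem_lat]
  exact ⟨fun ⟨m, n, h⟩ => ⟨![m, n], by simpa [latPt] using h⟩, fun ⟨i, h⟩ => ⟨i 0, i 1, h⟩⟩

/-- The only issue is the summand 1/z² of ℘ at z = 0. There ϑ⁸ vanishes to order at least 8, so
ϑ⁸/z² is O(z²) and is differentiable with the default value 0 on z = 0. -/
theorem differentiableAt_wpForm_of_notMem {p : ℂ × ℂ} (hp : p ∈ halfSpace)
    (hne : ∀ i : Fin 2 → ℤ, i ≠ 0 → p.1 ≠ latPt i p.2) :
    DifferentiableAt ℂ (fun p : ℂ × ℂ => wpForm (p.1, ofComplex p.2)) p := by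
  have hA := differentiableAt_thetaForm hp
  have hE := differentiableAt_weierstrassPExcept hp hne
  have heq : (fun p : ℂ × ℂ => wpForm (p.1, ofComplex p.2)) = fun p : ℂ × ℂ =>
      thetaForm (p.1, ofComplex p.2) * (lat (ofComplex p.2)).weierstrassPExcept 0 p.1 +
      thetaForm (p.1, ofComplex p.2) * (1 / p.1 ^ 2) := by
    funext q
    rw [wpForm, weierstrassP_eq_except]; ring
  rw [heq]
  refine (hA.mul hE).add ?_
  by_cases h0 : p.1 = 0
  · obtain ⟨C, hC⟩ := exists_norm_thetaForm_le hp h0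
    have hsmall : ∀ᶠ q : ℂ × ℂ in 𝓝 p, ‖q.1‖ < 1 :=
      (continuous_fst.norm.tendsto p).eventually_lt_const (by simp [h0])
    refine differentiableAt_of_norm_le_sq h0 (C := |C|) ?_
    filter_upwards [hC, hsmall] with q h1 h2
    rcases eq_or_ne q.1 0 with hq | hq
    · simp [hq]
    · rw [norm_mul, norm_div, norm_one, norm_pow, mul_one_div, div_le_iff₀ (by positivity)]
      have h3 : ‖q.1‖ ^ 8 ≤ ‖q.1‖ ^ 4 := pow_le_pow_of_le_one (norm_nonneg _) h2.le (by norm_num)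
      calc _ ≤ C * ‖q.1‖ ^ 8 := h1
        _ ≤ |C| * ‖q.1‖ ^ 4 := mul_le_mul (le_abs_self C) h3 (by positivity) (abs_nonneg C)
        _ = |C| * ‖q.1‖ ^ 2 * ‖q.1‖ ^ 2 := by ring
  · have h1 : p.1 ^ 2 ≠ 0 := pow_ne_zero 2 h0
    fun_prop (disch := exact h1)

/-- Near another lattice point iτ + j, which moves with τ, the quasi-periodicity of the form reduces
to the pole at the origin. -/
theorem differentiableAt_wpForm {p : ℂ × ℂ} (hp : p ∈ halfSpace) :
    DifferentiableAt ℂ (fun p : ℂ × ℂ => wpForm (p.1, ofComplex p.2)) p := by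
  by_cases hmem : ∃ i : Fin 2 → ℤ, p.1 = latPt i p.2
  · obtain ⟨i, hi⟩ := hmem
    have h0 : DifferentiableAt ℂ (fun p : ℂ × ℂ => wpForm (p.1, ofComplex p.2))
        (p.1 - latPt i p.2, p.2) := by
      refine differentiableAt_wpForm_of_notMem hp fun j hj h => ?_
      simp only [hi, sub_self] at h
      exact latPt_ne_zero (τ := ⟨p.2, hp⟩) hj h.symm
    have hl : DifferentiableAt ℂ (fun q : ℂ × ℂ => latPt i q.2) p :=
      (differentiable_latPt i _).comp p differentiableAt_snd
    have h1 := h0.comp p (f := fun q : ℂ × ℂ => (q.1 - latPt i q.2, q.2)) (by fun_prop)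
    have h2 : DifferentiableAt ℂ (fun q : ℂ × ℂ => Complex.exp (-(2 * Real.pi * Complex.I * (4 : ℤ) *
        ((i 0) ^ 2 * q.2 + 2 * (i 0) * (q.1 - latPt i q.2))))) p := by fun_prop
    refine (h2.mul h1).congr_of_eventuallyEq ?_
    filter_upwards [eventually_mem_halfSpace hp] with q hq
    have := wpForm_elliptic (i 0) (i 1) (q.1 - latPt i q.2, ofComplex q.2)
    rw [coe_ofComplex hq] at this
    simp only [Function.comp, Pi.mul_apply]
    rw [← this]
    congr 1
    simp [latticeShift, latPt, coe_ofComplex hq]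
    ring
  · push Not at hmem
    exact differentiableAt_wpForm_of_notMem hp fun i _ => hmem i

theorem isWeakJacobiForm_wpForm : IsWeakJacobiForm ⊤ 6 4 wpForm :=
  IsWeakJacobiForm.of_levelOne (fun _ hp => (differentiableAt_wpForm hp).differentiableWithinAt)
    wpForm_S wpForm_T wpForm_elliptic exists_bound_wpForm

end DiskPotential

end

/-! ### Functions algebraic over the Jacobi forms of level one -/

noncomputable section

namespace DiskPotential

open Filter Topology

/-! ### Holomorphic functions on `ℂ × ℍ` -/

theorem mk_mem_halfSpace (p : ℂ × ℍ) : ((p.1, (p.2 : ℂ)) : ℂ × ℂ) ∈ halfSpace := p.2.im_pos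

theorem continuousOn_toProd : ContinuousOn (fun p : ℂ × ℂ => ((p.1, ofComplex p.2) : ℂ × ℍ)) halfSpace := by
  intro p hp
  have h1 : ContinuousAt (fun τ : ℂ => (ofComplex τ : ℍ)) p.2 := (contMDiffAt_ofComplex (n := 0) hp).continuousAt
  exact (continuousAt_fst.prodMk (h1.comp continuousAt_snd)).continuousWithinAt

theorem continuous_ofProd : Continuous fun p : ℂ × ℍ => ((p.1, (p.2 : ℂ)) : ℂ × ℂ) := by fun_prop

theorem IsHolomorphicOn.continuousOn {Φ : ℂ × ℍ → ℂ} {V : Set (ℂ × ℍ)} (h : IsHolomorphicOn Φ V) :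
    ContinuousOn Φ V := by
  have h1 := DifferentiableOn.continuousOn h
  have := h1.comp (t := {p : ℂ × ℂ | 0 < p.2.im ∧ (p.1, ofComplex p.2) ∈ V}) (s := V)
    (f := fun p : ℂ × ℍ => ((p.1, (p.2 : ℂ)) : ℂ × ℂ)) continuous_ofProd.continuousOn
    fun p hp => ⟨p.2.im_pos, by simpa using hp⟩
  refine this.congr fun p _ => ?_
  simp

theorem IsHolomorphicOn.mono {Φ : ℂ × ℍ → ℂ} {V V' : Set (ℂ × ℍ)} (h : IsHolomorphicOn Φ V)
    (hV : V' ⊆ V) : IsHolomorphicOn Φ V' :=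
  DifferentiableOn.mono h fun _ hq => ⟨hq.1, hV hq.2⟩

theorem IsHolomorphicOn.div {Φ Ψ : ℂ × ℍ → ℂ} {V : Set (ℂ × ℍ)} (h : IsHolomorphicOn Φ V)
    (h' : IsHolomorphicOn Ψ V) (h0 : ∀ p ∈ V, Ψ p ≠ 0) : IsHolomorphicOn (fun p => Φ p / Ψ p) V := by
  intro p hp
  have h1 : DifferentiableWithinAt ℂ (fun p : ℂ × ℂ => Φ (p.1, ofComplex p.2)) _ p := h p hp
  have h2 : DifferentiableWithinAt ℂ (fun p : ℂ × ℂ => Ψ (p.1, ofComplex p.2)) _ p := h' p hp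
  have h3 : Ψ (p.1, ofComplex p.2) ≠ 0 := h0 _ hp.2
  simp only [div_eq_mul_inv]
  exact h1.mul (h2.fun_inv h3)

theorem isOpen_lift {V : Set (ℂ × ℍ)} (hV : IsOpen V) :
    IsOpen {p : ℂ × ℂ | 0 < p.2.im ∧ (p.1, ofComplex p.2) ∈ V} :=
  continuousOn_toProd.isOpen_inter_preimage isOpen_halfSpace hV

theorem frequently_lift {P : ℂ × ℍ → Prop} {p : ℂ × ℂ} (hp : p ∈ halfSpace)
    (h : ∃ᶠ q in 𝓝 ((p.1, ofComplex p.2) : ℂ × ℍ), P q) : ∃ᶠ q in 𝓝 p, P (q.1, ofComplex q.2) := by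
  have hc := continuous_ofProd.tendsto ((p.1, ofComplex p.2) : ℂ × ℍ)
  simp only [coe_ofComplex hp] at hc
  refine hc.frequently (h.mono fun q hq => ?_)
  simpa using hq

theorem eventually_lift {P : ℂ × ℍ → Prop} {p : ℂ × ℂ} (hp : p ∈ halfSpace)
    (h : ∀ᶠ q in 𝓝 ((p.1, ofComplex p.2) : ℂ × ℍ), P q) : ∀ᶠ q in 𝓝 p, P (q.1, ofComplex q.2) :=
  (continuousOn_toProd.continuousAt (isOpen_halfSpace.mem_nhds hp)).eventually h

/-- Riemann's extension theorem on `ℂ × ℍ`. -/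
theorem exists_holomorphic_extension {N : ℂ × ℍ → ℂ}
    (hloc : ∀ p : ℂ × ℍ, ∃ (V : Set (ℂ × ℍ)) (g : ℂ × ℍ → ℂ), IsOpen V ∧ p ∈ V ∧
      IsHolomorphicOn g V ∧ V ⊆ closure {w ∈ V | g w ≠ 0} ∧
      IsHolomorphicOn N {w ∈ V | g w ≠ 0} ∧
      ∀ q ∈ V, ∃ C, ∀ᶠ w in 𝓝 q, g w ≠ 0 → ‖N w‖ ≤ C) :
    ∃ M, IsHolomorphicOn M Set.univ ∧ ∃ O, IsOpen O ∧ Dense O ∧ ∀ w ∈ O, M w = N w := by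
  obtain ⟨M, hM, hMN⟩ := exists_extension (Ω := halfSpace)
    (N := fun p : ℂ × ℂ => N (p.1, ofComplex p.2)) (fun p hp => by
      obtain ⟨V, g, hV, hpV, hg, hcl, hN, hb⟩ := hloc (p.1, ofComplex p.2)
      have hgc := hg.continuousOn
      have hVg : IsOpen {w ∈ V | g w ≠ 0} := hgc.isOpen_inter_preimage hV isOpen_ne
      refine ⟨_, fun p => g (p.1, ofComplex p.2), isOpen_lift hV, ⟨hp, hpV⟩, hg, ?_, ?_, ?_⟩
      · rintro q ⟨hq1, hq2⟩
        refine frequently_lift hq1 (P := fun q => g q ≠ 0) ?_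
        exact (mem_closure_iff_frequently.mp (hcl hq2)).mono fun w hw => hw.2
      · rintro q ⟨hq1, hq2⟩ hq3
        exact DifferentiableOn.differentiableAt hN ((isOpen_lift hVg).mem_nhds ⟨hq1, hq2, hq3⟩)
      · rintro q ⟨hq1, hq2⟩
        obtain ⟨C, hC⟩ := hb _ hq2
        exact ⟨C, eventually_lift hq1 hC⟩) isOpen_halfSpace
  refine ⟨fun p => M (p.1, p.2), isHolomorphicOn_univ.mpr (hM.congr fun p hp => ?_),
    interior {w | M (w.1, w.2) = N w}, isOpen_interior, ?_, fun w hw =>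
      interior_subset (s := {w | M (w.1, w.2) = N w}) hw⟩
  · simp [coe_ofComplex hp]
  · intro p
    rw [mem_closure_iff_frequently]
    have h1 := hMN _ (mk_mem_halfSpace p)
    have h2 := ((continuousOn_toProd.continuousAt
      (isOpen_halfSpace.mem_nhds (mk_mem_halfSpace p))).tendsto.frequently
      (p := fun q => q ∈ interior {w | M (w.1, w.2) = N w}) ?_)
    · simpa using h2
    · refine (h1.and_eventually (eventually_mem_halfSpace (mk_mem_halfSpace p))).mono
        fun q ⟨hq1, hq2⟩ => ?_
      rw [mem_interior_iff_mem_nhds]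
      have hc := continuous_ofProd.tendsto ((q.1, ofComplex q.2) : ℂ × ℍ)
      simp only [coe_ofComplex hq2] at hc
      filter_upwards [hc.eventually hq1] with w hw
      simpa using hw

instance : Nontrivial ℍ := ⟨UpperHalfPlane.I, rhoPt, fun h => by
  have := congrArg UpperHalfPlane.re h
  norm_num [rhoPt, UpperHalfPlane.re] at this⟩

instance (τ : ℍ) : (𝓝[≠] τ).NeBot :=
  ConnectedSpace.neBot_nhdsWithin_compl_of_nontrivial_of_t1space τ

/-- A property which holds for all `u` off a discrete set, for all `τ` off a discrete set, holds on
a dense set. -/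
theorem dense_of_eventually {P : ℂ × ℍ → Prop}
    (h : ∀ᶠ τ in codiscrete ℍ, ∀ᶠ u in codiscrete ℂ, P (u, τ)) : Dense {p | P p} := by
  rintro ⟨u, τ⟩
  rw [mem_closure_iff_nhds]
  intro t ht
  rw [nhds_prod_eq, mem_prod_iff] at ht
  obtain ⟨A, hA, B, hB, hAB⟩ := ht
  have h1 : ∀ᶠ y in 𝓝[≠] τ, y ∈ B := nhdsWithin_le_nhds hB
  obtain ⟨τ', hτ', hB'⟩ := ((eventually_codiscrete_iff.mp h τ).and h1).exists
  obtain ⟨u', hu', hP⟩ := frequently_codiscrete_of_mem_nhds hτ' u hA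
  exact ⟨(u', τ'), hAB ⟨hu', hB'⟩, hP⟩

theorem eq_of_dense {F G : ℂ × ℍ → ℂ} (hF : Continuous F) (hG : Continuous G)
    (h : Dense {p | F p = G p}) : F = G :=
  hF.ext_on h hG fun _ hp => hp

theorem dense_holomorphic_ne_zero {Φ : ℂ × ℍ → ℂ} (h : IsHolomorphicOn Φ Set.univ)
    (hne : ∃ p, Φ p ≠ 0) : Dense {p | Φ p ≠ 0} := by
  obtain ⟨p₀, hp₀⟩ := hne
  intro p
  rw [mem_closure_iff_frequently]
  have h1 := dense_ne_zero (isHolomorphicOn_univ.mp h) (mk_mem_halfSpace p₀) (by simpa using hp₀)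
    (mk_mem_halfSpace p)
  have h2 := (continuousOn_toProd.continuousAt
    (isOpen_halfSpace.mem_nhds (mk_mem_halfSpace p))).tendsto.frequently
    (p := fun q => Φ q ≠ 0) h1
  simpa using h2

/-! ### The slash action on holomorphic functions -/

/-- The automorphy factor of the slash action. -/
def jacobiFactor (k l : ℤ) (γ : SL(2, ℤ)) (p : ℂ × ℍ) : ℂ :=
  autFactor γ p.2 ^ (-k) *
    Complex.exp (-(2 * Real.pi * Complex.I * l * ((γ 1 0 : ℤ) : ℂ) * p.1 ^ 2 / autFactor γ p.2))

theorem isHolomorphicOn_jacobiSlash {k l : ℤ} {Φ : ℂ × ℍ → ℂ} (h : IsHolomorphicOn Φ Set.univ)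
    (γ : SL(2, ℤ)) : IsHolomorphicOn (jacobiSlash k l Φ γ) Set.univ := by
  rw [isHolomorphicOn_univ] at *
  intro p hp
  have haut : ∀ q ∈ halfSpace, autFactor γ (ofComplex q.2) =
      ((γ 1 0 : ℤ) : ℂ) * q.2 + ((γ 1 1 : ℤ) : ℂ) := fun q hq => by
    rw [autFactor, coe_ofComplex hq]
  have hne : ((γ 1 0 : ℤ) : ℂ) * p.2 + ((γ 1 1 : ℤ) : ℂ) ≠ 0 := by
    rw [← haut p hp]; exact autFactor_ne_zero _ _
  have hcoe : ∀ q ∈ halfSpace, ((γ • (ofComplex q.2 : ℍ) : ℍ) : ℂ) =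
      (((γ 0 0 : ℤ) : ℂ) * q.2 + ((γ 0 1 : ℤ) : ℂ)) / (((γ 1 0 : ℤ) : ℂ) * q.2 + ((γ 1 1 : ℤ) : ℂ)) :=
    fun q hq => by rw [coe_smul_eq, haut q hq, coe_ofComplex hq]
  have h1 : DifferentiableAt ℂ (fun q : ℂ × ℂ => (((γ 1 0 : ℤ) : ℂ) * q.2 + ((γ 1 1 : ℤ) : ℂ)) ^ (-k) *
      Complex.exp (-(2 * Real.pi * Complex.I * l * ((γ 1 0 : ℤ) : ℂ) * q.1 ^ 2 /
        (((γ 1 0 : ℤ) : ℂ) * q.2 + ((γ 1 1 : ℤ) : ℂ))))) p := by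
    refine DifferentiableAt.mul (DifferentiableAt.zpow (by fun_prop) (Or.inl hne)) ?_
    fun_prop (disch := exact hne)
  set m : ℂ × ℂ → ℂ × ℂ := fun q => (q.1 / (((γ 1 0 : ℤ) : ℂ) * q.2 + ((γ 1 1 : ℤ) : ℂ)),
    (((γ 0 0 : ℤ) : ℂ) * q.2 + ((γ 0 1 : ℤ) : ℂ)) / (((γ 1 0 : ℤ) : ℂ) * q.2 + ((γ 1 1 : ℤ) : ℂ))) with hm
  have hmd : DifferentiableAt ℂ m p := by
    refine DifferentiableAt.prodMk ?_ ?_ <;> fun_prop (disch := exact hne)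
  have hmem : m p ∈ halfSpace := by
    change 0 < (m p).2.im
    simp only [hm]
    rw [← hcoe p hp]
    exact (γ • (ofComplex p.2 : ℍ)).im_pos
  have h2 := (h.differentiableAt (isOpen_halfSpace.mem_nhds hmem)).comp p hmd
  refine ((h1.mul h2).congr_of_eventuallyEq ?_).differentiableWithinAt
  filter_upwards [eventually_mem_halfSpace hp] with q hq
  simp only [jacobiSlash, Pi.mul_apply, Function.comp, hm, haut q hq, ← hcoe q hq, ofComplex_apply]

theorem jacobiSlash_apply (k l : ℤ) (Φ : ℂ × ℍ → ℂ) (γ : SL(2, ℤ)) (p : ℂ × ℍ) :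
    jacobiSlash k l Φ γ p = jacobiFactor k l γ p * Φ (p.1 / autFactor γ p.2, γ • p.2) := rfl

/-! ### Finite monodromy -/

/-- Cauchy's bound. It gives both the local boundedness needed for Riemann's theorem and the
behaviour at the cusps. -/
theorem norm_le_of_monic_root {n : ℕ} {c : ℕ → ℂ} {z : ℂ}
    (h : z ^ (n + 1) + ∑ i ∈ Finset.range (n + 1), c i * z ^ i = 0) :
    ‖z‖ ≤ 1 + ∑ i ∈ Finset.range (n + 1), ‖c i‖ := by
  by_contra! hcon
  set S := ∑ i ∈ Finset.range (n + 1), ‖c i‖ with hS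
  have hS0 : 0 ≤ S := Finset.sum_nonneg fun i _ => norm_nonneg _
  have h1 : 1 ≤ ‖z‖ := by linarith
  have h2 : ‖z‖ ^ (n + 1) ≤ S * ‖z‖ ^ n := by
    rw [← norm_pow, eq_neg_of_add_eq_zero_left h, norm_neg, hS, Finset.sum_mul]
    refine (norm_sum_le _ _).trans (Finset.sum_le_sum fun i hi => ?_)
    rw [norm_mul, norm_pow]
    have hin := Nat.lt_succ_iff.mp (Finset.mem_range.mp hi)
    gcongr
  rw [pow_succ'] at h2
  have h3 := le_of_mul_le_mul_right h2 (by positivity)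
  linarith

/-- The monic equation satisfied by `h (n + 1) * x` when `∑ i ≤ n + 1, h i * x ^ i = 0`. -/
def monicForm (n : ℕ) (h : ℕ → ℂ) (z : ℂ) : ℂ :=
  z ^ (n + 1) + ∑ i ∈ Finset.range (n + 1), h i * h (n + 1) ^ (n - i) * z ^ i

/-- The equation is homogeneous when z and all H_i scale by the same automorphy factor, so the slash
action permutes its solutions. -/
theorem monicForm_mul (n : ℕ) (h : ℕ → ℂ) (J z : ℂ) :
    monicForm n (fun i => J * h i) (J * z) = J ^ (n + 1) * monicForm n h z := by
  rw [monicForm, monicForm, mul_add, Finset.mul_sum, mul_pow]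
  congr 1
  refine Finset.sum_congr rfl fun i hi => ?_
  obtain ⟨j, hj⟩ := Nat.exists_eq_add_of_le (Nat.lt_succ_iff.mp (Finset.mem_range.mp hi))
  rw [show n - i = j by omega, mul_pow, mul_pow, hj]
  ring

theorem monicForm_eq (n : ℕ) (h : ℕ → ℂ) (x : ℂ) :
    monicForm n h (h (n + 1) * x) = h (n + 1) ^ n * ∑ i ∈ Finset.range (n + 2), h i * x ^ i := by
  rw [monicForm, Finset.sum_range_succ _ (n + 1), mul_add, Finset.mul_sum, add_comm, mul_pow]
  congr 1
  · refine Finset.sum_congr rfl fun i hi => ?_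
    obtain ⟨j, hj⟩ := Nat.exists_eq_add_of_le (Nat.lt_succ_iff.mp (Finset.mem_range.mp hi))
    rw [show n - i = j by omega, mul_pow, hj]
    ring
  · ring

/-- The ring of holomorphic functions on `ℂ × ℍ`. -/
def holoRing : Subring (ℂ × ℍ → ℂ) where
  carrier := {Φ | IsHolomorphicOn Φ Set.univ}
  mul_mem' h h' := DifferentiableOn.mul h h'
  one_mem' := differentiableOn_const 1
  add_mem' h h' := DifferentiableOn.add h h'
  zero_mem' := differentiableOn_const 0
  neg_mem' h := DifferentiableOn.neg h

instance : NoZeroDivisors holoRing where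
  eq_zero_or_eq_zero_of_mul_eq_zero := by
    rintro ⟨f, hf⟩ ⟨g, hg⟩ h
    have h' : ∀ p, f p * g p = 0 := fun p => congrFun (congrArg Subtype.val h) p
    have := eq_of_mul_eq_zero (isHolomorphicOn_univ.mp hf) (isHolomorphicOn_univ.mp hg)
      fun p _ => h' _
    refine this.imp (fun h => Subtype.ext (funext fun p => ?_))
      (fun h => Subtype.ext (funext fun p => ?_)) <;>
    simpa using h _ (mk_mem_halfSpace p)

instance : IsDomain holoRing := NoZeroDivisors.to_isDomain _

/-- A monic polynomial over the integral domain `holoRing` has finitely many roots. -/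
theorem finite_holomorphic_roots (n : ℕ) {c : ℕ → ℂ × ℍ → ℂ} (hc : ∀ i, c i ∈ holoRing) :
    {M : ℂ × ℍ → ℂ | IsHolomorphicOn M Set.univ ∧
      ∀ p, M p ^ (n + 1) + ∑ i ∈ Finset.range (n + 1), c i p * M p ^ i = 0}.Finite := by
  classical
  set Q : Polynomial holoRing := Polynomial.X ^ (n + 1) +
    ∑ i ∈ Finset.range (n + 1), Polynomial.C ⟨c i, hc i⟩ * Polynomial.X ^ i with hQ
  have hQ0 : Q.Monic := by
    refine Polynomial.monic_X_pow_add ?_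
    refine (Polynomial.degree_sum_le _ _).trans_lt ?_
    rw [Finset.sup_lt_iff (WithBot.bot_lt_coe _)]
    intro i hi
    refine (Polynomial.degree_C_mul_X_pow_le _ _).trans_lt ?_
    exact_mod_cast Finset.mem_range.mp hi
  refine ((Q.roots.toFinset.finite_toSet).image Subtype.val).subset ?_
  rintro M ⟨hM, hroot⟩
  refine ⟨⟨M, hM⟩, ?_, rfl⟩
  simp only [Finset.mem_coe, Multiset.mem_toFinset, Polynomial.mem_roots hQ0.ne_zero,
    Polynomial.IsRoot.def]
  refine Subtype.ext (funext fun p => ?_)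
  have := hroot p
  simpa [hQ, Polynomial.eval_finsetSum] using this

variable {k l : ℤ} {n : ℕ} {H : ℕ → ℂ × ℍ → ℂ}

/-- The holomorphic solutions of the monic equation with coefficients `H i`. -/
def monicRoots (n : ℕ) (H : ℕ → ℂ × ℍ → ℂ) : Set (ℂ × ℍ → ℂ) :=
  {M | IsHolomorphicOn M Set.univ ∧ ∀ p, monicForm n (fun i => H i p) (M p) = 0}

theorem finite_monicRoots (hH : ∀ i, IsWeakJacobiForm ⊤ k l (H i)) : (monicRoots n H).Finite := by
  refine finite_holomorphic_roots n (c := fun i => H i * H (n + 1) ^ (n - i)) fun i => ?_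
  exact mul_mem (hH i).holo (pow_mem (hH (n + 1)).holo _)

theorem jacobiSlash_mem_monicRoots (hH : ∀ i, IsWeakJacobiForm ⊤ k l (H i)) {M : ℂ × ℍ → ℂ}
    (hM : M ∈ monicRoots n H) (γ : SL(2, ℤ)) : jacobiSlash k l M γ ∈ monicRoots n H := by
  refine ⟨isHolomorphicOn_jacobiSlash hM.1 γ, fun p => ?_⟩
  have h1 : (fun i => H i p) = fun i => jacobiFactor k l γ p * H i (p.1 / autFactor γ p.2, γ • p.2) :=
    funext fun i => ((hH i).modular γ (Subgroup.mem_top γ) p).symm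
  rw [h1, jacobiSlash_apply, monicForm_mul, hM.2, mul_zero]

/-- The subgroup of `SL₂(ℤ)` fixing every holomorphic solution of the monic equation. -/
def monodromyKernel (_ : ∀ i, IsWeakJacobiForm ⊤ k l (H i)) (n : ℕ) : Subgroup SL(2, ℤ) where
  carrier := {γ | ∀ M ∈ monicRoots n H, jacobiSlash k l M γ = M}
  mul_mem' := fun {a b} ha hb M hM => by rw [jacobiSlash_mul, ha M hM, hb M hM]
  one_mem' := fun M _ => jacobiSlash_one k l M
  inv_mem' := fun {a} ha M hM => by
    conv_lhs => rw [← ha M hM]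
    rw [← jacobiSlash_mul, mul_inv_cancel, jacobiSlash_one]

theorem finiteIndex_monodromyKernel (hH : ∀ i, IsWeakJacobiForm ⊤ k l (H i)) :
    (monodromyKernel hH n).FiniteIndex := by
  have : Finite (monicRoots n H) := (finite_monicRoots hH).to_subtype
  -- The slash operation acts from the right, hence the inverse. The kernel of this action on a
  -- finite set has finite index and fixes every root.
  let act : MulAction SL(2, ℤ) (monicRoots n H) :=
    { smul := fun γ M => ⟨jacobiSlash k l M γ⁻¹, jacobiSlash_mem_monicRoots hH M.2 _⟩
      one_smul := fun M => Subtype.ext (by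
        change jacobiSlash k l M 1⁻¹ = M
        rw [inv_one, jacobiSlash_one])
      mul_smul := fun γ γ' M => Subtype.ext (by
        change jacobiSlash k l M (γ * γ')⁻¹ = jacobiSlash k l (jacobiSlash k l M γ'⁻¹) γ⁻¹
        rw [mul_inv_rev, jacobiSlash_mul]) }
  have h1 : (MulAction.toPermHom SL(2, ℤ) (monicRoots n H)).ker.FiniteIndex :=
    Subgroup.finiteIndex_ker _
  refine Subgroup.finiteIndex_of_le (H := (MulAction.toPermHom SL(2, ℤ) (monicRoots n H)).ker) ?_
  intro γ hγ
  have hγ' := inv_mem hγ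
  intro M hM
  have h2 := Equiv.ext_iff.mp (MonoidHom.mem_ker.mp hγ') ⟨M, hM⟩
  have h3 : jacobiSlash k l M γ⁻¹⁻¹ = M := congrArg Subtype.val h2
  rwa [inv_inv] at h3

theorem isBoundedAtImInfty_of_mem_monicRoots (hH : ∀ i, IsWeakJacobiForm ⊤ k l (H i))
    {M : ℂ × ℍ → ℂ} (hM : M ∈ monicRoots n H) (z : ℂ) :
    IsBoundedAtImInfty fun τ => M (z, τ) := by
  have hb : ∀ i, IsBoundedAtImInfty fun τ => H i (z, τ) * H (n + 1) (z, τ) ^ (n - i) := fun i => by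
    have := ((hH i).mul ((hH (n + 1)).pow (n - i))).cusps 1 z
    simpa only [jacobiSlash_one] using this
  choose C A hCA using fun i => isBoundedAtImInfty_iff.mp (hb i)
  rw [isBoundedAtImInfty_iff]
  refine ⟨1 + ∑ i ∈ Finset.range (n + 1), C i, ∑ i ∈ Finset.range (n + 1), |A i|, fun τ hτ => ?_⟩
  refine (norm_le_of_monic_root (hM.2 (z, τ))).trans ?_
  gcongr with i hi
  refine hCA i τ (le_trans ?_ hτ)
  exact (le_abs_self _).trans (Finset.single_le_sum (f := fun i => |A i|)
    (fun j _ => abs_nonneg _) hi)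

theorem continuousOn_monicForm {M : ℂ × ℍ → ℂ} {V : Set (ℂ × ℍ)}
    (hH : ∀ i, IsWeakJacobiForm ⊤ k l (H i)) (hM : ContinuousOn M V) :
    ContinuousOn (fun p => monicForm n (fun i => H i p) (M p)) V := by
  have h : ∀ i, ContinuousOn (H i) V := fun i => (hH i).holo.continuousOn.mono (Set.subset_univ V)
  unfold monicForm
  exact (hM.pow _).add (continuousOn_finsetSum _ fun i _ =>
    ((h i).mul ((h (n + 1)).pow _)).mul (hM.pow _))

/-- H_{n+1} x satisfies a monic equation, so it is locally bounded and extends to a holomorphic M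
with the same equation. Membership in `monicRoots` gives invariance under the kernel. Since every
slash of M is again a root, it also gives boundedness at all cusps. Quasi-periodicity passes from
H_{n+1} and the periodicity of x to M by density. -/
theorem isMeromorphicJacobiForm_of_algebraic (hH : ∀ i, IsWeakJacobiForm ⊤ k l (H i))
    (hne : ∃ p, H (n + 1) p ≠ 0) {x : ℂ × ℍ → ℂ} (hx : IsMeromorphic x)
    (hell : ∀ᶠ τ in codiscrete ℍ, ∀ (a b : ℤ) (u : ℂ), x (latticeShift a b (u, τ)) = x (u, τ))
    (heq : ∀ᶠ τ in codiscrete ℍ, ∀ᶠ u in codiscrete ℂ,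
      ∑ i ∈ Finset.range (n + 2), H i (u, τ) * x (u, τ) ^ i = 0) :
    IsMeromorphicJacobiForm (monodromyKernel hH n) 0 0 x := by
  have hdense : Dense {p : ℂ × ℍ | ∑ i ∈ Finset.range (n + 2), H i p * x p ^ i = 0} :=
    dense_of_eventually heq
  have hroot : ∀ p, ∑ i ∈ Finset.range (n + 2), H i p * x p ^ i = 0 →
      monicForm n (fun i => H i p) (H (n + 1) p * x p) = 0 := fun p hp => by
    have := monicForm_eq n (fun i => H i p) (x p)
    rw [hp, mul_zero] at this
    exact this
  obtain ⟨M, hM, O, hO, hOd, hMN⟩ := exists_holomorphic_extension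
    (N := fun p => H (n + 1) p * x p) fun p => by
      obtain ⟨V, f, g, hV, hpV, hf, hg, hcl, hxfg⟩ := hx p
      have hVg : IsOpen {w ∈ V | g w ≠ 0} := hg.continuousOn.isOpen_inter_preimage hV isOpen_ne
      have hhol : IsHolomorphicOn (fun p => H (n + 1) p * x p) {w ∈ V | g w ≠ 0} := by
        have h1 : IsHolomorphicOn (fun p => H (n + 1) p * (f p / g p)) {w ∈ V | g w ≠ 0} := by
          have hsub : {w ∈ V | g w ≠ 0} ⊆ V := fun w hw => hw.1
          exact DifferentiableOn.mul ((hH (n + 1)).holo.mono fun q _ => trivial)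
            ((hf.mono hsub).div (hg.mono hsub) fun q hq => hq.2)
        refine h1.congr fun q hq => ?_
        exact congrArg _ (hxfg _ hq.2.1 hq.2.2)
      have hzero : ∀ w ∈ {w ∈ V | g w ≠ 0},
          monicForm n (fun i => H i w) (H (n + 1) w * x w) = 0 := by
        intro w hw
        have hc := (continuousOn_monicForm (n := n) hH hhol.continuousOn).continuousAt
          (hVg.mem_nhds hw)
        refine eq_of_frequently_eq (F := fun w => monicForm n (fun i => H i w) (H (n + 1) w * x w))
          (G := fun _ => 0) hc continuousAt_const ?_
        exact (mem_closure_iff_frequently.mp (hdense w)).mono fun v hv => hroot v hv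
      refine ⟨V, g, hV, hpV, hg, hcl, hhol, fun q hq => ?_⟩
      have hcont : Continuous fun w => 1 + ∑ i ∈ Finset.range (n + 1),
          ‖H i w * H (n + 1) w ^ (n - i)‖ := by
        have h : ∀ i, Continuous (H i) := fun i => continuousOn_univ.mp (hH i).holo.continuousOn
        fun_prop
      have hqV : ∀ᶠ w in 𝓝 q, w ∈ V := hV.mem_nhds hq
      refine ⟨1 + ∑ i ∈ Finset.range (n + 1), ‖H i q * H (n + 1) q ^ (n - i)‖ + 1,
        (((hcont.tendsto q).eventually_lt_const (lt_add_one _)).and hqV).mono fun w hw hgw => ?_⟩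
      exact (norm_le_of_monic_root (hzero w ⟨hw.2, hgw⟩)).trans hw.1.le
  have hMc : Continuous M := continuousOn_univ.mp hM.continuousOn
  have hMR : M ∈ monicRoots n H := by
    refine ⟨hM, fun p => ?_⟩
    refine congrFun (eq_of_dense (G := fun _ => (0 : ℂ))
      (continuousOn_univ.mp (continuousOn_monicForm hH hM.continuousOn)) continuous_const
      ((hOd.inter_of_isOpen_left hdense hO).mono ?_)) p
    rintro q ⟨hq1, hq2⟩
    change monicForm n (fun i => H i q) (M q) = 0
    rw [hMN q hq1]
    exact hroot q hq2
  have hMell : ∀ (a b : ℤ) (p : ℂ × ℍ), M (latticeShift a b p) =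
      Complex.exp (-(2 * Real.pi * Complex.I * l * (a ^ 2 * (p.2 : ℂ) + 2 * a * p.1))) * M p := by
    intro a b p
    have hsc : Continuous (latticeShift a b) := by unfold latticeShift; fun_prop
    have hso : IsOpenMap (latticeShift a b) := by
      have hinv : ∀ q, latticeShift a b (latticeShift (-a) (-b) q) = q := fun q => by
        simp [latticeShift, add_assoc]
      have hinv' : ∀ q, latticeShift (-a) (-b) (latticeShift a b q) = q := fun q => by
        refine Prod.ext ?_ rfl
        simp only [latticeShift]
        push_cast
        ring
      exact (Homeomorph.mk ⟨latticeShift a b, latticeShift (-a) (-b), hinv', hinv⟩ hsc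
        (by unfold latticeShift; fun_prop)).isOpenMap
    refine congrFun (eq_of_dense (F := fun p => M (latticeShift a b p)) (G := fun p : ℂ × ℍ =>
      Complex.exp (-(2 * Real.pi * Complex.I * l * (a ^ 2 * (p.2 : ℂ) + 2 * a * p.1))) * M p)
      (hMc.comp hsc) (by fun_prop)
      (((hOd.inter_of_isOpen_left (hOd.preimage hso) hO).inter_of_isOpen_left
        (dense_of_eventually (P := fun p => x (latticeShift a b p) = x p)
          (hell.mono fun τ h => Eventually.of_forall fun u => h a b u))
        (hO.inter (hO.preimage hsc))).mono ?_)) p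
    rintro q ⟨⟨hq1, hq2⟩, hq3⟩
    change M (latticeShift a b q) = _ * M q
    rw [hMN q hq1, hMN _ hq2, hq3, (hH (n + 1)).elliptic, mul_assoc]
  have hD : IsOpen {p | H (n + 1) p ≠ 0} :=
    isOpen_ne.preimage (continuousOn_univ.mp (hH (n + 1)).holo.continuousOn)
  refine ⟨k, l, M, H (n + 1), ?_, (hH (n + 1)).mono le_top, O ∩ {p | H (n + 1) p ≠ 0},
    hO.inter hD, hOd.inter_of_isOpen_left ?_ hO, fun p hp => ⟨hp.2, ?_⟩⟩
  · rw [zero_add, zero_add]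
    exact ⟨hM, fun γ hγ p => congrFun (hγ M hMR) p, hMell, fun γ z =>
      isBoundedAtImInfty_of_mem_monicRoots hH (jacobiSlash_mem_monicRoots hH hMR γ) z⟩
  · exact dense_holomorphic_ne_zero (hH (n + 1)).holo hne
  · rw [hMN p hp.1, mul_div_cancel_left₀ _ hp.2]

end DiskPotential

end

/-! ### One algebraic equation for all fibres of a subfamily -/

noncomputable section

namespace DiskPotential

open Filter Topology Polynomial

/-! ### Algebraic elements -/

section Algebraic

variable {R B L : Type} [CommRing R] [IsDomain R] [CommRing B] [Field L]

/-- The elements of `L` which are algebraic over `R`, as a subfield. -/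
def algClosure (φ : R →+* L) : Subfield L :=
  letI := φ.toAlgebra
  { Subalgebra.algebraicClosure R L with
    inv_mem' := fun _ hz => IsAlgebraic.inv_iff.mpr hz
    neg_mem' := fun hz => IsAlgebraic.neg hz }

/-- F is required to be nonzero before its coefficients are mapped to L. If φ is not injective,
every element of L therefore counts as algebraic, which covers degenerate specializations without a
separate case. -/
theorem mem_algClosure {φ : R →+* L} {z : L} :
    z ∈ algClosure φ ↔ ∃ F : R[X], F ≠ 0 ∧ F.eval₂ φ z = 0 := Iff.rfl

theorem map_mem_algClosure (φ : R →+* L) (r : R) : φ r ∈ algClosure φ :=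
  mem_algClosure.mpr ⟨X - C r, X_sub_C_ne_zero r, by simp⟩

/-- The only algebraic extensions needed: ξ is a root of a quartic, and y is a root of a quadratic,
padded to degree four. -/
theorem mem_algClosure_of_quartic {φ : R →+* L} {a₃ a₂ a₁ a₀ z : L} (h₃ : a₃ ∈ algClosure φ)
    (h₂ : a₂ ∈ algClosure φ) (h₁ : a₁ ∈ algClosure φ) (h₀ : a₀ ∈ algClosure φ)
    (h : z ^ 4 + a₃ * z ^ 3 + a₂ * z ^ 2 + a₁ * z + a₀ = 0) : z ∈ algClosure φ := by
  let := φ.toAlgebra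
  set S := Subalgebra.algebraicClosure R L
  have hint : IsIntegral S z := by
    refine ⟨X ^ 4 + (C (⟨a₃, h₃⟩ : S) * X ^ 3 + C (⟨a₂, h₂⟩ : S) * X ^ 2 + C (⟨a₁, h₁⟩ : S) * X +
      C (⟨a₀, h₀⟩ : S)), monic_X_pow_add ?_, ?_⟩
    · exact lt_of_le_of_lt degree_cubic_le (by norm_num)
    · simp only [eval₂_add, eval₂_mul, eval₂_C, eval₂_pow, eval₂_X]
      rw [← h]
      change z ^ 4 + (a₃ * z ^ 3 + a₂ * z ^ 2 + a₁ * z + a₀) = _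
      ring
  have h1 : IsAlgebraic S z := hint.isAlgebraic
  exact h1.restrictScalars R

/-- An element of a ring is algebraic over `R` if its image in every field is. -/
theorem exists_eval₂_eq_zero (φ : R →+* B) (x : B)
    (h : ∀ (L : Type) [Field L] (ψ : B →+* L), ψ x ∈ algClosure (ψ.comp φ)) :
    ∃ F : R[X], F ≠ 0 ∧ F.eval₂ φ x = 0 := by
  by_contra! hcon
  set M : Submonoid B := (nonZeroDivisors R[X]).map (eval₂RingHom φ x) with hM
  have hdis : Disjoint ((⊥ : Ideal B) : Set B) M := by
    rw [Set.disjoint_left]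
    rintro z hz ⟨F, hF, rfl⟩
    exact hcon F (nonZeroDivisors.ne_zero hF) (by simpa using hz)
  -- If every nonzero F had F(x) ≠ 0, some prime ideal would avoid all these values. In the fraction
  -- field of the quotient x would not be algebraic, contrary to the hypothesis.
  obtain ⟨p, hp, -, hpM⟩ := Ideal.exists_le_prime_disjoint ⊥ M hdis
  obtain ⟨F, hF, hFx⟩ := mem_algClosure.mp
    (h (FractionRing (B ⧸ p)) ((algebraMap (B ⧸ p) _).comp (Ideal.Quotient.mk p)))
  rw [← hom_eval₂, RingHom.comp_apply] at hFx
  have h1 := (IsFractionRing.injective (B ⧸ p) (FractionRing (B ⧸ p))) (hFx.trans (map_zero _).symm)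
  rw [Ideal.Quotient.eq_zero_iff_mem] at h1
  exact Set.disjoint_left.mp hpM h1 ⟨F, mem_nonZeroDivisors_of_ne_zero hF, rfl⟩

theorem aevalAeval_eq_eval₂ {k : Type} [CommRing k] [Algebra k L] (x y : L) (F : k[X][X]) :
    F.aevalAeval x y = F.eval₂ (aeval x).toRingHom y := by
  induction F using Polynomial.induction_on' with
  | add p q hp hq => rw [map_add, hp, hq, eval₂_add]
  | monomial n a =>
    rw [← C_mul_X_pow_eq_monomial, map_mul, map_pow, aevalAeval_C, aevalAeval_Y, eval₂_mul, eval₂_C,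
      eval₂_pow, eval₂_X]
    rfl

/-- A nonzero polynomial relation between s and g may be read in either variable; it stays nonzero
after the swap. -/
theorem mem_algClosure_exchange {k : Type} [Field k] [Algebra k L] {s g : L}
    (h : g ∈ algClosure (aeval (R := k) s).toRingHom) : s ∈ algClosure (aeval (R := k) g).toRingHom := by
  obtain ⟨F, hF, hFx⟩ := mem_algClosure.mp h
  refine mem_algClosure.mpr ⟨Bivariate.swap F, by simpa using hF, ?_⟩
  rw [← aevalAeval_eq_eval₂, Bivariate.aevalAeval_swap, aevalAeval_eq_eval₂, hFx]

theorem mem_algClosure_of_comp {R' : Type} [CommRing R'] [IsDomain R'] {φ : R →+* L} {φ' : R' →+* L}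
    {i : R →+* R'} (hi : Function.Injective i) (hφ : φ'.comp i = φ) {z : L} (h : z ∈ algClosure φ) :
    z ∈ algClosure φ' := by
  obtain ⟨F, hF, hFx⟩ := mem_algClosure.mp h
  exact mem_algClosure.mpr ⟨F.map i, by rwa [Ne, Polynomial.map_eq_zero_iff hi], by
    rw [eval₂_map, hφ, hFx]⟩

end Algebraic

/-! ### The equations of a uniformized fibre -/

/-- A family of curves `y² + (1 + x + b x²) y + c (e₃ x + e₂ x² + e₁ x³ + e₀ x⁴) = 0`, where
`b = bn / bd` and `c = cn / cd` are rational functions of a parameter. -/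
structure CurveParams where
  (e₃ e₂ e₁ e₀ : ℂ)
  (bn bd cn cd : ℂ[X])

/-- The numerical data of a point of a fibre of a family of curves over the parameter `s`; the
remaining fields express that `(x, y)` corresponds to the point with abscissa `P` on the cubic
`4 X³ - G X - G`. -/
structure FiberPoint (D : CurveParams) where
  (G P s b c a₃ a₂ a₁ a₀ ξ f₁ f₂ f₃ α γ k x y : ℂ)
  b_eq : b * D.bd.eval s = D.bn.eval s
  c_eq : c * D.cd.eval s = D.cn.eval s
  bd_ne : D.bd.eval s ≠ 0
  cd_ne : D.cd.eval s ≠ 0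
  a₃_eq : a₃ = 2 - 4 * c * D.e₃
  a₂_eq : a₂ = 1 + 2 * b - 4 * c * D.e₂
  a₁_eq : a₁ = 2 * b - 4 * c * D.e₁
  a₀_eq : a₀ = b * b - 4 * c * D.e₀
  root : ξ ^ 4 + a₃ * ξ ^ 3 + a₂ * ξ ^ 2 + a₁ * ξ + a₀ = 0
  f₁_eq : f₁ = 4 * ξ ^ 3 + 3 * a₃ * ξ ^ 2 + 2 * a₂ * ξ + a₁
  f₂_eq : f₂ = 6 * ξ ^ 2 + 3 * a₃ * ξ + a₂
  f₃_eq : f₃ = 4 * ξ + a₃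
  cubic₃ : f₁ * α ^ 3 = 4 * k
  cubic₂ : 3 * f₁ * γ + f₂ = 0
  cubic₁ : (3 * f₁ * γ ^ 2 + 2 * f₂ * γ + f₃) * α = -(k * G)
  cubic₀ : f₁ * γ ^ 3 + f₂ * γ ^ 2 + f₃ * γ + 1 = -(k * G)
  f₁_ne : f₁ ≠ 0
  lin_ne : 3 * f₁ * γ ^ 2 + 2 * f₂ * γ + f₃ ≠ 0
  k_ne : k ≠ 0
  x_ne : ξ * (α * P + γ) + 1 ≠ 0
  x_eq : x * (ξ * (α * P + γ) + 1) = α * P + γ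
  y_eq : y ^ 2 + (1 + x + b * x ^ 2) * y + c * (D.e₃ * x + D.e₂ * x ^ 2 + D.e₁ * x ^ 3 + D.e₀ * x ^ 4) = 0

namespace FiberPoint

variable {D : CurveParams}

variable {L : Type} [Field L] (ψ : (FiberPoint D → ℂ) →+* L) (E : Subfield L)

/-- A function without zeros is a unit in the ring of all functions, so no homomorphism to a field
kills it. -/
theorem map_ne_zero {f : FiberPoint D → ℂ} (hf : ∀ t, f t ≠ 0) : ψ f ≠ 0 := by
  have h : f * (fun t => (f t)⁻¹) = 1 := funext fun t => mul_inv_cancel₀ (hf t)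
  intro h0
  have h1 := congrArg ψ h
  rw [map_mul, h0, zero_mul, map_one] at h1
  exact zero_ne_one h1

variable {ψ E}

theorem eval_mem (hC : ∀ z : ℂ, ψ (fun _ => z) ∈ E) (hs : ψ FiberPoint.s ∈ E) (p : ℂ[X]) :
    ψ (fun t => p.eval t.s) ∈ E := by
  induction p using Polynomial.induction_on' with
  | add p q hp hq =>
    have : (fun t : FiberPoint D => (p + q).eval t.s) = (fun t => p.eval t.s) + fun t => q.eval t.s := by
      ext t; simp
    rw [this, map_add]
    exact E.add_mem hp hq
  | monomial n a =>
    have : (fun t : FiberPoint D => (monomial n a).eval t.s) = (fun _ => a) * FiberPoint.s ^ n := by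
      ext t; simp
    rw [this, map_mul, map_pow]
    exact E.mul_mem (hC a) (E.pow_mem hs n)

theorem mem_of_mul_mem {u v : L} (hv : v ≠ 0) (hvE : v ∈ E) (h : u * v ∈ E) : u ∈ E := by
  rw [← mul_div_cancel_right₀ u hv]
  exact E.div_mem h hvE

/-- A relatively algebraically closed subfield containing the constants and `s` contains the
parameters of the fibre. -/
theorem mem_of_s_mem (hC : ∀ z : ℂ, ψ (fun _ => z) ∈ E)
    (hE : ∀ a₃ ∈ E, ∀ a₂ ∈ E, ∀ a₁ ∈ E, ∀ a₀ ∈ E, ∀ z,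
      z ^ 4 + a₃ * z ^ 3 + a₂ * z ^ 2 + a₁ * z + a₀ = 0 → z ∈ E) (hs : ψ FiberPoint.s ∈ E) :
    ψ FiberPoint.b ∈ E ∧ ψ FiberPoint.c ∈ E ∧ ψ FiberPoint.ξ ∈ E ∧ ψ FiberPoint.α ∈ E ∧
      ψ FiberPoint.γ ∈ E ∧ ψ FiberPoint.G ∈ E := by
  have hn : ∀ n : ℕ, (n : L) ∈ E := fun n => natCast_mem E n
  have h2 : (2 : L) ∈ E := hn 2
  have h3 : (3 : L) ∈ E := hn 3
  have h4 : (4 : L) ∈ E := hn 4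
  have h6 : (6 : L) ∈ E := hn 6
  have h1 : (1 : L) ∈ E := E.one_mem
  have c4 : (4 : L) ≠ 0 := by
    have := map_ne_zero ψ (f := fun _ => 4) fun _ => (by norm_num : (4 : ℂ) ≠ 0)
    rwa [show (fun _ : FiberPoint D => (4 : ℂ)) = 4 from rfl, map_ofNat] at this
  have c3 : (3 : L) ≠ 0 := by
    have := map_ne_zero ψ (f := fun _ => 3) fun _ => (by norm_num : (3 : ℂ) ≠ 0)
    rwa [show (fun _ : FiberPoint D => (3 : ℂ)) = 3 from rfl, map_ofNat] at this
  have hb : ψ FiberPoint.b ∈ E := by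
    refine mem_of_mul_mem (map_ne_zero ψ FiberPoint.bd_ne) (eval_mem hC hs D.bd) ?_
    rw [← map_mul, show FiberPoint.b * (fun t : FiberPoint D => D.bd.eval t.s) = fun t => D.bn.eval t.s from
      funext FiberPoint.b_eq]
    exact eval_mem hC hs D.bn
  have hc : ψ FiberPoint.c ∈ E := by
    refine mem_of_mul_mem (map_ne_zero ψ FiberPoint.cd_ne) (eval_mem hC hs D.cd) ?_
    rw [← map_mul, show FiberPoint.c * (fun t : FiberPoint D => D.cd.eval t.s) = fun t => D.cn.eval t.s from
      funext FiberPoint.c_eq]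
    exact eval_mem hC hs D.cn
  have ha₃ : ψ FiberPoint.a₃ ∈ E := by
    rw [show (FiberPoint.a₃ : FiberPoint D → ℂ) = 2 - 4 * FiberPoint.c * (fun _ => D.e₃) from
      funext FiberPoint.a₃_eq]
    simp only [map_sub, map_mul, map_ofNat]
    exact E.sub_mem h2 (E.mul_mem (E.mul_mem h4 hc) (hC _))
  have ha₂ : ψ FiberPoint.a₂ ∈ E := by
    rw [show (FiberPoint.a₂ : FiberPoint D → ℂ) = 1 + 2 * FiberPoint.b - 4 * FiberPoint.c * (fun _ => D.e₂) from
      funext FiberPoint.a₂_eq]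
    simp only [map_sub, map_add, map_mul, map_ofNat, map_one]
    exact E.sub_mem (E.add_mem h1 (E.mul_mem h2 hb)) (E.mul_mem (E.mul_mem h4 hc) (hC _))
  have ha₁ : ψ FiberPoint.a₁ ∈ E := by
    rw [show (FiberPoint.a₁ : FiberPoint D → ℂ) = 2 * FiberPoint.b - 4 * FiberPoint.c * (fun _ => D.e₁) from
      funext FiberPoint.a₁_eq]
    simp only [map_sub, map_mul, map_ofNat]
    exact E.sub_mem (E.mul_mem h2 hb) (E.mul_mem (E.mul_mem h4 hc) (hC _))
  have ha₀ : ψ FiberPoint.a₀ ∈ E := by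
    rw [show (FiberPoint.a₀ : FiberPoint D → ℂ) = FiberPoint.b * FiberPoint.b - 4 * FiberPoint.c * (fun _ => D.e₀)
      from funext FiberPoint.a₀_eq]
    simp only [map_sub, map_mul, map_ofNat]
    exact E.sub_mem (E.mul_mem hb hb) (E.mul_mem (E.mul_mem h4 hc) (hC _))
  have hξ : ψ FiberPoint.ξ ∈ E := by
    refine hE _ ha₃ _ ha₂ _ ha₁ _ ha₀ _ ?_
    simp only [← map_mul, ← map_pow, ← map_add]
    rw [← map_zero ψ]
    exact congrArg ψ (funext FiberPoint.root)
  have hf₁ : ψ FiberPoint.f₁ ∈ E := by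
    rw [show (FiberPoint.f₁ : FiberPoint D → ℂ) = 4 * FiberPoint.ξ ^ 3 + 3 * FiberPoint.a₃ * FiberPoint.ξ ^ 2 +
      2 * FiberPoint.a₂ * FiberPoint.ξ + FiberPoint.a₁ from funext FiberPoint.f₁_eq]
    simp only [map_add, map_mul, map_pow, map_ofNat]
    exact E.add_mem (E.add_mem (E.add_mem (E.mul_mem h4 (E.pow_mem hξ 3))
      (E.mul_mem (E.mul_mem h3 ha₃) (E.pow_mem hξ 2))) (E.mul_mem (E.mul_mem h2 ha₂) hξ)) ha₁
  have hf₂ : ψ FiberPoint.f₂ ∈ E := by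
    rw [show (FiberPoint.f₂ : FiberPoint D → ℂ) = 6 * FiberPoint.ξ ^ 2 + 3 * FiberPoint.a₃ * FiberPoint.ξ +
      FiberPoint.a₂ from funext FiberPoint.f₂_eq]
    simp only [map_add, map_mul, map_pow, map_ofNat]
    exact E.add_mem (E.add_mem (E.mul_mem h6 (E.pow_mem hξ 2)) (E.mul_mem (E.mul_mem h3 ha₃) hξ)) ha₂
  have hf₃ : ψ FiberPoint.f₃ ∈ E := by
    rw [show (FiberPoint.f₃ : FiberPoint D → ℂ) = 4 * FiberPoint.ξ + FiberPoint.a₃ from funext FiberPoint.f₃_eq]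
    simp only [map_add, map_mul, map_ofNat]
    exact E.add_mem (E.mul_mem h4 hξ) ha₃
  have hf₁0 : ψ FiberPoint.f₁ ≠ 0 := map_ne_zero ψ FiberPoint.f₁_ne
  have hγ : ψ FiberPoint.γ ∈ E := by
    refine mem_of_mul_mem (mul_ne_zero c3 hf₁0) (E.mul_mem h3 hf₁) ?_
    have h := congrArg ψ (show (3 * FiberPoint.f₁ * FiberPoint.γ + FiberPoint.f₂ : FiberPoint D → ℂ) = 0 from
      funext FiberPoint.cubic₂)
    simp only [map_add, map_mul, map_ofNat, map_zero] at h
    rw [mul_comm, eq_neg_of_add_eq_zero_left h]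
    exact E.neg_mem hf₂
  have hA0 : ψ (FiberPoint.f₁ * FiberPoint.γ ^ 3 + FiberPoint.f₂ * FiberPoint.γ ^ 2 +
      FiberPoint.f₃ * FiberPoint.γ + 1) ∈ E := by
    simp only [map_add, map_mul, map_pow, map_one]
    exact E.add_mem (E.add_mem (E.add_mem (E.mul_mem hf₁ (E.pow_mem hγ 3))
      (E.mul_mem hf₂ (E.pow_mem hγ 2))) (E.mul_mem hf₃ hγ)) h1
  have hA1 : ψ (3 * FiberPoint.f₁ * FiberPoint.γ ^ 2 + 2 * FiberPoint.f₂ * FiberPoint.γ +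
      FiberPoint.f₃) ∈ E := by
    simp only [map_add, map_mul, map_pow, map_ofNat]
    exact E.add_mem (E.add_mem (E.mul_mem (E.mul_mem h3 hf₁) (E.pow_mem hγ 2))
      (E.mul_mem (E.mul_mem h2 hf₂) hγ)) hf₃
  -- With both invariants equal to G, the two lowest coefficients of the cubic are both -kG.
  -- Comparing `cubic₁` with `cubic₀` makes α a rational function of f₁, f₂, f₃ and γ, without a
  -- cube root.
  have hα : ψ FiberPoint.α ∈ E := by
    refine mem_of_mul_mem (map_ne_zero ψ FiberPoint.lin_ne) hA1 ?_
    refine (congrArg (· ∈ E) ?_).mpr hA0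
    rw [← map_mul]
    refine congrArg ψ (funext fun t => ?_)
    have h1 := t.cubic₁
    rw [← t.cubic₀] at h1
    change t.α * (3 * t.f₁ * t.γ ^ 2 + 2 * t.f₂ * t.γ + t.f₃) = _
    rw [mul_comm, h1]
    rfl
  have hk : ψ FiberPoint.k ∈ E := by
    refine mem_of_mul_mem c4 h4 ?_
    rw [mul_comm, ← map_ofNat ψ 4, ← map_mul,
      ← show (FiberPoint.f₁ * FiberPoint.α ^ 3 : FiberPoint D → ℂ) = 4 * FiberPoint.k from
        funext FiberPoint.cubic₃, map_mul, map_pow]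
    exact E.mul_mem hf₁ (E.pow_mem hα 3)
  refine ⟨hb, hc, hξ, hα, hγ, mem_of_mul_mem (map_ne_zero ψ FiberPoint.k_ne) hk ?_⟩
  have h : (FiberPoint.G * FiberPoint.k : FiberPoint D → ℂ) = -(FiberPoint.f₁ * FiberPoint.γ ^ 3 +
      FiberPoint.f₂ * FiberPoint.γ ^ 2 + FiberPoint.f₃ * FiberPoint.γ + 1) := funext fun t => by
    have := t.cubic₀
    change t.G * t.k = -(t.f₁ * t.γ ^ 3 + t.f₂ * t.γ ^ 2 + t.f₃ * t.γ + 1)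
    linear_combination this
  rw [← map_mul, h, map_neg]
  exact E.neg_mem hA0

theorem x_mem (hP : ψ FiberPoint.P ∈ E) (hξ : ψ FiberPoint.ξ ∈ E) (hα : ψ FiberPoint.α ∈ E)
    (hγ : ψ FiberPoint.γ ∈ E) : ψ FiberPoint.x ∈ E := by
  have hW : ψ (FiberPoint.α * FiberPoint.P + FiberPoint.γ) ∈ E := by
    rw [map_add, map_mul]
    exact E.add_mem (E.mul_mem hα hP) hγ
  refine mem_of_mul_mem (map_ne_zero ψ FiberPoint.x_ne) ?_ ?_
  · rw [show (fun t : FiberPoint D => t.ξ * (t.α * t.P + t.γ) + 1) =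
      FiberPoint.ξ * (FiberPoint.α * FiberPoint.P + FiberPoint.γ) + 1 from rfl, map_add, map_mul,
      map_one]
    exact E.add_mem (E.mul_mem hξ hW) E.one_mem
  · rw [← map_mul, show FiberPoint.x * (fun t : FiberPoint D => t.ξ * (t.α * t.P + t.γ) + 1) =
      FiberPoint.α * FiberPoint.P + FiberPoint.γ from funext FiberPoint.x_eq]
    exact hW

theorem y_mem (hC : ∀ z : ℂ, ψ (fun _ => z) ∈ E)
    (hE : ∀ a₃ ∈ E, ∀ a₂ ∈ E, ∀ a₁ ∈ E, ∀ a₀ ∈ E, ∀ z,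
      z ^ 4 + a₃ * z ^ 3 + a₂ * z ^ 2 + a₁ * z + a₀ = 0 → z ∈ E) (hb : ψ FiberPoint.b ∈ E)
    (hc : ψ FiberPoint.c ∈ E) (hx : ψ FiberPoint.x ∈ E) : ψ FiberPoint.y ∈ E := by
  have h1 : ψ (1 + FiberPoint.x + FiberPoint.b * FiberPoint.x ^ 2) ∈ E := by
    simp only [map_add, map_mul, map_pow, map_one]
    exact E.add_mem (E.add_mem E.one_mem hx) (E.mul_mem hb (E.pow_mem hx 2))
  have h0 : ψ (FiberPoint.c * ((fun _ => D.e₃) * FiberPoint.x + (fun _ => D.e₂) * FiberPoint.x ^ 2 +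
      (fun _ => D.e₁) * FiberPoint.x ^ 3 + (fun _ => D.e₀) * FiberPoint.x ^ 4)) ∈ E := by
    simp only [map_add, map_mul, map_pow]
    exact E.mul_mem hc (E.add_mem (E.add_mem (E.add_mem (E.mul_mem (hC _) hx)
      (E.mul_mem (hC _) (E.pow_mem hx 2))) (E.mul_mem (hC _) (E.pow_mem hx 3)))
      (E.mul_mem (hC _) (E.pow_mem hx 4)))
  refine hE _ h1 _ h0 0 E.zero_mem 0 E.zero_mem _ ?_
  have h : (FiberPoint.y ^ 2 + (1 + FiberPoint.x + FiberPoint.b * FiberPoint.x ^ 2) * FiberPoint.y +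
      FiberPoint.c * ((fun _ => D.e₃) * FiberPoint.x + (fun _ => D.e₂) * FiberPoint.x ^ 2 +
      (fun _ => D.e₁) * FiberPoint.x ^ 3 + (fun _ => D.e₀) * FiberPoint.x ^ 4) : FiberPoint D → ℂ) = 0 :=
    funext FiberPoint.y_eq
  have h2 := congrArg ψ h
  rw [map_add, map_add, map_mul, map_pow, map_zero] at h2
  linear_combination ψ FiberPoint.y ^ 2 * h2

/-- Evaluation of polynomials in two variables at `(G, P)`. -/
def evalGP : ℂ[X][X] →+* (FiberPoint D → ℂ) := RingHom.pi fun t => evalEvalRingHom t.G t.P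

theorem evalGP_C_C (z : ℂ) : evalGP (D := D) (C (C z)) = fun _ => z := by
  ext t; simp [evalGP]

theorem evalGP_C_X : evalGP (D := D) (C X) = FiberPoint.G := by
  ext t; simp [evalGP]

theorem evalGP_X : evalGP (D := D) X = FiberPoint.P := by
  ext t; simp [evalGP]

/-- G is algebraic over ℂ[s]; exchange makes s algebraic over ℂ[G]. Then b, c, ξ, α, γ follow, x
follows rationally with P, and y follows from the curve equation. -/
theorem mem_algClosure_of_GP (ψ : (FiberPoint D → ℂ) →+* L) : ψ FiberPoint.x ∈ algClosure (ψ.comp evalGP) ∧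
    ψ FiberPoint.y ∈ algClosure (ψ.comp evalGP) := by
  let : Algebra ℂ L := (ψ.comp (RingHom.pi fun _ => RingHom.id ℂ)).toAlgebra
  have hCL : ∀ z : ℂ, algebraMap ℂ L z = ψ fun _ => z := fun z => rfl
  have hEs : ψ FiberPoint.G ∈ algClosure (aeval (R := ℂ) (ψ FiberPoint.s)).toRingHom := by
    refine (mem_of_s_mem (E := algClosure (aeval (R := ℂ) (ψ FiberPoint.s)).toRingHom)
      (fun z => ?_) (fun a₃ h₃ a₂ h₂ a₁ h₁ a₀ h₀ z => mem_algClosure_of_quartic h₃ h₂ h₁ h₀)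
      ?_).2.2.2.2.2
    · have := map_mem_algClosure (aeval (R := ℂ) (ψ FiberPoint.s)).toRingHom (C z)
      simpa [hCL] using this
    · have := map_mem_algClosure (aeval (R := ℂ) (ψ FiberPoint.s)).toRingHom X
      simpa using this
  have hC : ∀ z : ℂ, ψ (fun _ => z) ∈ algClosure (ψ.comp evalGP) := fun z => by
    have := map_mem_algClosure (ψ.comp evalGP) (C (C z))
    simpa [evalGP_C_C] using this
  have hs : ψ FiberPoint.s ∈ algClosure (ψ.comp evalGP) := by
    refine mem_algClosure_of_comp (i := C) C_injective ?_ (mem_algClosure_exchange hEs)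
    refine Polynomial.ringHom_ext (fun z => ?_) ?_
    · simp [hCL, evalGP_C_C]
    · simp [evalGP_C_X]
  have hP : ψ FiberPoint.P ∈ algClosure (ψ.comp evalGP) := by
    have := map_mem_algClosure (ψ.comp evalGP) X
    simpa [evalGP_X] using this
  have hE := fun a₃ h₃ a₂ h₂ a₁ h₁ a₀ h₀ (z : L) =>
    mem_algClosure_of_quartic (φ := ψ.comp evalGP) (a₃ := a₃) (a₂ := a₂) (a₁ := a₁) (a₀ := a₀)
      (z := z) h₃ h₂ h₁ h₀
  obtain ⟨hb, hc, hξ, hα, hγ, -⟩ := mem_of_s_mem hC hE hs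
  have hx := x_mem hP hξ hα hγ
  exact ⟨hx, y_mem hC hE hb hc hx⟩

/-- Since B is the ring of all functions on `FiberPoint D`, one relation in B is an equation valid
for every point of every fibre, with coefficients depending on D only. -/
theorem exists_polynomial_x : ∃ F : ℂ[X][X][X], F ≠ 0 ∧ ∀ t : FiberPoint D,
    F.eval₂ (evalEvalRingHom t.G t.P) t.x = 0 := by
  obtain ⟨F, hF, h⟩ := exists_eval₂_eq_zero (evalGP (D := D)) FiberPoint.x
    fun L _ ψ => (mem_algClosure_of_GP ψ).1
  refine ⟨F, hF, fun t => ?_⟩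
  have h1 := congrFun h t
  have h2 := hom_eval₂ F evalGP (Pi.evalRingHom (fun _ : FiberPoint D => ℂ) t) FiberPoint.x
  exact h2.symm.trans h1

theorem exists_polynomial_y : ∃ F : ℂ[X][X][X], F ≠ 0 ∧ ∀ t : FiberPoint D,
    F.eval₂ (evalEvalRingHom t.G t.P) t.y = 0 := by
  obtain ⟨F, hF, h⟩ := exists_eval₂_eq_zero (evalGP (D := D)) FiberPoint.y
    fun L _ ψ => (mem_algClosure_of_GP ψ).2
  refine ⟨F, hF, fun t => ?_⟩
  have h1 := congrFun h t
  have h2 := hom_eval₂ F evalGP (Pi.evalRingHom (fun _ : FiberPoint D => ℂ) t) FiberPoint.y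
  exact h2.symm.trans h1

end FiberPoint

end DiskPotential

end

noncomputable section

namespace DiskPotential

open Filter Topology Polynomial PeriodPair

/-! ### The mirror curves as plane curves of degree two in `y` -/

/-- The coefficient of `x² y` in `y * H`. -/
def Surface.coeffB : (S : Surface) → (Fin S.numParams → ℂ) → ℂ
  | .P2, _ => 0
  | .P1xP1, q => q (0 : Fin 2)
  | .WP112, q => q (0 : Fin 2)
  | .F1, q => q (1 : Fin 2)

/-- The coefficient of the monomial in `x` alone in `y * H`. -/
def Surface.coeffC : (S : Surface) → (Fin S.numParams → ℂ) → ℂ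
  | .P2, q => q (0 : Fin 1)
  | .P1xP1, q => q (1 : Fin 2)
  | .WP112, q => q (1 : Fin 2)
  | .F1, q => q (0 : Fin 2)

/-- The exponent of the monomial in `x` alone in `y * H`. -/
def Surface.degX : Surface → ℕ
  | .P2 => 3
  | .P1xP1 => 2
  | .WP112 => 4
  | .F1 => 1

theorem mul_mirrorH (S : Surface) (q : Fin S.numParams → ℂ) {x y : ℂ} (hy : y ≠ 0) :
    y * mirrorH S q x y =
      y ^ 2 + (1 + x + S.coeffB q * x ^ 2) * y + S.coeffC q * x ^ S.degX := by
  cases S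
  · have : mirrorH .P2 q x y = x + y + 1 + q (0 : Fin 1) * x ^ (3 : ℤ) * y ^ (-1 : ℤ) :=
      congrArg (x + y + 1 + ·) (Fin.sum_univ_one fun i : Fin 1 =>
        q i * x ^ (Surface.exponents .P2 i).1 * y ^ (Surface.exponents .P2 i).2)
    rw [this, zpow_neg_one, show x ^ (3 : ℤ) = x ^ 3 from zpow_natCast x 3]
    simp only [Surface.coeffB, Surface.coeffC, Surface.degX]
    field_simp
    ring
  · have : mirrorH .P1xP1 q x y = x + y + 1 + (q (0 : Fin 2) * x ^ (2 : ℤ) * y ^ (0 : ℤ) +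
        q (1 : Fin 2) * x ^ (2 : ℤ) * y ^ (-1 : ℤ)) :=
      congrArg (x + y + 1 + ·) (Fin.sum_univ_two fun i : Fin 2 =>
        q i * x ^ (Surface.exponents .P1xP1 i).1 * y ^ (Surface.exponents .P1xP1 i).2)
    rw [this, zpow_neg_one, show x ^ (2 : ℤ) = x ^ 2 from zpow_natCast x 2, zpow_zero]
    simp only [Surface.coeffB, Surface.coeffC, Surface.degX]
    field_simp
    ring
  · have : mirrorH .WP112 q x y = x + y + 1 + (q (0 : Fin 2) * x ^ (2 : ℤ) * y ^ (0 : ℤ) +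
        q (1 : Fin 2) * x ^ (4 : ℤ) * y ^ (-1 : ℤ)) :=
      congrArg (x + y + 1 + ·) (Fin.sum_univ_two fun i : Fin 2 =>
        q i * x ^ (Surface.exponents .WP112 i).1 * y ^ (Surface.exponents .WP112 i).2)
    rw [this, zpow_neg_one, show x ^ (2 : ℤ) = x ^ 2 from zpow_natCast x 2, zpow_zero,
      show x ^ (4 : ℤ) = x ^ 4 from zpow_natCast x 4]
    simp only [Surface.coeffB, Surface.coeffC, Surface.degX]
    field_simp
    ring
  · have : mirrorH .F1 q x y = x + y + 1 + (q (0 : Fin 2) * x ^ (1 : ℤ) * y ^ (-1 : ℤ) +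
        q (1 : Fin 2) * x ^ (2 : ℤ) * y ^ (0 : ℤ)) :=
      congrArg (x + y + 1 + ·) (Fin.sum_univ_two fun i : Fin 2 =>
        q i * x ^ (Surface.exponents .F1 i).1 * y ^ (Surface.exponents .F1 i).2)
    rw [this, zpow_neg_one, show x ^ (2 : ℤ) = x ^ 2 from zpow_natCast x 2, zpow_zero, zpow_one]
    simp only [Surface.coeffB, Surface.coeffC, Surface.degX]
    field_simp
    ring

theorem mem_affineCurve (S : Surface) (q : Fin S.numParams → ℂ) {x y : ℂ} :
    (x, y) ∈ affineCurve S q ↔ x ≠ 0 ∧ y ≠ 0 ∧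
      y ^ 2 + (1 + x + S.coeffB q * x ^ 2) * y + S.coeffC q * x ^ S.degX = 0 := by
  simp only [affineCurve, Set.mem_ofPred_eq]
  refine and_congr_right fun _ => and_congr_right fun hy => ?_
  rw [← mul_mirrorH S q hy, mul_eq_zero, or_iff_right hy]

theorem UniformizesCurve.isCurveUniformization {S : Surface} {q : Fin S.numParams → ℂ} {τ : ℍ}
    {x y : ℂ → ℂ} (h : UniformizesCurve S q τ x y) :
    IsCurveUniformization (lat τ) (S.coeffB q) (S.coeffC q) S.degX x y where
  ell_x := IsElliptic.of_periodic h.mero_x h.periodic_x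
  ell_y := IsElliptic.of_periodic h.mero_y h.periodic_y
  mapsTo u h1 h2 h3 h4 := ((mem_affineCurve S q).mp (h.mapsTo u h1 h2 h3 h4)).2.2
  surj X Y hX hY hXY := by
    obtain ⟨u, h1, h2, h3⟩ := h.surj (X, Y) ((mem_affineCurve S q).mpr ⟨hX, hY, hXY⟩)
    exact ⟨u, h1, h2, congrArg Prod.fst h3, congrArg Prod.snd h3⟩
  inj u v h1 h2 h3 h4 h5 h6 h7 h8 := by
    obtain ⟨m, n, rfl⟩ := h.inj u v h1 h2 h3 h4 (h.mapsTo u h1 h2 h5 h6) (by rw [h7, h8])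
    exact mem_lat.mpr ⟨m, n, by ring⟩
  ramified := h.ramified

theorem Surface.coeffC_ne_zero {S : Surface} {q : Fin S.numParams → ℂ} (hq : ∀ i, q i ≠ 0) :
    S.coeffC q ≠ 0 := by
  cases S <;> exact hq _

/-! ### Points of a fibre -/

/-- The curve parameters of a rational subfamily. -/
def Surface.params : (S : Surface) → (Fin S.numParams → RatFunc ℂ) → CurveParams
  | .P2, r => ⟨0, 0, 1, 0, 0, 1, (r (0 : Fin 1)).num, (r (0 : Fin 1)).denom⟩
  | .P1xP1, r => ⟨0, 1, 0, 0, (r (0 : Fin 2)).num, (r (0 : Fin 2)).denom,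
      (r (1 : Fin 2)).num, (r (1 : Fin 2)).denom⟩
  | .WP112, r => ⟨0, 0, 0, 1, (r (0 : Fin 2)).num, (r (0 : Fin 2)).denom,
      (r (1 : Fin 2)).num, (r (1 : Fin 2)).denom⟩
  | .F1, r => ⟨1, 0, 0, 0, (r (1 : Fin 2)).num, (r (1 : Fin 2)).denom,
      (r (0 : Fin 2)).num, (r (0 : Fin 2)).denom⟩

theorem denom_eval_ne_zero {f : RatFunc ℂ} {s : ℂ} (h : f.eval (RingHom.id ℂ) s ≠ 0) :
    f.denom.eval s ≠ 0 ∧ f.eval (RingHom.id ℂ) s * f.denom.eval s = f.num.eval s := by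
  have h1 : f.eval (RingHom.id ℂ) s = f.num.eval s / f.denom.eval s := rfl
  have h2 : f.denom.eval s ≠ 0 := fun h0 => h (by rw [h1, h0, div_zero])
  exact ⟨h2, by rw [h1, div_mul_cancel₀ _ h2]⟩

theorem params_spec (S : Surface) (r : Fin S.numParams → RatFunc ℂ) {s : ℂ}
    (h : ∀ i, subfamilyAt r s i ≠ 0) :
    (S.params r).bd.eval s ≠ 0 ∧ (S.params r).cd.eval s ≠ 0 ∧
    S.coeffB (subfamilyAt r s) * (S.params r).bd.eval s = (S.params r).bn.eval s ∧
    S.coeffC (subfamilyAt r s) * (S.params r).cd.eval s = (S.params r).cn.eval s := by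
  have h' := fun i => denom_eval_ne_zero (h i)
  cases S
  · exact ⟨by simp [Surface.params], (h' (0 : Fin 1)).1, by simp [Surface.params, Surface.coeffB],
      (h' (0 : Fin 1)).2⟩
  · exact ⟨(h' (0 : Fin 2)).1, (h' (1 : Fin 2)).1, (h' (0 : Fin 2)).2, (h' (1 : Fin 2)).2⟩
  · exact ⟨(h' (0 : Fin 2)).1, (h' (1 : Fin 2)).1, (h' (0 : Fin 2)).2, (h' (1 : Fin 2)).2⟩
  · exact ⟨(h' (1 : Fin 2)).1, (h' (0 : Fin 2)).1, (h' (1 : Fin 2)).2, (h' (0 : Fin 2)).2⟩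

theorem params_monomial (S : Surface) (r : Fin S.numParams → RatFunc ℂ) (N W : ℂ) :
    N ^ (4 - S.degX) * W ^ S.degX = (S.params r).e₃ * (N ^ 3 * W) + (S.params r).e₂ * (N ^ 2 * W ^ 2) +
      (S.params r).e₁ * (N * W ^ 3) + (S.params r).e₀ * W ^ 4 := by
  cases S <;> simp [Surface.degX, Surface.params]

theorem quartic_coeff_eq_zero {p₄ p₃ p₂ p₁ p₀ : ℂ}
    (h : ∀ X : ℂ, p₄ * X ^ 4 + p₃ * X ^ 3 + p₂ * X ^ 2 + p₁ * X + p₀ = 0) :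
    p₄ = 0 ∧ p₃ = 0 ∧ p₂ = 0 ∧ p₁ = 0 ∧ p₀ = 0 := by
  have a := h 0
  have b := h 1
  have c := h (-1)
  have d := h 2
  have e := h (-2)
  refine ⟨?_, ?_, ?_, ?_, ?_⟩
  · linear_combination (1 / 24) * (d + e - 4 * b - 4 * c + 6 * a)
  · linear_combination (1 / 12) * (d - e - 2 * b + 2 * c)
  · linear_combination (1 / 24) * (16 * b + 16 * c - d - e - 30 * a)
  · linear_combination (1 / 12) * (8 * b - 8 * c - d + e)
  · linear_combination a

/-- The substitution X = Z g₃/g₂ turns 4X³ - g₂X - g₃ into a multiple of 4Z³ - GZ - G. In powers of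
W the quartic at N = ξW + 1 has the Taylor coefficients 1, f₃, f₂, f₁, F₀ at ξ. Comparison in degree
four gives F₀ = 0, and the lower degrees give the relations `cubic₃` to `cubic₀`. -/
theorem exists_fiberPoint {S : Surface} {r : Fin S.numParams → RatFunc ℂ} {s : ℂ}
    (hq : ∀ i, subfamilyAt r s i ≠ 0) {g₂ g₃ ξ α γ β X x y : ℂ} (h₂ : g₂ ≠ 0) (h₃ : g₃ ≠ 0)
    (hnf : IsNormalForm g₂ g₃ (S.coeffB (subfamilyAt r s)) (S.coeffC (subfamilyAt r s)) S.degX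
      ξ α γ β)
    (hN : ξ * (α * X + γ) + 1 ≠ 0) (hx : x * (ξ * (α * X + γ) + 1) = α * X + γ)
    (hy : y ^ 2 + (1 + x + S.coeffB (subfamilyAt r s) * x ^ 2) * y +
      S.coeffC (subfamilyAt r s) * x ^ S.degX = 0) :
    ∃ t : FiberPoint (S.params r), t.G = g₂ ^ 3 / g₃ ^ 2 ∧ t.P = X * g₂ / g₃ ∧ t.x = x ∧ t.y = y := by
  obtain ⟨hbd, hcd, hb, hc⟩ := params_spec S r hq
  set b := S.coeffB (subfamilyAt r s)
  set c := S.coeffC (subfamilyAt r s)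
  set D := S.params r
  set α' := α * g₃ / g₂ with hα'
  set G := g₂ ^ 3 / g₃ ^ 2 with hG
  set k := β ^ 2 * g₃ ^ 3 / g₂ ^ 3 with hk
  have hα0 : α' ≠ 0 := div_ne_zero (mul_ne_zero hnf.α_ne h₃) h₂
  have hk0 : k ≠ 0 := div_ne_zero (mul_ne_zero (pow_ne_zero 2 hnf.β_ne) (pow_ne_zero 3 h₃))
    (pow_ne_zero 3 h₂)
  have hG0 : G ≠ 0 := div_ne_zero (pow_ne_zero 3 h₂) (pow_ne_zero 2 h₃)
  have hαP : α' * (X * g₂ / g₃) = α * X := by rw [hα']; field_simp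
  obtain ⟨a₃, ha₃⟩ : ∃ a, a = 2 - 4 * c * D.e₃ := ⟨_, rfl⟩
  obtain ⟨a₂, ha₂⟩ : ∃ a, a = 1 + 2 * b - 4 * c * D.e₂ := ⟨_, rfl⟩
  obtain ⟨a₁, ha₁⟩ : ∃ a, a = 2 * b - 4 * c * D.e₁ := ⟨_, rfl⟩
  obtain ⟨a₀, ha₀⟩ : ∃ a, a = b * b - 4 * c * D.e₀ := ⟨_, rfl⟩
  have hquart : ∀ N W, quarticForm b c S.degX N W =
      N ^ 4 + a₃ * N ^ 3 * W + a₂ * N ^ 2 * W ^ 2 + a₁ * N * W ^ 3 + a₀ * W ^ 4 := fun N W => by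
    rw [quarticForm, params_monomial S r, ha₃, ha₂, ha₁, ha₀]
    ring
  set F₀ := ξ ^ 4 + a₃ * ξ ^ 3 + a₂ * ξ ^ 2 + a₁ * ξ + a₀ with hF₀
  set f₁ := 4 * ξ ^ 3 + 3 * a₃ * ξ ^ 2 + 2 * a₂ * ξ + a₁ with hf₁
  set f₂ := 6 * ξ ^ 2 + 3 * a₃ * ξ + a₂ with hf₂
  set f₃ := 4 * ξ + a₃ with hf₃
  have hpoly := quartic_coeff_eq_zero (p₄ := F₀ * α' ^ 4)
    (p₃ := 4 * F₀ * α' ^ 3 * γ + f₁ * α' ^ 3 - 4 * k)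
    (p₂ := 6 * F₀ * α' ^ 2 * γ ^ 2 + 3 * f₁ * α' ^ 2 * γ + f₂ * α' ^ 2)
    (p₁ := 4 * F₀ * α' * γ ^ 3 + (3 * f₁ * γ ^ 2 + 2 * f₂ * γ + f₃) * α' + k * G)
    (p₀ := F₀ * γ ^ 4 + f₁ * γ ^ 3 + f₂ * γ ^ 2 + f₃ * γ + 1 + k * G) fun Z => by
      have h1 := hnf.eq (Z * g₃ / g₂)
      rw [hquart, show α * (Z * g₃ / g₂) = α' * Z by rw [hα']; ring] at h1
      have h2 : β ^ 2 * (4 * (Z * g₃ / g₂) ^ 3 - g₂ * (Z * g₃ / g₂) - g₃) =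
          k * (4 * Z ^ 3 - G * Z - G) := by
        rw [hk, hG]; field_simp
      rw [h2] at h1
      rw [hF₀, hf₁, hf₂, hf₃]
      linear_combination h1
  obtain ⟨e4, e3, e2, e1, e0⟩ := hpoly
  have hF0 : F₀ = 0 := (mul_eq_zero.mp e4).resolve_right (pow_ne_zero 4 hα0)
  rw [hF0] at e3 e2 e1 e0
  have e3' : f₁ * α' ^ 3 = 4 * k := by linear_combination e3
  have e1' : (3 * f₁ * γ ^ 2 + 2 * f₂ * γ + f₃) * α' = -(k * G) := by linear_combination e1
  refine ⟨⟨G, X * g₂ / g₃, s, b, c, a₃, a₂, a₁, a₀, ξ, f₁, f₂, f₃, α', γ, k, x, y, hb, hc, hbd, hcd,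
    ha₃, ha₂, ha₁, ha₀, hF0, hf₁, hf₂, hf₃, e3', ?_, e1', by linear_combination e0, ?_, ?_, hk0,
    by rwa [hαP], by rw [hαP, hx], ?_⟩, rfl, rfl, rfl, rfl⟩
  · refine (mul_eq_zero.mp (?_ : α' ^ 2 * _ = 0)).resolve_left (pow_ne_zero 2 hα0)
    linear_combination e2
  · intro h0
    rw [h0, zero_mul] at e3'
    exact mul_ne_zero (by norm_num) hk0 e3'.symm
  · intro h0
    rw [h0, zero_mul] at e1'
    exact neg_ne_zero.mpr (mul_ne_zero hk0 hG0) e1'.symm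
  · have := params_monomial S r 1 x
    simp only [one_pow, one_mul] at this
    rw [← this]
    exact hy

/-! ### Algebraicity of uniformizations -/

theorem eventually_codiscrete_ne_zero_of_holomorphic {f : ℍ → ℂ}
    (hf : DifferentiableOn ℂ (fun τ : ℂ => f (ofComplex τ)) {τ : ℂ | 0 < τ.im}) {τ₀ : ℍ}
    (h0 : f τ₀ ≠ 0) : ∀ᶠ τ in codiscrete ℍ, f τ ≠ 0 := by
  have hU : IsOpen {τ : ℂ | 0 < τ.im} := isOpen_lt continuous_const Complex.continuous_im
  have han := hf.analyticOnNhd hU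
  have hpre : IsPreconnected {τ : ℂ | 0 < τ.im} := (convex_halfSpace_im_gt 0).isPreconnected
  rw [eventually_codiscrete_iff]
  intro τ
  have h1 : ∀ᶠ w in 𝓝[≠] (τ : ℂ), f (ofComplex w) ≠ 0 := by
    rcases (han τ τ.im_pos).eventually_eq_zero_or_eventually_ne_zero with h | h
    · refine absurd ?_ h0
      simpa using han.eqOn_zero_of_preconnected_of_eventuallyEq_zero hpre τ.im_pos h τ₀.im_pos
    · exact h
  have ht : Tendsto ((↑) : ℍ → ℂ) (𝓝[≠] τ) (𝓝[≠] (τ : ℂ)) :=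
    tendsto_nhdsWithin_of_tendsto_nhds_of_eventually_within _
      (continuous_coe.continuousAt.mono_left nhdsWithin_le_nhds) <| by
        filter_upwards [self_mem_nhdsWithin] with w hw
        exact fun h => hw (UpperHalfPlane.ext h)
  filter_upwards [ht.eventually h1] with w hw
  simpa using hw

theorem differentiableOn_g₂ :
    DifferentiableOn ℂ (fun τ : ℂ => (lat (ofComplex τ)).g₂) {τ : ℂ | 0 < τ.im} := fun τ hτ =>
  ((differentiableAt_G (n := 4) (by norm_num) hτ).const_mul 60).differentiableWithinAt

theorem differentiableOn_g₃ :
    DifferentiableOn ℂ (fun τ : ℂ => (lat (ofComplex τ)).g₃) {τ : ℂ | 0 < τ.im} := fun τ hτ =>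
  ((differentiableAt_G (n := 6) (by norm_num) hτ).const_mul 140).differentiableWithinAt

theorem eventually_g₂_ne_zero : ∀ᶠ τ in codiscrete ℍ, (lat τ).g₂ ≠ 0 :=
  eventually_codiscrete_ne_zero_of_holomorphic differentiableOn_g₂ g₂_I_ne_zero

theorem eventually_g₃_ne_zero : ∀ᶠ τ in codiscrete ℍ, (lat τ).g₃ ≠ 0 :=
  eventually_codiscrete_ne_zero_of_holomorphic differentiableOn_g₃ g₃_rhoPt_ne_zero

theorem Surface.degX_ne_zero (S : Surface) : S.degX ≠ 0 := by
  cases S <;> simp [Surface.degX]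

theorem Surface.degX_le (S : Surface) : S.degX ≤ 4 := by
  cases S <;> simp [Surface.degX]

theorem IsUniformization.eventually_fiberPoint {S : Surface} {r : Fin S.numParams → RatFunc ℂ}
    {x y : ℂ × ℍ → ℂ} {s : ℍ → ℂ} (h : IsUniformization S r x y s) :
    ∀ᶠ τ in codiscrete ℍ, ∀ᶠ u in codiscrete ℂ, ∃ t : FiberPoint (S.params r),
      t.G = (lat τ).g₂ ^ 3 / (lat τ).g₃ ^ 2 ∧ t.P = ℘[lat τ] u * (lat τ).g₂ / (lat τ).g₃ ∧
      t.x = x (u, τ) ∧ t.y = y (u, τ) := by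
  filter_upwards [h.fiber, eventually_g₂_ne_zero, eventually_g₃_ne_zero] with τ ⟨hq, hu⟩ h₂ h₃
  have hcu := hu.isCurveUniformization
  have hc := Surface.coeffC_ne_zero hq.1
  obtain ⟨ξ, α, γ, β, hnf, hev⟩ := hcu.exists_normalForm hc S.degX_ne_zero S.degX_le
  filter_upwards [hev, eventually_affine_ne_zero (lat τ) (ξ := ξ) (γ := γ) hnf.α_ne,
    hcu.eventually_good hc] with u hu1 hu2 hu3
  exact exists_fiberPoint hq.1 h₂ h₃ hnf hu2 hu1.1
    (hcu.mapsTo u hu3.1 hu3.2.1 hu3.2.2.1 hu3.2.2.2)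

end DiskPotential

end

/-! ### Modularity of all uniformizations of a subfamily -/

noncomputable section

namespace DiskPotential

open Filter Topology Polynomial PeriodPair

/-! ### Homogenization by Jacobi forms -/

/-- The form `(g₃²)^d (ϑ g₃)^d h(g₂³/g₃², ℘ g₂/g₃)`. -/
def homForm (d : ℕ) (h : ℂ[X][X]) (p : ℂ × ℍ) : ℂ :=
  ∑ k ∈ Finset.range (d + 1), ∑ j ∈ Finset.range (d + 1), (h.coeff k).coeff j *
    (((lat p.2).g₂ ^ 3) ^ j * ((lat p.2).g₃ ^ 2) ^ (d - j) *
      ((wpForm p * (lat p.2).g₂) ^ k * (thetaForm p * (lat p.2).g₃) ^ (d - k)))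

/-- g₂³ and g₃² both have weight 12 and index 0; ϑ⁸℘g₂ and ϑ⁸g₃ both have weight 10 and index 4. So
all monomials have weight 22d and index 4d. -/
theorem isWeakJacobiForm_homForm (d : ℕ) (h : ℂ[X][X]) :
    IsWeakJacobiForm ⊤ (22 * d) (4 * d) (homForm d h) := by
  refine IsWeakJacobiForm.sum _ fun k hk => IsWeakJacobiForm.sum _ fun j hj =>
    IsWeakJacobiForm.const_mul ?_ _
  have hk' : k ≤ d := Nat.lt_succ_iff.mp (Finset.mem_range.mp hk)
  have hj' : j ≤ d := Nat.lt_succ_iff.mp (Finset.mem_range.mp hj)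
  have := ((((isWeakJacobiForm_g₂.pow 3).pow j).mul ((isWeakJacobiForm_g₃.pow 2).pow (d - j))).mul
    (((isWeakJacobiForm_wpForm.mul isWeakJacobiForm_g₂).pow k).mul
      ((isWeakJacobiForm_thetaForm.mul isWeakJacobiForm_g₃).pow (d - k))))
  convert this using 1 <;> (push_cast [Nat.cast_sub hk', Nat.cast_sub hj']; ring)

theorem homForm_eq {d : ℕ} {h : ℂ[X][X]} (hd : h.natDegree ≤ d)
    (hd' : ∀ k, (h.coeff k).natDegree ≤ d) {u : ℂ} {τ : ℍ} (h₃ : (lat τ).g₃ ≠ 0) :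
    homForm d h (u, τ) = ((lat τ).g₃ ^ 2) ^ d * (thetaForm (u, τ) * (lat τ).g₃) ^ d *
      h.evalEval ((lat τ).g₂ ^ 3 / (lat τ).g₃ ^ 2) (℘[lat τ] u * (lat τ).g₂ / (lat τ).g₃) := by
  rw [evalEval, eval_eq_sum_range' (Nat.lt_succ_of_le hd), eval_finsetSum, Finset.mul_sum, homForm]
  refine Finset.sum_congr rfl fun k hk => ?_
  rw [eval_mul, eval_pow, eval_C, eval_eq_sum_range' (Nat.lt_succ_of_le (hd' k)), Finset.sum_mul,
    Finset.mul_sum]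
  refine Finset.sum_congr rfl fun j hj => ?_
  obtain ⟨k', rfl⟩ := Nat.exists_eq_add_of_le (Nat.lt_succ_iff.mp (Finset.mem_range.mp hk))
  obtain ⟨j', hj'⟩ := Nat.exists_eq_add_of_le (Nat.lt_succ_iff.mp (Finset.mem_range.mp hj))
  have h1 : ∀ a b : ℂ, b ≠ 0 → a ^ j * b ^ (k + k' - j) = b ^ (k + k') * (a / b) ^ j := by
    intro a b hb
    rw [hj', Nat.add_sub_cancel_left, pow_add, div_pow]
    field_simp
  have h2 : ∀ a b A : ℂ, b ≠ 0 → (A * a) ^ k * (A * b) ^ (k + k' - k) =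
      (A * b) ^ (k + k') * (a / b) ^ k := by
    intro a b A hb
    rw [Nat.add_sub_cancel_left, pow_add, div_pow]
    simp only [mul_pow]
    field_simp
  simp only [wpForm]
  rw [h1 _ _ (pow_ne_zero 2 h₃), mul_assoc (thetaForm (u, τ)), h2 _ _ _ h₃]
  ring

/-- A product of nonzero elements of the domain `holoRing` is nonzero. The factors g₂³ - a g₃² do
not vanish at τ = i, where g₃ = 0. -/
theorem exists_g₂_g₃_notMem (s : Finset ℂ) : ∃ p : ℂ × ℍ, thetaForm p ≠ 0 ∧ (lat p.2).g₂ ≠ 0 ∧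
    (lat p.2).g₃ ≠ 0 ∧ (lat p.2).g₂ ^ 3 / (lat p.2).g₃ ^ 2 ∉ s := by
  classical
  have hg₂ := isWeakJacobiForm_g₂.holo
  have hg₃ := isWeakJacobiForm_g₃.holo
  set A : holoRing := ⟨thetaForm, isWeakJacobiForm_thetaForm.holo⟩
  set X₂ : holoRing := ⟨fun p => (lat p.2).g₂, hg₂⟩
  set X₃ : holoRing := ⟨fun p => (lat p.2).g₃, hg₃⟩
  set K : ℂ → holoRing := fun a => ⟨fun _ => a, (IsWeakJacobiForm.const (Γ := ⊤) a).holo⟩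
  have hne : ∀ {f : holoRing}, (∃ p, f.1 p ≠ 0) → f ≠ 0 := by
    rintro f ⟨p, hp⟩ rfl
    exact hp rfl
  have hprod : A * X₂ * X₃ * ∏ a ∈ s, (X₂ ^ 3 - K a * X₃ ^ 2) ≠ 0 := by
    refine mul_ne_zero (mul_ne_zero (mul_ne_zero (hne exists_thetaForm_ne_zero)
      (hne ⟨(0, UpperHalfPlane.I), g₂_I_ne_zero⟩)) (hne ⟨(0, rhoPt), g₃_rhoPt_ne_zero⟩)) ?_
    refine Finset.prod_ne_zero_iff.mpr fun a _ => hne ⟨(0, UpperHalfPlane.I), ?_⟩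
    change (lat UpperHalfPlane.I).g₂ ^ 3 - a * (lat UpperHalfPlane.I).g₃ ^ 2 ≠ 0
    rw [g₃_I]
    simpa using g₂_I_ne_zero
  have : ∃ p, (A * X₂ * X₃ * ∏ a ∈ s, (X₂ ^ 3 - K a * X₃ ^ 2)).1 p ≠ 0 := by
    by_contra! hcon
    exact hprod (Subtype.ext (funext hcon))
  obtain ⟨p, hp⟩ := this
  have hev : ∀ f g : holoRing, (f * g).1 p = f.1 p * g.1 p := fun f g => rfl
  rw [hev, hev, hev] at hp
  obtain ⟨h1, h4⟩ := mul_ne_zero_iff.mp hp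
  obtain ⟨h1, h3⟩ := mul_ne_zero_iff.mp h1
  obtain ⟨h1, h2⟩ := mul_ne_zero_iff.mp h1
  refine ⟨p, h1, h2, h3, fun hmem => h4 ?_⟩
  rw [← Finset.mul_prod_erase s _ hmem, hev]
  refine mul_eq_zero_of_left ?_ _
  change (lat p.2).g₂ ^ 3 - (lat p.2).g₂ ^ 3 / (lat p.2).g₃ ^ 2 * (lat p.2).g₃ ^ 2 = 0
  have h3' : (lat p.2).g₃ ≠ 0 := h3
  field_simp
  ring

/-- G and P are algebraically independent: choose τ so that the leading coefficient does not vanish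
at G, then u so that P avoids the finitely many roots. -/
theorem exists_homForm_ne_zero {d : ℕ} {h : ℂ[X][X]} (h0 : h ≠ 0) (hd : h.natDegree ≤ d)
    (hd' : ∀ k, (h.coeff k).natDegree ≤ d) : ∃ p, homForm d h p ≠ 0 := by
  classical
  obtain ⟨⟨u₀, τ⟩, hA, h₂, h₃, hG⟩ := exists_g₂_g₃_notMem (h.leadingCoeff.roots.toFinset)
  simp only at hA h₂ h₃ hG
  set G := (lat τ).g₂ ^ 3 / (lat τ).g₃ ^ 2
  have hlc : h.leadingCoeff.eval G ≠ 0 := by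
    simpa [h0] using hG
  set hP := h.map (evalRingHom G) with hhP
  have hP0 : hP ≠ 0 := by
    intro hz
    have := congrArg (fun f => coeff f h.natDegree) hz
    simp only [hhP, coeff_map, coeff_zero] at this
    exact hlc this
  have hroots : ∀ᶠ u in codiscrete ℂ, ∀ a ∈ hP.roots.toFinset,
      ℘[lat τ] u ≠ a * (lat τ).g₃ / (lat τ).g₂ := by
    rw [Filter.eventually_all_finset]
    exact fun a _ => eventually_weierstrassP_ne _ _
  have hcont : Continuous fun u => thetaForm (u, τ) :=
    (continuousOn_univ.mp isWeakJacobiForm_thetaForm.holo.continuousOn).comp (by fun_prop)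
  obtain ⟨u, hu1, hu2⟩ := frequently_codiscrete_of_mem_nhds hroots u₀
    (hcont.continuousAt.eventually_ne hA)
  refine ⟨(u, τ), ?_⟩
  rw [homForm_eq hd hd' h₃]
  refine mul_ne_zero (mul_ne_zero (pow_ne_zero _ (pow_ne_zero 2 h₃))
    (pow_ne_zero _ (mul_ne_zero hu1 h₃))) ?_
  intro hz
  rw [← map_evalRingHom_eval] at hz
  refine hu2 (℘[lat τ] u * (lat τ).g₂ / (lat τ).g₃) ?_ (by field_simp)
  simp only [Multiset.mem_toFinset, mem_roots hP0]
  exact hz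

/-- An algebraic equation over `ℂ[g₂³/g₃², ℘ g₂/g₃]` is one over the weak Jacobi forms of level one
of a fixed weight and index. -/
theorem exists_weakJacobiForm_equation {F : ℂ[X][X][X]} (hF : F ≠ 0) :
    ∃ (n : ℕ) (k l : ℤ) (H : ℕ → ℂ × ℍ → ℂ), (∀ i, IsWeakJacobiForm ⊤ k l (H i)) ∧
      (∃ p, H (n + 1) p ≠ 0) ∧ ∀ (u : ℂ) (τ : ℍ) (x : ℂ), (lat τ).g₃ ≠ 0 →
        F.eval₂ (evalEvalRingHom ((lat τ).g₂ ^ 3 / (lat τ).g₃ ^ 2)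
          (℘[lat τ] u * (lat τ).g₂ / (lat τ).g₃)) x = 0 →
        ∑ i ∈ Finset.range (n + 2), H i (u, τ) * x ^ i = 0 := by
  -- F may be constant in its outer variable; the factor X guarantees positive degree, so that there
  -- is a leading index n + 1.
  set F' := F * X with hF'
  have hdeg : F'.natDegree = F.natDegree + 1 := natDegree_mul_X hF
  have hF'0 : F' ≠ 0 := mul_ne_zero hF X_ne_zero
  obtain ⟨d, hd⟩ : ∃ d, ∀ i ∈ F'.support, (F'.coeff i).natDegree ≤ d ∧
      ∀ k ∈ (F'.coeff i).support, ((F'.coeff i).coeff k).natDegree ≤ d := by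
    refine ⟨F'.support.sup fun i => max (F'.coeff i).natDegree
      ((F'.coeff i).support.sup fun k => ((F'.coeff i).coeff k).natDegree), fun i hi => ?_⟩
    have h1 := Finset.le_sup (f := fun i => max (F'.coeff i).natDegree
      ((F'.coeff i).support.sup fun k => ((F'.coeff i).coeff k).natDegree)) hi
    refine ⟨(le_max_left _ _).trans h1, fun k hk => ?_⟩
    exact (Finset.le_sup (f := fun k => ((F'.coeff i).coeff k).natDegree) hk).trans
      ((le_max_right _ _).trans h1)
  have hd1 : ∀ i, (F'.coeff i).natDegree ≤ d := fun i => by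
    by_cases hi : i ∈ F'.support
    · exact (hd i hi).1
    · simp [notMem_support_iff.mp hi]
  have hd2 : ∀ i k, ((F'.coeff i).coeff k).natDegree ≤ d := fun i k => by
    by_cases hi : i ∈ F'.support
    · by_cases hk : k ∈ (F'.coeff i).support
      · exact (hd i hi).2 k hk
      · simp [notMem_support_iff.mp hk]
    · simp [notMem_support_iff.mp hi]
  refine ⟨F.natDegree, _, _, fun i => homForm d (F'.coeff i),
    fun i => isWeakJacobiForm_homForm d _, ?_, fun u τ x h₃ hx => ?_⟩
  · refine exists_homForm_ne_zero ?_ (hd1 _) (hd2 _)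
    rw [← hdeg]
    exact leadingCoeff_ne_zero.mpr hF'0
  · have h1 : F'.eval₂ (evalEvalRingHom ((lat τ).g₂ ^ 3 / (lat τ).g₃ ^ 2)
        (℘[lat τ] u * (lat τ).g₂ / (lat τ).g₃)) x = 0 := by
      rw [hF', eval₂_mul, hx, zero_mul]
    rw [eval₂_eq_sum_range, hdeg] at h1
    simp only [homForm_eq (hd1 _) (hd2 _) h₃, mul_assoc]
    rw [← Finset.mul_sum, ← Finset.mul_sum]
    have h2 : ∑ i ∈ Finset.range (F.natDegree + 2), (F'.coeff i).evalEval
        ((lat τ).g₂ ^ 3 / (lat τ).g₃ ^ 2) (℘[lat τ] u * (lat τ).g₂ / (lat τ).g₃) * x ^ i = 0 := h1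
    rw [h2, mul_zero, mul_zero]

/-! ### Modularity of uniformizations -/

theorem IsMeromorphicJacobiForm.mono {Γ Γ' : Subgroup SL(2, ℤ)} {k l : ℤ} {Φ : ℂ × ℍ → ℂ}
    (h : IsMeromorphicJacobiForm Γ k l Φ) (hΓ : Γ' ≤ Γ) : IsMeromorphicJacobiForm Γ' k l Φ := by
  obtain ⟨k', l', N, D, hN, hD, hW⟩ := h
  exact ⟨k', l', N, D, hN.mono hΓ, hD.mono hΓ, hW⟩

/-- Functions which are algebraic in this uniform way are modular for one group. -/
theorem exists_subgroup_of_algebraic {F : ℂ[X][X][X]} (hF : F ≠ 0) :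
    ∃ Γ : Subgroup SL(2, ℤ), Γ.FiniteIndex ∧ ∀ x : ℂ × ℍ → ℂ, IsMeromorphic x →
      (∀ᶠ τ in codiscrete ℍ, ∀ (a b : ℤ) (u : ℂ), x (latticeShift a b (u, τ)) = x (u, τ)) →
      (∀ᶠ τ in codiscrete ℍ, ∀ᶠ u in codiscrete ℂ,
        F.eval₂ (evalEvalRingHom ((lat τ).g₂ ^ 3 / (lat τ).g₃ ^ 2)
          (℘[lat τ] u * (lat τ).g₂ / (lat τ).g₃)) (x (u, τ)) = 0) →
      IsMeromorphicJacobiForm Γ 0 0 x := by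
  obtain ⟨n, k, l, H, hH, hne, heq⟩ := exists_weakJacobiForm_equation hF
  refine ⟨monodromyKernel hH n, finiteIndex_monodromyKernel hH, fun x hx hell hxF =>
    isMeromorphicJacobiForm_of_algebraic hH hne hx hell ?_⟩
  filter_upwards [hxF, eventually_g₃_ne_zero] with τ hτ h₃
  filter_upwards [hτ] with u hu
  exact heq u τ _ h₃ hu

theorem exists_subgroup (S : Surface) (r : Fin S.numParams → RatFunc ℂ) :
    ∃ Γ : Subgroup SL(2, ℤ), Γ.FiniteIndex ∧ ∀ (x y : ℂ × ℍ → ℂ) (s : ℍ → ℂ),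
      IsUniformization S r x y s →
        IsMeromorphicJacobiForm Γ 0 0 x ∧ IsMeromorphicJacobiForm Γ 0 0 y := by
  obtain ⟨F, hF, hFx⟩ := FiberPoint.exists_polynomial_x (D := S.params r)
  obtain ⟨F', hF', hFy⟩ := FiberPoint.exists_polynomial_y (D := S.params r)
  obtain ⟨Γ, hΓ, h⟩ := exists_subgroup_of_algebraic hF
  obtain ⟨Γ', hΓ', h'⟩ := exists_subgroup_of_algebraic hF'
  refine ⟨Γ ⊓ Γ', inferInstance, fun x y s hu => ⟨(h x hu.mero_x ?_ ?_).mono inf_le_left,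
    (h' y hu.mero_y ?_ ?_).mono inf_le_right⟩⟩
  · exact hu.fiber.mono fun τ hτ a b u => hτ.2.periodic_x a b u
  · filter_upwards [hu.eventually_fiberPoint] with τ hτ
    filter_upwards [hτ] with u hu
    obtain ⟨t, h1, h2, h3, -⟩ := hu
    rw [← h1, ← h2, ← h3]
    exact hFx t
  · exact hu.fiber.mono fun τ hτ a b u => hτ.2.periodic_y a b u
  · filter_upwards [hu.eventually_fiberPoint] with τ hτ
    filter_upwards [hτ] with u hu
    obtain ⟨t, h1, h2, -, h4⟩ := hu
    rw [← h1, ← h2, ← h4]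
    exact hFy t

/-! ### The disk potential -/

theorem exp_mul_diskPotential {x y : ℂ × ℍ → ℂ} {V : Set (ℂ × ℍ)} {W : ℂ × ℍ → ℂ}
    (h : IsSuperpotential x y V W) {p : ℂ × ℍ} (hp : p ∈ V) (hd : derivU x p ≠ 0) :
    Complex.exp (x p * diskPotential x W p) = y p := by
  obtain ⟨-, -, -, hne, logy, -, hexp, hW⟩ := h
  have h1 : derivU W p = logy p * derivU x p / x p := (hW p hp).deriv
  have hx := (hne p hp).1
  rw [diskPotential, h1, ← hexp p hp]
  congr 1
  field_simp

end DiskPotential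

end

/-! ### From normal forms to uniformizations -/

noncomputable section

namespace DiskPotential

open Filter Topology PeriodPair

/-! ### The uniformization of a curve in normal form -/

theorem eventuallyEq_nhds_of_meromorphicNFAt {f g : ℂ → ℂ} {u : ℂ} (hf : MeromorphicNFAt f u)
    (hg : MeromorphicNFAt g u) (h : f =ᶠ[codiscrete ℂ] g) : f =ᶠ[𝓝 u] g :=
  (hf.eventuallyEq_nhdsNE_iff_eventuallyEq_nhds hg).mp (eventually_codiscrete_iff.mp h u)

theorem exists_quarticForm_coeffs (b c : ℂ) {m : ℕ} (hm : m ≤ 4) : ∃ d₄ d₃ d₂ d₁ d₀ : ℂ,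
    ∀ N W, quarticForm b c m N W =
      d₄ * N ^ 4 + d₃ * N ^ 3 * W + d₂ * N ^ 2 * W ^ 2 + d₁ * N * W ^ 3 + d₀ * W ^ 4 := by
  simp only [quarticForm]
  interval_cases m
  · exact ⟨1 - 4 * c, 2, 1 + 2 * b, 2 * b, b ^ 2, fun N W => by ring⟩
  · exact ⟨1, 2 - 4 * c, 1 + 2 * b, 2 * b, b ^ 2, fun N W => by ring⟩
  · exact ⟨1, 2, 1 + 2 * b - 4 * c, 2 * b, b ^ 2, fun N W => by ring⟩
  · exact ⟨1, 2, 1 + 2 * b, 2 * b - 4 * c, b ^ 2, fun N W => by ring⟩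
  · exact ⟨1, 2, 1 + 2 * b, 2 * b, b ^ 2 - 4 * c, fun N W => by ring⟩

/-- The right side of the normal form is cubic in X, so the coefficient α⁴ · quarticForm(ξ, 1) of X⁴
vanishes. The values at 0, ±1, ±2 extract it. -/
theorem IsNormalForm.leading {g₂ g₃ b c : ℂ} {m : ℕ} {ξ α γ β : ℂ} (hm : m ≤ 4)
    (h : IsNormalForm g₂ g₃ b c m ξ α γ β) : quarticForm b c m ξ 1 = 0 := by
  obtain ⟨d₄, d₃, d₂, d₁, d₀, hd⟩ := exists_quarticForm_coeffs b c hm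
  have key : ∀ X, d₄ * (ξ * (α * X + γ) + 1) ^ 4 +
      d₃ * (ξ * (α * X + γ) + 1) ^ 3 * (α * X + γ) +
      d₂ * (ξ * (α * X + γ) + 1) ^ 2 * (α * X + γ) ^ 2 +
      d₁ * (ξ * (α * X + γ) + 1) * (α * X + γ) ^ 3 + d₀ * (α * X + γ) ^ 4 -
      β ^ 2 * (4 * X ^ 3 - g₂ * X - g₃) = 0 := fun X => by
    rw [← hd, h.eq X, sub_self]
  have k0 := key 0
  have k1 := key 1
  have k2 := key (-1)
  have k3 := key 2
  have k4 := key (-2)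
  have : α ^ 4 * quarticForm b c m ξ 1 = 0 := by
    rw [hd]
    linear_combination (1 / 24) * (k3 + k4 - 4 * k1 - 4 * k2 + 6 * k0)
  exact (mul_eq_zero.mp this).resolve_left (pow_ne_zero 4 h.α_ne)

theorem order_affine_weierstrassP (L : PeriodPair) {A B : ℂ} (hA : A ≠ 0) {u : ℂ}
    (hu : u ∈ L.lattice) : meromorphicOrderAt (fun z => A * ℘[L] z + B) u = -2 := by
  have h1 : meromorphicOrderAt (fun z => A * ℘[L] z) u = -2 := by
    have := meromorphicOrderAt_mul (f := fun _ : ℂ => A) (g := ℘[L]) (x := u) (by fun_prop)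
      (by fun_prop)
    rw [L.order_weierstrassP u hu, order_eq_zero analyticAt_const hA, zero_add] at this
    exact this
  have h2 : 0 ≤ meromorphicOrderAt (fun _ : ℂ => B) u := analyticAt_const.meromorphicOrderAt_nonneg
  have h3 := meromorphicOrderAt_add_eq_left_of_lt (f₁ := fun z => A * ℘[L] z)
    (f₂ := fun _ : ℂ => B) (x := u) (by fun_prop) (lt_of_lt_of_le (by rw [h1]; decide) h2)
  rw [h1] at h3
  exact h3

/-- The functions `x, y` determined by a normal form, normalized on the discrete set of poles. -/
structure IsNormalUniformization (L : PeriodPair) (b c : ℂ) (m : ℕ) (ξ α γ β : ℂ) (x y : ℂ → ℂ) :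
    Prop where
  le : m ≤ 4
  nf : IsNormalForm L.g₂ L.g₃ b c m ξ α γ β
  nf_x : ∀ u, MeromorphicNFAt x u
  nf_y : ∀ u, MeromorphicNFAt y u
  eq_x : ∀ᶠ u in codiscrete ℂ, x u * (ξ * (α * ℘[L] u + γ) + 1) = α * ℘[L] u + γ
  eq_y : ∀ᶠ u in codiscrete ℂ, (2 * y u + (1 + x u + b * x u ^ 2)) *
    (ξ * (α * ℘[L] u + γ) + 1) ^ 2 = β * ℘'[L] u

namespace IsNormalUniformization

variable {L : PeriodPair} {b c : ℂ} {m : ℕ} {ξ α γ β : ℂ} {x y : ℂ → ℂ}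

theorem periodic (h : IsNormalUniformization L b c m ξ α γ β x y) {l : ℂ} (hl : l ∈ L.lattice)
    (u : ℂ) : x (u + l) = x u ∧ y (u + l) = y u := by
  have hN := eventually_affine_ne_zero L (ξ := ξ) (γ := γ) h.nf.α_ne
  have hP : ∀ u, ℘[L] (u + l) = ℘[L] u := fun u => L.weierstrassP_add_coe u ⟨l, hl⟩
  have hP' : ∀ u, ℘'[L] (u + l) = ℘'[L] u := fun u => L.derivWeierstrassP_add_coe u ⟨l, hl⟩
  have hx : (x ∘ (· + l)) =ᶠ[codiscrete ℂ] x := by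
    filter_upwards [h.eq_x, eventually_codiscrete_add l h.eq_x, hN] with u h1 h2 h3
    rw [hP] at h2
    exact mul_right_cancel₀ h3 (h2.trans h1.symm)
  have hy : (y ∘ (· + l)) =ᶠ[codiscrete ℂ] y := by
    filter_upwards [h.eq_y, eventually_codiscrete_add l h.eq_y, hN, hx] with u h1 h2 h3 h4
    have h4' : x (u + l) = x u := h4
    rw [hP, hP', h4'] at h2
    have := mul_right_cancel₀ (pow_ne_zero 2 h3) (h2.trans h1.symm)
    change y (u + l) = y u
    linear_combination this / 2
  exact ⟨(eventuallyEq_nhds_of_meromorphicNFAt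
      (meromorphicNFAt_comp_add_const_iff_meromorphicNFAt.mpr (h.nf_x _)) (h.nf_x u) hx).eq_of_nhds,
    (eventuallyEq_nhds_of_meromorphicNFAt
      (meromorphicNFAt_comp_add_const_iff_meromorphicNFAt.mpr (h.nf_y _)) (h.nf_y u) hy).eq_of_nhds⟩

theorem even (h : IsNormalUniformization L b c m ξ α γ β x y) (u : ℂ) : x (-u) = x u := by
  have hx : (x ∘ fun u => -u) =ᶠ[codiscrete ℂ] x := by
    filter_upwards [h.eq_x, eventually_codiscrete_neg h.eq_x,
      eventually_affine_ne_zero L (ξ := ξ) (γ := γ) h.nf.α_ne] with u h1 h2 h3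
    rw [L.weierstrassP_neg] at h2
    exact mul_right_cancel₀ h3 (h2.trans h1.symm)
  exact (eventuallyEq_nhds_of_meromorphicNFAt
    ((h.nf_x (-u)).comp_analyticAt (g := fun u => -u) (by fun_prop)) (h.nf_x u) hx).eq_of_nhds

theorem eq_x_of_analyticAt (h : IsNormalUniformization L b c m ξ α γ β x y) {u : ℂ}
    (hu : u ∉ L.lattice) (hx : AnalyticAt ℂ x u) :
    x u * (ξ * (α * ℘[L] u + γ) + 1) = α * ℘[L] u + γ := by
  have hP := L.analyticOnNhd_weierstrassP u hu
  exact eq_of_eventuallyEq_codiscrete h.eq_x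
    (ContinuousAt.mul hx.continuousAt (by have := hP.continuousAt; fun_prop))
    (by have := hP.continuousAt; fun_prop)

theorem eq_y_of_analyticAt (h : IsNormalUniformization L b c m ξ α γ β x y) {u : ℂ}
    (hu : u ∉ L.lattice) (hx : AnalyticAt ℂ x u) (hy : AnalyticAt ℂ y u) :
    (2 * y u + (1 + x u + b * x u ^ 2)) * (ξ * (α * ℘[L] u + γ) + 1) ^ 2 = β * ℘'[L] u := by
  have hP := (L.analyticOnNhd_weierstrassP u hu).continuousAt
  have hP' := (L.analyticOnNhd_derivWeierstrassP u hu).continuousAt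
  have h1 := hx.continuousAt
  have h2 := hy.continuousAt
  exact eq_of_eventuallyEq_codiscrete h.eq_y (by fun_prop) (by fun_prop)

/-- A nonzero value of x off the lattice is never 1/ξ; this distinguishes such points from lattice
points. -/
theorem mul_ne_one {X W : ℂ} (hX : X ≠ 0) (h : X * (ξ * W + 1) = W) : ξ * X ≠ 1 := fun h0 =>
  hX (by linear_combination h - W * h0)

theorem analyticAt_of_ne_zero (h : IsNormalUniformization L b c m ξ α γ β x y) {u : ℂ}
    (hu : u ∉ L.lattice) (hN : ξ * (α * ℘[L] u + γ) + 1 ≠ 0) :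
    AnalyticAt ℂ x u ∧ AnalyticAt ℂ y u := by
  have hP := L.analyticOnNhd_weierstrassP u hu
  have hP' := L.analyticOnNhd_derivWeierstrassP u hu
  have hNe := eventually_affine_ne_zero L (ξ := ξ) (γ := γ) h.nf.α_ne
  have a1 : AnalyticAt ℂ (fun u => (α * ℘[L] u + γ) / (ξ * (α * ℘[L] u + γ) + 1)) u := by
    fun_prop (disch := exact hN)
  have hx : AnalyticAt ℂ x u := a1.congr (eventuallyEq_nhds_of_meromorphicNFAt (h.nf_x u)
    a1.meromorphicNFAt (by
      filter_upwards [h.eq_x, hNe] with v h1 h2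
      rw [eq_div_iff h2, h1])).symm
  have a2 : AnalyticAt ℂ (fun u => (β * ℘'[L] u / (ξ * (α * ℘[L] u + γ) + 1) ^ 2 -
      (1 + x u + b * x u ^ 2)) / 2) u := by
    fun_prop (disch := exact pow_ne_zero 2 hN)
  exact ⟨hx, a2.congr (eventuallyEq_nhds_of_meromorphicNFAt (h.nf_y u) a2.meromorphicNFAt (by
      filter_upwards [h.eq_y, hNe] with v h1 h2
      rw [← h1, mul_div_cancel_right₀ _ (pow_ne_zero 2 h2)]; ring)).symm⟩

/-- x = W (1 - ξ x), and W has a double pole at lattice points; if x is analytic there, the other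
factor must vanish. -/
theorem mul_eq_one_of_mem (h : IsNormalUniformization L b c m ξ α γ β x y) {u : ℂ}
    (hu : u ∈ L.lattice) (hx : AnalyticAt ℂ x u) : ξ * x u = 1 := by
  by_contra hne
  have h1 : x =ᶠ[𝓝[≠] u] (fun z => α * ℘[L] z + γ) * fun z => 1 - ξ * x z := by
    filter_upwards [eventually_codiscrete_iff.mp h.eq_x u] with z hz
    simp only [Pi.mul_apply]
    linear_combination hz
  have h2 : AnalyticAt ℂ (fun z => 1 - ξ * x z) u := by fun_prop
  have h3 := meromorphicOrderAt_congr h1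
  rw [meromorphicOrderAt_mul (by fun_prop) h2.meromorphicAt,
    order_affine_weierstrassP L h.nf.α_ne hu,
    order_eq_zero h2 (sub_ne_zero.mpr (Ne.symm hne)), add_zero] at h3
  have h4 := hx.meromorphicOrderAt_nonneg
  rw [h3] at h4
  exact absurd h4 (by decide)

theorem curve_eq (h : IsNormalUniformization L b c m ξ α γ β x y) {u : ℂ}
    (hx : AnalyticAt ℂ x u) (hy : AnalyticAt ℂ y u) :
    y u ^ 2 + (1 + x u + b * x u ^ 2) * y u + c * x u ^ m = 0 := by
  refine eq_of_eventuallyEq_codiscrete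
    (f := fun u => y u ^ 2 + (1 + x u + b * x u ^ 2) * y u + c * x u ^ m) (g := fun _ => 0) ?_
    (by have := hx.continuousAt; have := hy.continuousAt; fun_prop) continuousAt_const
  filter_upwards [h.eq_x, h.eq_y, eventually_affine_ne_zero L (ξ := ξ) (γ := γ) h.nf.α_ne,
    eventually_notMem_lattice L] with u h1 h2 h3 h4
  have h5 := h.nf.eq (℘[L] u)
  rw [quarticForm_eq h.le h1, ← L.derivWeierstrassP_sq u h4] at h5
  refine mul_right_cancel₀ (pow_ne_zero 4 h3) ?_
  linear_combination ((2 * y u + (1 + x u + b * x u ^ 2)) *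
    (ξ * (α * ℘[L] u + γ) + 1) ^ 2 + β * ℘'[L] u) / 4 * h2 - h5 / 4

/-- Numerator and denominator of x both have order -2, so x has order 0. Since V N² = β℘' has order
-3 and N² has order -4, V has order 1 and vanishes at 0. -/
theorem analyticAt_zero (h : IsNormalUniformization L b c m ξ α γ β x y) (hξ : ξ ≠ 0) :
    AnalyticAt ℂ x 0 ∧ AnalyticAt ℂ y 0 ∧ ξ * x 0 = 1 ∧
      2 * y 0 + (1 + x 0 + b * x 0 ^ 2) = 0 := by
  have h0 := zero_mem L.lattice
  have hN : meromorphicOrderAt (fun u => ξ * (α * ℘[L] u + γ) + 1) 0 = -2 := by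
    have := order_affine_weierstrassP L (A := ξ * α) (B := ξ * γ + 1) (mul_ne_zero hξ h.nf.α_ne) h0
    rwa [show (fun z => ξ * α * ℘[L] z + (ξ * γ + 1)) = fun u => ξ * (α * ℘[L] u + γ) + 1 from
      funext fun z => by ring] at this
  have hx : AnalyticAt ℂ x 0 := by
    refine (h.nf_x 0).meromorphicOrderAt_nonneg_iff_analyticAt.mp ?_
    have h1 : (x * fun u => ξ * (α * ℘[L] u + γ) + 1) =ᶠ[𝓝[≠] 0] fun u => α * ℘[L] u + γ :=
      eventually_codiscrete_iff.mp h.eq_x 0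
    have h2 := meromorphicOrderAt_congr h1
    rw [meromorphicOrderAt_mul (h.nf_x 0).meromorphicAt (by fun_prop), hN,
      order_affine_weierstrassP L h.nf.α_ne h0] at h2
    generalize meromorphicOrderAt x 0 = o at h2
    cases o with
    | top => exact le_top
    | coe a =>
      have : a + -2 = -2 := WithTop.coe_injective h2
      exact_mod_cast (by omega : (0 : ℤ) ≤ a)
  have hmx := (h.nf_x 0).meromorphicAt
  have hmy := (h.nf_y 0).meromorphicAt
  set D : ℂ → ℂ := fun u => 2 * y u + (1 + x u + b * x u ^ 2) with hD
  have hmD : MeromorphicAt D 0 := by fun_prop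
  have hD1 : 0 < meromorphicOrderAt D 0 := by
    have h1 : (D * (fun u => ξ * (α * ℘[L] u + γ) + 1) ^ 2) =ᶠ[𝓝[≠] 0]
        (fun _ => β) * ℘'[L] := eventually_codiscrete_iff.mp h.eq_y 0
    have h2 := meromorphicOrderAt_congr h1
    rw [meromorphicOrderAt_mul hmD (by fun_prop), meromorphicOrderAt_pow (by fun_prop), hN,
      meromorphicOrderAt_mul (by fun_prop) (by fun_prop), order_derivWeierstrassP_zero,
      order_eq_zero analyticAt_const h.nf.β_ne] at h2
    generalize meromorphicOrderAt D 0 = o at h2 ⊢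
    cases o with
    | top => exact WithTop.coe_lt_top 0
    | coe a =>
      have : a + 2 * -2 = 0 + -3 := WithTop.coe_injective h2
      exact_mod_cast (by omega : (0 : ℤ) < a)
  have hy : AnalyticAt ℂ y 0 := by
    refine (h.nf_y 0).meromorphicOrderAt_nonneg_iff_analyticAt.mp ?_
    have e : y = (fun _ => (1 / 2 : ℂ)) * (D + fun u => -(1 + x u + b * x u ^ 2)) := by
      funext u; simp only [Pi.mul_apply, Pi.add_apply, hD]; ring
    have a1 : AnalyticAt ℂ (fun u => -(1 + x u + b * x u ^ 2)) 0 := by fun_prop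
    rw [e, meromorphicOrderAt_mul (by fun_prop) (hmD.add a1.meromorphicAt),
      order_eq_zero analyticAt_const (by norm_num), zero_add]
    exact le_trans (le_min hD1.le a1.meromorphicOrderAt_nonneg) (meromorphicOrderAt_add hmD
      a1.meromorphicAt)
  refine ⟨hx, hy, h.mul_eq_one_of_mem h0 hx, ?_⟩
  have hDa : AnalyticAt ℂ D 0 := by fun_prop
  by_contra hne
  rw [order_eq_zero hDa hne] at hD1
  exact lt_irrefl _ hD1

/-- If ξX = 1, then X is the branch value x(0), the discriminant vanishes, and u = 0 works.
Otherwise X prescribes ℘(z), and the two roots Y correspond to z and -z. -/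
theorem exists_point (h : IsNormalUniformization L b c m ξ α γ β x y) {X Y : ℂ}
    (hXY : Y ^ 2 + (1 + X + b * X ^ 2) * Y + c * X ^ m = 0) :
    ∃ u, AnalyticAt ℂ x u ∧ AnalyticAt ℂ y u ∧ x u = X ∧ y u = Y := by
  by_cases hξX : ξ * X = 1
  · have hξ : ξ ≠ 0 := left_ne_zero_of_mul_eq_one hξX
    obtain ⟨h1, h2, h3, h4⟩ := h.analyticAt_zero hξ
    have hx0 : x 0 = X := mul_left_cancel₀ hξ (h3.trans hξX.symm)
    refine ⟨0, h1, h2, hx0, ?_⟩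
    have h5 := h.nf.leading h.le
    rw [quarticForm_eq h.le (show X * ξ = 1 by rw [mul_comm, hξX])] at h5
    have h6 := (mul_eq_zero.mp h5).resolve_right (pow_ne_zero 4 hξ)
    have h7 : (2 * Y + (1 + X + b * X ^ 2)) ^ 2 = 0 := by linear_combination 4 * hXY + h6
    rw [hx0] at h4
    linear_combination (h4 - (pow_eq_zero_iff two_ne_zero).mp h7) / 2
  · have h1X : 1 - ξ * X ≠ 0 := sub_ne_zero.mpr (Ne.symm hξX)
    obtain ⟨z, hz, hPz⟩ := weierstrassP_surjective L ((X / (1 - ξ * X) - γ) / α)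
    have hα := h.nf.α_ne
    have hW : α * ℘[L] z + γ = X / (1 - ξ * X) := by rw [hPz]; field_simp; ring
    have hN : ξ * (α * ℘[L] z + γ) + 1 = 1 / (1 - ξ * X) := by rw [hW]; field_simp; ring
    have hXW : X * (ξ * (α * ℘[L] z + γ) + 1) = α * ℘[L] z + γ := by rw [hN, hW]; ring
    have hN0 : ξ * (α * ℘[L] z + γ) + 1 ≠ 0 := by rw [hN]; exact one_div_ne_zero h1X
    have key : ∀ v ∉ L.lattice, ℘[L] v = ℘[L] z →
        (2 * Y + (1 + X + b * X ^ 2)) * (ξ * (α * ℘[L] z + γ) + 1) ^ 2 = β * ℘'[L] v →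
        ∃ u, AnalyticAt ℂ x u ∧ AnalyticAt ℂ y u ∧ x u = X ∧ y u = Y := by
      intro v hv hvz hYv
      obtain ⟨a1, a2⟩ := h.analyticAt_of_ne_zero hv (by rwa [hvz])
      have e1 := h.eq_x_of_analyticAt hv a1
      have e2 := h.eq_y_of_analyticAt hv a1 a2
      rw [hvz] at e1 e2
      have hxv : x v = X := mul_right_cancel₀ hN0 (e1.trans hXW.symm)
      refine ⟨v, a1, a2, hxv, ?_⟩
      rw [hxv] at e2
      have := mul_right_cancel₀ (pow_ne_zero 2 hN0) (e2.trans hYv.symm)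
      linear_combination this / 2
    have hsq := h.nf.eq (℘[L] z)
    rw [quarticForm_eq h.le hXW, ← L.derivWeierstrassP_sq z hz] at hsq
    have hpm : ((2 * Y + (1 + X + b * X ^ 2)) * (ξ * (α * ℘[L] z + γ) + 1) ^ 2 - β * ℘'[L] z) *
        ((2 * Y + (1 + X + b * X ^ 2)) * (ξ * (α * ℘[L] z + γ) + 1) ^ 2 + β * ℘'[L] z) = 0 := by
      linear_combination hsq + 4 * (ξ * (α * ℘[L] z + γ) + 1) ^ 4 * hXY
    rcases mul_eq_zero.mp hpm with h1 | h1
    · exact key z hz rfl (sub_eq_zero.mp h1)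
    · refine key (-z) (fun h => hz (by simpa using neg_mem h)) (L.weierstrassP_neg z) ?_
      rw [L.derivWeierstrassP_neg]
      linear_combination h1

/-- Off the lattice x determines ℘ and y then determines ℘'. In the case v ≡ -u, equality of ℘'
makes it zero, so u is a half period and again v ≡ u. -/
theorem sub_mem (h : IsNormalUniformization L b c m ξ α γ β x y) {u v : ℂ}
    (hxu : AnalyticAt ℂ x u) (hyu : AnalyticAt ℂ y u) (hxv : AnalyticAt ℂ x v)
    (hyv : AnalyticAt ℂ y v) (h0 : x u ≠ 0) (hx : x v = x u) (hy : y v = y u) :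
    v - u ∈ L.lattice := by
  by_cases hu : u ∈ L.lattice <;> by_cases hv : v ∈ L.lattice
  · exact _root_.sub_mem hv hu
  · have h1 := h.mul_eq_one_of_mem hu hxu
    rw [← hx] at h1 h0
    exact absurd h1 (mul_ne_one h0 (h.eq_x_of_analyticAt hv hxv))
  · have h1 := h.mul_eq_one_of_mem hv hxv
    rw [hx] at h1
    exact absurd h1 (mul_ne_one h0 (h.eq_x_of_analyticAt hu hxu))
  · have e1 := h.eq_x_of_analyticAt hu hxu
    have e2 := h.eq_x_of_analyticAt hv hxv
    have e3 := h.eq_y_of_analyticAt hu hxu hyu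
    have e4 := h.eq_y_of_analyticAt hv hxv hyv
    rw [hx] at e2
    rw [hx, hy] at e4
    have hne := mul_ne_one h0 e1
    have hW : α * ℘[L] v + γ = α * ℘[L] u + γ := by
      refine mul_left_cancel₀ (sub_ne_zero.mpr hne) ?_
      linear_combination e2 - e1
    have hP : ℘[L] v = ℘[L] u := mul_left_cancel₀ h.nf.α_ne (add_right_cancel hW)
    rw [hP, e3] at e4
    have hP' : ℘'[L] u = ℘'[L] v := mul_left_cancel₀ h.nf.β_ne e4
    rcases weierstrassP_eq_imp L hv hu hP with h1 | h1
    · exact h1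
    · refine sub_mem_lattice_of_derivWeierstrassP_eq_zero L hv hu hP ?_
      have h2 := L.derivWeierstrassP_add_coe (-u) ⟨v + u, h1⟩
      simp only [neg_add_cancel_comm_assoc, L.derivWeierstrassP_neg] at h2
      rw [← hP'] at h2
      linear_combination h2 / 2

theorem ramified (h : IsNormalUniformization L b c m ξ α γ β x y) :
    (AnalyticAt ℂ x 0 ∧ deriv x 0 = 0) ∨ meromorphicOrderAt x 0 ≤ ((-2 : ℤ) : WithTop ℤ) := by
  by_cases hξ : ξ = 0
  · right
    have h1 : x =ᶠ[𝓝[≠] 0] fun u => α * ℘[L] u + γ := by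
      filter_upwards [eventually_codiscrete_iff.mp h.eq_x 0] with u hu
      simpa [hξ] using hu
    rw [meromorphicOrderAt_congr h1, order_affine_weierstrassP L h.nf.α_ne (zero_mem _)]
    exact le_rfl
  · left
    refine ⟨(h.analyticAt_zero hξ).1, ?_⟩
    have h1 : (fun u => x (-u)) = x := funext h.even
    have h2 := deriv_comp_neg x 0
    rw [h1, neg_zero] at h2
    linear_combination h2 / 2

end IsNormalUniformization

theorem IsNormalUniformization.uniformizesCurve {S : Surface} {q : Fin S.numParams → ℂ} {τ : ℍ}
    {ξ α γ β : ℂ} {x y : ℂ → ℂ}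
    (h : IsNormalUniformization (lat τ) (S.coeffB q) (S.coeffC q) S.degX ξ α γ β x y) :
    UniformizesCurve S q τ x y where
  mero_x u _ := (h.nf_x u).meromorphicAt
  mero_y u _ := (h.nf_y u).meromorphicAt
  periodic_x m n u := by
    rw [add_assoc]; exact (h.periodic (mem_lat.mpr ⟨m, n, rfl⟩) u).1
  periodic_y m n u := by
    rw [add_assoc]; exact (h.periodic (mem_lat.mpr ⟨m, n, rfl⟩) u).2
  mapsTo u hx hy hx0 hy0 := (mem_affineCurve S q).mpr ⟨hx0, hy0, h.curve_eq hx hy⟩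
  surj p hp := by
    obtain ⟨X, Y⟩ := p
    obtain ⟨-, -, hXY⟩ := (mem_affineCurve S q).mp hp
    obtain ⟨u, h1, h2, h3, h4⟩ := h.exists_point hXY
    exact ⟨u, h1, h2, by rw [h3, h4]⟩
  inj u v hxu hyu hxv hyv hp he := by
    obtain ⟨m, n, hmn⟩ := mem_lat.mp (h.sub_mem hxu hyu hxv hyv ((mem_affineCurve S q).mp hp).1
      (congrArg Prod.fst he) (congrArg Prod.snd he))
    exact ⟨m, n, by linear_combination hmn⟩
  ramified := h.ramified

end DiskPotential

end

noncomputable section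

namespace DiskPotential

open Filter Topology PeriodPair

/-! ### Smoothness of curves in normal form -/

/-- A double root X of the discriminant splits (W - XN)² off the quartic form. After the Möbius
substitution this is a double root of the Weierstrass cubic, against g₂³ ≠ 27 g₃². -/
theorem IsNormalForm.deriv_discriminant_ne_zero {g₂ g₃ b c : ℂ} {m : ℕ} {ξ α γ β : ℂ} (hm : m ≤ 4)
    (h : IsNormalForm g₂ g₃ b c m ξ α γ β) (hd : g₂ ^ 3 - 27 * g₃ ^ 2 ≠ 0) {X : ℂ}
    (h0 : (1 + X + b * X ^ 2) ^ 2 - 4 * (c * X ^ m) = 0) :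
    2 * (1 + X + b * X ^ 2) * (1 + 2 * b * X) - 4 * (c * (m * X ^ (m - 1))) ≠ 0 := by
  intro h1
  obtain ⟨d₄, d₃, d₂, d₁, d₀, hq⟩ := exists_quarticForm_coeffs b c hm
  have hD : ∀ x, (1 + x + b * x ^ 2) ^ 2 - 4 * (c * x ^ m) =
      d₄ + d₃ * x + d₂ * x ^ 2 + d₁ * x ^ 3 + d₀ * x ^ 4 := fun x => by
    have := quarticForm_eq (b := b) (c := c) hm (show x * 1 = x from mul_one x)
    rw [hq] at this
    linear_combination -this
  have hD' : 2 * (1 + X + b * X ^ 2) * (1 + 2 * b * X) - 4 * (c * (m * X ^ (m - 1))) =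
      d₃ + 2 * d₂ * X + 3 * d₁ * X ^ 2 + 4 * d₀ * X ^ 3 := by
    have k1 : HasDerivAt (fun x : ℂ => (1 + x + b * x ^ 2) ^ 2 - 4 * (c * x ^ m))
        (2 * (1 + X + b * X ^ 2) * (1 + 2 * b * X) - 4 * (c * (m * X ^ (m - 1)))) X := by
      have a1 := ((((hasDerivAt_id X).const_add 1).add ((hasDerivAt_pow 2 X).const_mul b)).pow 2).sub
        (((hasDerivAt_pow m X).const_mul c).const_mul 4)
      convert! a1 using 1
      simp only [Pi.add_apply, id]
      push_cast
      ring
    have k2 : HasDerivAt (fun x : ℂ => d₄ + d₃ * x + d₂ * x ^ 2 + d₁ * x ^ 3 + d₀ * x ^ 4)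
        (d₃ + 2 * d₂ * X + 3 * d₁ * X ^ 2 + 4 * d₀ * X ^ 3) X := by
      have a1 := (((((hasDerivAt_id X).const_mul d₃).const_add d₄).add
        ((hasDerivAt_pow 2 X).const_mul d₂)).add ((hasDerivAt_pow 3 X).const_mul d₁)).add
        ((hasDerivAt_pow 4 X).const_mul d₀)
      convert! a1 using 1
      push_cast
      ring
    rw [funext hD] at k1
    exact k1.unique k2
  rw [hD] at h0
  rw [hD'] at h1
  obtain ⟨e₁, he₁⟩ : ∃ e, e = d₁ + 2 * X * d₀ := ⟨_, rfl⟩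
  obtain ⟨e₂, he₂⟩ : ∃ e, e = d₂ + 2 * X * d₁ + 3 * X ^ 2 * d₀ := ⟨_, rfl⟩
  have hq' : ∀ N W, quarticForm b c m N W =
      (W - X * N) ^ 2 * (d₀ * W ^ 2 + e₁ * W * N + e₂ * N ^ 2) := fun N W => by
    rw [hq, he₁, he₂]
    linear_combination N ^ 4 * h0 + (N ^ 3 * W - X * N ^ 4) * h1
  obtain ⟨R, hR⟩ : ∃ R : ℂ → ℂ, R = fun Z => d₀ * (α * Z + γ) ^ 2 +
    e₁ * (α * Z + γ) * (ξ * (α * Z + γ) + 1) + e₂ * (ξ * (α * Z + γ) + 1) ^ 2 := ⟨_, rfl⟩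
  have hP : ∀ Z, ((1 - ξ * X) * (α * Z + γ) - X) ^ 2 * R Z =
      β ^ 2 * (4 * Z ^ 3 - g₂ * Z - g₃) := fun Z => by
    rw [← h.eq, hq', hR]
    ring
  -- Here the double root has moved to infinity: the square factor is the constant X², so the left
  -- side has degree at most two and the cubic coefficient 4β² would vanish.
  by_cases hX : ξ * X = 1
  · have k1 := hP 1
    have k2 := hP (-1)
    have k3 := hP 2
    have k4 := hP (-2)
    rw [hX, hR] at k1 k2 k3 k4
    have : β ^ 2 * 4 = 0 := by
      linear_combination (-1 / 12) * (k3 - k4 - 2 * k1 + 2 * k2)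
    exact mul_ne_zero (pow_ne_zero 2 h.β_ne) (by norm_num) this
  · have h1X : 1 - ξ * X ≠ 0 := sub_ne_zero.mpr (Ne.symm hX)
    have hα := h.α_ne
    obtain ⟨Z₀, hZ₀⟩ : ∃ Z, (1 - ξ * X) * (α * Z + γ) - X = 0 :=
      ⟨(X / (1 - ξ * X) - γ) / α, by field_simp; ring⟩
    have hβ := pow_ne_zero 2 h.β_ne
    have hroot : 4 * Z₀ ^ 3 - g₂ * Z₀ - g₃ = 0 := by
      have := hP Z₀
      rw [hZ₀, zero_pow two_ne_zero, zero_mul] at this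
      exact (mul_eq_zero.mp this.symm).resolve_left hβ
    have hderiv : 12 * Z₀ ^ 2 - g₂ = 0 := by
      have k1 : HasDerivAt (fun Z : ℂ => ((1 - ξ * X) * (α * Z + γ) - X) ^ 2 * R Z) 0 Z₀ := by
        have hRd : DifferentiableAt ℂ R Z₀ := by rw [hR]; fun_prop
        have a1 := ((((((hasDerivAt_id Z₀).const_mul α).add_const γ).const_mul
          (1 - ξ * X)).sub_const X).pow 2).mul hRd.hasDerivAt
        convert! a1 using 1
        simp only [id]
        simp [hZ₀]
      have k2 : HasDerivAt (fun Z : ℂ => β ^ 2 * (4 * Z ^ 3 - g₂ * Z - g₃))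
          (β ^ 2 * (12 * Z₀ ^ 2 - g₂)) Z₀ := by
        have a1 := (((((hasDerivAt_pow 3 Z₀).const_mul 4).sub
          ((hasDerivAt_id Z₀).const_mul g₂)).sub_const g₃)).const_mul (β ^ 2)
        convert! a1 using 1
        push_cast
        ring
      rw [funext hP] at k1
      exact (mul_eq_zero.mp (k2.unique k1)).resolve_left hβ
    refine hd ?_
    have e2 : g₂ = 12 * Z₀ ^ 2 := by linear_combination -hderiv
    have e3 : g₃ = -8 * Z₀ ^ 3 := by linear_combination -hroot + Z₀ * hderiv
    rw [e2, e3]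
    ring

/-- At a singular point ∂H/∂y = 0 makes y a double root, so the discriminant vanishes, and ∂H/∂x = 0
then makes its derivative vanish as well. -/
theorem IsNormalForm.mem_mirrorBase {S : Surface} {q : Fin S.numParams → ℂ} {τ : ℍ} {ξ α γ β : ℂ}
    (h : IsNormalForm (lat τ).g₂ (lat τ).g₃ (S.coeffB q) (S.coeffC q) S.degX ξ α γ β)
    (hq : ∀ i, q i ≠ 0) : q ∈ mirrorBase S := by
  refine ⟨hq, fun p hp => ?_⟩
  obtain ⟨X, Y⟩ := p
  obtain ⟨hX, hY, hXY⟩ := (mem_affineCurve S q).mp hp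
  by_contra! hcon
  obtain ⟨hx, hy⟩ := hcon
  set b := S.coeffB q
  set c := S.coeffC q
  set m := S.degX
  have hx1 : (fun x => mirrorH S q x Y) =
      fun x => (Y ^ 2 + (1 + x + b * x ^ 2) * Y + c * x ^ m) / Y := funext fun x => by
    rw [eq_div_iff hY, mul_comm, mul_mirrorH S q hY]
  have hx2 : HasDerivAt (fun x => mirrorH S q x Y)
      (((1 + 2 * b * X) * Y + c * (m * X ^ (m - 1))) / Y) X := by
    rw [hx1]
    have a1 := ((((((hasDerivAt_id X).const_add 1).add ((hasDerivAt_pow 2 X).const_mul b)).mul_const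
      Y).const_add (Y ^ 2)).add ((hasDerivAt_pow m X).const_mul c)).div_const Y
    convert! a1 using 1
    simp
    ring
  have hx3 : (1 + 2 * b * X) * Y + c * (m * X ^ (m - 1)) = 0 := by
    rw [hx2.deriv] at hx
    exact (div_eq_zero_iff.mp hx).resolve_right hY
  have hy1 : (fun y => mirrorH S q X y) =ᶠ[𝓝 Y]
      fun y => (y ^ 2 + (1 + X + b * X ^ 2) * y + c * X ^ m) / y := by
    filter_upwards [isOpen_ne.mem_nhds hY] with y hy
    rw [eq_div_iff hy, mul_comm, mul_mirrorH S q hy]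
  have hy2 : HasDerivAt (fun y => (y ^ 2 + (1 + X + b * X ^ 2) * y + c * X ^ m) / y)
      ((2 * Y + (1 + X + b * X ^ 2)) / Y) Y := by
    have a1 := ((((hasDerivAt_pow 2 Y).add ((hasDerivAt_id Y).const_mul
      (1 + X + b * X ^ 2))).add_const (c * X ^ m))).div (hasDerivAt_id Y) hY
    convert! a1 using 1
    simp only [id, Pi.add_apply, mul_one]
    field_simp
    push_cast
    linear_combination hXY
  have hy3 : 2 * Y + (1 + X + b * X ^ 2) = 0 := by
    have h1 : deriv (fun y => mirrorH S q X y) Y = 0 := hy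
    rw [hy1.deriv_eq, hy2.deriv] at h1
    exact (div_eq_zero_iff.mp h1).resolve_right hY
  refine h.deriv_discriminant_ne_zero S.degX_le (discr_ne_zero _) (X := X) ?_ ?_
  · linear_combination (2 * Y + (1 + X + b * X ^ 2)) * hy3 - 4 * hXY
  · linear_combination 2 * (1 + 2 * b * X) * hy3 - 4 * hx3

end DiskPotential

end

noncomputable section

namespace DiskPotential

open Filter Topology PeriodPair

/-! ### Uniformizations from families of normal forms -/

/-- Cauchy's formula writes the u-derivative as the average of t⁻¹ Φ(u + t, τ) over the unit circle,
which is holomorphic in both variables. -/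
theorem isHolomorphicOn_derivU {Φ : ℂ × ℍ → ℂ} (h : IsHolomorphicOn Φ Set.univ) :
    IsHolomorphicOn (derivU Φ) Set.univ := by
  rw [isHolomorphicOn_univ] at h ⊢
  set f : ℂ × ℂ → ℂ := fun p => Φ (p.1, ofComplex p.2) with hf
  have key : ∀ p ∈ halfSpace, derivU Φ (p.1, ofComplex p.2) =
      Real.circleAverage (fun t => t⁻¹ * f (p + t • (1, 0))) 0 1 := by
    intro p hp
    have hmem : ∀ t : ℂ, p + t • ((1, 0) : ℂ × ℂ) ∈ halfSpace := fun t => by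
      simpa [halfSpace] using hp
    have hφ : Differentiable ℂ (fun t : ℂ => f (p + t • ((1, 0) : ℂ × ℂ))) := fun t =>
      (h.differentiableAt (isOpen_halfSpace.mem_nhds (hmem t))).comp t
        (f := fun t : ℂ => p + t • ((1, 0) : ℂ × ℂ)) (by fun_prop)
    have h1 := Complex.two_pi_I_inv_smul_circleIntegral_sub_sq_inv_smul_of_differentiable
      isOpen_univ (c := 0) (w₀ := 0) (R := 1) (Set.subset_univ _) hφ.differentiableOn
      (Metric.mem_ball_self one_pos)
    have h2 : derivU Φ (p.1, ofComplex p.2) =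
        deriv (fun t : ℂ => f (p + t • ((1, 0) : ℂ × ℂ))) 0 := by
      have : (fun t : ℂ => f (p + t • ((1, 0) : ℂ × ℂ))) =
          fun t => (fun u => Φ (u, ofComplex p.2)) (p.1 + t) := by
        funext t; simp [hf]
      rw [this, deriv_comp_const_add (fun u => Φ (u, ofComplex p.2)), add_zero]
      rfl
    rw [h2, ← h1, Real.circleAverage_eq_circleIntegral one_ne_zero]
    congr 2
    funext t
    simp only [smul_eq_mul, sub_zero, sq, mul_inv, mul_assoc]
  refine DifferentiableOn.congr (fun p hp => ?_) key
  refine (differentiableAt_circleAverage (v := (1, 0)) isOpen_halfSpace h one_pos (fun t _ => ?_)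
    (k := fun t => t⁻¹) ?_).differentiableWithinAt
  · simpa [halfSpace] using hp
  · exact continuousOn_inv₀.mono fun t ht => by
      rintro rfl
      simp at ht

/-- Holomorphic functions on the upper half plane. -/
def IsHoloFun (a : ℍ → ℂ) : Prop :=
  DifferentiableOn ℂ (fun τ : ℂ => a (ofComplex τ)) {τ : ℂ | 0 < τ.im}

theorem isHolomorphicOn_snd {a : ℍ → ℂ} (h : IsHoloFun a) :
    IsHolomorphicOn (fun p => a p.2) Set.univ := by
  unfold IsHoloFun at h
  exact isHolomorphicOn_univ.mpr (h.comp differentiableOn_snd fun _ hp => hp)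

section Operations

variable {Φ Ψ : ℂ × ℍ → ℂ} {V : Set (ℂ × ℍ)}

theorem IsHolomorphicOn.mul (h : IsHolomorphicOn Φ V) (h' : IsHolomorphicOn Ψ V) :
    IsHolomorphicOn (fun p => Φ p * Ψ p) V := DifferentiableOn.mul h h'

theorem IsHolomorphicOn.add (h : IsHolomorphicOn Φ V) (h' : IsHolomorphicOn Ψ V) :
    IsHolomorphicOn (fun p => Φ p + Ψ p) V := DifferentiableOn.add h h'

theorem IsHolomorphicOn.sub (h : IsHolomorphicOn Φ V) (h' : IsHolomorphicOn Ψ V) :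
    IsHolomorphicOn (fun p => Φ p - Ψ p) V := DifferentiableOn.sub h h'

end Operations

theorem IsMeromorphic.of_div {Φ f g : ℂ × ℍ → ℂ} (hf : IsHolomorphicOn f Set.univ)
    (hg : IsHolomorphicOn g Set.univ) (h0 : ∃ p, g p ≠ 0) (h : ∀ p, g p ≠ 0 → Φ p = f p / g p) :
    IsMeromorphic Φ := fun p =>
  ⟨Set.univ, f, g, isOpen_univ, Set.mem_univ p, hf, hg, fun q _ => by
    simpa using dense_holomorphic_ne_zero hg h0 q, fun w _ => h w⟩

theorem thetaForm_eq_zero_of_mem {u : ℂ} {τ : ℍ} (h : u ∈ (lat τ).lattice) :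
    thetaForm (u, τ) = 0 := by
  obtain ⟨m, n, rfl⟩ := mem_lat.mp h
  have h1 := thetaForm_elliptic m n (0, τ)
  have h2 : thetaForm (0, τ) = 0 := by
    rw [thetaForm, oddTheta_zero]; simp
  rw [h2, mul_zero, latticeShift, zero_add] at h1
  exact h1

theorem toMeromorphicNFOn_eq_of_analyticAt {f : ℂ → ℂ} (hf : Meromorphic f) {u : ℂ}
    (hu : AnalyticAt ℂ f u) : toMeromorphicNFOn f Set.univ u = f u := by
  rw [toMeromorphicNFOn_eq_toMeromorphicNFAt (fun z _ => hf z) (Set.mem_univ u),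
    toMeromorphicNFAt_eq_self.2 hu.meromorphicNFAt]

/-- The values of `x` given by the coefficients of a normal form. -/
def moebiusX (L : PeriodPair) (ξ α γ : ℂ) (u : ℂ) : ℂ :=
  (α * ℘[L] u + γ) / (ξ * (α * ℘[L] u + γ) + 1)

/-- The values of `y` given by the coefficients of a normal form. -/
def moebiusY (L : PeriodPair) (b ξ α γ β : ℂ) (u : ℂ) : ℂ :=
  (β * ℘'[L] u / (ξ * (α * ℘[L] u + γ) + 1) ^ 2 -
    (1 + moebiusX L ξ α γ u + b * moebiusX L ξ α γ u ^ 2)) / 2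

section Moebius

variable {L : PeriodPair} {b c : ℂ} {m : ℕ} {ξ α γ β : ℂ}

theorem meromorphic_moebiusX : Meromorphic (moebiusX L ξ α γ) := by
  unfold moebiusX
  fun_prop

theorem meromorphic_moebiusY : Meromorphic (moebiusY L b ξ α γ β) := by
  have := meromorphic_moebiusX (L := L) (ξ := ξ) (α := α) (γ := γ)
  unfold moebiusY
  fun_prop

theorem analyticAt_moebius {u : ℂ} (hu : u ∉ L.lattice) (hN : ξ * (α * ℘[L] u + γ) + 1 ≠ 0) :
    AnalyticAt ℂ (moebiusX L ξ α γ) u ∧ AnalyticAt ℂ (moebiusY L b ξ α γ β) u := by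
  have hP := L.analyticOnNhd_weierstrassP u hu
  have hP' := L.analyticOnNhd_derivWeierstrassP u hu
  have hx : AnalyticAt ℂ (moebiusX L ξ α γ) u := by
    unfold moebiusX
    fun_prop (disch := exact hN)
  refine ⟨hx, ?_⟩
  unfold moebiusY
  fun_prop (disch := exact pow_ne_zero 2 hN)

theorem IsNormalForm.isNormalUniformization (hm : m ≤ 4)
    (h : IsNormalForm L.g₂ L.g₃ b c m ξ α γ β) :
    IsNormalUniformization L b c m ξ α γ β (toMeromorphicNFOn (moebiusX L ξ α γ) Set.univ)
      (toMeromorphicNFOn (moebiusY L b ξ α γ β) Set.univ) where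
  le := hm
  nf := h
  nf_x u := meromorphicNFOn_toMeromorphicNFOn _ _ (Set.mem_univ u)
  nf_y u := meromorphicNFOn_toMeromorphicNFOn _ _ (Set.mem_univ u)
  eq_x := by
    filter_upwards [eventually_affine_ne_zero L (ξ := ξ) (γ := γ) h.α_ne,
      eventually_notMem_lattice L] with u h1 h2
    rw [toMeromorphicNFOn_eq_of_analyticAt meromorphic_moebiusX (analyticAt_moebius (b := b)
      (β := β) h2 h1).1]
    exact div_mul_cancel₀ _ h1
  eq_y := by
    filter_upwards [eventually_affine_ne_zero L (ξ := ξ) (γ := γ) h.α_ne,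
      eventually_notMem_lattice L] with u h1 h2
    have ha := analyticAt_moebius (b := b) (β := β) h2 h1
    rw [toMeromorphicNFOn_eq_of_analyticAt meromorphic_moebiusX ha.1,
      toMeromorphicNFOn_eq_of_analyticAt meromorphic_moebiusY ha.2]
    have : 2 * moebiusY L b ξ α γ β u + (1 + moebiusX L ξ α γ u + b * moebiusX L ξ α γ u ^ 2) =
        β * ℘'[L] u / (ξ * (α * ℘[L] u + γ) + 1) ^ 2 := by
      rw [moebiusY]; ring
    rw [this, div_mul_cancel₀ _ (pow_ne_zero 2 h1)]

end Moebius

section Family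

variable {ξ α γ β b : ℍ → ℂ}

/-- The numerator of `moebiusX`, multiplied by the theta form. -/
def moebiusNum (α γ : ℍ → ℂ) (p : ℂ × ℍ) : ℂ := α p.2 * wpForm p + γ p.2 * thetaForm p

/-- The denominator of `moebiusX`, multiplied by the theta form. -/
def moebiusDen (ξ α γ : ℍ → ℂ) (p : ℂ × ℍ) : ℂ := ξ p.2 * moebiusNum α γ p + thetaForm p

theorem moebiusNum_eq (p : ℂ × ℍ) :
    moebiusNum α γ p = thetaForm p * (α p.2 * ℘[lat p.2] p.1 + γ p.2) := by
  simp only [moebiusNum, wpForm]; ring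

theorem moebiusDen_eq (p : ℂ × ℍ) : moebiusDen ξ α γ p =
    thetaForm p * (ξ p.2 * (α p.2 * ℘[lat p.2] p.1 + γ p.2) + 1) := by
  simp only [moebiusDen, moebiusNum_eq]; ring

theorem isHolomorphicOn_thetaForm : IsHolomorphicOn thetaForm Set.univ :=
  isWeakJacobiForm_thetaForm.holo

theorem isHolomorphicOn_wpForm : IsHolomorphicOn wpForm Set.univ := isWeakJacobiForm_wpForm.holo

theorem isHolomorphicOn_moebiusNum
    (hα : IsHoloFun α)
    (hγ : IsHoloFun γ) :
    IsHolomorphicOn (moebiusNum α γ) Set.univ :=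
  ((isHolomorphicOn_snd hα).mul isHolomorphicOn_wpForm).add
    ((isHolomorphicOn_snd hγ).mul isHolomorphicOn_thetaForm)

theorem isHolomorphicOn_moebiusDen
    (hξ : IsHoloFun ξ)
    (hα : IsHoloFun α)
    (hγ : IsHoloFun γ) :
    IsHolomorphicOn (moebiusDen ξ α γ) Set.univ :=
  ((isHolomorphicOn_snd hξ).mul (isHolomorphicOn_moebiusNum hα hγ)).add isHolomorphicOn_thetaForm

theorem exists_moebiusDen_ne_zero (hα0 : ∀ᶠ τ in codiscrete ℍ, α τ ≠ 0) :
    ∃ p, thetaForm p ≠ 0 ∧ moebiusDen ξ α γ p ≠ 0 := by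
  have hAc : Continuous thetaForm := by
    simpa using IsHolomorphicOn.continuousOn isHolomorphicOn_thetaForm
  have hdense : Dense {p : ℂ × ℍ | ξ p.2 * (α p.2 * ℘[lat p.2] p.1 + γ p.2) + 1 ≠ 0} :=
    dense_of_eventually (P := fun p => ξ p.2 * (α p.2 * ℘[lat p.2] p.1 + γ p.2) + 1 ≠ 0)
      (by filter_upwards [hα0] with τ hτ using eventually_affine_ne_zero (lat τ) hτ)
  obtain ⟨p₀, hp₁, hp₂⟩ := hdense.inter_open_nonempty {p | thetaForm p ≠ 0}
    (isOpen_ne.preimage hAc) exists_thetaForm_ne_zero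
  exact ⟨p₀, hp₁, by rw [moebiusDen_eq]; exact mul_ne_zero hp₁ hp₂⟩

theorem notMem_lattice_of_ne_zero {p : ℂ × ℍ} (h1 : thetaForm p ≠ 0)
    (h2 : moebiusDen ξ α γ p ≠ 0) : p.1 ∉ (lat p.2).lattice ∧
      ξ p.2 * (α p.2 * ℘[lat p.2] p.1 + γ p.2) + 1 ≠ 0 :=
  ⟨fun h => h1 (thetaForm_eq_zero_of_mem h), fun h => h2 (by rw [moebiusDen_eq, h, mul_zero])⟩

theorem isMeromorphic_moebiusX
    (hξ : IsHoloFun ξ)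
    (hα : IsHoloFun α)
    (hγ : IsHoloFun γ)
    (hα0 : ∀ᶠ τ in codiscrete ℍ, α τ ≠ 0) :
    IsMeromorphic (fun p : ℂ × ℍ =>
      toMeromorphicNFOn (moebiusX (lat p.2) (ξ p.2) (α p.2) (γ p.2)) Set.univ p.1) := by
  obtain ⟨p₀, hp₀, hp₀'⟩ := exists_moebiusDen_ne_zero (ξ := ξ) (γ := γ) hα0
  -- The extra factor ϑ⁸ in numerator and denominator makes the denominator vanish at lattice
  -- points, where the formula for x is not available.
  refine IsMeromorphic.of_div (isHolomorphicOn_thetaForm.mul (isHolomorphicOn_moebiusNum hα hγ))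
    (isHolomorphicOn_thetaForm.mul (isHolomorphicOn_moebiusDen hξ hα hγ))
    ⟨p₀, mul_ne_zero hp₀ hp₀'⟩ fun p hp => ?_
  obtain ⟨h1, h2⟩ := mul_ne_zero_iff.mp hp
  obtain ⟨h3, h4⟩ := notMem_lattice_of_ne_zero h1 h2
  rw [toMeromorphicNFOn_eq_of_analyticAt meromorphic_moebiusX
    (analyticAt_moebius (b := 0) (β := 0) h3 h4).1, mul_div_mul_left _ _ h1, moebiusNum_eq,
    moebiusDen_eq, mul_div_mul_left _ _ h1, moebiusX]

theorem derivU_wpForm {p : ℂ × ℍ} (hp : p.1 ∉ (lat p.2).lattice) : derivU wpForm p =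
    derivU thetaForm p * ℘[lat p.2] p.1 + thetaForm p * ℘'[lat p.2] p.1 := by
  have hdA : DifferentiableAt ℂ (fun u => thetaForm (u, p.2)) p.1 := by
    have h5 := (differentiableAt_thetaForm (mk_mem_halfSpace p)).comp p.1
      (f := fun u : ℂ => ((u, (p.2 : ℂ)) : ℂ × ℂ)) (by fun_prop)
    simpa [Function.comp_def] using h5
  have hP := ((lat p.2).analyticOnNhd_weierstrassP p.1 hp).differentiableAt
  have := (hdA.hasDerivAt.mul hP.hasDerivAt).deriv
  rw [PeriodPair.deriv_weierstrassP] at this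
  exact this

/-- With A = ϑ⁸ and B = ϑ⁸℘ the quotient rule reads A²℘' = B_u A - B A_u, which clears the poles of
℘' by holomorphic functions already at hand. -/
theorem isMeromorphic_moebiusY
    (hξ : IsHoloFun ξ)
    (hα : IsHoloFun α)
    (hγ : IsHoloFun γ)
    (hβ : IsHoloFun β)
    (hb : IsHoloFun b)
    (hα0 : ∀ᶠ τ in codiscrete ℍ, α τ ≠ 0) :
    IsMeromorphic (fun p : ℂ × ℍ =>
      toMeromorphicNFOn (moebiusY (lat p.2) (b p.2) (ξ p.2) (α p.2) (γ p.2) (β p.2))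
        Set.univ p.1) := by
  have kA := isHolomorphicOn_thetaForm
  have kB := isHolomorphicOn_wpForm
  have kf := isHolomorphicOn_moebiusNum hα hγ
  have kg := isHolomorphicOn_moebiusDen hξ hα hγ
  obtain ⟨p₀, hp₀, hp₀'⟩ := exists_moebiusDen_ne_zero (ξ := ξ) (γ := γ) hα0
  refine IsMeromorphic.of_div (kA.mul ((((isHolomorphicOn_snd hβ).mul
    (((isHolomorphicOn_derivU kB).mul kA).sub (kB.mul (isHolomorphicOn_derivU kA)))).sub
    (kg.mul kg)).sub ((kf.mul kg).add ((isHolomorphicOn_snd hb).mul (kf.mul kf)))))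
    (kA.mul ((kg.mul kg).add (kg.mul kg)))
    ⟨p₀, mul_ne_zero hp₀ (by
      rw [← two_mul]
      exact mul_ne_zero two_ne_zero (mul_ne_zero hp₀' hp₀'))⟩ fun p hp => ?_
  obtain ⟨h1, h2'⟩ := mul_ne_zero_iff.mp hp
  rw [← two_mul] at h2'
  have h2 := (mul_ne_zero_iff.mp (mul_ne_zero_iff.mp h2').2).1
  obtain ⟨h3, h4⟩ := notMem_lattice_of_ne_zero h1 h2
  rw [toMeromorphicNFOn_eq_of_analyticAt meromorphic_moebiusY (analyticAt_moebius h3 h4).2,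
    mul_div_mul_left _ _ h1, moebiusY, moebiusX, derivU_wpForm h3, moebiusNum_eq, moebiusDen_eq,
    wpForm]
  set N := ξ p.2 * (α p.2 * ℘[lat p.2] p.1 + γ p.2) + 1
  field_simp
  ring

/-- Normal form coefficients holomorphic in τ suffice: they give joint meromorphy of x and y, and on
almost every fibre both smoothness and the bijection with the affine curve. -/
theorem exists_isUniformization {S : Surface} {r : Fin S.numParams → RatFunc ℂ} {s : ℍ → ℂ}
    (hs : MeromorphicOn (fun w : ℂ => s (ofComplex w)) {w : ℂ | 0 < w.im})
    (hξ : IsHoloFun ξ)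
    (hα : IsHoloFun α)
    (hγ : IsHoloFun γ)
    (hβ : IsHoloFun β)
    (hb : IsHoloFun b)
    (h : ∀ᶠ τ in codiscrete ℍ, (∀ i, subfamilyAt r (s τ) i ≠ 0) ∧
      S.coeffB (subfamilyAt r (s τ)) = b τ ∧
      IsNormalForm (lat τ).g₂ (lat τ).g₃ (b τ) (S.coeffC (subfamilyAt r (s τ))) S.degX
        (ξ τ) (α τ) (γ τ) (β τ)) :
    ∃ x y s, IsUniformization S r x y s := by
  have hα0 : ∀ᶠ τ in codiscrete ℍ, α τ ≠ 0 := h.mono fun τ hτ => hτ.2.2.α_ne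
  refine ⟨_, _, s, isMeromorphic_moebiusX hξ hα hγ hα0, isMeromorphic_moebiusY hξ hα hγ hβ hb hα0,
    hs, ?_⟩
  filter_upwards [h] with τ ⟨h1, h2, h3⟩
  rw [← h2] at h3
  refine ⟨h3.mem_mirrorBase h1, ?_⟩
  have := (h3.isNormalUniformization S.degX_le).uniformizesCurve
  rwa [h2] at this

end Family

end DiskPotential

end

/-! ### Existence with half periods: ℙ¹ × ℙ¹, 𝔽₁ and WP[1,1,2] -/

noncomputable section

namespace DiskPotential

open Filter Topology PeriodPair

/-! ### Holomorphic functions on the upper half plane -/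

theorem isOpen_im_pos : IsOpen {τ : ℂ | 0 < τ.im} := isOpen_lt continuous_const Complex.continuous_im

namespace IsHoloFun

variable {a b : ℍ → ℂ}

theorem const (c : ℂ) : IsHoloFun fun _ => c := differentiableOn_const c

theorem add (ha : IsHoloFun a) (hb : IsHoloFun b) : IsHoloFun fun τ => a τ + b τ :=
  DifferentiableOn.add ha hb

theorem sub (ha : IsHoloFun a) (hb : IsHoloFun b) : IsHoloFun fun τ => a τ - b τ :=
  DifferentiableOn.sub ha hb

theorem neg (ha : IsHoloFun a) : IsHoloFun fun τ => -a τ := DifferentiableOn.neg ha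

theorem mul (ha : IsHoloFun a) (hb : IsHoloFun b) : IsHoloFun fun τ => a τ * b τ :=
  DifferentiableOn.mul ha hb

theorem pow (ha : IsHoloFun a) (n : ℕ) : IsHoloFun fun τ => a τ ^ n := DifferentiableOn.pow ha n

theorem div (ha : IsHoloFun a) (hb : IsHoloFun b) (h0 : ∀ τ, b τ ≠ 0) :
    IsHoloFun fun τ => a τ / b τ :=
  DifferentiableOn.div ha hb fun _ _ => h0 _

theorem meromorphicOn (ha : IsHoloFun a) :
    MeromorphicOn (fun τ : ℂ => a (ofComplex τ)) {τ : ℂ | 0 < τ.im} := fun τ hτ =>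
  (DifferentiableOn.analyticOnNhd ha isOpen_im_pos τ hτ).meromorphicAt

/-- ℍ is simply connected, so a nowhere zero function has a continuous square root f. It is
holomorphic because its difference quotient is that of a divided by f(w) + f(τ). -/
theorem exists_pow_eq (ha : IsHoloFun a) (h0 : ∀ τ, a τ ≠ 0) :
    ∃ q : ℍ → ℂ, IsHoloFun q ∧ ∀ τ, q τ ^ 2 = a τ := by
  have hsc : IsSimplyConnected {τ : ℂ | 0 < τ.im} := by
    have : ContractibleSpace {τ : ℂ | 0 < τ.im} :=
      (convex_halfSpace_im_gt 0).contractibleSpace ⟨Complex.I, by simp⟩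
    exact SimplyConnectedSpace.ofContractible _
  obtain ⟨f, hfc, hf⟩ := Complex.exists_continuousOn_pow_eq hsc isOpen_im_pos
    (DifferentiableOn.continuousOn ha) (by rintro ⟨τ, -, h⟩; exact h0 _ h) two_ne_zero
  refine ⟨fun τ => f τ, fun τ hτ => DifferentiableAt.differentiableWithinAt ?_, fun τ => by
    simpa using hf τ⟩
  have hfd : DifferentiableAt ℂ f τ := by
    have hd := (DifferentiableOn.differentiableAt ha (isOpen_im_pos.mem_nhds hτ)).hasDerivAt
    have hc : ContinuousAt f τ := hfc.continuousAt (isOpen_im_pos.mem_nhds hτ)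
    have hne : f τ + f τ ≠ 0 := by
      rw [← two_mul]
      refine mul_ne_zero two_ne_zero fun h => h0 (ofComplex τ) ?_
      rw [← hf, h, zero_pow two_ne_zero]
    have hlim : Tendsto (fun w => f w + f τ) (𝓝[≠] τ) (𝓝 (f τ + f τ)) :=
      (hc.tendsto.mono_left nhdsWithin_le_nhds).add_const _
    refine HasDerivAt.differentiableAt (f' := deriv (fun τ : ℂ => a (ofComplex τ)) τ / (f τ + f τ))
      (hasDerivAt_iff_tendsto_slope.mpr ?_)
    refine ((hasDerivAt_iff_tendsto_slope.mp hd).div hlim hne).congr' ?_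
    filter_upwards [hlim.eventually_ne hne] with w hw
    rw [Pi.div_apply, slope_def_field, slope_def_field, ← hf, ← hf]
    field_simp
    ring
  refine hfd.congr_of_eventuallyEq ?_
  filter_upwards [isOpen_im_pos.mem_nhds hτ] with w hw
  rw [coe_ofComplex hw]

theorem weierstrassP_section (A B : ℂ) (h : ∀ τ : ℍ, A + B * (τ : ℂ) ∉ (lat τ).lattice) :
    IsHoloFun fun τ => ℘[lat τ] (A + B * τ) := by
  intro τ hτ
  refine DifferentiableAt.differentiableWithinAt ?_
  have h1 := h (ofComplex τ)
  rw [coe_ofComplex hτ] at h1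
  have h2 := (differentiableAt_weierstrassPExcept (p := (A + B * τ, τ)) hτ fun i hi he => h1
    (eq_latPt_of_mem.mpr ⟨i, by rw [coe_ofComplex hτ]; exact he⟩)).comp τ
    (f := fun τ : ℂ => ((A + B * τ, τ) : ℂ × ℂ)) (by fun_prop)
  have h3 : A + B * τ ≠ 0 := fun h0 => h1 (by rw [h0]; exact zero_mem _)
  have h4 : DifferentiableAt ℂ (fun τ : ℂ => 1 / (A + B * τ) ^ 2) τ := by
    fun_prop (disch := exact pow_ne_zero 2 h3)
  refine (h2.add h4).congr_of_eventuallyEq ?_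
  filter_upwards [isOpen_im_pos.mem_nhds hτ] with w hw
  rw [coe_ofComplex hw, weierstrassP_eq_except]
  rfl

theorem eventually_ne_zero (ha : IsHoloFun a) {τ₀ : ℍ} (h0 : a τ₀ ≠ 0) :
    ∀ᶠ τ in codiscrete ℍ, a τ ≠ 0 :=
  eventually_codiscrete_ne_zero_of_holomorphic ha h0

end IsHoloFun

/-! ### The half periods -/

/-- Fourth roots of the differences of the values of `℘` at the half periods, and a square root
of the sum of their squares. -/
structure IsHalfPeriodData (g₂ g₃ e p r n : ℂ) : Prop where
  p_ne : p ≠ 0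
  r_ne : r ≠ 0
  sq : n ^ 2 = p ^ 2 + r ^ 2
  pow_ne : p ^ 4 - r ^ 4 ≠ 0
  cubic : ∀ X, 4 * X ^ 3 - g₂ * X - g₃ = 4 * (X - e) * (X - e + p ^ 4) * (X - e + r ^ 4)

namespace IsHalfPeriodData

variable {g₂ g₃ e p r n : ℂ}

theorem ne (h : IsHalfPeriodData g₂ g₃ e p r n) :
    n ≠ 0 ∧ p + r ≠ 0 ∧ p - r ≠ 0 ∧ n + p ≠ 0 ∧ n + r ≠ 0 := by
  have h1 := h.pow_ne
  rw [show p ^ 4 - r ^ 4 = (p + r) * (p - r) * (p ^ 2 + r ^ 2) by ring, ← h.sq] at h1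
  obtain ⟨h2, h3⟩ := mul_ne_zero_iff.mp h1
  obtain ⟨h4, h5⟩ := mul_ne_zero_iff.mp h2
  have hp := pow_ne_zero 2 h.p_ne
  have hr := pow_ne_zero 2 h.r_ne
  rw [show p ^ 2 = (n + r) * (n - r) by linear_combination -h.sq] at hp
  rw [show r ^ 2 = (n + p) * (n - p) by linear_combination -h.sq] at hr
  exact ⟨fun h0 => h3 (by rw [h0]; norm_num), h4, h5, left_ne_zero_of_mul hr,
    left_ne_zero_of_mul hp⟩

theorem coeffs (h : IsHalfPeriodData g₂ g₃ e p r n) :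
    p ^ 4 + r ^ 4 = 3 * e ∧ p ^ 4 * r ^ 4 = 3 * e ^ 2 - g₂ / 4 ∧ 4 * e ^ 3 - g₂ * e = g₃ := by
  have k0 := h.cubic e
  have k1 := h.cubic (e + 1)
  have k2 := h.cubic (e - 1)
  have k3 : p ^ 4 + r ^ 4 = 3 * e := by linear_combination (2 * k0 - k1 - k2) / 8
  refine ⟨k3, ?_, by linear_combination k0⟩
  linear_combination (k2 - k1) / 8

end IsHalfPeriodData

/-- With P² = e₁ - e₂ and R² = e₁ - e₃ one has P² - R² = e₃ - e₂ ≠ 0. So P, R and P + R have no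
zeros, and their square roots p, r, n exist on all of ℍ. -/
theorem exists_halfPeriodData_of_roots {g₂ g₃ e₁ e₂ e₃ : ℍ → ℂ} (m1 : IsHoloFun e₁)
    (m2 : IsHoloFun e₂) (m3 : IsHoloFun e₃)
    (hne : ∀ τ, e₁ τ ≠ e₂ τ ∧ e₁ τ ≠ e₃ τ ∧ e₂ τ ≠ e₃ τ)
    (r1 : ∀ τ, 4 * e₁ τ ^ 3 - g₂ τ * e₁ τ - g₃ τ = 0)
    (r2 : ∀ τ, 4 * e₂ τ ^ 3 - g₂ τ * e₂ τ - g₃ τ = 0)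
    (r3 : ∀ τ, 4 * e₃ τ ^ 3 - g₂ τ * e₃ τ - g₃ τ = 0) :
    ∃ e p r n : ℍ → ℂ, IsHoloFun e ∧ IsHoloFun p ∧ IsHoloFun r ∧ IsHoloFun n ∧
      ∀ τ, IsHalfPeriodData (g₂ τ) (g₃ τ) (e τ) (p τ) (r τ) (n τ) := by
  obtain ⟨P, hP, hP2⟩ := (m1.sub m2).exists_pow_eq fun τ => sub_ne_zero.mpr (hne τ).1
  obtain ⟨R, hR, hR2⟩ := (m1.sub m3).exists_pow_eq fun τ => sub_ne_zero.mpr (hne τ).2.1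
  have hP0 : ∀ τ, P τ ≠ 0 := fun τ h => (hne τ).1 (by
    have := hP2 τ; rw [h] at this; linear_combination -this)
  have hR0 : ∀ τ, R τ ≠ 0 := fun τ h => (hne τ).2.1 (by
    have := hR2 τ; rw [h] at this; linear_combination -this)
  have hPR : ∀ τ, P τ ^ 2 - R τ ^ 2 ≠ 0 := fun τ h => (hne τ).2.2 (by
    linear_combination -h + hP2 τ - hR2 τ)
  obtain ⟨p, hp, hp2⟩ := hP.exists_pow_eq hP0
  obtain ⟨r, hr, hr2⟩ := hR.exists_pow_eq hR0
  obtain ⟨n, hn, hn2⟩ := (hP.add hR).exists_pow_eq fun τ h => hPR τ (by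
    linear_combination (P τ - R τ) * h)
  have hp4 : ∀ τ, p τ ^ 4 = e₁ τ - e₂ τ := fun τ => by
    rw [← hP2, ← hp2]; ring
  have hr4 : ∀ τ, r τ ^ 4 = e₁ τ - e₃ τ := fun τ => by
    rw [← hR2, ← hr2]; ring
  refine ⟨e₁, p, r, n, m1, hp, hr, hn, fun τ => ⟨fun h => hP0 τ (by rw [← hp2, h]; norm_num),
    fun h => hR0 τ (by rw [← hr2, h]; norm_num), by rw [hn2, hp2, hr2], ?_, fun X => ?_⟩⟩
  · rw [hp4, hr4]
    intro h
    exact (hne τ).2.2 (by linear_combination -h)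
  · obtain ⟨h1, h2, h3⟩ := cubic_eq_prod_of_roots (hne τ).1 (hne τ).2.1 (hne τ).2.2 (r1 τ) (r2 τ)
      (r3 τ)
    rw [hp4, hr4]
    linear_combination 4 * X ^ 2 * h1 - X * h2 - h3

theorem exists_halfPeriodData : ∃ e p r n : ℍ → ℂ, IsHoloFun e ∧ IsHoloFun p ∧ IsHoloFun r ∧
    IsHoloFun n ∧ ∀ τ, IsHalfPeriodData (lat τ).g₂ (lat τ).g₃ (e τ) (p τ) (r τ) (n τ) := by
  have hω : ∀ τ : ℍ, 1 / 2 + 0 * (τ : ℂ) = (lat τ).ω₁ / 2 ∧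
      0 + 1 / 2 * (τ : ℂ) = (lat τ).ω₂ / 2 ∧
      1 / 2 + 1 / 2 * (τ : ℂ) = (lat τ).ω₁ / 2 + (lat τ).ω₂ / 2 := fun τ => by
    simp only [lat]
    refine ⟨by ring, by ring, by ring⟩
  have n1 : ∀ τ : ℍ, 1 / 2 + 0 * (τ : ℂ) ∉ (lat τ).lattice := fun τ => by
    rw [(hω τ).1]; exact (lat τ).ω₁_div_two_notMem_lattice
  have n2 : ∀ τ : ℍ, 0 + 1 / 2 * (τ : ℂ) ∉ (lat τ).lattice := fun τ => by
    rw [(hω τ).2.1]; exact (lat τ).ω₂_div_two_notMem_lattice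
  have n3 : ∀ τ : ℍ, 1 / 2 + 1 / 2 * (τ : ℂ) ∉ (lat τ).lattice := fun τ => by
    rw [(hω τ).2.2]; exact half_sum_notMem_lattice _
  refine exists_halfPeriodData_of_roots (IsHoloFun.weierstrassP_section _ _ n1)
    (IsHoloFun.weierstrassP_section _ _ n2) (IsHoloFun.weierstrassP_section _ _ n3)
    (fun τ => ?_) (fun τ => half_period_root _ (n1 τ) (mem_lat.mpr ⟨0, 1, ?_⟩))
    (fun τ => half_period_root _ (n2 τ) (mem_lat.mpr ⟨1, 0, ?_⟩))
    (fun τ => half_period_root _ (n3 τ) (mem_lat.mpr ⟨1, 1, ?_⟩))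
  · rw [(hω τ).1, (hω τ).2.1, (hω τ).2.2]
    exact weierstrass_half_ne (lat τ)
  all_goals push_cast; ring

end DiskPotential

end

noncomputable section

namespace DiskPotential

open Filter Topology PeriodPair

/-! ### Normal forms from the half periods -/

namespace IsHalfPeriodData

variable {g₂ g₃ e p r n : ℂ}

/-- Since c = k², the quartic is a difference of squares, and N + W/2 = κW + 1. With H = (pr)² and Z
= X - e the first factor is 2κW + 1 = Z/H. The relation κ²H = k n⁴ turns the second into a multiple
of Z² + (n⁴ - 2H) Z + H² = (Z + p⁴)(Z + r⁴). -/
theorem isNormalForm_WP112 (h : IsHalfPeriodData g₂ g₃ e p r n) {k κ : ℂ} (hκ0 : κ ≠ 0)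
    (hκ : κ ^ 2 * (p * r) ^ 2 = k * n ^ 4) :
    IsNormalForm g₂ g₃ (1 / 4 + 2 * k - κ ^ 2) (k ^ 2) 4 (κ - 1 / 2) (1 / (2 * (p * r) ^ 2 * κ))
      (-(e + (p * r) ^ 2) / (2 * (p * r) ^ 2 * κ)) (1 / (2 * (p * r) ^ 2 * n ^ 2)) := by
  have hp := h.p_ne
  have hr := h.r_ne
  have hn := h.ne.1
  have hn2 := h.sq
  refine ⟨one_div_ne_zero (mul_ne_zero (mul_ne_zero two_ne_zero (by positivity)) hκ0),
    one_div_ne_zero (mul_ne_zero (mul_ne_zero two_ne_zero (by positivity)) (by positivity)),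
    fun X => ?_⟩
  rw [h.cubic]
  obtain ⟨Z, rfl⟩ : ∃ Z, X = Z + e := ⟨X - e, by ring⟩
  obtain ⟨W, hW⟩ : ∃ W, W = 1 / (2 * (p * r) ^ 2 * κ) * (Z + e) +
    -(e + (p * r) ^ 2) / (2 * (p * r) ^ 2 * κ) := ⟨_, rfl⟩
  have hWU : 2 * (p * r) ^ 2 * (κ * W) = Z - (p * r) ^ 2 := by
    rw [hW]; field_simp; ring
  rw [← hW]
  have e1 : quarticForm (1 / 4 + 2 * k - κ ^ 2) (k ^ 2) 4 ((κ - 1 / 2) * W + 1) W =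
      ((κ * W + 1) ^ 2 - (κ * W) ^ 2) * ((κ * W + 1) ^ 2 - (κ * W) ^ 2 + 4 * k * W ^ 2) := by
    rw [quarticForm]; ring
  have e2 : 4 * k * W ^ 2 * n ^ 4 = 4 * (p * r) ^ 2 * (κ * W) ^ 2 := by
    linear_combination -4 * W ^ 2 * hκ
  have e3 : κ * W = (Z - (p * r) ^ 2) / (2 * (p * r) ^ 2) := by
    rw [← hWU]; field_simp
  have hn4 : n ^ 4 = (p ^ 2 + r ^ 2) ^ 2 := by rw [← hn2]; ring
  have e4 : 4 * k * W ^ 2 = 4 * (p * r) ^ 2 * (κ * W) ^ 2 / n ^ 4 :=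
    eq_div_of_mul_eq (by positivity) e2
  have e5 : (1 / (2 * (p * r) ^ 2 * n ^ 2)) ^ 2 = 1 / (4 * (p * r) ^ 4 * n ^ 4) := by
    field_simp; ring
  have hs : p ^ 2 + r ^ 2 ≠ 0 := by rw [← hn2]; positivity
  rw [e1, e4, e5, e3, hn4]
  field_simp
  ring

/-- Since c = b = w², the quartic splits into N² + (1 ± 2w) NW + w²W². Both factors are diagonal in
Z - H and Z + H, where H = (pr)² and Z = X - e. From κ²(1 - 4w) = 1 one is a multiple of (Z - H)² -
(Z + H)² = -4HZ, and the other becomes a multiple of (Z + p⁴)(Z + r⁴). -/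
theorem isNormalForm_P1xP1 (h : IsHalfPeriodData g₂ g₃ e p r n) {w κ μ : ℂ}
    (hw : 2 * n ^ 2 * w = p * r) (hκ : κ * (p - r) = n) (hμ : 4 * κ * w * (p * r) ^ 2 * μ = 1 - κ) :
    IsNormalForm g₂ g₃ (w ^ 2) (w ^ 2) 2 (w * (1 + κ) / (1 - κ)) (μ * (1 - κ))
      (-(μ * (1 - κ) * e) - μ * (1 + κ) * (p * r) ^ 2)
      (2 * μ ^ 2 * w * κ * (p * r) ^ 2 / n ^ 2) := by
  have hp := h.p_ne
  have hr := h.r_ne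
  obtain ⟨hn, -, hpr, -, -⟩ := h.ne
  have hn2 := h.sq
  have hw0 : w ≠ 0 := by rintro rfl; exact mul_ne_zero hp hr (by simpa using hw.symm)
  have hκ0 : κ ≠ 0 := by rintro rfl; exact hn (by simpa using hκ.symm)
  have hκ1 : 1 - κ ≠ 0 := fun h0 => mul_ne_zero hp hr (by
    obtain rfl : κ = 1 := by linear_combination -h0
    rw [one_mul] at hκ
    rw [← hκ] at hn2
    linear_combination -hn2 / 2)
  have hμ0 : μ ≠ 0 := by rintro rfl; exact hκ1 (by simpa using hμ.symm)
  have hκ2 : κ ^ 2 * (1 - 4 * w) = 1 := by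
    have : n ^ 2 * (κ ^ 2 * (1 - 4 * w)) = n ^ 2 * 1 := by
      linear_combination -2 * κ ^ 2 * hw + κ ^ 2 * hn2 + (κ * (p - r) + n) * hκ
    exact mul_left_cancel₀ (pow_ne_zero 2 hn) this
  refine ⟨mul_ne_zero hμ0 hκ1, div_ne_zero (mul_ne_zero (mul_ne_zero (mul_ne_zero
    (mul_ne_zero two_ne_zero (by positivity)) hw0) hκ0) (by positivity)) (by positivity), fun X => ?_⟩
  rw [h.cubic]
  obtain ⟨Z, rfl⟩ : ∃ Z, X = Z + e := ⟨X - e, by ring⟩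
  set H := (p * r) ^ 2 with hH
  have hH0 : H ≠ 0 := by positivity
  obtain ⟨W, hW⟩ : ∃ W, W = μ * ((Z - H) - κ * (Z + H)) := ⟨_, rfl⟩
  have hW1 : μ * (1 - κ) * (Z + e) + (-(μ * (1 - κ) * e) - μ * (1 + κ) * H) = W := by
    rw [hW]; ring
  have hN : w * (1 + κ) / (1 - κ) * W + 1 = μ * w * ((Z - H) + κ * (Z + H)) := by
    rw [hW]
    field_simp
    linear_combination -hμ
  rw [hW1, hN, hW]
  have e1 : quarticForm (w ^ 2) (w ^ 2) 2 (μ * w * ((Z - H) + κ * (Z + H)))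
      (μ * ((Z - H) - κ * (Z + H))) = μ ^ 4 * w ^ 2 * ((Z - H) ^ 2 - κ ^ 2 * (1 - 4 * w) * (Z + H) ^ 2) *
        ((1 + 4 * w) * (Z - H) ^ 2 - κ ^ 2 * (Z + H) ^ 2) := by
    rw [quarticForm]; ring
  have e2 : 1 + 4 * w = κ ^ 2 * (1 - 16 * w ^ 2) := by
    linear_combination -(1 + 4 * w) * hκ2
  have e3 : n ^ 4 * (1 - 16 * w ^ 2) = n ^ 4 - 4 * H := by
    rw [hH]
    linear_combination -4 * (2 * n ^ 2 * w + p * r) * hw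
  have hn4 : n ^ 4 = p ^ 4 + r ^ 4 + 2 * H := by
    rw [hH]; linear_combination (n ^ 2 + p ^ 2 + r ^ 2) * hn2
  have hprod : p ^ 4 * r ^ 4 = H ^ 2 := by rw [hH]; ring
  rw [e1, hκ2, e2]
  refine mul_left_cancel₀ (pow_ne_zero 4 hn) ?_
  have e4 : n ^ 4 * ((2 * μ ^ 2 * w * κ * H / n ^ 2) ^ 2 * (4 * (Z + e - e) * (Z + e - e + p ^ 4) *
      (Z + e - e + r ^ 4))) = 16 * μ ^ 4 * w ^ 2 * κ ^ 2 * H ^ 2 * Z *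
      (Z ^ 2 + (p ^ 4 + r ^ 4) * Z + p ^ 4 * r ^ 4) := by
    field_simp; ring
  rw [e4, hprod]
  have e5 : n ^ 4 * (μ ^ 4 * w ^ 2 * ((Z - H) ^ 2 - 1 * (Z + H) ^ 2) *
      (κ ^ 2 * (1 - 16 * w ^ 2) * (Z - H) ^ 2 - κ ^ 2 * (Z + H) ^ 2)) =
      -4 * H * Z * μ ^ 4 * w ^ 2 * κ ^ 2 * ((n ^ 4 * (1 - 16 * w ^ 2)) * (Z - H) ^ 2 -
        n ^ 4 * (Z + H) ^ 2) := by ring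
  rw [e5, e3, hn4]
  ring

/-- With t = pr/n², u = (p + r)/n and v = (p - r)/n one has u² = 1 + 2t and v² = 1 - 2t. The quartic
has the roots N/W = (1 ± u)²/4 and (1 ± v)²/4. Taking ξ = (1 + u)²/4 leaves three linear factors,
proportional to Z, Z + p⁴ and Z + r⁴ with Z = X - e. -/
theorem isNormalForm_F1 (h : IsHalfPeriodData g₂ g₃ e p r n) {α : ℂ}
    (hα : α * (p * r * (n + p) * (n + r) * (p + r)) = n) :
    IsNormalForm g₂ g₃ (-(p * r) ^ 2 / (4 * n ^ 4)) 1 1 ((n + p + r) ^ 2 / (4 * n ^ 2)) α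
      (-(α * e) - n / (p + r)) (α / (2 * n ^ 2)) := by
  have hp := h.p_ne
  have hr := h.r_ne
  obtain ⟨hn, hs, -, hnp, hnr⟩ := h.ne
  have hn2 := h.sq
  have hα0 : α ≠ 0 := by rintro rfl; exact hn (by simpa using hα.symm)
  refine ⟨hα0, div_ne_zero hα0 (mul_ne_zero two_ne_zero (by positivity)), fun X => ?_⟩
  rw [h.cubic]
  obtain ⟨Z, rfl⟩ : ∃ Z, X = Z + e := ⟨X - e, by ring⟩
  obtain ⟨W, hW⟩ : ∃ W, W = α * Z - n / (p + r) := ⟨_, rfl⟩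
  have hW1 : α * (Z + e) + (-(α * e) - n / (p + r)) = W := by
    rw [hW]; ring
  rw [hW1]
  have f1 : (p + r) / n * W + 1 = α * (p + r) / n * Z := by
    rw [hW]; field_simp; ring
  have f2 : r * (n + p) / n ^ 2 * W + 1 = α * (r * (n + p)) / n ^ 2 * (Z + p ^ 4) := by
    have hαe : α = n / (p * r * (n + p) * (n + r) * (p + r)) := eq_div_of_mul_eq (by positivity) hα
    rw [hW, hαe]; field_simp
    linear_combination p ^ 2 * hn2
  have f3 : p * (n + r) / n ^ 2 * W + 1 = α * (p * (n + r)) / n ^ 2 * (Z + r ^ 4) := by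
    have hαe : α = n / (p * r * (n + p) * (n + r) * (p + r)) := eq_div_of_mul_eq (by positivity) hα
    rw [hW, hαe]; field_simp
    linear_combination r ^ 2 * hn2
  obtain ⟨t, ht⟩ : ∃ t, t = p * r / n ^ 2 := ⟨_, rfl⟩
  obtain ⟨u, hu⟩ : ∃ u, u = (p + r) / n := ⟨_, rfl⟩
  obtain ⟨v, hv⟩ : ∃ v, v = (p - r) / n := ⟨_, rfl⟩
  have hut : u ^ 2 = 1 + 2 * t := by
    rw [hu, ht]; field_simp; linear_combination -hn2
  have hvt : v ^ 2 = 1 - 2 * t := by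
    rw [hv, ht]; field_simp; linear_combination -hn2
  have e1 : quarticForm (-(p * r) ^ 2 / (4 * n ^ 4)) 1 1 ((n + p + r) ^ 2 / (4 * n ^ 2) * W + 1) W =
      ((p + r) / n * W + 1) * (r * (n + p) / n ^ 2 * W + 1) * (p * (n + r) / n ^ 2 * W + 1) := by
    have k0 : -(p * r) ^ 2 / (4 * n ^ 4) = -t ^ 2 / 4 := by rw [ht]; field_simp
    have k1 : (n + p + r) ^ 2 / (4 * n ^ 2) = (1 + u) ^ 2 / 4 := by rw [hu]; field_simp; ring
    have k2 : (p + r) / n = (1 + u) ^ 2 / 4 - (1 - u) ^ 2 / 4 := by rw [hu]; ring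
    have k3 : r * (n + p) / n ^ 2 = (1 + u) ^ 2 / 4 - (1 + v) ^ 2 / 4 := by
      rw [hu, hv]; field_simp; ring
    have k4 : p * (n + r) / n ^ 2 = (1 + u) ^ 2 / 4 - (1 - v) ^ 2 / 4 := by
      rw [hu, hv]; field_simp; ring
    rw [k0, k1, k2, k3, k4]
    obtain ⟨N, hN⟩ : ∃ N, N = (1 + u) ^ 2 / 4 * W + 1 := ⟨_, rfl⟩
    have q1 : N ^ 2 - (1 + t) * N * W + t ^ 2 / 4 * W ^ 2 =
        (N - (1 + u) ^ 2 / 4 * W) * (N - (1 - u) ^ 2 / 4 * W) := by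
      linear_combination (N * W / 2 - (u ^ 2 - 1 + 2 * t) / 16 * W ^ 2) * hut
    have q2 : N ^ 2 - (1 - t) * N * W + t ^ 2 / 4 * W ^ 2 =
        (N - (1 + v) ^ 2 / 4 * W) * (N - (1 - v) ^ 2 / 4 * W) := by
      linear_combination (N * W / 2 - (v ^ 2 - 1 - 2 * t) / 16 * W ^ 2) * hvt
    have q3 : quarticForm (-t ^ 2 / 4) 1 1 N W = (N ^ 2 - (1 + t) * N * W + t ^ 2 / 4 * W ^ 2) *
        (N ^ 2 - (1 - t) * N * W + t ^ 2 / 4 * W ^ 2) := by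
      rw [quarticForm]; ring
    rw [← hN, q3, q1, q2, hN]
    ring
  rw [e1, f1, f2, f3]
  have e2 : α * (p + r) / n * Z * (α * (r * (n + p)) / n ^ 2 * (Z + p ^ 4)) *
      (α * (p * (n + r)) / n ^ 2 * (Z + r ^ 4)) = α ^ 2 *
      (α * (p * r * (n + p) * (n + r) * (p + r))) / n ^ 5 * Z * (Z + p ^ 4) * (Z + r ^ 4) := by
    field_simp
  rw [e2, hα]
  field_simp
  ring

end IsHalfPeriodData

end DiskPotential

end

noncomputable section

namespace DiskPotential

open Filter Topology PeriodPair

/-! ### Uniformizations with half periods -/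

theorem subfamilyAt_X {S : Surface} {r : Fin S.numParams → RatFunc ℂ} {i : Fin S.numParams}
    (h : r i = RatFunc.X) (s : ℂ) : subfamilyAt r s i = s := by
  rw [subfamilyAt, h, RatFunc.eval_X]

theorem subfamilyAt_C {S : Surface} {r : Fin S.numParams → RatFunc ℂ} {i : Fin S.numParams} {c : ℂ}
    (h : r i = RatFunc.C c) (s : ℂ) : subfamilyAt r s i = c := by
  rw [subfamilyAt, h, RatFunc.eval_C, RingHom.id_apply]

theorem exists_isUniformization_P1xP1 :
    ∃ x y s, IsUniformization .P1xP1 ![RatFunc.X, RatFunc.X] x y s := by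
  obtain ⟨e, p, r, n, he, hp, hr, hn, hd⟩ := exists_halfPeriodData
  have hp0 := fun τ => (hd τ).p_ne
  have hr0 := fun τ => (hd τ).r_ne
  have hn0 := fun τ => (hd τ).ne.1
  have hpr0 := fun τ => (hd τ).ne.2.2.1
  obtain ⟨w, hw⟩ : ∃ w : ℍ → ℂ, w = fun τ => p τ * r τ / (2 * n τ ^ 2) := ⟨_, rfl⟩
  obtain ⟨κ, hκ⟩ : ∃ κ : ℍ → ℂ, κ = fun τ => n τ / (p τ - r τ) := ⟨_, rfl⟩
  have hw' : ∀ τ, 2 * n τ ^ 2 * w τ = p τ * r τ := fun τ => by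
    rw [hw]
    exact mul_div_cancel₀ _ (mul_ne_zero two_ne_zero (pow_ne_zero 2 (hn0 τ)))
  have hκ' : ∀ τ, κ τ * (p τ - r τ) = n τ := fun τ => by
    rw [hκ]
    exact div_mul_cancel₀ _ (hpr0 τ)
  have hw0 : ∀ τ, w τ ≠ 0 := fun τ h0 => by
    have := hw' τ
    rw [h0, mul_zero] at this
    exact mul_ne_zero (hp0 τ) (hr0 τ) this.symm
  have hκ0 : ∀ τ, κ τ ≠ 0 := fun τ h0 => by
    have := hκ' τ
    rw [h0, zero_mul] at this
    exact hn0 τ this.symm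
  have hκ1 : ∀ τ, 1 - κ τ ≠ 0 := fun τ h0 => mul_ne_zero (hp0 τ) (hr0 τ) (by
    have h1 := hκ' τ
    rw [show κ τ = 1 by linear_combination -h0, one_mul] at h1
    have h2 := (hd τ).sq
    rw [← h1] at h2
    linear_combination -h2 / 2)
  have hwh : IsHoloFun w := by
    rw [hw]
    exact (hp.mul hr).div ((IsHoloFun.const 2).mul (hn.pow 2)) fun τ =>
      mul_ne_zero two_ne_zero (pow_ne_zero 2 (hn0 τ))
  have hκh : IsHoloFun κ := by
    rw [hκ]
    exact hn.div (hp.sub hr) hpr0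
  have hH : IsHoloFun fun τ => (p τ * r τ) ^ 2 := (hp.mul hr).pow 2
  have hH0 : ∀ τ, (p τ * r τ) ^ 2 ≠ 0 := fun τ => pow_ne_zero 2 (mul_ne_zero (hp0 τ) (hr0 τ))
  have h1κ := (IsHoloFun.const 1).sub hκh
  have hden0 : ∀ τ, 4 * κ τ * w τ * (p τ * r τ) ^ 2 ≠ 0 := fun τ =>
    mul_ne_zero (mul_ne_zero (mul_ne_zero (by norm_num) (hκ0 τ)) (hw0 τ)) (hH0 τ)
  obtain ⟨μ, hμ⟩ : ∃ μ : ℍ → ℂ, μ = fun τ => (1 - κ τ) / (4 * κ τ * w τ * (p τ * r τ) ^ 2) :=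
    ⟨_, rfl⟩
  have hμ' : ∀ τ, 4 * κ τ * w τ * (p τ * r τ) ^ 2 * μ τ = 1 - κ τ := fun τ => by
    rw [hμ]
    exact mul_div_cancel₀ _ (hden0 τ)
  have hμh : IsHoloFun μ := by
    rw [hμ]
    exact h1κ.div ((((IsHoloFun.const 4).mul hκh).mul hwh).mul hH) hden0
  have hs : IsHoloFun fun τ => w τ ^ 2 := hwh.pow 2
  have hμκ := hμh.mul h1κ
  have hX0 : ∀ s : ℂ, subfamilyAt (S := .P1xP1) ![RatFunc.X, RatFunc.X] s (0 : Fin 2) = s :=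
    subfamilyAt_X rfl
  have hX1 : ∀ s : ℂ, subfamilyAt (S := .P1xP1) ![RatFunc.X, RatFunc.X] s (1 : Fin 2) = s :=
    subfamilyAt_X rfl
  refine exists_isUniformization (s := fun τ => w τ ^ 2) hs.meromorphicOn
    ((hwh.mul ((IsHoloFun.const 1).add hκh)).div h1κ hκ1) hμκ
    ((hμκ.mul he).neg.sub ((hμh.mul ((IsHoloFun.const 1).add hκh)).mul hH))
    ((((((IsHoloFun.const 2).mul (hμh.pow 2)).mul hwh).mul hκh).mul hH).div (hn.pow 2)
      fun τ => pow_ne_zero 2 (hn0 τ)) hs (Eventually.of_forall fun τ => ⟨?_, hX0 _, ?_⟩)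
  · refine Fin.forall_fin_two.mpr ⟨?_, ?_⟩
    · rw [hX0]; exact pow_ne_zero 2 (hw0 τ)
    · rw [hX1]; exact pow_ne_zero 2 (hw0 τ)
  · rw [show Surface.coeffC .P1xP1 (subfamilyAt ![RatFunc.X, RatFunc.X] (w τ ^ 2)) = w τ ^ 2 from
      hX1 _]
    exact (hd τ).isNormalForm_P1xP1 (hw' τ) (hκ' τ) (hμ' τ)

theorem exists_isUniformization_F1 : ∃ x y s, IsUniformization .F1 ![1, RatFunc.X] x y s := by
  obtain ⟨e, p, r, n, he, hp, hr, hn, hd⟩ := exists_halfPeriodData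
  have hp0 := fun τ => (hd τ).p_ne
  have hr0 := fun τ => (hd τ).r_ne
  have hne := fun τ => (hd τ).ne
  have hn0 := fun τ => (hd τ).ne.1
  have hden0 : ∀ τ, p τ * r τ * (n τ + p τ) * (n τ + r τ) * (p τ + r τ) ≠ 0 := fun τ =>
    mul_ne_zero (mul_ne_zero (mul_ne_zero (mul_ne_zero (hp0 τ) (hr0 τ)) (hne τ).2.2.2.1)
      (hne τ).2.2.2.2) (hne τ).2.1
  obtain ⟨α, hα⟩ : ∃ α : ℍ → ℂ, α = fun τ =>
    n τ / (p τ * r τ * (n τ + p τ) * (n τ + r τ) * (p τ + r τ)) := ⟨_, rfl⟩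
  have hαh : IsHoloFun α := by
    rw [hα]
    exact hn.div ((((hp.mul hr).mul (hn.add hp)).mul (hn.add hr)).mul (hp.add hr)) hden0
  have hα' : ∀ τ, α τ * (p τ * r τ * (n τ + p τ) * (n τ + r τ) * (p τ + r τ)) = n τ := fun τ => by
    rw [hα]
    exact div_mul_cancel₀ _ (hden0 τ)
  have h4n : ∀ (k : ℂ), k ≠ 0 → ∀ (i : ℕ) (τ : ℍ), k * n τ ^ i ≠ 0 := fun k hk i τ =>
    mul_ne_zero hk (pow_ne_zero i (hn0 τ))
  have hs : IsHoloFun fun τ => -(p τ * r τ) ^ 2 / (4 * n τ ^ 4) :=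
    ((hp.mul hr).pow 2).neg.div ((IsHoloFun.const 4).mul (hn.pow 4)) (h4n 4 (by norm_num) 4)
  have hX0 : ∀ s : ℂ, subfamilyAt (S := .F1) ![1, RatFunc.X] s (0 : Fin 2) = 1 := fun s =>
    subfamilyAt_C (c := 1) (map_one RatFunc.C).symm s
  have hX1 : ∀ s : ℂ, subfamilyAt (S := .F1) ![1, RatFunc.X] s (1 : Fin 2) = s :=
    subfamilyAt_X rfl
  refine exists_isUniformization (s := fun τ => -(p τ * r τ) ^ 2 / (4 * n τ ^ 4)) hs.meromorphicOn
    ((((hn.add hp).add hr).pow 2).div ((IsHoloFun.const 4).mul (hn.pow 2))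
      (h4n 4 (by norm_num) 2)) hαh ((hαh.mul he).neg.sub (hn.div (hp.add hr) fun τ => (hne τ).2.1))
    (hαh.div ((IsHoloFun.const 2).mul (hn.pow 2)) (h4n 2 two_ne_zero 2)) hs
    (Eventually.of_forall fun τ => ⟨?_, hX1 _, ?_⟩)
  · refine Fin.forall_fin_two.mpr ⟨?_, ?_⟩
    · rw [hX0]; exact one_ne_zero
    · rw [hX1]
      exact div_ne_zero (neg_ne_zero.mpr (pow_ne_zero 2 (mul_ne_zero (hp0 τ) (hr0 τ))))
        (h4n 4 (by norm_num) 4 τ)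
  · rw [show Surface.coeffC .F1 (subfamilyAt ![1, RatFunc.X] (-(p τ * r τ) ^ 2 / (4 * n τ ^ 4))) = 1
      from hX0 _]
    exact (hd τ).isNormalForm_F1 (hα' τ)

theorem exists_isUniformization_WP112 {c : ℂ} (hc : c ≠ 0) :
    ∃ x y s, IsUniformization .WP112 ![RatFunc.X, RatFunc.C c] x y s := by
  obtain ⟨e, p, r, n, he, hp, hr, hn, hd⟩ := exists_halfPeriodData
  -- The normal form needs c = k² and κ²(pr)² = k n⁴; with c = ν⁴ these are solved by k = ν² and κ =
  -- ν n²/(pr).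
  obtain ⟨ν, hν⟩ := IsAlgClosed.exists_pow_nat_eq c (n := 4) (by norm_num)
  have hν0 : ν ≠ 0 := by rintro rfl; exact hc (by simpa using hν.symm)
  have hp0 := fun τ => (hd τ).p_ne
  have hr0 := fun τ => (hd τ).r_ne
  have hn0 := fun τ => (hd τ).ne.1
  have hpr0 : ∀ τ, p τ * r τ ≠ 0 := fun τ => mul_ne_zero (hp0 τ) (hr0 τ)
  obtain ⟨κ, hκ⟩ : ∃ κ : ℍ → ℂ, κ = fun τ => ν * n τ ^ 2 / (p τ * r τ) := ⟨_, rfl⟩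
  have hκh : IsHoloFun κ := by
    rw [hκ]
    exact ((IsHoloFun.const ν).mul (hn.pow 2)).div (hp.mul hr) hpr0
  have hκ0 : ∀ τ, κ τ ≠ 0 := fun τ => by
    rw [hκ]
    exact div_ne_zero (mul_ne_zero hν0 (pow_ne_zero 2 (hn0 τ))) (hpr0 τ)
  have hκ' : ∀ τ, κ τ ^ 2 * (p τ * r τ) ^ 2 = ν ^ 2 * n τ ^ 4 := fun τ => by
    have h1 : κ τ * (p τ * r τ) = ν * n τ ^ 2 := by rw [hκ]; exact div_mul_cancel₀ _ (hpr0 τ)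
    linear_combination (κ τ * (p τ * r τ) + ν * n τ ^ 2) * h1
  have hs : IsHoloFun fun τ => 1 / 4 + 2 * ν ^ 2 - κ τ ^ 2 := (IsHoloFun.const _).sub (hκh.pow 2)
  have hH : IsHoloFun fun τ => 2 * (p τ * r τ) ^ 2 := (IsHoloFun.const 2).mul ((hp.mul hr).pow 2)
  have hH0 : ∀ τ, 2 * (p τ * r τ) ^ 2 ≠ 0 := fun τ =>
    mul_ne_zero two_ne_zero (pow_ne_zero 2 (hpr0 τ))
  have hzero : ∀ τ, 1 / 4 + 2 * ν ^ 2 - κ τ ^ 2 = 0 →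
      144 * ν ^ 4 * e τ ^ 2 = 3 * e τ ^ 2 - (lat τ).g₂ / 4 := fun τ h0 => by
    obtain ⟨k1, k2, -⟩ := (hd τ).coeffs
    have k3 : n τ ^ 4 = (p τ ^ 2 + r τ ^ 2) ^ 2 := by rw [← (hd τ).sq]; ring
    have k4 : ν ^ 2 * (3 * e τ) = (p τ * r τ) ^ 2 / 4 := by
      rw [← k1]
      linear_combination -hκ' τ - ν ^ 2 * k3 - (p τ * r τ) ^ 2 * h0
    rw [← k2]
    linear_combination (16 * (ν ^ 2 * (3 * e τ)) + 4 * (p τ * r τ) ^ 2) * k4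
  -- The parameter must not vanish identically. A zero at ρ, where g₂ = 0, forces 144ν⁴ = 3; with
  -- this a zero at i, where g₃ = 0, would force g₂(i) = 0.
  have hsne : ∀ᶠ τ in codiscrete ℍ, 1 / 4 + 2 * ν ^ 2 - κ τ ^ 2 ≠ 0 := by
    by_cases h1 : 1 / 4 + 2 * ν ^ 2 - κ rhoPt ^ 2 = 0
    · refine hs.eventually_ne_zero (τ₀ := UpperHalfPlane.I) fun h2 => g₂_I_ne_zero ?_
      have k1 := hzero _ h1
      have k2 := hzero _ h2
      have k3 := (hd rhoPt).coeffs.2.2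
      have k4 := (hd UpperHalfPlane.I).coeffs.2.2
      rw [g₂_rhoPt] at k1 k3
      rw [g₃_I] at k4
      have hne : e rhoPt ≠ 0 := fun h => g₃_rhoPt_ne_zero (by rw [← k3, h]; ring)
      have k5 : 144 * ν ^ 4 = 3 :=
        mul_right_cancel₀ (pow_ne_zero 2 hne) (by linear_combination k1)
      rw [k5] at k2
      linear_combination 4 * k2
    · exact hs.eventually_ne_zero h1
  have hX0 : ∀ s : ℂ, subfamilyAt (S := .WP112) ![RatFunc.X, RatFunc.C c] s (0 : Fin 2) = s :=
    subfamilyAt_X rfl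
  have hX1 : ∀ s : ℂ, subfamilyAt (S := .WP112) ![RatFunc.X, RatFunc.C c] s (1 : Fin 2) = c :=
    subfamilyAt_C rfl
  refine exists_isUniformization (s := fun τ => 1 / 4 + 2 * ν ^ 2 - κ τ ^ 2) hs.meromorphicOn
    (hκh.sub (IsHoloFun.const (1 / 2)))
    ((IsHoloFun.const 1).div (hH.mul hκh) fun τ => mul_ne_zero (hH0 τ) (hκ0 τ))
    ((he.add ((hp.mul hr).pow 2)).neg.div (hH.mul hκh) fun τ => mul_ne_zero (hH0 τ) (hκ0 τ))
    ((IsHoloFun.const 1).div (hH.mul (hn.pow 2)) fun τ =>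
      mul_ne_zero (hH0 τ) (pow_ne_zero 2 (hn0 τ))) hs (hsne.mono fun τ hτ => ⟨?_, hX0 _, ?_⟩)
  · refine Fin.forall_fin_two.mpr ⟨?_, ?_⟩
    · rw [hX0]; exact hτ
    · rw [hX1]; exact hc
  · rw [show Surface.coeffC .WP112 (subfamilyAt ![RatFunc.X, RatFunc.C c]
      (1 / 4 + 2 * ν ^ 2 - κ τ ^ 2)) = (ν ^ 2) ^ 2 from (hX1 _).trans (by rw [← hν]; ring)]
    exact (hd τ).isNormalForm_WP112 (hκ0 τ) (hκ' τ)

end DiskPotential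

end

/-! ### Existence with a point of order three: ℙ² -/

noncomputable section

namespace DiskPotential

open Filter Topology PeriodPair

/-! ### Points of order three -/

section Three

variable (L : PeriodPair)

/-- The period pair obtained by dividing the first period by three. -/
def thirdPair : PeriodPair where
  ω₁ := L.ω₁ / 3
  ω₂ := L.ω₂
  indep := by
    refine LinearIndependent.pair_iff.mpr fun s t h => ?_
    have h1 := LinearIndependent.pair_iff.mp L.indep (s / 3) t (by
      rw [← h]; simp only [Complex.real_smul]; push_cast; ring)
    exact ⟨by linarith [h1.1], h1.2⟩

theorem lattice_le_thirdPair {l : ℂ} (hl : l ∈ L.lattice) : l ∈ (thirdPair L).lattice := by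
  obtain ⟨m, n, rfl⟩ := mem_lattice.mp hl
  refine mem_lattice.mpr ⟨3 * m, n, ?_⟩
  simp only [thirdPair]
  push_cast
  ring

theorem third_mem : L.ω₁ / 3 ∈ (thirdPair L).lattice := (thirdPair L).ω₁_mem_lattice

theorem third_add_third_notMem : L.ω₁ / 3 + L.ω₁ / 3 ∉ L.lattice := by
  intro h
  obtain ⟨m, n, hmn⟩ := mem_lattice.mp h
  have h1 := LinearIndependent.pair_iff.mp L.indep (m - 2 / 3) n (by
    simp only [Complex.real_smul]; push_cast; linear_combination hmn)
  have h2 : ((3 * m : ℤ) : ℝ) = (2 : ℤ) := by push_cast; linarith [h1.1]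
  have h3 : 3 * m = 2 := by exact_mod_cast h2
  omega

theorem third_notMem : L.ω₁ / 3 ∉ L.lattice := fun h =>
  third_add_third_notMem L (add_mem h h)

theorem derivWeierstrassP_third_ne_zero : ℘'[L] (L.ω₁ / 3) ≠ 0 := fun h =>
  third_add_third_notMem L
    (two_mul_mem_lattice_of_derivWeierstrassP_eq_zero L (third_notMem L) h)

/-- The difference of `℘' / 2` and an affine function of `℘`. -/
def lineFun (k X₀ Y₀ : ℂ) (u : ℂ) : ℂ := ℘'[L] u / 2 - k * (℘[L] u - X₀) - Y₀

variable {k X₀ Y₀ : ℂ}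

theorem meromorphic_lineFun : Meromorphic (lineFun L k X₀ Y₀) := by
  unfold lineFun
  fun_prop

theorem lineFun_add {l : ℂ} (hl : l ∈ L.lattice) (u : ℂ) :
    lineFun L k X₀ Y₀ (u + l) = lineFun L k X₀ Y₀ u := by
  have h1 := L.weierstrassP_add_coe u ⟨l, hl⟩
  have h2 := L.derivWeierstrassP_add_coe u ⟨l, hl⟩
  simp only at h1 h2
  rw [lineFun, h1, h2, lineFun]

theorem analyticAt_lineFun {u : ℂ} (hu : u ∉ L.lattice) : AnalyticAt ℂ (lineFun L k X₀ Y₀) u := by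
  have hP := L.analyticOnNhd_weierstrassP u hu
  have hP' := L.analyticOnNhd_derivWeierstrassP u hu
  unfold lineFun
  fun_prop

theorem order_lineFun_zero : meromorphicOrderAt (lineFun L k X₀ Y₀) 0 = -3 := by
  have h1 : meromorphicOrderAt (fun u => 1 / 2 * ℘'[L] u) 0 = -3 := by
    have := meromorphicOrderAt_mul (f := fun _ : ℂ => (1 / 2 : ℂ)) (g := ℘'[L]) (x := 0)
      (by fun_prop) (by fun_prop)
    rw [order_derivWeierstrassP_zero, order_eq_zero analyticAt_const (by norm_num), zero_add] at this
    exact this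
  have h2 : ((-2 : ℤ) : WithTop ℤ) ≤ meromorphicOrderAt (fun u => -k * ℘[L] u + (k * X₀ - Y₀)) 0 := by
    by_cases hk : k = 0
    · refine le_trans (by decide) (?_ : (0 : WithTop ℤ) ≤ _)
      simp only [hk, neg_zero, zero_mul, zero_add]
      exact analyticAt_const.meromorphicOrderAt_nonneg
    · rw [order_affine_weierstrassP L (neg_ne_zero.mpr hk) (zero_mem _)]
      exact le_rfl
  have h3 := meromorphicOrderAt_add_eq_left_of_lt (f₁ := fun u => 1 / 2 * ℘'[L] u)
    (f₂ := fun u => -k * ℘[L] u + (k * X₀ - Y₀)) (x := 0) (by fun_prop)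
    (lt_of_lt_of_le (by rw [h1]; decide) h2)
  rw [h1] at h3
  rw [← h3]
  congr 1
  funext u
  simp only [lineFun, Pi.add_apply]
  ring

theorem order_lineFun_add (u v : ℂ) : meromorphicOrderAt (fun z => lineFun L k X₀ Y₀ (z + v)) u =
    meromorphicOrderAt (lineFun L k X₀ Y₀) (u + v) :=
  meromorphicOrderAt_comp_add_const_eq_meromorphicOrderAt (f := lineFun L k X₀ Y₀) (c := v)

theorem order_lineFun_prod (t u : ℂ) : meromorphicOrderAt (fun u => lineFun L k X₀ Y₀ u *
      lineFun L k X₀ Y₀ (u + t) * lineFun L k X₀ Y₀ (u + -t)) u =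
    meromorphicOrderAt (lineFun L k X₀ Y₀) u + meromorphicOrderAt (lineFun L k X₀ Y₀) (u + t) +
      meromorphicOrderAt (lineFun L k X₀ Y₀) (u + -t) := by
  have hm := meromorphic_lineFun L (k := k) (X₀ := X₀) (Y₀ := Y₀)
  have h1 := meromorphicOrderAt_mul (f := fun u => lineFun L k X₀ Y₀ u *
      lineFun L k X₀ Y₀ (u + t)) (g := fun u => lineFun L k X₀ Y₀ (u + -t)) (x := u)
    (by fun_prop) (by fun_prop)
  have h2 := meromorphicOrderAt_mul (f := lineFun L k X₀ Y₀)
    (g := fun u => lineFun L k X₀ Y₀ (u + t)) (x := u) (by fun_prop) (by fun_prop)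
  rw [← order_lineFun_add, ← order_lineFun_add, ← h2]
  exact h1

theorem isElliptic_lineFun_prod : IsElliptic (thirdPair L) (fun u => lineFun L k X₀ Y₀ u *
    lineFun L k X₀ Y₀ (u + L.ω₁ / 3) * lineFun L k X₀ Y₀ (u + -(L.ω₁ / 3))) := by
  have hm := meromorphic_lineFun L (k := k) (X₀ := X₀) (Y₀ := Y₀)
  set f := fun u => lineFun L k X₀ Y₀ u *
    lineFun L k X₀ Y₀ (u + L.ω₁ / 3) * lineFun L k X₀ Y₀ (u + -(L.ω₁ / 3)) with hf
  refine ⟨fun u => by simp only [hf]; fun_prop, fun l hl => Eventually.of_forall ?_⟩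
  have h1 : Function.Periodic f (L.ω₁ / 3) := fun u => by
    simp only [hf]
    have := lineFun_add L (k := k) (X₀ := X₀) (Y₀ := Y₀) L.ω₁_mem_lattice (u + -(L.ω₁ / 3))
    rw [show u + -(L.ω₁ / 3) + L.ω₁ = u + L.ω₁ / 3 + L.ω₁ / 3 by ring] at this
    rw [this, add_neg_cancel_right]
    ring
  have h2 : Function.Periodic f L.ω₂ := fun u => by
    simp only [hf]
    rw [add_right_comm u L.ω₂, add_right_comm u L.ω₂, lineFun_add L L.ω₂_mem_lattice,
      lineFun_add L L.ω₂_mem_lattice, lineFun_add L L.ω₂_mem_lattice]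
  obtain ⟨m, n, rfl⟩ := mem_lattice.mp hl
  exact ((h1.int_mul m).add_period (h2.int_mul n))

/-- The norm of the line function: substituting the tangent at (X₀, Y₀) into the cubic leaves the
double root X₀ and the third root k² - 2X₀. -/
theorem lineFun_mul_neg {u : ℂ} (hu : u ∉ L.lattice) (hY : 4 * Y₀ ^ 2 = 4 * X₀ ^ 3 - L.g₂ * X₀ - L.g₃)
    (hk : 4 * (k * Y₀) = 6 * X₀ ^ 2 - L.g₂ / 2) : lineFun L k X₀ Y₀ u * lineFun L k X₀ Y₀ (-u) =
      -1 * ((℘[L] u - X₀) * (℘[L] u - X₀) * (℘[L] u - (k ^ 2 - 2 * X₀))) := by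
  rw [lineFun, lineFun, L.derivWeierstrassP_neg, L.weierstrassP_neg]
  have := L.derivWeierstrassP_sq u hu
  linear_combination -this / 4 + hY / 4 + (℘[L] u - X₀) / 2 * hk

/-- The slope `k` of the tangent at a point `(X₀, Y₀)` of order three satisfies `k² = 3 X₀`. -/
theorem sq_eq_three_mul_of_third (hX : X₀ = ℘[L] (L.ω₁ / 3)) (hY : Y₀ = ℘'[L] (L.ω₁ / 3) / 2)
    (hk : 4 * (k * Y₀) = 6 * X₀ ^ 2 - L.g₂ / 2) : k ^ 2 = 3 * X₀ := by
  set t := L.ω₁ / 3 with ht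
  have htn : t ∉ L.lattice := third_notMem L
  have htn' : -t ∉ L.lattice := fun h => htn (by simpa using neg_mem h)
  have hY0 : Y₀ ≠ 0 := by
    rw [hY]; exact div_ne_zero (derivWeierstrassP_third_ne_zero L) two_ne_zero
  have hY2 : 4 * Y₀ ^ 2 = 4 * X₀ ^ 3 - L.g₂ * X₀ - L.g₃ := by
    rw [hX, ← L.derivWeierstrassP_sq t htn, hY]; ring
  set Z := lineFun L k X₀ Y₀ with hZ
  have hZn : meromorphicOrderAt Z (-t) = 0 := by
    refine order_eq_zero (analyticAt_lineFun L htn') ?_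
    have : Z (-t) = -2 * Y₀ := by
      rw [hZ, lineFun, L.derivWeierstrassP_neg, L.weierstrassP_neg, hX, hY]; ring
    rw [this]
    exact mul_ne_zero (by norm_num) hY0
  have hZ2 : ((2 : ℤ) : WithTop ℤ) ≤ meromorphicOrderAt Z t := by
    refine two_le_order (analyticAt_lineFun L htn) ?_ ?_
    · rw [hZ, lineFun, hX, hY]; ring
    · have hP := (L.analyticOnNhd_weierstrassP t htn).differentiableAt.hasDerivAt
      have hP' := (L.analyticOnNhd_derivWeierstrassP t htn).differentiableAt.hasDerivAt
      rw [deriv_weierstrassP] at hP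
      rw [deriv_derivWeierstrassP L htn, ← hX] at hP'
      have := (((hP'.div_const 2).sub ((hP.sub_const X₀).const_mul k)).sub_const Y₀).deriv
      refine Eq.trans this ?_
      linear_combination -hk / 2 + 2 * k * hY
  have hE := isElliptic_lineFun_prod L (k := k) (X₀ := X₀) (Y₀ := Y₀)
  rw [← ht, ← hZ] at hE
  have hord := order_lineFun_prod L (k := k) (X₀ := X₀) (Y₀ := Y₀) t
  rw [← hZ] at hord
  have hord0 := hord 0
  rw [zero_add, zero_add, hZ, order_lineFun_zero, ← hZ, hZn, add_zero] at hord0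
  have hnonneg : ∀ z ∉ L.lattice, 0 ≤ meromorphicOrderAt Z z := fun z hz =>
    (analyticAt_lineFun L hz).meromorphicOrderAt_nonneg
  -- The product of the translates of Z by 0, t and -t has the finer lattice generated by ω₁/3 and
  -- ω₂ as periods. Its only possible pole is at the origin, of order 3 - ord_t Z ≤ 1, so it is
  -- constant and the tangent meets the curve at t to order three.
  have hthird : meromorphicOrderAt Z t = 3 ∨ meromorphicOrderAt Z t = ⊤ := by
    obtain ⟨C, hC⟩ := hE.exists_eq_const_of_neg_one_le (fun z hz => by
      rw [hord]
      have a1 : z ∉ L.lattice := fun h => hz (lattice_le_thirdPair L h)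
      have a2 : z + t ∉ L.lattice := fun h => hz (by
        have := sub_mem (lattice_le_thirdPair L h) (third_mem L)
        rwa [add_sub_cancel_right] at this)
      have a3 : z + -t ∉ L.lattice := fun h => hz (by
        have := add_mem (lattice_le_thirdPair L h) (third_mem L)
        rwa [neg_add_cancel_right] at this)
      exact add_nonneg (add_nonneg (hnonneg _ a1) (hnonneg _ a2)) (hnonneg _ a3)) (by
      rw [hord0]
      calc ((-1 : ℤ) : WithTop ℤ) = ((-3 : ℤ) : WithTop ℤ) + ((2 : ℤ) : WithTop ℤ) := by decide
        _ ≤ _ := add_le_add le_rfl hZ2)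
    have h1 := meromorphicOrderAt_congr (eventually_codiscrete_iff.mp hC 0)
    rw [hord0] at h1
    by_cases hC0 : C = 0
    · right
      have h2 : meromorphicOrderAt (fun _ : ℂ => C) 0 = ⊤ := by
        rw [hC0]; exact meromorphicOrderAt_eq_top_iff.mpr (Eventually.of_forall fun _ => rfl)
      rw [h2] at h1
      generalize meromorphicOrderAt Z t = o at h1 ⊢
      cases o with
      | top => rfl
      | coe a => exact absurd h1 (WithTop.coe_ne_top (a := -3 + a))
    · left
      rw [order_eq_zero analyticAt_const hC0] at h1
      generalize meromorphicOrderAt Z t = o at h1 ⊢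
      cases o with
      | top => exact absurd h1.symm (WithTop.coe_ne_top (a := (0 : ℤ)))
      | coe a =>
        have h3 : -3 + a = 0 := WithTop.coe_injective h1
        exact congrArg _ (by omega : a = 3)
  -- If k² ≠ 3X₀, the third intersection differs from X₀ and the norm of Z vanishes only to order
  -- two at t, against `hthird`.
  by_contra hne
  have hPa := L.analyticOnNhd_weierstrassP t htn
  have hA : meromorphicOrderAt (fun u => ℘[L] u - X₀) t = 1 := by
    refine order_eq_one (by fun_prop) (by rw [hX, sub_self]) ?_
    rw [deriv_sub_const, deriv_weierstrassP]
    exact derivWeierstrassP_third_ne_zero L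
  have hB : meromorphicOrderAt (fun u => ℘[L] u - (k ^ 2 - 2 * X₀)) t = 0 := by
    refine order_eq_zero (by fun_prop) fun h => hne ?_
    rw [← hX] at h
    linear_combination -h
  have hm := meromorphic_lineFun L (k := k) (X₀ := X₀) (Y₀ := Y₀)
  have hneg : meromorphicOrderAt (fun u => Z (-u)) t = 0 := by
    have h1 := meromorphicOrderAt_comp_of_deriv_ne_zero (f := Z) (g := fun z => -z) (x := t)
      (by fun_prop) (by simp)
    exact h1.trans hZn
  have hprod : (Z * fun u => Z (-u)) =ᶠ[𝓝[≠] t] (fun _ => (-1 : ℂ)) * (((fun u => ℘[L] u - X₀) *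
      fun u => ℘[L] u - X₀) * fun u => ℘[L] u - (k ^ 2 - 2 * X₀)) := by
    filter_upwards [eventually_codiscrete_iff.mp (eventually_notMem_lattice L) t] with u hu
    exact lineFun_mul_neg L hu hY2 hk
  have hfin := meromorphicOrderAt_congr hprod
  have hmP : MeromorphicAt (fun u => ℘[L] u - X₀) t := by fun_prop
  rw [meromorphicOrderAt_mul (hm t) (by fun_prop), hneg, add_zero,
    meromorphicOrderAt_mul (by fun_prop) (by fun_prop), order_eq_zero analyticAt_const (by norm_num),
    zero_add, meromorphicOrderAt_mul (by fun_prop) (by fun_prop), meromorphicOrderAt_mul hmP hmP, hA,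
    hB] at hfin
  rcases hthird with h3 | h3 <;> rw [h3] at hfin <;> exact absurd hfin (by decide)

end Three

end DiskPotential

end

noncomputable section

namespace DiskPotential

open Filter Topology PeriodPair

/-! ### Uniformizations with a point of order three -/

/-- At an inflection point a quarter of the cubic is (l (X - X₀) + Y)² + (X - X₀)³. Divided by Y²,
with W = l (X - X₀)/Y, it becomes (1 + W)² - 4sW³ for s = -Y/(4l³), which is the discriminant for ℙ²
with ξ = 0. -/
theorem isNormalForm_P2 {g₂ g₃ X₀ Y l : ℂ} (hY0 : Y ≠ 0) (hl0 : l ≠ 0)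
    (hY : Y ^ 2 = X₀ ^ 3 - g₂ * X₀ / 4 - g₃ / 4) (hl : 4 * (l * Y) = 6 * X₀ ^ 2 - g₂ / 2)
    (hl2 : l ^ 2 = 3 * X₀) :
    IsNormalForm g₂ g₃ 0 (-Y / (4 * l ^ 3)) 3 0 (l / Y) (-(X₀ * l) / Y) (1 / (2 * Y)) := by
  refine ⟨div_ne_zero hl0 hY0, one_div_ne_zero (mul_ne_zero two_ne_zero hY0), fun X => ?_⟩
  obtain ⟨W, hW⟩ : ∃ W, W = l / Y * X + -(X₀ * l) / Y := ⟨_, rfl⟩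
  have hW1 : Y * W = l * (X - X₀) := by
    rw [hW]; field_simp; ring
  rw [← hW]
  obtain ⟨s, hs⟩ : ∃ s, s = -Y / (4 * l ^ 3) := ⟨_, rfl⟩
  have hs1 : 4 * l ^ 3 * s = -Y := by
    rw [hs]
    exact mul_div_cancel₀ _ (mul_ne_zero (by norm_num) (pow_ne_zero 3 hl0))
  rw [← hs]
  have e1 : Y ^ 2 * (4 * s * W ^ 3) = -(X - X₀) ^ 3 := by
    refine mul_left_cancel₀ hY0 ?_
    calc Y * (Y ^ 2 * (4 * s * W ^ 3)) = 4 * s * (Y * W) ^ 3 := by ring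
      _ = (4 * l ^ 3 * s) * (X - X₀) ^ 3 := by rw [hW1]; ring
      _ = Y * -(X - X₀) ^ 3 := by rw [hs1]; ring
  have e2 : (1 / (2 * Y)) ^ 2 * (4 * X ^ 3 - g₂ * X - g₃) * Y ^ 2 = X ^ 3 - g₂ * X / 4 - g₃ / 4 := by
    field_simp; ring
  refine mul_right_cancel₀ (pow_ne_zero 2 hY0) ?_
  rw [e2, quarticForm]
  linear_combination (Y * W + l * (X - X₀) + 2 * Y) * hW1 - e1 + (X - X₀) ^ 2 * hl2 +
    (X - X₀) / 2 * hl + hY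

theorem exists_isUniformization_P2 : ∃ x y s, IsUniformization .P2 ![RatFunc.X] x y s := by
  have hω : ∀ τ : ℍ, 1 / 3 + 0 * (τ : ℂ) = (lat τ).ω₁ / 3 := fun τ => by
    simp only [lat]; ring
  obtain ⟨X₀, hX₀⟩ : ∃ X₀ : ℍ → ℂ, X₀ = fun τ => ℘[lat τ] (1 / 3 + 0 * τ) := ⟨_, rfl⟩
  have hX : IsHoloFun X₀ := by
    rw [hX₀]
    exact IsHoloFun.weierstrassP_section _ _ fun τ => by rw [hω]; exact third_notMem _
  have hX₀' : ∀ τ, X₀ τ = ℘[lat τ] ((lat τ).ω₁ / 3) := fun τ => by rw [hX₀, ← hω]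
  have hsq : ∀ τ, X₀ τ ^ 3 - (lat τ).g₂ * X₀ τ / 4 - (lat τ).g₃ / 4 =
      (℘'[lat τ] ((lat τ).ω₁ / 3) / 2) ^ 2 := fun τ => by
    have := (lat τ).derivWeierstrassP_sq _ (third_notMem (lat τ))
    rw [hX₀']
    linear_combination -this / 4
  have hg₂ : IsHoloFun fun τ => (lat τ).g₂ := differentiableOn_g₂
  have hg₃ : IsHoloFun fun τ => (lat τ).g₃ := differentiableOn_g₃
  have h4 : ∀ τ : ℍ, (4 : ℂ) ≠ 0 := fun _ => by norm_num
  obtain ⟨Y, hYh, hY⟩ := IsHoloFun.exists_pow_eq (a := fun τ => X₀ τ ^ 3 -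
      (lat τ).g₂ * X₀ τ / 4 - (lat τ).g₃ / 4)
    (((hX.pow 3).sub ((hg₂.mul hX).div (IsHoloFun.const 4) h4)).sub
      (hg₃.div (IsHoloFun.const 4) h4)) fun τ => by
        rw [hsq]
        exact pow_ne_zero 2 (div_ne_zero (derivWeierstrassP_third_ne_zero _) two_ne_zero)
  have hY0 : ∀ τ, Y τ ≠ 0 := fun τ h => by
    have h1 := hsq τ
    rw [← hY, h, zero_pow two_ne_zero] at h1
    exact pow_ne_zero 2 (div_ne_zero (derivWeierstrassP_third_ne_zero (lat τ)) two_ne_zero) h1.symm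
  have h4Y : ∀ τ, 4 * Y τ ≠ 0 := fun τ => mul_ne_zero (h4 τ) (hY0 τ)
  obtain ⟨l, hl⟩ : ∃ l : ℍ → ℂ, l = fun τ => (6 * X₀ τ ^ 2 - (lat τ).g₂ / 2) / (4 * Y τ) := ⟨_, rfl⟩
  have hlh : IsHoloFun l := by
    rw [hl]
    exact (((IsHoloFun.const 6).mul (hX.pow 2)).sub (hg₂.div (IsHoloFun.const 2)
      fun _ => two_ne_zero)).div ((IsHoloFun.const 4).mul hYh) h4Y
  have hl1 : ∀ τ, 4 * (l τ * Y τ) = 6 * X₀ τ ^ 2 - (lat τ).g₂ / 2 := fun τ => by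
    rw [mul_left_comm, hl]
    exact div_mul_cancel₀ _ (h4Y τ)
  have hl2 : ∀ τ, l τ ^ 2 = 3 * X₀ τ := fun τ => by
    have h1 := hsq τ
    rw [← hY] at h1
    -- The holomorphic root Y is known to be ℘'/2 only up to sign; in the other case the tangent at
    -- (X₀, -Y) has slope -l.
    rcases sq_eq_sq_iff_eq_or_eq_neg.mp h1 with h2 | h2
    · exact sq_eq_three_mul_of_third (lat τ) (hX₀' τ) h2 (hl1 τ)
    · rw [← neg_sq]
      refine sq_eq_three_mul_of_third (lat τ) (hX₀' τ) (Y₀ := -Y τ) (by rw [h2, neg_neg]) ?_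
      rw [← hl1]; ring
  have hX0 : ∀ s : ℂ, subfamilyAt (S := .P2) ![RatFunc.X] s (0 : Fin 1) = s := subfamilyAt_X rfl
  have hs : MeromorphicOn (fun w : ℂ => -Y (ofComplex w) / (4 * l (ofComplex w) ^ 3))
      {w : ℂ | 0 < w.im} :=
    hYh.neg.meromorphicOn.div ((IsHoloFun.const 4).mul (hlh.pow 3)).meromorphicOn
  refine exists_isUniformization (s := fun τ => -Y τ / (4 * l τ ^ 3)) hs (IsHoloFun.const 0)
    (hlh.div hYh hY0) ((hX.mul hlh).neg.div hYh hY0)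
    ((IsHoloFun.const 1).div ((IsHoloFun.const 2).mul hYh) fun τ =>
      mul_ne_zero two_ne_zero (hY0 τ)) (IsHoloFun.const 0) ?_
  -- At a zero of l also X₀ = 0 and then g₂ = 0. These points are discrete; s may have poles there,
  -- so it is only meromorphic.
  filter_upwards [eventually_g₂_ne_zero] with τ hτ
  have hl0 : l τ ≠ 0 := fun h => hτ (by
    have h1 := hl1 τ
    have h2 := hl2 τ
    rw [h] at h1 h2
    have h3 : X₀ τ = 0 := by linear_combination -h2 / 3
    rw [h3] at h1
    linear_combination 2 * h1)
  refine ⟨Fin.forall_fin_one.mpr ?_, rfl, ?_⟩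
  · rw [hX0]
    exact div_ne_zero (neg_ne_zero.mpr (hY0 τ)) (mul_ne_zero (h4 τ) (pow_ne_zero 3 hl0))
  · rw [show Surface.coeffC .P2 (subfamilyAt ![RatFunc.X] (-Y τ / (4 * l τ ^ 3))) =
      -Y τ / (4 * l τ ^ 3) from hX0 _]
    exact isNormalForm_P2 (hY0 τ) hl0 (hY τ) (hl1 τ) (hl2 τ)

end DiskPotential

end

/-! ### Conclusion: modularity, disk potential and existence -/

theorem mainTheorem7 :
    -- for every one-parameter subfamily: modularity for a group depending only on the subfamily
    (∀ (S : DiskPotential.Surface) (r : Fin S.numParams → RatFunc ℂ),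
      ∃ Γ : Subgroup SL(2, ℤ), Γ.FiniteIndex ∧
        ∀ (x y : ℂ × ℍ → ℂ) (s : ℍ → ℂ), DiskPotential.IsUniformization S r x y s →
          DiskPotential.IsMeromorphicJacobiForm Γ 0 0 x ∧
          DiskPotential.IsMeromorphicJacobiForm Γ 0 0 y ∧
          ∀ (V : Set (ℂ × ℍ)) (W : ℂ × ℍ → ℂ), DiskPotential.IsSuperpotential x y V W →
            ∀ p ∈ V, DiskPotential.derivU x p ≠ 0 →
              Complex.exp (x p * DiskPotential.diskPotential x W p) = y p) ∧
    -- such uniformizations exist for subfamilies of each of the four mirror families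
    (∃ x y s, DiskPotential.IsUniformization .P2 ![RatFunc.X] x y s) ∧
    (∃ x y s, DiskPotential.IsUniformization .P1xP1 ![RatFunc.X, RatFunc.X] x y s) ∧
    (∀ c : ℂ, c ≠ 0 →
      ∃ x y s, DiskPotential.IsUniformization .WP112 ![RatFunc.X, RatFunc.C c] x y s) ∧
    (∃ x y s, DiskPotential.IsUniformization .F1 ![1, RatFunc.X] x y s) := by
  refine ⟨fun S r => ?_, DiskPotential.exists_isUniformization_P2,
    DiskPotential.exists_isUniformization_P1xP1,
    fun c hc => DiskPotential.exists_isUniformization_WP112 hc,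
    DiskPotential.exists_isUniformization_F1⟩
  obtain ⟨Γ, hΓ, h⟩ := DiskPotential.exists_subgroup S r
  exact ⟨Γ, hΓ, fun x y s hu => ⟨(h x y s hu).1, (h x y s hu).2, fun V W hW p hp hd =>
    DiskPotential.exp_mul_diskPotential hW hp hd⟩⟩
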